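/- **Setting.** Let $F$ be a field and let $\xi\in F$ be such that $e$ is the smallest integer $\ge 2$ with $1+\xi+\dots+\xi^{e-1}=0$. Let $I=\mathbb Z/e\mathbb Z$, and write $i\to j$ if $j=i+1$ and $i\neq j+1$, and $i\rightleftarrows j$ if $j=i+1$ and $i=j+1$. For $n\ge 0$, let $R_n$ be the KLR algebra over $F$ with generators $e(\boldsymbol i)$ ($\boldsymbol i\in I^n$), $y_1,\dots,y_n$, $\psi_1,\dots,\psi_{n-1}$ and the relations: $e(\boldsymbol i)e(\boldsymbol j)=\delta_{\boldsymbol i,\boldsymbol j}e(\boldsymbol i)$; $\sum_{\boldsymbol i} e(\boldsymbol i)=1$; $y_re(\boldsymbol i)=e(\boldsymbol i)y_r$; $\psi_re(\boldsymbol i)=e(s_r\boldsymbol i)\psi_r$; $y_ry_s=y_sy_r$; $\psi_r\psi_s=\psi_s\psi_r$ if $|r-s|>1$; $\psi_ry_s=y_s\psi_r$ if $s\ne r,r+1$; $\psi_ry_{r+1}e(\boldsymbol i)=(y_r\psi_r+\delta_{i_r,i_{r+1}})e(\boldsymbol i)$; $y_{r+1}\psi_re(\boldsymbol i)=(\psi_ry_r+\delta_{i_r,i_{r+1}})e(\boldsymbol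 i)$; $\psi_r^2e(\boldsymbol i)=L_{i_r,i_{r+1}}(y_r,y_{r+1})e(\boldsymbol i)$, where $L_{ij}(y,y')$ is $0$ if $i=j$, $y'-y$ if $i\to j$, $y-y'$ if $j\to i$, $(y'-y)(y-y')$ if $i\rightleftarrows j$, and $1$ otherwise; and $\psi_r\psi_{r+1}\psi_re(\boldsymbol i)=(\psi_{r+1}\psi_r\psi_{r+1}+b)e(\boldsymbol i)$, where $b=1$ if $i_{r+2}=i_r\to i_{r+1}$, $b=-1$ if $i_{r+1}\to i_r=i_{r+2}$, $b=-2y_{r+1}+y_r+y_{r+2}$ if $i_{r+2}=i_r\rightleftarrows i_{r+1}$, and $b=0$ otherwise. It is graded by $\deg e(\boldsymbol i)=0$, $\deg y_r=2$, $\deg \psi_re(\boldsymbol i)=-\mathtt c_{i_r,i_{r+1}}$, where $\mathtt c_{ij}$ is $2$ if $i=j$, $-2$ if $i\rightleftarrows j$, $-1$ if $i\to j$ or $j\to i$, and $0$ otherwise. All subquotients below carry the induced gradings, and $X_{\{m\}}$ is the degree $m$ component of $X$. Let $d\ge 0$. Let $I^{m\delta}\subset I^{me}$ be the set of sequences in which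 each element of $I$ occurs exactly $m$ times, let $e_{m\delta}=\sum_{\boldsymbol i\in I^{m\delta}}e(\boldsymbol i)$ (a central idempotent of $R_{me}$) and $R_{m\delta}=R_{me}e_{m\delta}$. Let $R^{\Lambda_0}_\delta$ be the quotient of $R_\delta$ by the two-sided ideal generated by all $y_1^{\delta_{i_1,0}}e(\boldsymbol i)$, $\boldsymbol i\in I^\delta$. Let $I^{\varnothing,1}\subset I^\delta$ be the set of residue sequences of standard tableaux whose shape has empty $e$-core and $e$-weight $1$ (the box in row $a$ and column $b$ has residue $b-a$), and let $\mathcal E_d$ be the set of all shuffles of $d$ elements of $I^{\varnothing,1}$, i.e. of all $w(\boldsymbol i^{(1)}\cdots\boldsymbol i^{(d)})$ with $\boldsymbol i^{(k)}\in I^{\varnothing,1}$ and $w\in\mathfrak S_{de}$ increasing on each block $\{(k-1)e+1,\dots,ke\}$. Let $\overline R_\delta$ be the quotient of $R_\delta$ by the two-sided ideal generated by all $e(\boldsymbol i)$ with $\boldsymbol i\in I^\delta\setminus I^{\varnothing,1}$, and $\overline R_{d\delta}$ the quotient of $R_{d\delta}$ by the two-sided ideal generated by all $e(\boldsymbol i)$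 with $\boldsymbol i\in I^{d\delta}\setminus\mathcal E_d$. Let $e_{\delta^d}\in\overline R_{d\delta}$ be the sum of the $e(\boldsymbol i)$ over all concatenations $\boldsymbol i$ of $d$ elements of $I^\delta$. Let $\iota\colon\overline R_\delta^{\otimes d}\to e_{\delta^d}\overline R_{d\delta}e_{\delta^d}$ be the homomorphism induced by the embedding $R_e^{\otimes d}\to R_{de}$ (the $t$-th tensor factor acts on the $t$-th block of $e$ positions). Let $\eta\colon R^{\Lambda_0}_\delta\to\overline R_\delta$ be the homomorphism with $e(\boldsymbol i)\mapsto e(\boldsymbol i)$, $\psi_r\mapsto\psi_r$, $y_t\mapsto y_t-y_1$, let $H=\iota\circ\eta^{\otimes d}$, and let $\eta_t(x)=\iota(1^{\otimes t-1}\otimes\eta(x)\otimes1^{\otimes d-t})$. For $1\le r<n$, let $\varphi_r\in R_n$ be the element with $\varphi_re(\boldsymbol i)=(\psi_ry_r-y_r\psi_r)e(\boldsymbol i)$ if $i_r=i_{r+1}$ and $\varphi_re(\boldsymbol i)=\psi_re(\boldsymbol i)$ otherwise. For $1\le r<d$, let $w_r\in\mathfrak S_{de}$ be the permutation that exchanges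 the $r$-th and $(r+1)$-st blocks, let $\sigma_r=\psi_{w_r}$ and $\varphi_{w_r}$ be the products of the $\psi$'s and of the $\varphi$'s along a reduced expression of $w_r$; for $u\in\mathfrak S_d$ let $\sigma_u=\sigma_{r_1}\cdots\sigma_{r_m}$ for a reduced expression $u=s_{r_1}\cdots s_{r_m}$. (The reduced expressions are fixed arbitrarily.) Let $K$ be the left ideal of $\overline R_\delta$ generated by all $y_k-y_t$, let $\mathcal K=\sum_{r=1}^d\iota(\overline R_\delta^{\otimes r-1}\otimes K\otimes\overline R_\delta^{\otimes d-r})$ and $\mathcal J=e_{\delta^d}\overline R_{d\delta}\mathcal K$. Let $(\overline R_\delta)_{\{0,1\}}=(\overline R_\delta)_{\{0\}}+(\overline R_\delta)_{\{1\}}$, $S=((\overline R_\delta)_{\{0,1\}})^{\otimes d}$, $T=\sum_{u\in\mathfrak S_d}\sigma_u\iota(S)$, $S^{(r)}=1^{\otimes r-1}\otimes(\overline R_\delta)_{\{0,1\}}\otimes(\overline R_\delta)_{\{0,1\}}\otimes1^{\otimes d-r-1}$ and $z_r=y_{(r-1)e+1}e_{\delta^d}$. Let $\mathcal T$ be the unital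 subalgebra of $e_{\delta^d}\overline R_{d\delta}e_{\delta^d}$ generated by $T\cup\mathcal K$. **Theorem.** For each $1\le r<d$ there are unique elements $\tau_r\in\sigma_re_{\delta^d}+\iota(S^{(r)}_{\{0\}})$ and $\epsilon_r\in\iota(S^{(r)}_{\{2\}})$ such that $$\varphi_{w_r}e_{\delta^d}\equiv\tau_r(z_r-z_{r+1})^e+\epsilon_r(z_r-z_{r+1})^{e-1}\pmod{\mathcal J}.$$ They satisfy, for $1\le r<d$: 1. $\tau_r^2=e_{\delta^d}$; 2. $\tau_r\tau_{r+1}\tau_r=\tau_{r+1}\tau_r\tau_{r+1}$ if $r<d-1$; 3. $\tau_r\tau_t=\tau_t\tau_r$ if $1\le t<d$ and $|t-r|\ge2$; 4. $\eta_r(x)\tau_r=\tau_r\eta_{r+1}(x)$ and $\eta_{r+1}(x)\tau_r=\tau_r\eta_r(x)$ for all $x\in R^{\Lambda_0}_\delta$; 5. $y_{re+1}e_{\delta^d}\in\tau_ry_{(r-1)e+1}\tau_r+\mathcal T$. Moreover, there is a graded unital algebra homomorphism $\Theta\colon R^{\Lambda_0}_\delta\wr\mathfrak S_d\to e_{\delta^d}\overline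 R_{d\delta}e_{\delta^d}$ with $\Theta(a)=H(a)$ for all $a\in(R^{\Lambda_0}_\delta)^{\otimes d}$ and $\Theta(s_r)=\tau_r$ for $1\le r<d$. Here $R^{\Lambda_0}_\delta\wr\mathfrak S_d=(R^{\Lambda_0}_\delta)^{\otimes d}\otimes F\mathfrak S_d$ with $(x_1\otimes\cdots\otimes x_d\otimes\sigma)(y_1\otimes\cdots\otimes y_d\otimes\tau)=x_1y_{\sigma^{-1}(1)}\otimes\cdots\otimes x_dy_{\sigma^{-1}(d)}\otimes\sigma\tau$ and $\mathfrak S_d$ in degree $0$. -/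

import Mathlib

noncomputable section

namespace KLRTheta

/-! ### Residue sequences, simple transpositions and reduced words -/

section Combinatorics

/-- The position `r` (counted from `0`) that the generator `ψ_r` acts on. -/
def lo {n : ℕ} (r : Fin (n - 1)) : Fin n := ⟨r, by omega⟩

/-- The position `r + 1` that the generator `ψ_r` acts on. -/
def hi {n : ℕ} (r : Fin (n - 1)) : Fin n := ⟨r + 1, by omega⟩

/-- The simple transposition exchanging `r` and `r + 1`. -/
def simpleT {n : ℕ} (r : Fin (n - 1)) : Equiv.Perm (Fin n) := Equiv.swap (lo r) (hi r)

/-- The action of a permutation on sequences: `(w i)_k = i_{w⁻¹ k}`. -/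
def act {n : ℕ} {X : Type*} (w : Equiv.Perm (Fin n)) (i : Fin n → X) : Fin n → X :=
  fun k => i (w⁻¹ k)

/-- `l = [r₁, …, r_m]` is a reduced word for `w`: `w = s_{r₁} ⋯ s_{r_m}` with `m` minimal. -/
def IsReducedWord {n : ℕ} (l : List (Fin (n - 1))) (w : Equiv.Perm (Fin n)) : Prop :=
  (l.map simpleT).prod = w ∧
    ∀ l' : List (Fin (n - 1)), (l'.map simpleT).prod = w → l.length ≤ l'.length

/-- The relation `i → j`: there is an edge from `i` to `j` and none from `j` to `i`. -/
def Arrow {e : ℕ} (i j : ZMod e) : Prop := j = i + 1 ∧ i ≠ j + 1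

/-- The relation `i ⇄ j`: there are edges in both directions (this occurs only for `e = 2`). -/
def DoubleArrow {e : ℕ} (i j : ZMod e) : Prop := j = i + 1 ∧ i = j + 1

open Classical in
/-- The Cartan integer `c_{ij}`. -/
def cartan {e : ℕ} (i j : ZMod e) : ℤ :=
  if i = j then 2
  else if DoubleArrow i j then -2
  else if Arrow i j ∨ Arrow j i then -1
  else 0

open Classical in
/-- The value `L_{ij}(a, b)` of the polynomial `L_{ij}` at (commuting) elements `a`, `b`. -/
def Lval {e : ℕ} {A : Type*} [Ring A] (i j : ZMod e) (a b : A) : A :=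
  if i = j then 0
  else if DoubleArrow i j then (b - a) * (a - b)
  else if Arrow i j then b - a
  else if Arrow j i then a - b
  else 1

end Combinatorics

/-! ### Residue sequences of standard tableaux, cores and weights -/

section Tableaux

/-- Two boxes share an edge. -/
def BoxAdj (a b : ℕ × ℕ) : Prop :=
  (a.1 = b.1 ∧ (a.2 = b.2 + 1 ∨ b.2 = a.2 + 1)) ∨ (a.2 = b.2 ∧ (a.1 = b.1 + 1 ∨ b.1 = a.1 + 1))

/-- `μ` is obtained from `lam` by removing a rim `e`-hook, that is, `lam ∖ μ` is a connected skew
diagram with `e` boxes that contains no `2 × 2` square. -/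
def RemovesRimHook (e : ℕ) (lam μ : YoungDiagram) : Prop :=
  μ ≤ lam ∧ (lam.cells \ μ.cells).card = e ∧
  (∀ a b : ℕ, ¬ ((a, b) ∈ lam.cells \ μ.cells ∧ (a + 1, b) ∈ lam.cells \ μ.cells ∧
    (a, b + 1) ∈ lam.cells \ μ.cells ∧ (a + 1, b + 1) ∈ lam.cells \ μ.cells)) ∧
  ∀ x ∈ lam.cells \ μ.cells, ∀ y ∈ lam.cells \ μ.cells,
    Relation.ReflTransGen (fun a b => BoxAdj a b ∧ b ∈ lam.cells \ μ.cells) x y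

/-- `ρ` is obtained from `lam` by removing `d` rim `e`-hooks successively. -/
inductive RemovesRimHooks (e : ℕ) : ℕ → YoungDiagram → YoungDiagram → Prop
  | refl (lam : YoungDiagram) : RemovesRimHooks e 0 lam lam
  | step {d : ℕ} {lam μ ρ : YoungDiagram} : RemovesRimHook e lam μ → RemovesRimHooks e d μ ρ →
      RemovesRimHooks e (d + 1) lam ρ

/-- `lam` has `e`-core `ρ` and `e`-weight `d`. -/
def HasCoreWeight (e : ℕ) (lam ρ : YoungDiagram) (d : ℕ) : Prop :=
  RemovesRimHooks e d lam ρ ∧ ∀ μ, ¬ RemovesRimHook e ρ μ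

/-- `t` is a standard tableau of shape `lam`: a bijection from `{0, …, n - 1}` onto the boxes of
`lam` whose inverse increases along rows and columns. -/
structure IsStandard {n : ℕ} (lam : YoungDiagram) (t : Fin n → ℕ × ℕ) : Prop where
  inj : Function.Injective t
  range : Set.range t = (lam.cells : Set (ℕ × ℕ))
  row : ∀ a b, (t a).1 = (t b).1 → (t a).2 < (t b).2 → a < b
  col : ∀ a b, (t a).2 = (t b).2 → (t a).1 < (t b).1 → a < b

/-- The residue of a box, column minus row modulo `e`. -/
def boxRes (e : ℕ) (b : ℕ × ℕ) : ZMod e := (b.2 : ZMod e) - (b.1 : ZMod e)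

/-- The set `I^{ρ,d}` (inside `I^n`) of residue sequences of standard tableaux whose shape has
`e`-core `ρ` and `e`-weight `d`. -/
def resSeqs (e n : ℕ) (ρ : YoungDiagram) (d : ℕ) : Set (Fin n → ZMod e) :=
  {i | ∃ lam : YoungDiagram, HasCoreWeight e lam ρ d ∧
    ∃ t : Fin n → ℕ × ℕ, IsStandard lam t ∧ i = fun k => boxRes e (t k)}

/-- The set `I^{∅,1} ⊆ I^e`. -/
def Iempty1 (e : ℕ) : Set (Fin e → ZMod e) := resSeqs e e ⊥ 1

theorem IsStandard.first {n : ℕ} {lam : YoungDiagram} {t : Fin n → ℕ × ℕ} (h : IsStandard lam t)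
    (k : Fin n) (hk : (k : ℕ) = 0) : t k = (0, 0) := by
  have hmem : ∀ x, x ∈ lam.cells ↔ ∃ a, t a = x := fun x => by
    have := h.range
    rw [Set.ext_iff] at this
    simpa using (this x).symm
  have h1 : t k ∈ lam := (hmem _).2 ⟨k, rfl⟩
  obtain ⟨⟨p, q⟩, hpq⟩ : ∃ x, t k = x := ⟨_, rfl⟩
  rw [hpq] at h1
  have hp : p = 0 := by
    by_contra hp
    obtain ⟨b, hb⟩ := (hmem (0, q)).1 (lam.up_left_mem (Nat.zero_le _) le_rfl h1)
    have := h.col b k (by rw [hb, hpq]) (by rw [hb, hpq]; exact Nat.pos_of_ne_zero hp)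
    have : (b : ℕ) < k := this
    omega
  have hq : q = 0 := by
    by_contra hq
    obtain ⟨b, hb⟩ := (hmem (p, 0)).1 (lam.up_left_mem le_rfl (Nat.zero_le _) h1)
    have := h.row b k (by rw [hb, hpq]) (by rw [hb, hpq]; exact Nat.pos_of_ne_zero hq)
    have : (b : ℕ) < k := this
    omega
  rw [hpq, hp, hq]

theorem IsStandard.second {n : ℕ} {lam : YoungDiagram} {t : Fin n → ℕ × ℕ} (h : IsStandard lam t)
    (k : Fin n) (hk : (k : ℕ) = 1) : t k = (0, 1) ∨ t k = (1, 0) := by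
  have hmem : ∀ x, x ∈ lam.cells ↔ ∃ a, t a = x := fun x => by
    have := h.range
    rw [Set.ext_iff] at this
    simpa using (this x).symm
  have h1 : t k ∈ lam := (hmem _).2 ⟨k, rfl⟩
  have hne : t k ≠ (0, 0) := fun h0 => by
    have hk0 := h.first ⟨0, by omega⟩ rfl
    have := congrArg Fin.val (h.inj (h0.trans hk0.symm))
    simp at this
    omega
  obtain ⟨⟨p, q⟩, hpq⟩ : ∃ x, t k = x := ⟨_, rfl⟩
  rw [hpq] at h1 hne
  rcases p with _ | p
  · rcases q with _ | q
    · exact absurd rfl hne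
    · obtain ⟨b, hb⟩ := (hmem (0, q)).1 (lam.up_left_mem le_rfl (Nat.le_succ _) h1)
      have hbk : (b : ℕ) < k := h.row b k (by rw [hb, hpq]) (by rw [hb, hpq]; simp)
      have := h.first b (by omega)
      rw [hb] at this
      have hq : q = 0 := congrArg Prod.snd this
      left
      rw [hpq, hq]
  · obtain ⟨b, hb⟩ := (hmem (p, q)).1 (lam.up_left_mem (Nat.le_succ _) le_rfl h1)
    have hbk : (b : ℕ) < k := h.col b k (by rw [hb, hpq]) (by rw [hb, hpq]; simp)
    have := h.first b (by omega)
    rw [hb] at this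
    have hp : p = 0 := congrArg Prod.fst this
    have hq : q = 0 := congrArg Prod.snd this
    right
    rw [hpq, hp, hq]

theorem Iempty1.first {e : ℕ} {i : Fin e → ZMod e} (h : i ∈ Iempty1 e) (k : Fin e)
    (hk : (k : ℕ) = 0) : i k = 0 := by
  obtain ⟨lam, -, t, ht, rfl⟩ := h
  simp [boxRes, ht.first k hk]

theorem Iempty1.second {e : ℕ} {i : Fin e → ZMod e} (h : i ∈ Iempty1 e) (k : Fin e)
    (hk : (k : ℕ) = 1) : i k ≠ 0 := by
  obtain ⟨lam, -, t, ht, rfl⟩ := h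
  have : Fact (1 < e) := ⟨by omega⟩
  rcases ht.second k hk with h | h <;> simp [boxRes, h]

end Tableaux

/-! ### Blocks of size `e` in sequences of length `d * e` -/

section Blocks

/-- The position `a` in the block `t` (both counted from `0`), i.e. the position `t * e + a`. -/
def pos {d e : ℕ} (t : Fin d) (a : Fin e) : Fin (d * e) := finProdFinEquiv (t, a)

/-- The index in `{0, …, d * e - 2}` of the generator `ψ` that is the `r`-th one in block `t`. -/
def posPsi {d e : ℕ} (t : Fin d) (r : Fin (e - 1)) : Fin (d * e - 1) :=
  ⟨r + e * t, by
    have := (pos t (hi r)).isLt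
    simp [pos, hi, finProdFinEquiv] at this
    omega⟩

/-- The concatenation of `d` sequences of length `e`. -/
def concat {d e : ℕ} {X : Type*} (i : Fin d → Fin e → X) : Fin (d * e) → X :=
  fun k => i (finProdFinEquiv.symm k).1 (finProdFinEquiv.symm k).2

/-- The `t`-th block of a sequence of length `d * e`. -/
def block {d e : ℕ} {X : Type*} (t : Fin d) (k : Fin (d * e) → X) : Fin e → X :=
  fun a => k (pos t a)

/-- The set of minimal length left coset representatives of `𝔖_{(e^d)}` in `𝔖_{de}`. -/
def minCosetReps (d e : ℕ) : Set (Equiv.Perm (Fin (d * e))) :=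
  {w | ∀ (t : Fin d) (a b : Fin e), a < b → w (pos t a) < w (pos t b)}

/-- The set `ℰ_d` of shuffles of `d` elements of `I^{∅,1}`. -/
def shuffles (e d : ℕ) : Set (Fin (d * e) → ZMod e) :=
  {k | ∃ w ∈ minCosetReps d e, ∃ i : Fin d → Fin e → ZMod e,
    (∀ t, i t ∈ Iempty1 e) ∧ k = act w (concat i)}

/-- The set `I^α`, for `α = ∑ α_c ⬝ (simple root c)`. -/
def Ialpha {e : ℕ} (n : ℕ) (α : ZMod e → ℕ) : Set (Fin n → ZMod e) :=
  {i | ∀ c, Nat.card {r : Fin n // i r = c} = α c}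

/-- The root `m δ = m (α_0 + ⋯ + α_{e-1})`. -/
def mdelta (e m : ℕ) : ZMod e → ℕ := fun _ => m

/-- The concatenations of `d` elements of `I^δ`. -/
def Idd (e d : ℕ) : Set (Fin (d * e) → ZMod e) :=
  {k | ∀ t, block t k ∈ Ialpha e (mdelta e 1)}

/-- The permutation `w_r`, exchanging the blocks `r` and `r + 1`. -/
def blockSwap (e : ℕ) {d : ℕ} (r : Fin (d - 1)) : Equiv.Perm (Fin (d * e)) :=
  finProdFinEquiv.permCongr (Equiv.prodCongr (simpleT r) (Equiv.refl (Fin e)))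

variable {d e : ℕ}

theorem pos_lt_pos {t t' : Fin d} {a a' : Fin e} (h : pos t a ≤ pos t' a') : t ≤ t' := by
  have h1 : (a : ℕ) + e * t ≤ a' + e * t' := by simpa [pos, finProdFinEquiv] using h
  by_contra hc
  have h2 : (t' : ℕ) + 1 ≤ t := by
    rw [not_le] at hc
    exact hc
  have h3 : e * ((t' : ℕ) + 1) ≤ e * t := Nat.mul_le_mul_left _ h2
  have := a'.isLt
  rw [Nat.mul_add] at h3
  omega

theorem pos_inj {t t' : Fin d} {a a' : Fin e} (h : pos t a = pos t' a') : t = t' ∧ a = a' := by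
  simpa [pos] using h

theorem pos_surj (p : Fin (d * e)) : ∃ t a, p = pos (d := d) (e := e) t a :=
  ⟨(finProdFinEquiv.symm p).1, (finProdFinEquiv.symm p).2, (finProdFinEquiv.apply_symm_apply p).symm⟩

/-- If a concatenation of elements of `I^δ` is a shuffle, then each of them lies in `I^{∅,1}`. -/
theorem block_mem_of_shuffle (he : 0 < e) {k : Fin (d * e) → ZMod e} (hk : k ∈ Idd e d)
    (hE : k ∈ shuffles e d) (t : Fin d) : block t k ∈ Iempty1 e := by
  obtain ⟨w, hw, j, hj, rfl⟩ := hE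
  have hval : ∀ s a, act w (concat j) (w (pos s a)) = j s a := fun s a => by
    simp [act, concat, pos]
  set k := act w (concat j) with hkdef
  let z : Fin e := ⟨0, he⟩
  have hz : ∀ s, k (w (pos s z)) = 0 := fun s => by rw [hval]; exact Iempty1.first (hj s) z rfl
  have hmin : ∀ s a, w (pos s z) ≤ w (pos s a) := fun s a => by
    rcases eq_or_ne a z with rfl | h
    · exact le_rfl
    · refine (hw s z a ?_).le
      rw [Fin.lt_def]
      exact Nat.pos_of_ne_zero fun h0 => h (Fin.ext h0)
  have huniq : ∀ (t : Fin d) (a b : Fin e), k (pos t a) = 0 → k (pos t b) = 0 → a = b := by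
    intro t a b ha hb
    have h1 := hk t 0
    have : Subsingleton {r : Fin e // block t k r = 0} :=
      (Nat.card_eq_one_iff_unique.1 h1).1
    exact congrArg Subtype.val (Subsingleton.elim (⟨a, ha⟩ : {r : Fin e // block t k r = 0}) ⟨b, hb⟩)
  have claim : ∀ n : ℕ, ∀ t : Fin d, (t : ℕ) = n → ∃ s, ∀ a, w (pos s a) = pos t a := by
    intro n
    induction n using Nat.strong_induction_on with
    | _ n ih =>
      intro t htn
      have key : ∀ a : Fin e, ∃ s a' m, w (pos s a') = pos t a ∧ w (pos s z) = pos t m := by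
        intro a
        obtain ⟨s, a', hsa⟩ := pos_surj (d := d) (e := e) (w⁻¹ (pos t a))
        have hsa' : w (pos s a') = pos t a := by rw [← hsa]; simp
        obtain ⟨t', m, hm⟩ := pos_surj (d := d) (e := e) (w (pos s z))
        have hle : t' ≤ t := pos_lt_pos (by rw [← hm, ← hsa']; exact hmin s a')
        rcases hle.lt_or_eq with hlt | heq
        · obtain ⟨s', hs'⟩ := ih t' (by rw [← htn]; exact hlt) t' rfl
          have h1 := hs' m
          rw [← hm] at h1
          have h2 := (pos_inj (w.injective h1)).1
          subst h2
          have h3 := hs' a'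
          rw [hsa'] at h3
          exact absurd (pos_inj h3).1.symm hlt.ne
        · subst heq
          exact ⟨s, a', m, hsa', hm⟩
      choose S f M h1 h2 using key
      have hM : ∀ a b, M a = M b := fun a b =>
        huniq t _ _ (by rw [← h2 a]; exact hz _) (by rw [← h2 b]; exact hz _)
      have hS : ∀ a, S a = S z := fun a => by
        have : w (pos (S a) z) = w (pos (S z) z) := by rw [h2, h2, hM a z]
        exact (pos_inj (w.injective this)).1
      have h1' : ∀ a, w (pos (S z) (f a)) = pos t a := fun a => by rw [← h1 a, hS a]
      have hf : Function.Injective f := fun a b hab => by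
        have := h1' a
        rw [hab, h1' b] at this
        exact (pos_inj this).2.symm
      have hfs := Finite.injective_iff_surjective.1 hf
      have : ∀ a', ∃ a, w (pos (S z) a') = pos t a := fun a' => by
        obtain ⟨a, rfl⟩ := hfs a'
        exact ⟨a, h1' a⟩
      choose g hg using this
      have hgm : StrictMono g := fun a b hab => by
        have := hw (S z) a b hab
        rw [hg, hg, Fin.lt_def] at this
        simpa [pos, finProdFinEquiv] using this
      have hgr : Set.range g = Set.range (id : Fin e → Fin e) := by
        rw [Set.range_id]
        exact Set.eq_univ_of_forall fun a =>
          ⟨f a, ((pos_inj ((h1' a).symm.trans (hg (f a)))).2).symm⟩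
      have hgid : g = id := (hgm.range_inj strictMono_id).1 hgr
      refine ⟨S z, fun a => ?_⟩
      rw [hg, hgid]
      rfl
  obtain ⟨s, hs⟩ := claim t t rfl
  have : block t k = j s := by
    funext a
    rw [block, ← hs a, hval]
  rw [this]
  exact hj s

theorem pos_lo (t : Fin d) (r : Fin (e - 1)) : pos t (lo r) = lo (posPsi t r) := by
  ext; simp [pos, lo, posPsi, finProdFinEquiv]

theorem pos_hi (t : Fin d) (r : Fin (e - 1)) : pos t (hi r) = hi (posPsi t r) := by
  ext; simp [pos, hi, posPsi, finProdFinEquiv]; omega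

end Blocks

/-! ### The KLR algebra -/

section KLR

theorem map_Lval {e : ℕ} {A B G : Type*} [Ring A] [Ring B] [FunLike G A B] [RingHomClass G A B]
    (f : G) (i j : ZMod e) (a b : A) : f (Lval i j a b) = Lval i j (f a) (f b) := by
  unfold Lval
  split_ifs <;> simp

theorem act_mem_Ialpha {e n : ℕ} {α : ZMod e → ℕ} (w : Equiv.Perm (Fin n)) {i : Fin n → ZMod e} :
    i ∈ Ialpha n α ↔ act w i ∈ Ialpha n α := by
  refine forall_congr' fun c => ?_
  rw [Nat.card_congr (Equiv.subtypeEquiv w (fun a => ?_))]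
  simp [act]

/-- The generators `e(i)`, `y_r` and `ψ_r` of the KLR algebra `R_n`. -/
inductive KGen (e n : ℕ) : Type
  | idem (i : Fin n → ZMod e) : KGen e n
  | y (r : Fin n) : KGen e n
  | psi (r : Fin (n - 1)) : KGen e n

/-- The defining relations of the KLR algebra `R_n`, for families `E i`, `Y r`, `P r` of elements
of a ring in the place of the generators `e(i)`, `y_r`, `ψ_r`. -/
inductive KLRRel {e n : ℕ} [NeZero e] {B : Type*} [Ring B] (E : (Fin n → ZMod e) → B)
    (Y : Fin n → B) (P : Fin (n - 1) → B) : B → B → Prop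
  | idem (i) : KLRRel E Y P (E i * E i) (E i)
  | orth (i j) : i ≠ j → KLRRel E Y P (E i * E j) 0
  | sum_one : KLRRel E Y P (∑ i, E i) 1
  | y_idem (r i) : KLRRel E Y P (Y r * E i) (E i * Y r)
  | psi_idem (r i) : KLRRel E Y P (P r * E i) (E (act (simpleT r) i) * P r)
  | y_y (r s) : KLRRel E Y P (Y r * Y s) (Y s * Y r)
  | psi_psi (r s : Fin (n - 1)) : (r : ℕ) + 1 < s ∨ (s : ℕ) + 1 < r → KLRRel E Y P (P r * P s) (P s * P r)
  | psi_y (r s) : s ≠ lo r → s ≠ hi r → KLRRel E Y P (P r * Y s) (Y s * P r)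
  | psi_y_eq (r i) : i (lo r) = i (hi r) →
      KLRRel E Y P (P r * Y (hi r) * E i) ((Y (lo r) * P r + 1) * E i)
  | psi_y_ne (r i) : i (lo r) ≠ i (hi r) →
      KLRRel E Y P (P r * Y (hi r) * E i) (Y (lo r) * P r * E i)
  | y_psi_eq (r i) : i (lo r) = i (hi r) →
      KLRRel E Y P (Y (hi r) * P r * E i) ((P r * Y (lo r) + 1) * E i)
  | y_psi_ne (r i) : i (lo r) ≠ i (hi r) →
      KLRRel E Y P (Y (hi r) * P r * E i) (P r * Y (lo r) * E i)
  | psi_sq (r i) :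
      KLRRel E Y P (P r * P r * E i) (Lval (i (lo r)) (i (hi r)) (Y (lo r)) (Y (hi r)) * E i)
  | braid_arrow (r s : Fin (n - 1)) (i) : (s : ℕ) = r + 1 → i (hi s) = i (lo r) → Arrow (i (lo r)) (i (hi r)) →
      KLRRel E Y P (P r * P s * P r * E i) ((P s * P r * P s + 1) * E i)
  | braid_arrow' (r s : Fin (n - 1)) (i) : (s : ℕ) = r + 1 → i (hi s) = i (lo r) → Arrow (i (hi r)) (i (lo r)) →
      KLRRel E Y P (P r * P s * P r * E i) ((P s * P r * P s - 1) * E i)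
  | braid_double (r s : Fin (n - 1)) (i) : (s : ℕ) = r + 1 → i (hi s) = i (lo r) →
      DoubleArrow (i (lo r)) (i (hi r)) →
      KLRRel E Y P (P r * P s * P r * E i)
        ((P s * P r * P s - 2 * Y (hi r) + Y (lo r) + Y (hi s)) * E i)
  | braid_other (r s : Fin (n - 1)) (i) : (s : ℕ) = r + 1 →
      ¬ (i (hi s) = i (lo r) ∧ (Arrow (i (lo r)) (i (hi r)) ∨ Arrow (i (hi r)) (i (lo r)) ∨
        DoubleArrow (i (lo r)) (i (hi r)))) →
      KLRRel E Y P (P r * P s * P r * E i) (P s * P r * P s * E i)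

variable (F : Type*) [Field F] (e n : ℕ) [NeZero e]

/-- The KLR algebra `R_n` (of type `A_{e-1}^{(1)}`) over `F`. -/
def KLR : Type _ :=
  RingQuot (KLRRel (B := FreeAlgebra F (KGen e n)) (fun i => FreeAlgebra.ι F (KGen.idem i))
    (fun r => FreeAlgebra.ι F (KGen.y r)) (fun r => FreeAlgebra.ι F (KGen.psi r)))

instance : Ring (KLR F e n) := inferInstanceAs (Ring (RingQuot _))
instance : Algebra F (KLR F e n) := inferInstanceAs (Algebra F (RingQuot _))

/-- The canonical projection from the free algebra. -/
def KLR.mk : FreeAlgebra F (KGen e n) →ₐ[F] KLR F e n := RingQuot.mkAlgHom F _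

variable {e n}

/-- The element `e(i)` of `R_n`. -/
def KLR.idem (i : Fin n → ZMod e) : KLR F e n := KLR.mk F e n (FreeAlgebra.ι F (KGen.idem i))

/-- The element `y_r` of `R_n`. -/
def KLR.y (r : Fin n) : KLR F e n := KLR.mk F e n (FreeAlgebra.ι F (KGen.y r))

/-- The element `ψ_r` of `R_n`. -/
def KLR.psi (r : Fin (n - 1)) : KLR F e n := KLR.mk F e n (FreeAlgebra.ι F (KGen.psi r))

theorem KLRRel.map {A B : Type*} [Ring A] [Ring B] (f : A →+* B) {E : (Fin n → ZMod e) → A}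
    {Y : Fin n → A} {P : Fin (n - 1) → A} {a b : A} (h : KLRRel E Y P a b) :
    KLRRel (fun i => f (E i)) (fun r => f (Y r)) (fun r => f (P r)) (f a) (f b) := by
  induction h with
  | idem i => simpa using KLRRel.idem i
  | orth i j h => simpa using KLRRel.orth i j h
  | sum_one =>
    have := KLRRel.sum_one (E := fun i => f (E i)) (Y := fun r => f (Y r)) (P := fun r => f (P r))
    simpa using this
  | y_idem r i => simpa using KLRRel.y_idem r i
  | psi_idem r i => simpa using KLRRel.psi_idem r i
  | y_y r s => simpa using KLRRel.y_y r s
  | psi_psi r s h => simpa using KLRRel.psi_psi r s h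
  | psi_y r s h h' => simpa using KLRRel.psi_y r s h h'
  | psi_y_eq r i h => simpa using KLRRel.psi_y_eq r i h
  | psi_y_ne r i h => simpa using KLRRel.psi_y_ne r i h
  | y_psi_eq r i h => simpa using KLRRel.y_psi_eq r i h
  | y_psi_ne r i h => simpa using KLRRel.y_psi_ne r i h
  | psi_sq r i => simpa [map_Lval] using KLRRel.psi_sq r i
  | braid_arrow r s i h h1 h2 => simpa using KLRRel.braid_arrow r s i h h1 h2
  | braid_arrow' r s i h h1 h2 => simpa using KLRRel.braid_arrow' r s i h h1 h2
  | braid_double r s i h h1 h2 =>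
    have := KLRRel.braid_double (E := fun i => f (E i)) (Y := fun r => f (Y r))
      (P := fun r => f (P r)) r s i h h1 h2
    simpa [map_ofNat] using this
  | braid_other r s i h h1 => simpa using KLRRel.braid_other r s i h h1

theorem KLR.rel {a b : KLR F e n}
    (h : KLRRel (B := KLR F e n) (KLR.idem F) (KLR.y F) (KLR.psi F) a b) : a = b := by
  have key : ∀ {x y : FreeAlgebra F (KGen e n)}, KLRRel (B := FreeAlgebra F (KGen e n))
      (fun i => FreeAlgebra.ι F (KGen.idem i)) (fun r => FreeAlgebra.ι F (KGen.y r))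
      (fun r => FreeAlgebra.ι F (KGen.psi r)) x y → KLR.mk F e n x = KLR.mk F e n y :=
    fun h => RingQuot.mkAlgHom_rel F h
  induction h with
  | idem i => simpa [KLR.idem, KLR.y, KLR.psi] using key (KLRRel.idem i)
  | orth i j h => simpa [KLR.idem, KLR.y, KLR.psi] using key (KLRRel.orth i j h)
  | sum_one => simpa [KLR.idem, KLR.y, KLR.psi] using key KLRRel.sum_one
  | y_idem r i => simpa [KLR.idem, KLR.y, KLR.psi] using key (KLRRel.y_idem r i)
  | psi_idem r i => simpa [KLR.idem, KLR.y, KLR.psi] using key (KLRRel.psi_idem r i)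
  | y_y r s => simpa [KLR.idem, KLR.y, KLR.psi] using key (KLRRel.y_y r s)
  | psi_psi r s h => simpa [KLR.idem, KLR.y, KLR.psi] using key (KLRRel.psi_psi r s h)
  | psi_y r s h h' => simpa [KLR.idem, KLR.y, KLR.psi] using key (KLRRel.psi_y r s h h')
  | psi_y_eq r i h => simpa [KLR.idem, KLR.y, KLR.psi] using key (KLRRel.psi_y_eq r i h)
  | psi_y_ne r i h => simpa [KLR.idem, KLR.y, KLR.psi] using key (KLRRel.psi_y_ne r i h)
  | y_psi_eq r i h => simpa [KLR.idem, KLR.y, KLR.psi] using key (KLRRel.y_psi_eq r i h)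
  | y_psi_ne r i h => simpa [KLR.idem, KLR.y, KLR.psi] using key (KLRRel.y_psi_ne r i h)
  | psi_sq r i => simpa [map_Lval, KLR.idem, KLR.y, KLR.psi] using key (KLRRel.psi_sq r i)
  | braid_arrow r s i h h1 h2 => simpa [KLR.idem, KLR.y, KLR.psi] using key (KLRRel.braid_arrow r s i h h1 h2)
  | braid_arrow' r s i h h1 h2 => simpa [KLR.idem, KLR.y, KLR.psi] using key (KLRRel.braid_arrow' r s i h h1 h2)
  | braid_double r s i h h1 h2 => simpa [KLR.idem, KLR.y, KLR.psi, map_ofNat] using key (KLRRel.braid_double r s i h h1 h2)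
  | braid_other r s i h h1 => simpa [KLR.idem, KLR.y, KLR.psi] using key (KLRRel.braid_other r s i h h1)

/-- The value of a family on a generator. -/
def genValue {B : Type*} (E : (Fin n → ZMod e) → B) (Y : Fin n → B) (P : Fin (n - 1) → B) :
    KGen e n → B
  | KGen.idem i => E i
  | KGen.y r => Y r
  | KGen.psi r => P r

/-- The universal property of the KLR algebra. -/
def KLR.lift {B : Type*} [Ring B] [Algebra F B] (E : (Fin n → ZMod e) → B) (Y : Fin n → B)
    (P : Fin (n - 1) → B) (h : ∀ a b, KLRRel E Y P a b → a = b) : KLR F e n →ₐ[F] B :=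
  RingQuot.liftAlgHom F
    ⟨FreeAlgebra.lift F (genValue E Y P), fun a b hab => h _ _ (by
        simpa [genValue] using hab.map (FreeAlgebra.lift F (genValue E Y P)).toRingHom)⟩

section lift

variable {F} {B : Type*} [Ring B] [Algebra F B] {E : (Fin n → ZMod e) → B} {Y : Fin n → B}
    {P : Fin (n - 1) → B} (h : ∀ a b, KLRRel E Y P a b → a = b)

theorem KLR.lift_mk (x : FreeAlgebra F (KGen e n)) :
    KLR.lift F E Y P h (KLR.mk F e n x) = FreeAlgebra.lift F (genValue E Y P) x :=
  RingQuot.liftAlgHom_mkAlgHom_apply F _ _ x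

@[simp] theorem KLR.lift_idem (i) : KLR.lift F E Y P h (KLR.idem F i) = E i := by
  simp [KLR.idem, KLR.lift_mk, genValue]

@[simp] theorem KLR.lift_y (r) : KLR.lift F E Y P h (KLR.y F r) = Y r := by
  simp [KLR.y, KLR.lift_mk, genValue]

@[simp] theorem KLR.lift_psi (r) : KLR.lift F E Y P h (KLR.psi F r) = P r := by
  simp [KLR.psi, KLR.lift_mk, genValue]

end lift

variable {F} in
/-- A subalgebra that contains the generators is everything. -/
theorem KLR.induction {S : Subalgebra F (KLR F e n)} (h1 : ∀ i, KLR.idem F i ∈ S)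
    (h2 : ∀ r, KLR.y F r ∈ S) (h3 : ∀ r, KLR.psi F r ∈ S) (x : KLR F e n) : x ∈ S := by
  obtain ⟨x, rfl⟩ := RingQuot.mkAlgHom_surjective F _ x
  change KLR.mk F e n x ∈ S
  induction x using FreeAlgebra.induction with
  | grade0 r => rw [AlgHom.commutes]; exact S.algebraMap_mem r
  | grade1 g => cases g with
    | idem i => exact h1 i
    | y r => exact h2 r
    | psi r => exact h3 r
  | mul a b ha hb => rw [map_mul]; exact S.mul_mem ha hb
  | add a b ha hb => rw [map_add]; exact S.add_mem ha hb

open Classical in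
/-- The idempotent `∑_{i ∈ S} e(i)`. -/
def KLR.esum (S : Set (Fin n → ZMod e)) : KLR F e n := ∑ i ∈ Finset.univ.filter (· ∈ S), KLR.idem F i

section esum

variable {F}

theorem KLR.idem_mul_idem (i j : Fin n → ZMod e) [Decidable (i = j)] :
    KLR.idem F i * KLR.idem F j = if i = j then KLR.idem F i else 0 := by
  split_ifs with h
  · subst h; exact KLR.rel F (KLRRel.idem i)
  · exact KLR.rel F (KLRRel.orth i j h)

theorem KLR.idem_mul_esum (i : Fin n → ZMod e) (S : Set (Fin n → ZMod e)) [Decidable (i ∈ S)] :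
    KLR.idem F i * KLR.esum F S = if i ∈ S then KLR.idem F i else 0 := by
  classical
  simp [KLR.esum, Finset.mul_sum, KLR.idem_mul_idem]

theorem KLR.esum_mul_idem (i : Fin n → ZMod e) (S : Set (Fin n → ZMod e)) [Decidable (i ∈ S)] :
    KLR.esum F S * KLR.idem F i = if i ∈ S then KLR.idem F i else 0 := by
  classical
  simp only [KLR.esum, Finset.sum_mul, KLR.idem_mul_idem]
  rw [Finset.sum_ite_eq']
  simp

theorem KLR.esum_mul_esum (S T : Set (Fin n → ZMod e)) :
    KLR.esum F S * KLR.esum F T = KLR.esum F (S ∩ T) := by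
  classical
  conv_lhs => rw [KLR.esum, Finset.sum_mul]
  simp only [KLR.idem_mul_esum]
  rw [KLR.esum, ← Finset.sum_filter, Finset.filter_filter]
  exact Finset.sum_congr (by ext; simp) fun _ _ => rfl

theorem KLR.isIdempotentElem_esum (S : Set (Fin n → ZMod e)) :
    IsIdempotentElem (KLR.esum F S) := by
  rw [IsIdempotentElem, KLR.esum_mul_esum, Set.inter_self]

theorem KLR.esum_univ : KLR.esum F (Set.univ : Set (Fin n → ZMod e)) = 1 := by
  classical
  simpa [KLR.esum] using KLR.rel F (e := e) (n := n) KLRRel.sum_one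

theorem KLR.esum_empty : KLR.esum F (∅ : Set (Fin n → ZMod e)) = 0 := by
  simp [KLR.esum]

theorem KLR.y_mul_esum (r : Fin n) (S : Set (Fin n → ZMod e)) :
    KLR.y F r * KLR.esum F S = KLR.esum F S * KLR.y F r := by
  rw [KLR.esum, Finset.mul_sum, Finset.sum_mul]
  exact Finset.sum_congr rfl fun i _ => KLR.rel F (KLRRel.y_idem r i)

theorem act_simpleT_act_simpleT {X : Type*} (r : Fin (n - 1)) (i : Fin n → X) :
    act (simpleT r) (act (simpleT r) i) = i := by
  funext k; simp [act, simpleT]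

theorem KLR.psi_mul_esum (r : Fin (n - 1)) (S T : Set (Fin n → ZMod e))
    (h : ∀ i, i ∈ S ↔ act (simpleT r) i ∈ T) :
    KLR.psi F r * KLR.esum F S = KLR.esum F T * KLR.psi F r := by
  classical
  rw [KLR.esum, Finset.mul_sum, KLR.esum, Finset.sum_mul]
  refine Finset.sum_bij' (fun i _ => act (simpleT r) i) (fun i _ => act (simpleT r) i) ?_ ?_ ?_ ?_ ?_
  · intro i hi; simpa [← h] using hi
  · intro i hi; simpa [h, act_simpleT_act_simpleT] using hi
  · intro i _; exact act_simpleT_act_simpleT r i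
  · intro i _; exact act_simpleT_act_simpleT r i
  · intro i _; exact KLR.rel F (KLRRel.psi_idem r i)

/-- Equalities of the form `a e(i) = b e(i)` can be summed over `i`. -/
theorem KLR.mul_esum_congr {a b : KLR F e n} {S : Set (Fin n → ZMod e)}
    (h : ∀ i ∈ S, a * KLR.idem F i = b * KLR.idem F i) : a * KLR.esum F S = b * KLR.esum F S := by
  rw [KLR.esum, Finset.mul_sum, Finset.mul_sum]
  exact Finset.sum_congr rfl fun i hi => h i (by simpa using hi)

/-- The element `e_α` commutes with everything. -/
theorem KLR.esum_Ialpha_comm (α : ZMod e → ℕ) (x : KLR F e n) :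
    KLR.esum F (Ialpha n α) * x = x * KLR.esum F (Ialpha n α) := by
  have := KLR.induction (S := Subalgebra.centralizer F {KLR.esum F (Ialpha n α)}) ?_ ?_ ?_ x
  · exact (Subalgebra.mem_centralizer_iff F).1 this _ rfl
  · classical
    intro i
    rw [Subalgebra.mem_centralizer_iff]
    rintro _ rfl
    rw [KLR.esum_mul_idem, KLR.idem_mul_esum]
  · intro r
    rw [Subalgebra.mem_centralizer_iff]
    rintro _ rfl
    rw [KLR.y_mul_esum]
  · intro r
    rw [Subalgebra.mem_centralizer_iff]
    rintro _ rfl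
    rw [KLR.psi_mul_esum r _ (Ialpha n α) fun i => act_mem_Ialpha _]

end esum

end KLR

/-! ### Idempotent truncations -/

section Corner

variable {F A B : Type*} [Field F] [Ring A] [Algebra F A] [Ring B] [Algebra F B]

/-- The algebra structure on `p A p`. -/
instance cornerAlgebra {p : A} (hp : IsIdempotentElem p) : Algebra F hp.Corner where
  smul r x := ⟨r • x.1, by
    obtain ⟨a, ha⟩ := x.2
    exact ⟨r • a, by simp [← ha]⟩⟩
  algebraMap :=
    { toFun := fun r => ⟨r • p, r • 1, by simp [hp.eq]⟩
      map_one' := Subtype.ext (one_smul F p)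
      map_mul' := fun r s => Subtype.ext (by
        change (r * s) • p = r • p * s • p
        rw [smul_mul_smul_comm, hp.eq])
      map_zero' := Subtype.ext (zero_smul F p)
      map_add' := fun r s => Subtype.ext (add_smul r s p) }
  commutes' r x := Subtype.ext (by
    have := (Subsemigroup.mem_corner_iff hp).1 x.2
    change r • p * x.1 = x.1 * r • p
    simp [this.1, this.2])
  smul_def' r x := Subtype.ext (by
    have := (Subsemigroup.mem_corner_iff hp).1 x.2
    change r • x.1 = r • p * x.1
    simp [this.1])

/-- The inclusion of `p A p` in `A`. -/
def cornerVal {p : A} (hp : IsIdempotentElem p) : hp.Corner →ₗ[F] A where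
  toFun x := x.1
  map_add' _ _ := rfl
  map_smul' _ _ := rfl

/-- The linear map `a ↦ p a p` from `A` to `p A p`. -/
def truncate {p : A} (hp : IsIdempotentElem p) : A →ₗ[F] hp.Corner where
  toFun a := ⟨p * a * p, a, rfl⟩
  map_add' a b := Subtype.ext (by
    change p * (a + b) * p = p * a * p + p * b * p
    simp [mul_add, add_mul])
  map_smul' r a := Subtype.ext (by
    change p * (r • a) * p = r • (p * a * p)
    simp)

/-- An algebra homomorphism `f` that maps `p` to `1` restricts to a unital one on `p A p`. -/
def cornerLift {p : A} (hp : IsIdempotentElem p) (f : A →ₐ[F] B) (h : f p = 1) :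
    hp.Corner →ₐ[F] B :=
  AlgHom.ofLinearMap (f.toLinearMap ∘ₗ cornerVal hp) h fun x y => map_mul f x.1 y.1

/-- If `p` commutes with the image of `f : A → B`, then `a ↦ p f(a) p = f(a) p` is a unital
homomorphism from `A` to `p B p`. -/
def cornerHom (f : A →ₐ[F] B) {p : B} (hp : IsIdempotentElem p) (hc : ∀ x, p * f x = f x * p) :
    A →ₐ[F] hp.Corner :=
  AlgHom.ofLinearMap (truncate hp ∘ₗ f.toLinearMap)
    (Subtype.ext (by
      change p * f 1 * p = p
      simp [hp.eq]))
    fun x y => Subtype.ext (by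
      change p * f (x * y) * p = p * f x * p * (p * f y * p)
      have h1 : ∀ z, p * f z * p = f z * p := fun z => by rw [hc, mul_assoc, hp.eq]
      rw [h1, h1, h1, map_mul, mul_assoc (f x) p, ← mul_assoc p, hc, mul_assoc (f y) p, hp.eq,
        mul_assoc])

end Corner

/-! ### The algebras `R_α`, their quotients, and cyclotomic KLR algebras -/

section Quotients

variable (F : Type*) [Field F] {e : ℕ} [NeZero e] (n : ℕ)

/-- The algebra `R_α = R_n e_α = e_α R_n e_α` (the idempotent `e_α` is central), for `α` of
height `n`. -/
def KLRa (α : ZMod e → ℕ) : Type _ :=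
  (KLR.isIdempotentElem_esum (F := F) (Ialpha n α)).Corner

instance (α : ZMod e → ℕ) : Ring (KLRa F n α) := inferInstanceAs (Ring (IsIdempotentElem.Corner _))
instance (α : ZMod e → ℕ) : Algebra F (KLRa F n α) :=
  inferInstanceAs (Algebra F (IsIdempotentElem.Corner _))

/-- The projection `x ↦ x e_α` from `R_n` onto `R_α`. -/
def KLRa.proj (α : ZMod e → ℕ) : KLR F e n →ₐ[F] KLRa F n α :=
  cornerHom (AlgHom.id F _) (KLR.isIdempotentElem_esum (F := F) (Ialpha n α))
    (KLR.esum_Ialpha_comm α)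

variable {F} {n} in
/-- A homomorphism from `R_n` that maps `e_α` to `1` restricts to `R_α`. -/
def KLRa.lift {B : Type*} [Ring B] [Algebra F B] (α : ZMod e → ℕ) (g : KLR F e n →ₐ[F] B)
    (h1 : g (KLR.esum F (Ialpha n α)) = 1) : KLRa F n α →ₐ[F] B :=
  cornerLift (KLR.isIdempotentElem_esum (F := F) (Ialpha n α)) g h1

variable {F} {n} in
theorem KLRa.lift_proj {B : Type*} [Ring B] [Algebra F B] (α : ZMod e → ℕ) (g : KLR F e n →ₐ[F] B)
    (h1 : g (KLR.esum F (Ialpha n α)) = 1) (x : KLR F e n) :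
    KLRa.lift α g h1 (KLRa.proj F n α x) = g x := by
  change g (KLR.esum F (Ialpha n α) * x * KLR.esum F (Ialpha n α)) = g x
  rw [map_mul, map_mul, h1, one_mul, mul_one]

/-- The quotient of `R_α` by the two-sided ideal generated by the elements `e(i)` with
`i ∈ I^α ∖ X`. -/
def KLRbar (α : ZMod e → ℕ) (X : Set (Fin n → ZMod e)) : Type _ :=
  RingQuot fun a b : KLRa F n α =>
    (∃ i ∈ Ialpha n α, i ∉ X ∧ a = KLRa.proj F n α (KLR.idem F i)) ∧ b = 0

variable (α : ZMod e → ℕ) (X : Set (Fin n → ZMod e))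

instance : Ring (KLRbar F n α X) := inferInstanceAs (Ring (RingQuot _))
instance : Algebra F (KLRbar F n α X) := inferInstanceAs (Algebra F (RingQuot _))

/-- The natural projection from `R_α` onto its quotient `KLRbar`. -/
def KLRbar.mk : KLRa F n α →ₐ[F] KLRbar F n α X := RingQuot.mkAlgHom F _

/-- The natural projection from `R_n` onto the quotient `KLRbar` of `R_α`. -/
def KLRbar.proj : KLR F e n →ₐ[F] KLRbar F n α X :=
  (KLRbar.mk F n α X).comp (KLRa.proj F n α)

variable {F n} in
/-- The universal property of `KLRbar`. -/
def KLRbar.lift {B : Type*} [Ring B] [Algebra F B] (g : KLR F e n →ₐ[F] B)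
    (h1 : g (KLR.esum F (Ialpha n α)) = 1)
    (h2 : ∀ i ∈ Ialpha n α, i ∉ X → g (KLR.idem F i) = 0) : KLRbar F n α X →ₐ[F] B :=
  RingQuot.liftAlgHom F ⟨KLRa.lift α g h1, by
    rintro _ _ ⟨⟨i, hi, hX, rfl⟩, rfl⟩
    rw [KLRa.lift_proj, h2 i hi hX, map_zero]⟩

variable {F n} in
theorem KLRbar.lift_proj {B : Type*} [Ring B] [Algebra F B] (g : KLR F e n →ₐ[F] B)
    (h1 : g (KLR.esum F (Ialpha n α)) = 1)
    (h2 : ∀ i ∈ Ialpha n α, i ∉ X → g (KLR.idem F i) = 0) (x : KLR F e n) :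
    KLRbar.lift α X g h1 h2 (KLRbar.proj F n α X x) = g x :=
  (RingQuot.liftAlgHom_mkAlgHom_apply F _ _ _).trans (KLRa.lift_proj α g h1 x)

variable {n X} in
theorem KLRbar.proj_idem_eq_zero {i : Fin n → ZMod e} (h : i ∈ Ialpha n α → i ∉ X) :
    KLRbar.proj F n α X (KLR.idem F i) = 0 := by
  classical
  by_cases hi : i ∈ Ialpha n α
  · have : KLRbar.mk F n α X (KLRa.proj F n α (KLR.idem F i)) = KLRbar.mk F n α X 0 :=
      RingQuot.mkAlgHom_rel F ⟨⟨i, hi, h hi, rfl⟩, rfl⟩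
    exact this.trans (map_zero (KLRbar.mk F n α X))
  · have : KLRa.proj F n α (KLR.idem F i) = 0 := Subtype.ext (by
      change KLR.esum F (Ialpha n α) * KLR.idem F i * KLR.esum F (Ialpha n α) = 0
      simp [KLR.esum_mul_idem, hi])
    exact (congrArg (KLRbar.mk F n α X) this).trans (map_zero _)

theorem KLRbar.proj_esum_Ialpha : KLRbar.proj F n α X (KLR.esum F (Ialpha n α)) = 1 := by
  have : KLRa.proj F n α (KLR.esum F (Ialpha n α)) = 1 := Subtype.ext (by
    change KLR.esum F (Ialpha n α) * KLR.esum F (Ialpha n α) * KLR.esum F (Ialpha n α) =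
      KLR.esum F (Ialpha n α)
    rw [(KLR.isIdempotentElem_esum _).eq, (KLR.isIdempotentElem_esum _).eq])
  exact (congrArg (KLRbar.mk F n α X) this).trans (map_one _)

variable {n X} in
theorem KLRbar.proj_esum_eq_zero {S : Set (Fin n → ZMod e)}
    (h : ∀ i ∈ S, i ∈ Ialpha n α → i ∉ X) : KLRbar.proj F n α X (KLR.esum F S) = 0 := by
  rw [KLR.esum, map_sum]
  exact Finset.sum_eq_zero fun i hi => KLRbar.proj_idem_eq_zero F α (h i (by simpa using hi))

/-- The cyclotomic KLR algebra `R_n^Λ`, where `Λ = ∑ Λ_i ⬝ (fundamental weight i)`: the quotient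
of `R_n` by the two-sided ideal generated by all `y_1^{Λ_{i_1}} e(i)`. -/
def KLRcyc (lam : ZMod e → ℕ) : Type _ :=
  RingQuot fun a b : KLR F e n =>
    (∃ (i : Fin n → ZMod e) (h : 0 < n),
      a = KLR.y F ⟨0, h⟩ ^ lam (i ⟨0, h⟩) * KLR.idem F i) ∧ b = 0

instance (lam : ZMod e → ℕ) : Ring (KLRcyc F n lam) := inferInstanceAs (Ring (RingQuot _))
instance (lam : ZMod e → ℕ) : Algebra F (KLRcyc F n lam) :=
  inferInstanceAs (Algebra F (RingQuot _))

/-- The natural projection from `R_n` onto `R_n^Λ`. -/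
def KLRcyc.proj (lam : ZMod e → ℕ) : KLR F e n →ₐ[F] KLRcyc F n lam := RingQuot.mkAlgHom F _

/-- The universal property of `R_n^Λ`. -/
def KLRcyc.lift {B : Type*} [Ring B] [Algebra F B] (lam : ZMod e → ℕ) (g : KLR F e n →ₐ[F] B)
    (hg : ∀ (i : Fin n → ZMod e) (h : 0 < n),
      g (KLR.y F ⟨0, h⟩) ^ lam (i ⟨0, h⟩) * g (KLR.idem F i) = 0) : KLRcyc F n lam →ₐ[F] B :=
  RingQuot.liftAlgHom F ⟨g, by
    rintro _ _ ⟨⟨i, h, rfl⟩, rfl⟩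
    simpa using hg i h⟩

theorem KLRcyc.lift_proj {B : Type*} [Ring B] [Algebra F B] (lam : ZMod e → ℕ)
    (g : KLR F e n →ₐ[F] B)
    (hg : ∀ (i : Fin n → ZMod e) (h : 0 < n),
      g (KLR.y F ⟨0, h⟩) ^ lam (i ⟨0, h⟩) * g (KLR.idem F i) = 0) (x : KLR F e n) :
    KLRcyc.lift F n lam g hg (KLRcyc.proj F n lam x) = g x :=
  RingQuot.liftAlgHom_mkAlgHom_apply F _ _ x

theorem KLRcyc.isIdempotentElem (lam : ZMod e → ℕ) :
    IsIdempotentElem (KLRcyc.proj F n lam (KLR.esum F (Ialpha n α))) :=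
  (KLR.isIdempotentElem_esum (F := F) (Ialpha n α)).map _

/-- The algebra `R_α^Λ = R_n^Λ e_α`, for `α` of height `n`. -/
def KLRcyca (lam : ZMod e → ℕ) : Type _ := (KLRcyc.isIdempotentElem F n α lam).Corner

instance (lam : ZMod e → ℕ) : Ring (KLRcyca F n α lam) :=
  inferInstanceAs (Ring (IsIdempotentElem.Corner _))
instance (lam : ZMod e → ℕ) : Algebra F (KLRcyca F n α lam) :=
  inferInstanceAs (Algebra F (IsIdempotentElem.Corner _))

/-- The projection `x ↦ x e_α` from `R_n` onto `R_α^Λ`. -/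
def KLRcyca.proj (lam : ZMod e → ℕ) : KLR F e n →ₗ[F] KLRcyca F n α lam :=
  truncate (KLRcyc.isIdempotentElem F n α lam) ∘ₗ (KLRcyc.proj F n lam).toLinearMap

variable {F} {n} in
/-- The universal property of `R_α^Λ`. -/
def KLRcyca.lift {B : Type*} [Ring B] [Algebra F B] (lam : ZMod e → ℕ) (g : KLR F e n →ₐ[F] B)
    (hg : ∀ (i : Fin n → ZMod e) (h : 0 < n),
      g (KLR.y F ⟨0, h⟩) ^ lam (i ⟨0, h⟩) * g (KLR.idem F i) = 0)
    (h1 : g (KLR.esum F (Ialpha n α)) = 1) : KLRcyca F n α lam →ₐ[F] B :=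
  cornerLift (KLRcyc.isIdempotentElem F n α lam) (KLRcyc.lift F n lam g hg)
    ((KLRcyc.lift_proj F n lam g hg _).trans h1)

end Quotients

/-! ### Gradings

All algebras here are graded by `deg e(i) = 0`, `deg y_r = 2`, `deg ψ_r e(i) = -c_{i_r,i_{r+1}}`. -/

section Grading

variable (F : Type*) [Field F] {e n : ℕ} [NeZero e]

/-- Products of homogeneous generators of `R_n`, with their degrees. -/
inductive IsMonomial : ℤ → KLR F e n → Prop
  | one : IsMonomial 0 1
  | idem_mul {m : ℤ} {x : KLR F e n} (i : Fin n → ZMod e) :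
      IsMonomial m x → IsMonomial m (KLR.idem F i * x)
  | y_mul {m : ℤ} {x : KLR F e n} (r : Fin n) : IsMonomial m x → IsMonomial (2 + m) (KLR.y F r * x)
  | psi_mul {m : ℤ} {x : KLR F e n} (r : Fin (n - 1)) (i : Fin n → ZMod e) : IsMonomial m x →
      IsMonomial (-cartan (i (lo r)) (i (hi r)) + m) (KLR.psi F r * KLR.idem F i * x)

/-- The homogeneous component of degree `m` of `R_n`. -/
def KLR.deg (m : ℤ) : Submodule F (KLR F e n) := Submodule.span F {x | IsMonomial F m x}

/-- The homogeneous component of degree `m` of a quotient `KLRbar` of `R_α`. -/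
def KLRbar.deg (α : ZMod e → ℕ) (X : Set (Fin n → ZMod e)) (m : ℤ) :
    Submodule F (KLRbar F n α X) :=
  (KLR.deg F m).map (KLRbar.proj F n α X).toLinearMap

/-- The homogeneous component of degree `m` of `R_α^Λ`. -/
def KLRcyca.deg (α lam : ZMod e → ℕ) (m : ℤ) : Submodule F (KLRcyca F n α lam) :=
  (KLR.deg F m).map (KLRcyca.proj F n α lam)

end Grading

/-! ### Wreath products -/

section Wreath

variable (F A : Type*) [Field F] [Ring A] [Algebra F A] (d : ℕ)

open scoped TensorProduct in
/-- The `d`-th tensor power of the algebra `A`. -/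
abbrev TPow : Type _ := ⨂[F] _ : Fin d, A

variable {F A d} in
/-- The homogeneous tensors `x_1 ⊗ ⋯ ⊗ x_d` of degree `m`, for a family `V` of homogeneous
components of `A`. -/
def IsHomTensor (V : ℤ → Submodule F A) (m : ℤ) (x : Fin d → A) : Prop :=
  ∃ a : Fin d → ℤ, (∀ k, x k ∈ V (a k)) ∧ ∑ k, a k = m

/-- The symmetric group permutes the tensor factors: `σ(x_1 ⊗ ⋯ ⊗ x_d)` has `k`-th factor
`x_{σ⁻¹ k}`. -/
instance permAction : MulSemiringAction (Equiv.Perm (Fin d)) (TPow F A d) where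
  smul σ x := PiTensorProduct.reindex F (fun _ => A) σ x
  one_smul x := by
    change PiTensorProduct.reindex F (fun _ => A) (Equiv.refl _) x = x
    rw [PiTensorProduct.reindex_refl]
    rfl
  mul_smul σ τ x := (PiTensorProduct.reindex_reindex (R := F) (s := fun _ => A) τ σ x).symm
  smul_zero σ := map_zero _
  smul_add σ := map_add _
  smul_one σ := by
    change PiTensorProduct.reindex F (fun _ => A) σ 1 = 1
    rw [PiTensorProduct.one_def, PiTensorProduct.reindex_tprod]
    rfl
  smul_mul σ x y := by
    change PiTensorProduct.reindex F (fun _ => A) σ (x * y) =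
      PiTensorProduct.reindex F (fun _ => A) σ x * PiTensorProduct.reindex F (fun _ => A) σ y
    induction x using PiTensorProduct.induction_on with
    | smul_tprod r f =>
      induction y using PiTensorProduct.induction_on with
      | smul_tprod s g =>
        simp only [smul_mul_assoc, mul_smul_comm, map_smul, PiTensorProduct.tprod_mul_tprod,
          PiTensorProduct.reindex_tprod]
        rfl
      | add a b ha hb => simp only [mul_add, map_add, ha, hb]
    | add a b ha hb => simp only [add_mul, map_add, ha, hb]

/-- The wreath product `A ≀ 𝔖_d`: its elements are sums of `a σ` (written `single σ a`) with
`a ∈ A^{⊗ d}` and `σ ∈ 𝔖_d`, with the product `(a σ)(b τ) = (a σ(b)) (σ τ)`. -/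
abbrev Wreath : Type _ := SkewMonoidAlgebra (TPow F A d) (Equiv.Perm (Fin d))

theorem permAction_smul_comm (σ : Equiv.Perm (Fin d)) (r : F) (x : TPow F A d) :
    σ • (r • x) = r • (σ • x) :=
  map_smul (PiTensorProduct.reindex F (fun _ => A) σ) r x

instance : Algebra F (Wreath F A d) :=
  Algebra.ofModule
    (fun r x y => by
      induction x using SkewMonoidAlgebra.induction_on with
      | zero => simp
      | single σ a =>
        induction y using SkewMonoidAlgebra.induction_on with
        | zero => simp
        | single τ b => simp [SkewMonoidAlgebra.smul_single, SkewMonoidAlgebra.single_mul_single]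
        | add p q hp hq => simp only [mul_add, smul_add, hp, hq]
      | add p q hp hq => simp only [add_mul, smul_add, hp, hq])
    (fun r x y => by
      induction x using SkewMonoidAlgebra.induction_on with
      | zero => simp
      | single σ a =>
        induction y using SkewMonoidAlgebra.induction_on with
        | zero => simp
        | single τ b => simp [SkewMonoidAlgebra.smul_single, SkewMonoidAlgebra.single_mul_single,
            permAction_smul_comm]
        | add p q hp hq => simp only [mul_add, smul_add, hp, hq]
      | add p q hp hq => simp only [add_mul, smul_add, hp, hq])

variable {A} in
/-- The homogeneous component of degree `m` of the wreath product. -/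
def Wreath.deg (V : ℤ → Submodule F A) (m : ℤ) : Submodule F (Wreath F A d) :=
  Submodule.span F {z | ∃ (σ : Equiv.Perm (Fin d)) (x : Fin d → A), IsHomTensor V m x ∧
    z = SkewMonoidAlgebra.single σ (PiTensorProduct.tprod F x)}

end Wreath

/-! ### The embeddings of `R_δ` into the quotient of `R_{dδ}` -/

section Embedding

variable (F : Type*) [Field F] {e : ℕ} [NeZero e] {d : ℕ}

theorem simpleT_pos_self (t : Fin d) (r : Fin (e - 1)) (a : Fin e) :
    simpleT (posPsi t r) (pos t a) = pos t (simpleT r a) := by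
  have hinj : Function.Injective (pos (d := d) (e := e) t) := fun a b h => (pos_inj h).2
  rw [simpleT, simpleT, ← pos_lo, ← pos_hi]
  exact hinj.swap_apply _ _ _

theorem simpleT_pos_of_ne {s t : Fin d} (h : s ≠ t) (r : Fin (e - 1)) (a : Fin e) :
    simpleT (posPsi t r) (pos s a) = pos s a := by
  rw [simpleT, ← pos_lo, ← pos_hi]
  exact Equiv.swap_apply_of_ne_of_ne (fun h' => h (pos_inj h').1) fun h' => h (pos_inj h').1

theorem block_act_self {X : Type*} (t : Fin d) (r : Fin (e - 1)) (k : Fin (d * e) → X) :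
    block t (act (simpleT (posPsi t r)) k) = act (simpleT r) (block t k) := by
  funext a
  simp only [block, act]
  have h1 : (simpleT (posPsi t r))⁻¹ = simpleT (posPsi t r) := Equiv.swap_inv _ _
  have h2 : (simpleT r)⁻¹ = simpleT r := Equiv.swap_inv _ _
  rw [h1, h2, simpleT_pos_self]

theorem block_act_of_ne {X : Type*} {s t : Fin d} (h : s ≠ t) (r : Fin (e - 1))
    (k : Fin (d * e) → X) : block s (act (simpleT (posPsi t r)) k) = block s k := by
  funext a
  simp only [block, act]
  have h1 : (simpleT (posPsi t r))⁻¹ = simpleT (posPsi t r) := Equiv.swap_inv _ _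
  rw [h1, simpleT_pos_of_ne h]

/-- The sequences whose `t`-th block is `i`. -/
def blockEq (t : Fin d) (i : Fin e → ZMod e) : Set (Fin (d * e) → ZMod e) := {k | block t k = i}

theorem blockEq_lo {t : Fin d} {i : Fin e → ZMod e} {k : Fin (d * e) → ZMod e}
    (h : k ∈ blockEq t i) (r : Fin (e - 1)) : k (lo (posPsi t r)) = i (lo r) := by
  rw [← pos_lo]; exact congrFun h _

theorem blockEq_hi {t : Fin d} {i : Fin e → ZMod e} {k : Fin (d * e) → ZMod e}
    (h : k ∈ blockEq t i) (r : Fin (e - 1)) : k (hi (posPsi t r)) = i (hi r) := by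
  rw [← pos_hi]; exact congrFun h _

theorem sum_esum_blockEq (t : Fin d) :
    ∑ i : Fin e → ZMod e, KLR.esum F (blockEq t i) = 1 := by
  classical
  rw [← KLR.esum_univ]
  simp only [KLR.esum, blockEq, Set.mem_setOf_eq, Set.mem_univ, Finset.filter_true]
  exact Finset.sum_fiberwise _ _ _

theorem posPsi_val (t : Fin d) (r : Fin (e - 1)) : (posPsi t r : ℕ) = r + e * t := rfl

/-- The embedding of `R_e` into `R_{de}` as the `t`-th factor of `R_e ⊗ ⋯ ⊗ R_e`: `e(i)` maps to
the sum of the `e(k)` over the `k` with `t`-th block `i`, and `y_a`, `ψ_a` map to the corresponding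
generators in the block `t`. -/
def blockHom (t : Fin d) : KLR F e e →ₐ[F] KLR F e (d * e) :=
  KLR.lift F (fun i => KLR.esum F (blockEq t i)) (fun a => KLR.y F (pos t a))
    (fun r => KLR.psi F (posPsi t r)) (by
    intro a b h
    have hpp : ∀ r s : Fin (e - 1), (s : ℕ) = r + 1 → (posPsi t s : ℕ) = posPsi t r + 1 :=
      fun r s h => by rw [posPsi_val, posPsi_val, h]; omega
    induction h with
    | idem i => exact KLR.isIdempotentElem_esum _
    | orth i j h =>
      rw [KLR.esum_mul_esum, ← KLR.esum_empty]
      congr 1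
      exact Set.eq_empty_of_forall_notMem fun k hk => h (hk.1.symm.trans hk.2)
    | sum_one => exact sum_esum_blockEq F t
    | y_idem r i => exact KLR.y_mul_esum _ _
    | psi_idem r i =>
      refine KLR.psi_mul_esum _ _ _ fun k => ?_
      change block t k = i ↔ block t _ = _
      rw [block_act_self]
      refine ⟨fun h => by rw [h], fun h => ?_⟩
      rw [← act_simpleT_act_simpleT r i, ← h, act_simpleT_act_simpleT]
    | y_y r s => exact KLR.rel F (KLRRel.y_y _ _)
    | psi_psi r s h =>
      refine KLR.rel F (KLRRel.psi_psi _ _ ?_)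
      rw [posPsi_val, posPsi_val]
      omega
    | psi_y r s h h' =>
      refine KLR.rel F (KLRRel.psi_y _ _ ?_ ?_)
      · rw [← pos_lo]; exact fun h1 => h (pos_inj h1).2
      · rw [← pos_hi]; exact fun h1 => h' (pos_inj h1).2
    | psi_y_eq r i h =>
      refine KLR.mul_esum_congr fun k hk => ?_
      rw [pos_lo, pos_hi]
      exact KLR.rel F (KLRRel.psi_y_eq _ _ (by rw [blockEq_lo hk, blockEq_hi hk, h]))
    | psi_y_ne r i h =>
      refine KLR.mul_esum_congr fun k hk => ?_
      rw [pos_lo, pos_hi]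
      exact KLR.rel F (KLRRel.psi_y_ne _ _ (by rwa [blockEq_lo hk, blockEq_hi hk]))
    | y_psi_eq r i h =>
      refine KLR.mul_esum_congr fun k hk => ?_
      rw [pos_lo, pos_hi]
      exact KLR.rel F (KLRRel.y_psi_eq _ _ (by rw [blockEq_lo hk, blockEq_hi hk, h]))
    | y_psi_ne r i h =>
      refine KLR.mul_esum_congr fun k hk => ?_
      rw [pos_lo, pos_hi]
      exact KLR.rel F (KLRRel.y_psi_ne _ _ (by rwa [blockEq_lo hk, blockEq_hi hk]))
    | psi_sq r i =>
      refine KLR.mul_esum_congr fun k hk => ?_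
      rw [pos_lo, pos_hi, ← blockEq_lo hk, ← blockEq_hi hk]
      exact KLR.rel F (KLRRel.psi_sq _ _)
    | braid_arrow r s i h h1 h2 =>
      refine KLR.mul_esum_congr fun k hk => ?_
      rw [← blockEq_lo hk, ← blockEq_hi hk] at h1 h2
      exact KLR.rel F (KLRRel.braid_arrow _ _ _ (hpp r s h) h1 h2)
    | braid_arrow' r s i h h1 h2 =>
      refine KLR.mul_esum_congr fun k hk => ?_
      rw [← blockEq_lo hk, ← blockEq_hi hk] at h1 h2
      exact KLR.rel F (KLRRel.braid_arrow' _ _ _ (hpp r s h) h1 h2)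
    | braid_double r s i h h1 h2 =>
      refine KLR.mul_esum_congr fun k hk => ?_
      rw [← blockEq_lo hk, ← blockEq_hi hk] at h1 h2
      rw [pos_lo, pos_hi, pos_hi]
      exact KLR.rel F (KLRRel.braid_double _ _ _ (hpp r s h) h1 h2)
    | braid_other r s i h h1 =>
      refine KLR.mul_esum_congr fun k hk => ?_
      rw [← blockEq_lo hk, ← blockEq_hi hk, ← blockEq_hi hk] at h1
      exact KLR.rel F (KLRRel.braid_other _ _ _ (hpp r s h) h1))

theorem blockHom_esum (t : Fin d) (S : Set (Fin e → ZMod e)) :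
    blockHom F t (KLR.esum F S) = KLR.esum F {k | block t k ∈ S} := by
  classical
  rw [KLR.esum, map_sum]
  simp only [blockHom, KLR.lift_idem, KLR.esum, blockEq, Set.mem_setOf_eq]
  rw [← Finset.sum_fiberwise_of_maps_to (s := Finset.univ.filter fun k => block t k ∈ S)
    (t := Finset.univ.filter (· ∈ S)) (g := block t) (by simp)]
  refine Finset.sum_congr rfl fun i hi => Finset.sum_congr ?_ fun _ _ => rfl
  ext k
  simp only [Finset.mem_filter, Finset.mem_univ, true_and] at hi ⊢
  exact ⟨fun h => ⟨h ▸ hi, h⟩, fun h => h.2⟩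

/-- The idempotent `e_{δ^d}` commutes with the image of `blockHom`. -/
theorem esum_Idd_comm (t : Fin d) (x : KLR F e e) :
    KLR.esum F (Idd e d) * blockHom F t x = blockHom F t x * KLR.esum F (Idd e d) := by
  have := KLR.induction
    (S := (Subalgebra.centralizer F {KLR.esum F (Idd e d)}).comap (blockHom F t)) ?_ ?_ ?_ x
  · exact (Subalgebra.mem_centralizer_iff F).1 this _ rfl
  · intro i
    rw [Subalgebra.mem_comap, Subalgebra.mem_centralizer_iff]
    rintro _ rfl
    rw [blockHom, KLR.lift_idem, KLR.esum_mul_esum, KLR.esum_mul_esum, Set.inter_comm]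
  · intro r
    rw [Subalgebra.mem_comap, Subalgebra.mem_centralizer_iff]
    rintro _ rfl
    rw [blockHom, KLR.lift_y, KLR.y_mul_esum]
  · intro r
    rw [Subalgebra.mem_comap, Subalgebra.mem_centralizer_iff]
    rintro _ rfl
    rw [blockHom, KLR.lift_psi, KLR.psi_mul_esum _ _ (Idd e d)]
    intro k
    refine forall_congr' fun s => ?_
    by_cases h : s = t
    · subst h
      rw [block_act_self]
      exact act_mem_Ialpha _
    · rw [block_act_of_ne h]

variable (e d)

/-- The quotient of `R_{dδ}` by the two-sided ideal generated by all `e(i)` with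
`i ∈ I^{dδ} ∖ ℰ_d`. -/
abbrev Rbar : Type _ := KLRbar F (d * e) (mdelta e d) (shuffles e d)

/-- The natural projection from `R_{de}` onto `Rbar`. -/
abbrev Rbar.proj : KLR F e (d * e) →ₐ[F] Rbar F e d :=
  KLRbar.proj F (d * e) (mdelta e d) (shuffles e d)

/-- The quotient of `R_δ` by the two-sided ideal generated by all `e(i)` with
`i ∈ I^δ ∖ I^{∅,1}`. -/
abbrev RbarDelta : Type _ := KLRbar F e (mdelta e 1) (Iempty1 e)

/-- The natural projection from `R_e` onto `RbarDelta`. -/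
abbrev RbarDelta.proj : KLR F e e →ₐ[F] RbarDelta F e :=
  KLRbar.proj F e (mdelta e 1) (Iempty1 e)

/-- The idempotent `e_{δ^d}` of `Rbar`. -/
def edd : Rbar F e d := Rbar.proj F e d (KLR.esum F (Idd e d))

theorem isIdempotentElem_edd : IsIdempotentElem (edd F e d) :=
  (KLR.isIdempotentElem_esum (F := F) (Idd e d)).map (Rbar.proj F e d)

/-- The algebra `e_{δ^d} Rbar e_{δ^d}`. -/
def TruncR : Type _ := (isIdempotentElem_edd F e d).Corner

instance : Ring (TruncR F e d) := inferInstanceAs (Ring (IsIdempotentElem.Corner _))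
instance : Algebra F (TruncR F e d) := inferInstanceAs (Algebra F (IsIdempotentElem.Corner _))

/-- The inclusion of `e_{δ^d} Rbar e_{δ^d}` in `Rbar`. -/
def TruncR.val : TruncR F e d →ₗ[F] Rbar F e d := cornerVal (isIdempotentElem_edd F e d)

/-- The homogeneous component of degree `m` of `e_{δ^d} Rbar e_{δ^d}`. -/
def TruncR.deg (m : ℤ) : Submodule F (TruncR F e d) :=
  (KLRbar.deg F (mdelta e d) (shuffles e d) m).comap (TruncR.val F e d)

/-- The map that sends `x ∈ R_{de}` to `e_{δ^d} x e_{δ^d}`, taken in the quotient `Rbar`. (It will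
be applied to elements that commute with `e_{δ^d}`, for which this is `x e_{δ^d}`.) -/
def TruncR.proj : KLR F e (d * e) →ₗ[F] TruncR F e d :=
  truncate (isIdempotentElem_edd F e d) ∘ₗ (Rbar.proj F e d).toLinearMap

variable {e d}

/-- The map `x ↦ e_{δ^d} blockHom(x) e_{δ^d}`, as a homomorphism from `R_e`. -/
def preIotaAt (t : Fin d) : KLR F e e →ₐ[F] TruncR F e d :=
  cornerHom ((Rbar.proj F e d).comp (blockHom F t)) (isIdempotentElem_edd F e d) fun x => by
    have := congrArg (Rbar.proj F e d) (esum_Idd_comm F t x)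
    rw [map_mul, map_mul] at this
    exact this

theorem preIotaAt_val (t : Fin d) (x : KLR F e e) : TruncR.val F e d (preIotaAt F t x) =
    Rbar.proj F e d (KLR.esum F (Idd e d) * blockHom F t x * KLR.esum F (Idd e d)) := by
  rw [map_mul, map_mul]
  rfl

theorem TruncR.ext {x y : TruncR F e d} (h : TruncR.val F e d x = TruncR.val F e d y) : x = y :=
  Subtype.ext h

/-- The embedding of the quotient `RbarDelta` of `R_δ` as the `t`-th factor. -/
def iotaAt (t : Fin d) : RbarDelta F e →ₐ[F] TruncR F e d :=
  KLRbar.lift (mdelta e 1) (Iempty1 e) (preIotaAt F t)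
    (by
      apply TruncR.ext
      rw [preIotaAt_val, blockHom_esum, KLR.esum_mul_esum, KLR.esum_mul_esum]
      have : Idd e d ∩ {k | block t k ∈ Ialpha e (mdelta e 1)} ∩ Idd e d = Idd e d := by
        ext k
        exact ⟨fun h => h.2, fun h => ⟨⟨h, h t⟩, h⟩⟩
      rw [this]
      rfl)
    (fun i _ hX => by
      apply TruncR.ext
      rw [preIotaAt_val, blockHom, KLR.lift_idem, KLR.esum_mul_esum, KLR.esum_mul_esum, map_zero]
      refine KLRbar.proj_esum_eq_zero F _ fun k hk _ hE => hX ?_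
      have := block_mem_of_shuffle (NeZero.pos e) hk.2 hE t
      rwa [show block t k = i from hk.1.2] at this)

variable (e d) in
/-- The map `ι : RbarDelta^{⊗ d} → e_{δ^d} Rbar e_{δ^d}`. -/
def iota : TPow F (RbarDelta F e) d →ₗ[F] TruncR F e d :=
  PiTensorProduct.lift ((MultilinearMap.mkPiAlgebraFin F d (TruncR F e d)).compLinearMap
    fun t => (iotaAt F t).toLinearMap)

end Embedding

/-! ### The embedding of the cyclotomic algebra `R_δ^{Λ_0}` -/

section Eta

variable (F : Type*) [Field F] {e : ℕ} [NeZero e]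

theorem Lval_sub_sub {A : Type*} [Ring A] (i j : ZMod e) (a b c : A) :
    Lval i j (a - c) (b - c) = Lval i j a b := by
  simp [Lval]

theorem RbarDelta.proj_psi_zero (r : Fin (e - 1)) (hr : (r : ℕ) = 0) :
    RbarDelta.proj F e (KLR.psi F r) = 0 := by
  rw [← mul_one (KLR.psi F r), ← KLR.esum_univ, KLR.esum, Finset.mul_sum, map_sum]
  refine Finset.sum_eq_zero fun i _ => ?_
  by_cases hi : i ∈ Iempty1 e
  · rw [KLR.rel F (KLRRel.psi_idem r i), map_mul, KLRbar.proj_idem_eq_zero, zero_mul]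
    intro _ h2
    have h3 := Iempty1.first h2 (lo r) hr
    rw [act, simpleT, Equiv.swap_inv, Equiv.swap_apply_left] at h3
    exact Iempty1.second hi (KLRTheta.hi r) (by simp [KLRTheta.hi, hr]) h3
  · rw [map_mul, KLRbar.proj_idem_eq_zero F (mdelta e 1) (fun _ => hi), mul_zero]

theorem RbarDelta.y_zero_psi (r : Fin (e - 1)) :
    RbarDelta.proj F e (KLR.y F ⟨0, NeZero.pos e⟩) * RbarDelta.proj F e (KLR.psi F r) =
      RbarDelta.proj F e (KLR.psi F r) * RbarDelta.proj F e (KLR.y F ⟨0, NeZero.pos e⟩) := by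
  by_cases hr : (r : ℕ) = 0
  · rw [RbarDelta.proj_psi_zero F r hr, mul_zero, zero_mul]
  · rw [← map_mul, ← map_mul]
    refine congrArg _ (KLR.rel F (KLRRel.psi_y r _ ?_ ?_)).symm
    · intro h
      have := congrArg Fin.val h
      simp only [lo] at this
      omega
    · intro h
      have := congrArg Fin.val h
      simp [hi] at this

variable (e) in
/-- The homomorphism from `R_e` to `RbarDelta` that fixes all `e(i)` and `ψ_r` and maps `y_r` to
`y_r - y_1` (in the notation that counts from `1`). -/
def etaKLR : KLR F e e →ₐ[F] RbarDelta F e :=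
  KLR.lift F (fun i => RbarDelta.proj F e (KLR.idem F i))
    (fun t => RbarDelta.proj F e (KLR.y F t - KLR.y F ⟨0, NeZero.pos e⟩))
    (fun r => RbarDelta.proj F e (KLR.psi F r)) (by
    intro a b h
    have hc := RbarDelta.y_zero_psi F (e := e)
    have hcc : ∀ r, RbarDelta.proj F e (KLR.y F r) * RbarDelta.proj F e (KLR.y F ⟨0, NeZero.pos e⟩) =
        RbarDelta.proj F e (KLR.y F ⟨0, NeZero.pos e⟩) * RbarDelta.proj F e (KLR.y F r) := fun r => by
      rw [← map_mul, ← map_mul, KLR.rel F (KLRRel.y_y r _)]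
    have hci : ∀ i, RbarDelta.proj F e (KLR.y F ⟨0, NeZero.pos e⟩) * RbarDelta.proj F e (KLR.idem F i) =
        RbarDelta.proj F e (KLR.idem F i) * RbarDelta.proj F e (KLR.y F ⟨0, NeZero.pos e⟩) := fun i => by
      rw [← map_mul, ← map_mul, KLR.rel F (KLRRel.y_idem _ i)]
    have key : ∀ {x y : KLR F e e}, KLRRel (B := KLR F e e) (KLR.idem F) (KLR.y F) (KLR.psi F) x y →
        RbarDelta.proj F e x = RbarDelta.proj F e y := fun h => congrArg _ (KLR.rel F h)
    generalize RbarDelta.proj F e = p at h hc hcc hci key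
    simp only [map_sub] at h
    generalize p (KLR.y F ⟨0, NeZero.pos e⟩) = c at h hc hcc hci
    induction h with
    | idem i => simpa using key (KLRRel.idem i)
    | orth i j h => simpa using key (KLRRel.orth i j h)
    | sum_one => simpa using key KLRRel.sum_one
    | y_idem r i =>
      have := key (KLRRel.y_idem r i)
      rw [map_mul, map_mul] at this
      rw [sub_mul, mul_sub, this, hci]
    | psi_idem r i => simpa using key (KLRRel.psi_idem r i)
    | y_y r s =>
      have := key (KLRRel.y_y r s)
      rw [map_mul, map_mul] at this
      simp only [sub_mul, mul_sub, this, hcc]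
      abel
    | psi_psi r s h => simpa using key (KLRRel.psi_psi r s h)
    | psi_y r s h h' =>
      have := key (KLRRel.psi_y r s h h')
      rw [map_mul, map_mul] at this
      rw [sub_mul, mul_sub, this, hc]
    | psi_y_eq r i h =>
      have := key (KLRRel.psi_y_eq r i h)
      simp only [map_mul, map_add, map_one, add_mul] at this
      simp only [sub_mul, mul_sub, add_mul, this, hc]
      abel
    | psi_y_ne r i h =>
      have := key (KLRRel.psi_y_ne r i h)
      simp only [map_mul] at this
      simp only [sub_mul, mul_sub, this, hc]
    | y_psi_eq r i h =>
      have := key (KLRRel.y_psi_eq r i h)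
      simp only [map_mul, map_add, map_one, add_mul] at this
      simp only [sub_mul, mul_sub, add_mul, this, hc]
      abel
    | y_psi_ne r i h =>
      have := key (KLRRel.y_psi_ne r i h)
      simp only [map_mul] at this
      simp only [sub_mul, mul_sub, this, hc]
    | psi_sq r i =>
      have := key (KLRRel.psi_sq r i)
      simp only [map_mul, map_Lval] at this
      rw [Lval_sub_sub, this]
    | braid_arrow r s i h h1 h2 => simpa using key (KLRRel.braid_arrow r s i h h1 h2)
    | braid_arrow' r s i h h1 h2 => simpa using key (KLRRel.braid_arrow' r s i h h1 h2)
    | braid_double r s i h h1 h2 =>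
      have := key (KLRRel.braid_double r s i h h1 h2)
      simp only [map_mul, map_add, map_sub, map_ofNat] at this
      rw [this]
      congr 1
      noncomm_ring
    | braid_other r s i h h1 => simpa using key (KLRRel.braid_other r s i h h1))

variable (e) in
/-- The homomorphism `η` from `R_δ^{Λ_0}` to `RbarDelta` that maps `e(i)`, `ψ_r` and `y_r` to
`e(i)`, `ψ_r` and `y_r - y_1` (in the notation that counts from `1`). -/
def eta : KLRcyca F e (mdelta e 1) (Pi.single (0 : ZMod e) 1) →ₐ[F] RbarDelta F e :=
  KLRcyca.lift (mdelta e 1) (Pi.single 0 1) (etaKLR F e)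
    (fun i h => by
      rw [etaKLR, KLR.lift_y, KLR.lift_idem]
      by_cases h0 : i ⟨0, h⟩ = 0
      · rw [h0, Pi.single_eq_same, pow_one, sub_self, map_zero, zero_mul]
      · rw [KLRbar.proj_idem_eq_zero, mul_zero]
        exact fun _ hi => h0 (Iempty1.first hi _ rfl))
    (by
      have : etaKLR F e (KLR.esum F (Ialpha e (mdelta e 1))) =
          RbarDelta.proj F e (KLR.esum F (Ialpha e (mdelta e 1))) := by
        rw [KLR.esum, map_sum, map_sum]
        exact Finset.sum_congr rfl fun i _ => by rw [etaKLR, KLR.lift_idem]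
      rw [this]
      exact KLRbar.proj_esum_Ialpha F e _ _)

end Eta

/-! ### Intertwiners and the elements `τ_r` -/

section Tau

variable (F : Type*) [Field F] {e : ℕ} [NeZero e] {d : ℕ}

/-- The algebra `R_δ^{Λ_0}`. -/
abbrev Rcyc (e : ℕ) [NeZero e] : Type _ := KLRcyca F e (mdelta e 1) (Pi.single (0 : ZMod e) 1)

/-- The homogeneous component of degree `m` of `R_δ^{Λ_0}`. -/
abbrev Rcyc.deg (e : ℕ) [NeZero e] (m : ℤ) : Submodule F (Rcyc F e) :=
  KLRcyca.deg F (mdelta e 1) (Pi.single (0 : ZMod e) 1) m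

/-- The homogeneous component of degree `m` of `RbarDelta`. -/
abbrev RbarDelta.deg (e : ℕ) [NeZero e] (m : ℤ) : Submodule F (RbarDelta F e) :=
  KLRbar.deg F (mdelta e 1) (Iempty1 e) m

/-- The homomorphism `η_t` from `R_δ^{Λ_0}` to `e_{δ^d} Rbar e_{δ^d}`, which is `η` followed by the
embedding as the `t`-th factor. -/
def etaAt (t : Fin d) : Rcyc F e →ₐ[F] TruncR F e d := (iotaAt F t).comp (eta F e)

/-- The map `ι ∘ η^{⊗ d}`. -/
def etaTensor (e d : ℕ) [NeZero e] : TPow F (Rcyc F e) d →ₗ[F] TruncR F e d :=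
  iota F e d ∘ₗ PiTensorProduct.map fun _ => (eta F e).toLinearMap

/-- The intertwiner `φ_r` of `R_n`: `φ_r e(i) = (ψ_r y_r - y_r ψ_r) e(i)` if `i_r = i_{r+1}`, and
`φ_r e(i) = ψ_r e(i)` otherwise. -/
def phi {n : ℕ} (r : Fin (n - 1)) : KLR F e n :=
  ∑ i : Fin n → ZMod e,
    (if i (lo r) = i (hi r) then KLR.psi F r * KLR.y F (lo r) - KLR.y F (lo r) * KLR.psi F r
      else KLR.psi F r) * KLR.idem F i

/-- The element `φ_{w_r} e_{δ^d}`, where `ω` assigns a reduced word to each permutation. -/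
def phiBlock (ω : Equiv.Perm (Fin (d * e)) → List (Fin (d * e - 1))) (r : Fin (d - 1)) :
    TruncR F e d :=
  TruncR.proj F e d (((ω (blockSwap e r)).map (phi F)).prod)

/-- The element `σ_r e_{δ^d} = ψ_{w_r} e_{δ^d}`, where `ω` assigns a reduced word to each
permutation. -/
def sigma (ω : Equiv.Perm (Fin (d * e)) → List (Fin (d * e - 1))) (r : Fin (d - 1)) :
    TruncR F e d :=
  TruncR.proj F e d (((ω (blockSwap e r)).map (KLR.psi F)).prod)

/-- The element `z_t = y_{te+1} e_{δ^d}` given by the first position of the block `t`, where blocks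
are counted from `0` and positions from `1`. -/
def zElt (t : Fin d) : TruncR F e d := TruncR.proj F e d (KLR.y F (pos t ⟨0, NeZero.pos e⟩))

/-- The left ideal of `RbarDelta` generated by all differences `y_k - y_t`. -/
def Kideal (e : ℕ) [NeZero e] : Submodule (RbarDelta F e) (RbarDelta F e) :=
  Submodule.span (RbarDelta F e) {x | ∃ k t : Fin e, x = RbarDelta.proj F e (KLR.y F k - KLR.y F t)}

/-- The subspace `𝒦`: the image under `ι` of the sum of the subspaces
`RbarDelta ⊗ ⋯ ⊗ K ⊗ ⋯ ⊗ RbarDelta`, where `K` is the left ideal `Kideal`. -/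
def calK (e d : ℕ) [NeZero e] : Submodule F (TruncR F e d) :=
  (Submodule.span F {x | ∃ a : Fin d → RbarDelta F e, (∃ t, a t ∈ Kideal F e) ∧
    x = PiTensorProduct.tprod F a}).map (iota F e d)

/-- The left ideal `𝒥` of `e_{δ^d} Rbar e_{δ^d}` generated by `𝒦`. -/
def calJ (e d : ℕ) [NeZero e] : Submodule (TruncR F e d) (TruncR F e d) :=
  Submodule.span (TruncR F e d) (calK F e d : Set (TruncR F e d))

/-- The span of the `x_1 ⊗ ⋯ ⊗ x_d` such that each `x_t` is homogeneous of degree `0` or `1`. -/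
def calS (e d : ℕ) [NeZero e] : Submodule F (TPow F (RbarDelta F e) d) :=
  Submodule.span F {x | ∃ a : Fin d → RbarDelta F e,
    (∀ t, a t ∈ RbarDelta.deg F e 0 ∨ a t ∈ RbarDelta.deg F e 1) ∧
      x = PiTensorProduct.tprod F a}

/-- The component of degree `m` of `S^{(r)}`: the span of the `x_1 ⊗ ⋯ ⊗ x_d` of total degree `m`
such that `x_r`, `x_{r+1}` are homogeneous of degree `0` or `1` and all other factors are `1`. -/
def calSr (r : Fin (d - 1)) (m : ℤ) : Submodule F (TPow F (RbarDelta F e) d) :=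
  Submodule.span F {x | ∃ (a : Fin d → RbarDelta F e) (p q : ℤ), (p = 0 ∨ p = 1) ∧ (q = 0 ∨ q = 1) ∧
    p + q = m ∧ a (lo r) ∈ RbarDelta.deg F e p ∧ a (hi r) ∈ RbarDelta.deg F e q ∧
    (∀ t, t ≠ lo r → t ≠ hi r → a t = 1) ∧ x = PiTensorProduct.tprod F a}

/-- The subspace `T = ∑_u σ_u ι(S)`, where the sum is over `u ∈ 𝔖_d`, where `σ_u` is the product of
the `σ_r` along the reduced word `ν u`. -/
def calT (ω : Equiv.Perm (Fin (d * e)) → List (Fin (d * e - 1)))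
    (ν : Equiv.Perm (Fin d) → List (Fin (d - 1))) : Submodule F (TruncR F e d) :=
  ⨆ u : Equiv.Perm (Fin d), ((calS F e d).map (iota F e d)).map
    (LinearMap.mulLeft F (((ν u).map (sigma F ω)).prod))

/-- The unital subalgebra of `e_{δ^d} Rbar e_{δ^d}` generated by `T ∪ 𝒦`. -/
def scrT (ω : Equiv.Perm (Fin (d * e)) → List (Fin (d * e - 1)))
    (ν : Equiv.Perm (Fin d) → List (Fin (d - 1))) : Subalgebra F (TruncR F e d) :=
  Algebra.adjoin F ((calT F ω ν : Set (TruncR F e d)) ∪ calK F e d)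

/-- The conditions that define the elements `τ = τ_r` and `ε = ε_r`:
`φ_{w_r} e_{δ^d} = τ_r (z_r - z_{r+1})^e + ε_r (z_r - z_{r+1})^{e-1}` modulo `𝒥`, with
`τ_r ∈ σ_r e_{δ^d} + ι(S^{(r)}_0)` and `ε_r ∈ ι(S^{(r)}_2)`. -/
structure IsTau (ω : Equiv.Perm (Fin (d * e)) → List (Fin (d * e - 1))) (r : Fin (d - 1))
    (τ ε : TruncR F e d) : Prop where
  tau_mem : τ - sigma F ω r ∈ (calSr F r 0).map (iota F e d)
  eps_mem : ε ∈ (calSr F r 2).map (iota F e d)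
  eq_mod : phiBlock F ω r - (τ * (zElt F (lo r) - zElt F (hi r)) ^ e +
    ε * (zElt F (lo r) - zElt F (hi r)) ^ (e - 1)) ∈ calJ F e d

end Tau

end KLRTheta

end

open KLRTheta

noncomputable section

set_option linter.unusedSectionVars false

namespace KLRTheta

/-! ### Inversions, reduced words and braid moves in the symmetric group -/

section Words

variable {n : ℕ}

theorem simpleT_lo (r : Fin (n - 1)) : simpleT r (lo r) = hi r := Equiv.swap_apply_left _ _

theorem simpleT_hi (r : Fin (n - 1)) : simpleT r (hi r) = lo r := Equiv.swap_apply_right _ _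

theorem simpleT_of_ne (r : Fin (n - 1)) {a : Fin n} (h1 : a ≠ lo r) (h2 : a ≠ hi r) :
    simpleT r a = a := Equiv.swap_apply_of_ne_of_ne h1 h2

theorem simpleT_inv (r : Fin (n - 1)) : (simpleT r)⁻¹ = simpleT r := Equiv.swap_inv _ _

theorem simpleT_mul_self (r : Fin (n - 1)) : simpleT r * simpleT r = 1 := Equiv.swap_mul_self _ _

theorem simpleT_mul_cancel (r : Fin (n - 1)) (w : Equiv.Perm (Fin n)) :
    simpleT r * (simpleT r * w) = w := by
  rw [← mul_assoc, simpleT_mul_self, one_mul]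

theorem simpleT_apply_apply (r : Fin (n - 1)) (a : Fin n) : simpleT r (simpleT r a) = a :=
  Equiv.swap_apply_self _ _ _

theorem simpleT_val (r : Fin (n - 1)) (a : Fin n) :
    (simpleT r a : ℕ) = if (a : ℕ) = r then (r : ℕ) + 1 else if (a : ℕ) = r + 1 then (r : ℕ) else a := by
  split_ifs with h1 h2
  · rw [show a = lo r from Fin.ext h1, simpleT_lo]; rfl
  · rw [show a = hi r from Fin.ext h2, simpleT_hi]; rfl
  · rw [simpleT_of_ne r (fun h => h1 (by rw [h]; rfl)) (fun h => h2 (by rw [h]; rfl))]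

theorem lo_val (r : Fin (n - 1)) : (lo r : ℕ) = r := rfl

theorem hi_val (r : Fin (n - 1)) : (hi r : ℕ) = r + 1 := rfl

theorem lo_lt_hi (r : Fin (n - 1)) : lo r < hi r := by
  rw [Fin.lt_def, lo_val, hi_val]; omega

theorem lo_ne_hi (r : Fin (n - 1)) : lo r ≠ hi r := (lo_lt_hi r).ne

theorem act_act {X : Type*} (v w : Equiv.Perm (Fin n)) (i : Fin n → X) :
    act v (act w i) = act (v * w) i := by
  funext k; simp [act]

theorem act_one {X : Type*} (i : Fin n → X) : act 1 i = i := by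
  funext k; simp [act]

/-- The set of inversions of a permutation. -/
def inv (w : Equiv.Perm (Fin n)) : Finset (Fin n × Fin n) :=
  Finset.univ.filter fun p => p.1 < p.2 ∧ w p.2 < w p.1

theorem mem_inv {w : Equiv.Perm (Fin n)} {p q : Fin n} : (p, q) ∈ inv w ↔ p < q ∧ w q < w p := by
  simp [inv]

theorem inv_one : inv (1 : Equiv.Perm (Fin n)) = ∅ := by
  ext ⟨p, q⟩
  simp [mem_inv]
  omega

theorem notMem_inv (r : Fin (n - 1)) (v : Equiv.Perm (Fin n)) :
    (v⁻¹ (lo r), v⁻¹ (hi r)) ∉ inv v := by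
  have := lo_lt_hi r
  simp [mem_inv]
  omega

theorem inv_simpleT_mul {r : Fin (n - 1)} {v : Equiv.Perm (Fin n)}
    (h : v⁻¹ (lo r) < v⁻¹ (hi r)) :
    inv (simpleT r * v) = insert (v⁻¹ (lo r), v⁻¹ (hi r)) (inv v) := by
  ext ⟨p, q⟩
  have hp : v⁻¹ (v p) = p := by simp
  have hq : v⁻¹ (v q) = q := by simp
  have key : ∀ a b : Fin n, v⁻¹ a = p → v⁻¹ b = q →
      ((p, q) ∈ inv (simpleT r * v) ↔ p < q ∧ simpleT r b < simpleT r a) := by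
    rintro a b rfl rfl
    simp [mem_inv]
  rw [Finset.mem_insert, key _ _ hp hq, mem_inv, Fin.lt_def (a := simpleT r _), simpleT_val,
    simpleT_val, Prod.mk.injEq]
  have e1 : p = v⁻¹ (lo r) ↔ (v p : ℕ) = r := by
    rw [← hp, v⁻¹.injective.eq_iff, Fin.ext_iff, lo_val]; simp
  have e2 : q = v⁻¹ (hi r) ↔ (v q : ℕ) = r + 1 := by
    rw [← hq, v⁻¹.injective.eq_iff, Fin.ext_iff, hi_val]; simp
  have e3 : (v q : ℕ) = r → (v p : ℕ) = r + 1 → ¬ p < q := by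
    intro h1 h2
    have h1' : q = v⁻¹ (lo r) := by
      rw [← hq]; congr 1; exact Fin.ext h1
    have h2' : p = v⁻¹ (hi r) := by
      rw [← hp]; congr 1; exact Fin.ext h2
    rw [h1', h2']; omega
  have e4 : (v p : ℕ) = r → (v q : ℕ) = r + 1 → p < q := by
    intro h1 h2
    rw [e1.2 h1, e2.2 h2]; exact h
  rw [e1, e2, Fin.lt_def (a := v q)]
  split_ifs <;> omega

theorem card_inv_simpleT_mul {r : Fin (n - 1)} {v : Equiv.Perm (Fin n)}
    (h : v⁻¹ (lo r) < v⁻¹ (hi r)) : (inv (simpleT r * v)).card = (inv v).card + 1 := by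
  rw [inv_simpleT_mul h, Finset.card_insert_of_notMem (notMem_inv r v)]

theorem simpleT_mul_inv_lo (r : Fin (n - 1)) (v : Equiv.Perm (Fin n)) :
    (simpleT r * v)⁻¹ (lo r) = v⁻¹ (hi r) := by
  rw [mul_inv_rev, simpleT_inv, Equiv.Perm.mul_apply, simpleT_lo]

theorem simpleT_mul_inv_hi (r : Fin (n - 1)) (v : Equiv.Perm (Fin n)) :
    (simpleT r * v)⁻¹ (hi r) = v⁻¹ (lo r) := by
  rw [mul_inv_rev, simpleT_inv, Equiv.Perm.mul_apply, simpleT_hi]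

theorem card_inv_simpleT_mul' {r : Fin (n - 1)} {v : Equiv.Perm (Fin n)}
    (h : v⁻¹ (hi r) < v⁻¹ (lo r)) : (inv (simpleT r * v)).card + 1 = (inv v).card := by
  have := card_inv_simpleT_mul (r := r) (v := simpleT r * v)
    (by rwa [simpleT_mul_inv_lo, simpleT_mul_inv_hi])
  rw [simpleT_mul_cancel] at this
  omega

theorem inv_lo_lt_or (r : Fin (n - 1)) (v : Equiv.Perm (Fin n)) :
    v⁻¹ (lo r) < v⁻¹ (hi r) ∨ v⁻¹ (hi r) < v⁻¹ (lo r) := by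
  rcases lt_trichotomy (v⁻¹ (lo r)) (v⁻¹ (hi r)) with h | h | h
  · exact Or.inl h
  · exact absurd (v⁻¹.injective h) (lo_ne_hi r)
  · exact Or.inr h

/-- The permutation that a word represents. -/
def wprod (l : List (Fin (n - 1))) : Equiv.Perm (Fin n) := (l.map simpleT).prod

@[simp] theorem wprod_nil : wprod ([] : List (Fin (n - 1))) = 1 := rfl

@[simp] theorem wprod_cons (r : Fin (n - 1)) (l : List (Fin (n - 1))) :
    wprod (r :: l) = simpleT r * wprod l := by simp [wprod]

theorem wprod_append (l l' : List (Fin (n - 1))) : wprod (l ++ l') = wprod l * wprod l' := by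
  simp [wprod]

/-- Reduced words, described by their construction from the right. -/
inductive Red : List (Fin (n - 1)) → Equiv.Perm (Fin n) → Prop
  | nil : Red [] 1
  | cons {r l v} : Red l v → v⁻¹ (lo r) < v⁻¹ (hi r) → Red (r :: l) (simpleT r * v)

theorem Red.wprod_eq {l : List (Fin (n - 1))} {w : Equiv.Perm (Fin n)} (h : Red l w) :
    wprod l = w := by
  induction h with
  | nil => rfl
  | cons _ _ ih => rw [wprod_cons, ih]

theorem Red.length_eq {l : List (Fin (n - 1))} {w : Equiv.Perm (Fin n)} (h : Red l w) :
    l.length = (inv w).card := by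
  induction h with
  | nil => simp [inv_one]
  | cons _ h ih => rw [card_inv_simpleT_mul h, List.length_cons, ih]

theorem card_inv_wprod_le (l : List (Fin (n - 1))) : (inv (wprod l)).card ≤ l.length := by
  induction l with
  | nil => simp [inv_one]
  | cons r l ih =>
    rw [wprod_cons, List.length_cons]
    rcases inv_lo_lt_or r (wprod l) with h | h
    · rw [card_inv_simpleT_mul h]; omega
    · have := card_inv_simpleT_mul' h; omega

theorem red_wprod {l : List (Fin (n - 1))} (h : l.length ≤ (inv (wprod l)).card) :
    Red l (wprod l) := by
  induction l with
  | nil => exact Red.nil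
  | cons r l ih =>
    rw [wprod_cons, List.length_cons] at h
    rw [wprod_cons]
    rcases inv_lo_lt_or r (wprod l) with h1 | h1
    · rw [card_inv_simpleT_mul h1] at h
      exact Red.cons (ih (by omega)) h1
    · have := card_inv_simpleT_mul' h1
      have := card_inv_wprod_le l
      omega

theorem eq_one_of_forall_lt {v : Equiv.Perm (Fin n)}
    (h : ∀ r : Fin (n - 1), v⁻¹ (lo r) < v⁻¹ (hi r)) : v = 1 := by
  have hm : StrictMono (v⁻¹ : Equiv.Perm (Fin n)) := by
    cases n with
    | zero => exact fun a => a.elim0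
    | succ n => exact Fin.strictMono_iff_lt_succ.2 fun i => h i
  have hv : ⇑(v⁻¹) = id :=
    (hm.range_inj strictMono_id).1 (by rw [v⁻¹.surjective.range_eq, Set.range_id])
  rw [← inv_eq_one]
  exact Equiv.ext fun a => congrFun hv a

theorem exists_red (w : Equiv.Perm (Fin n)) : ∃ l, Red l w := by
  generalize hm : (inv w).card = m
  induction m generalizing w with
  | zero =>
    have : w = 1 := eq_one_of_forall_lt fun r => by
      rcases inv_lo_lt_or r w with h | h
      · exact h
      · have := card_inv_simpleT_mul' h; omega
    exact ⟨[], this ▸ Red.nil⟩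
  | succ m ih =>
    by_cases hw : ∀ r : Fin (n - 1), w⁻¹ (lo r) < w⁻¹ (hi r)
    · rw [eq_one_of_forall_lt hw, inv_one] at hm
      simp at hm
    · push Not at hw
      obtain ⟨r, hr⟩ := hw
      have hr' := (inv_lo_lt_or r w).resolve_left (not_lt.2 hr)
      have := card_inv_simpleT_mul' hr'
      obtain ⟨l, hl⟩ := ih (simpleT r * w) (by omega)
      refine ⟨r :: l, ?_⟩
      have := Red.cons (r := r) hl (by rwa [simpleT_mul_inv_lo, simpleT_mul_inv_hi])
      rwa [simpleT_mul_cancel] at this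

theorem isReducedWord_iff {l : List (Fin (n - 1))} {w : Equiv.Perm (Fin n)} :
    IsReducedWord l w ↔ Red l w := by
  constructor
  · rintro ⟨h1, h2⟩
    obtain ⟨l', hl'⟩ := exists_red w
    have h3 := h2 l' hl'.wprod_eq
    rw [hl'.length_eq] at h3
    have h1' : wprod l = w := h1
    rw [← h1'] at h3 ⊢
    exact red_wprod h3
  · intro h
    refine ⟨h.wprod_eq, fun l' hl' => ?_⟩
    have := card_inv_wprod_le l'
    rw [show wprod l' = w from hl'] at this
    rwa [h.length_eq]

theorem red_of_length {l : List (Fin (n - 1))} {w : Equiv.Perm (Fin n)} (h : wprod l = w)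
    (hl : l.length = (inv w).card) : Red l w := by
  subst h; exact red_wprod hl.le

theorem Red.cons_of_gt {r : Fin (n - 1)} {l : List (Fin (n - 1))} {w : Equiv.Perm (Fin n)}
    (h : Red l (simpleT r * w)) (hr : w⁻¹ (hi r) < w⁻¹ (lo r)) : Red (r :: l) w := by
  have := Red.cons (r := r) h (by rwa [simpleT_mul_inv_lo, simpleT_mul_inv_hi])
  rwa [simpleT_mul_cancel] at this

theorem Red.of_cons {r : Fin (n - 1)} {l : List (Fin (n - 1))} {w : Equiv.Perm (Fin n)}
    (h : Red (r :: l) w) : Red l (simpleT r * w) ∧ w⁻¹ (hi r) < w⁻¹ (lo r) := by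
  cases h with
  | cons h hr =>
    rw [simpleT_mul_cancel, simpleT_mul_inv_lo, simpleT_mul_inv_hi]
    exact ⟨h, hr⟩

/-- Sums over the letters of a reduced word are sums over the inversions. -/
theorem Red.prod_inv {M : Type*} [CommMonoid M] (g : Fin n → Fin n → M) {r : Fin (n - 1)}
    {v : Equiv.Perm (Fin n)} (h : v⁻¹ (lo r) < v⁻¹ (hi r)) :
    ∏ p ∈ inv (simpleT r * v), g p.1 p.2 =
      g (v⁻¹ (lo r)) (v⁻¹ (hi r)) * ∏ p ∈ inv v, g p.1 p.2 := by
  rw [inv_simpleT_mul h, Finset.prod_insert (notMem_inv r v)]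

/-- Words that are related by braid moves. -/
inductive BEq : List (Fin (n - 1)) → List (Fin (n - 1)) → Prop
  | refl (l) : BEq l l
  | symm {l l'} : BEq l l' → BEq l' l
  | trans {l l' l''} : BEq l l' → BEq l' l'' → BEq l l''
  | cons (r) {l l'} : BEq l l' → BEq (r :: l) (r :: l')
  | comm (r s : Fin (n - 1)) (l) : (r : ℕ) + 1 < s ∨ (s : ℕ) + 1 < r → BEq (r :: s :: l) (s :: r :: l)
  | braid (r s : Fin (n - 1)) (l) : (s : ℕ) = r + 1 → BEq (r :: s :: r :: l) (s :: r :: s :: l)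

theorem simpleT_comm {r s : Fin (n - 1)} (h : (r : ℕ) + 1 < s ∨ (s : ℕ) + 1 < r) :
    simpleT r * simpleT s = simpleT s * simpleT r := by
  ext a
  simp only [Equiv.Perm.mul_apply, simpleT_val]
  split_ifs <;> omega

theorem simpleT_braid {r s : Fin (n - 1)} (h : (s : ℕ) = r + 1) :
    simpleT r * (simpleT s * simpleT r) = simpleT s * (simpleT r * simpleT s) := by
  have hm : lo s = hi r := Fin.ext (by rw [hi_val, lo_val, h])
  have h1 : lo r ≠ hi s := by rw [Ne, Fin.ext_iff, hi_val, lo_val]; omega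
  have f1 : simpleT r (hi s) = hi s := simpleT_of_ne _ h1.symm
    (by rw [Ne, Fin.ext_iff, hi_val, hi_val]; omega)
  have f2 : simpleT s (lo r) = lo r := simpleT_of_ne _
    (by rw [Ne, Fin.ext_iff, lo_val, lo_val]; omega) h1
  have f3 : simpleT s (hi r) = hi s := hm ▸ simpleT_lo s
  have f4 : simpleT s (hi s) = hi r := hm ▸ simpleT_hi s
  ext1 a
  simp only [Equiv.Perm.mul_apply]
  by_cases e1 : a = lo r
  · simp only [e1, simpleT_lo, f1, f2, f3]
  by_cases e2 : a = hi r
  · simp only [e2, simpleT_hi, f1, f2, f3, simpleT_lo, hm]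
  by_cases e3 : a = hi s
  · simp only [e3, simpleT_hi, f1, f2, f4]
  have g1 : simpleT r a = a := simpleT_of_ne _ e1 e2
  have g2 : simpleT s a = a := simpleT_of_ne _ (hm ▸ e2) e3
  simp only [g1, g2]

theorem BEq.wprod_eq {l l' : List (Fin (n - 1))} (h : BEq l l') : wprod l = wprod l' := by
  induction h with
  | refl => rfl
  | symm _ ih => exact ih.symm
  | trans _ _ h1 h2 => exact h1.trans h2
  | cons r _ ih => rw [wprod_cons, wprod_cons, ih]
  | comm r s l h => simp only [wprod_cons, ← mul_assoc, simpleT_comm h]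
  | braid r s l h =>
    simp only [wprod_cons]
    rw [← mul_assoc (simpleT s) (simpleT r), ← mul_assoc (simpleT r) (simpleT s * simpleT r),
      simpleT_braid h]
    simp only [mul_assoc]

theorem BEq.length_eq {l l' : List (Fin (n - 1))} (h : BEq l l') : l.length = l'.length := by
  induction h with
  | refl => rfl
  | symm _ ih => exact ih.symm
  | trans _ _ h1 h2 => exact h1.trans h2
  | cons r _ ih => simp [ih]
  | comm r s l h => simp
  | braid r s l h => simp

theorem inv_simpleT_mul_apply (s : Fin (n - 1)) (w : Equiv.Perm (Fin n)) (a : Fin n) :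
    (simpleT s * w)⁻¹ a = w⁻¹ (simpleT s a) := by
  rw [mul_inv_rev, simpleT_inv, Equiv.Perm.mul_apply]

theorem matsumoto_aux {r s : Fin (n - 1)} {v1 v2 : List (Fin (n - 1))} {w : Equiv.Perm (Fin n)}
    (h1 : Red v1 (simpleT r * w)) (h2 : Red v2 (simpleT s * w))
    (hr : w⁻¹ (hi r) < w⁻¹ (lo r)) (hs : w⁻¹ (hi s) < w⁻¹ (lo s)) (hrs : r < s)
    (ih : ∀ {l l' : List (Fin (n - 1))} {v : Equiv.Perm (Fin n)}, Red l v → Red l' v →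
      l.length < v1.length + 1 → BEq l l') : BEq (r :: v1) (s :: v2) := by
  have hlen : v2.length = v1.length := by
    have e1 := card_inv_simpleT_mul' hr
    have e2 := card_inv_simpleT_mul' hs
    rw [h1.length_eq, h2.length_eq]
    omega
  rcases Nat.lt_or_ge ((r : ℕ) + 1) s with hc | hc
  · have far : (r : ℕ) + 1 < s ∨ (s : ℕ) + 1 < r := Or.inl hc
    have f1 : simpleT r (hi s) = hi s := simpleT_of_ne _
      (by rw [Ne, Fin.ext_iff, hi_val, lo_val]; omega) (by rw [Ne, Fin.ext_iff, hi_val, hi_val]; omega)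
    have f2 : simpleT r (lo s) = lo s := simpleT_of_ne _
      (by rw [Ne, Fin.ext_iff, lo_val, lo_val]; omega) (by rw [Ne, Fin.ext_iff, lo_val, hi_val]; omega)
    have f3 : simpleT s (hi r) = hi r := simpleT_of_ne _
      (by rw [Ne, Fin.ext_iff, hi_val, lo_val]; omega) (by rw [Ne, Fin.ext_iff, hi_val, hi_val]; omega)
    have f4 : simpleT s (lo r) = lo r := simpleT_of_ne _
      (by rw [Ne, Fin.ext_iff, lo_val, lo_val]; omega) (by rw [Ne, Fin.ext_iff, lo_val, hi_val]; omega)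
    obtain ⟨v, hv⟩ := exists_red (simpleT s * (simpleT r * w))
    have hv' : Red v (simpleT r * (simpleT s * w)) := by
      rwa [← mul_assoc, simpleT_comm far, mul_assoc]
    have hsv := hv.cons_of_gt (by rwa [inv_simpleT_mul_apply, inv_simpleT_mul_apply, f1, f2])
    have hrv := hv'.cons_of_gt (by rwa [inv_simpleT_mul_apply, inv_simpleT_mul_apply, f3, f4])
    exact ((ih h1 hsv (by omega)).cons r).trans ((BEq.comm r s v far).trans
      ((ih h2 hrv (by omega)).cons s).symm)
  · have hsr : (s : ℕ) = r + 1 := by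
      have : (r : ℕ) < s := hrs
      omega
    have hm : hi r = lo s := Fin.ext (by rw [hi_val, lo_val, hsr])
    have f1 : simpleT r (hi s) = hi s := simpleT_of_ne _
      (by rw [Ne, Fin.ext_iff, hi_val, lo_val]; omega) (by rw [Ne, Fin.ext_iff, hi_val, hi_val]; omega)
    have f4 : simpleT s (lo r) = lo r := simpleT_of_ne _
      (by rw [Ne, Fin.ext_iff, lo_val, lo_val]; omega) (by rw [Ne, Fin.ext_iff, lo_val, hi_val]; omega)
    obtain ⟨v, hv⟩ := exists_red (simpleT r * (simpleT s * (simpleT r * w)))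
    have hv' : Red v (simpleT s * (simpleT r * (simpleT s * w))) := by
      have := simpleT_braid hsr
      rw [← mul_assoc (simpleT r) (simpleT s) w, ← mul_assoc, ← this]
      simpa only [mul_assoc] using hv
    have a1 := hv.cons_of_gt (by
      rw [inv_simpleT_mul_apply, inv_simpleT_mul_apply, inv_simpleT_mul_apply,
        inv_simpleT_mul_apply, hm, simpleT_lo, f1, f4, simpleT_lo, hm]
      exact hs)
    have a2 := a1.cons_of_gt (by
      rw [inv_simpleT_mul_apply, inv_simpleT_mul_apply, ← hm, simpleT_hi, f1]
      exact (hm ▸ hs : w⁻¹ (hi s) < w⁻¹ (hi r)).trans hr)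
    have b1 := hv'.cons_of_gt (by
      rw [inv_simpleT_mul_apply, inv_simpleT_mul_apply, inv_simpleT_mul_apply,
        inv_simpleT_mul_apply, ← hm, simpleT_hi, f1, f4, simpleT_hi, ← hm]
      exact hr)
    have b2 := b1.cons_of_gt (by
      rw [inv_simpleT_mul_apply, inv_simpleT_mul_apply, hm, simpleT_lo, f4]
      exact hs.trans (hm ▸ hr))
    exact ((ih h1 a2 (by omega)).cons r).trans ((BEq.braid r s v hsr).trans
      ((ih h2 b2 (by omega)).cons s).symm)

/-- Any two reduced words of a permutation are related by braid moves. -/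
theorem matsumoto {l l' : List (Fin (n - 1))} {w : Equiv.Perm (Fin n)} (h : Red l w)
    (h' : Red l' w) : BEq l l' := by
  generalize hm : l.length = m
  induction m using Nat.strong_induction_on generalizing l l' w with
  | _ m ih =>
    have hlen : l.length = l'.length := by rw [h.length_eq, h'.length_eq]
    have ih' : ∀ {l l' : List (Fin (n - 1))} {v : Equiv.Perm (Fin n)}, Red l v → Red l' v →
      l.length < m → BEq l l' := fun h h' hl => ih _ hl h h' rfl
    rcases l with _ | ⟨r, v1⟩
    · rw [List.length_eq_zero_iff.1 hlen.symm]
      exact BEq.refl _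
    rcases l' with _ | ⟨s, v2⟩
    · simp at hlen
    obtain ⟨h1, hr⟩ := h.of_cons
    obtain ⟨h2, hs⟩ := h'.of_cons
    simp only [List.length_cons] at hm hlen
    rcases lt_trichotomy r s with hrs | rfl | hrs
    · exact matsumoto_aux h1 h2 hr hs hrs fun h h' hl => ih' h h' (by omega)
    · exact (ih' h1 h2 (by omega)).cons r
    · exact (matsumoto_aux h2 h1 hs hr hrs fun h h' hl => ih' h h' (by omega)).symm

end Words

/-! ### Filtration of the KLR algebra by the number of crossings -/

section SpanLemmas

variable {F A : Type*} [Field F] [Ring A] [Algebra F A]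

theorem mul_mem_of_mem_span {S : Set A} {N : Submodule F A} (a : A) (h : ∀ x ∈ S, a * x ∈ N) {y : A}
    (hy : y ∈ Submodule.span F S) : a * y ∈ N :=
  (Submodule.span_le (p := N.comap (LinearMap.mulLeft F a))).2 h hy

theorem mem_mul_of_mem_span {S : Set A} {N : Submodule F A} (a : A) (h : ∀ x ∈ S, x * a ∈ N) {y : A}
    (hy : y ∈ Submodule.span F S) : y * a ∈ N :=
  (Submodule.span_le (p := N.comap (LinearMap.mulRight F a))).2 h hy

end SpanLemmas

section Relations

variable {F : Type*} [Field F] {e n : ℕ} [NeZero e]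

theorem cartan_comm {i j : ZMod e} : cartan i j = cartan j i := by
  unfold cartan DoubleArrow Arrow
  by_cases h : i = j
  · simp [h]
  · simp [h, Ne.symm h, and_comm, or_comm]

theorem cartan_self (i : ZMod e) : cartan i i = 2 := by simp [cartan]

theorem act_simpleT_mul {X : Type*} (r : Fin (n - 1)) (w : Equiv.Perm (Fin n)) (k : Fin n → X)
    (p : Fin n) : act (simpleT r * w) k p = act w k (simpleT r p) := by
  simp [act, simpleT_inv]

theorem act_simpleT {X : Type*} (r : Fin (n - 1)) (k : Fin n → X) (p : Fin n) :
    act (simpleT r) k p = k (simpleT r p) := by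
  simp [act, simpleT_inv]

theorem psi_mul_idem (r : Fin (n - 1)) (i : Fin n → ZMod e) :
    KLR.psi F r * KLR.idem F i = KLR.idem F (act (simpleT r) i) * KLR.psi F r :=
  KLR.rel F (KLRRel.psi_idem r i)

theorem idem_mul_self (i : Fin n → ZMod e) : KLR.idem F i * KLR.idem F i = KLR.idem F i :=
  KLR.rel F (KLRRel.idem i)

theorem idem_mul_of_ne {i j : Fin n → ZMod e} (h : i ≠ j) : KLR.idem F i * KLR.idem F j = 0 :=
  KLR.rel F (KLRRel.orth i j h)

theorem sum_idem : ∑ i : Fin n → ZMod e, KLR.idem F i = 1 := KLR.rel F KLRRel.sum_one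

theorem y_mul_idem (p : Fin n) (i : Fin n → ZMod e) :
    KLR.y F p * KLR.idem F i = KLR.idem F i * KLR.y F p :=
  KLR.rel F (KLRRel.y_idem p i)

theorem y_mul_y (p q : Fin n) : KLR.y (e := e) F p * KLR.y F q = KLR.y F q * KLR.y F p :=
  KLR.rel F (KLRRel.y_y p q)

/-- Moving a `y` past a `ψ`. -/
theorem y_mul_psi_mul_idem (p : Fin n) (r : Fin (n - 1)) (i : Fin n → ZMod e) :
    ∃ c : F, KLR.y F p * KLR.psi F r * KLR.idem F i =
      KLR.psi F r * KLR.y F (simpleT r p) * KLR.idem F i + c • KLR.idem F i ∧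
      (c ≠ 0 → i (lo r) = i (hi r)) := by
  by_cases hi' : i (lo r) = i (hi r)
  · by_cases h1 : p = lo r
    · refine ⟨-1, ?_, fun _ => hi'⟩
      rw [h1, simpleT_lo, KLR.rel F (KLRRel.psi_y_eq r i hi'), add_mul, one_mul, neg_one_smul]
      abel
    by_cases h2 : p = hi r
    · refine ⟨1, ?_, fun _ => hi'⟩
      rw [h2, simpleT_hi, KLR.rel F (KLRRel.y_psi_eq r i hi'), add_mul, one_mul, one_smul]
    · refine ⟨0, ?_, fun _ => hi'⟩
      rw [simpleT_of_ne r h1 h2, KLR.rel F (KLRRel.psi_y r p h1 h2), zero_smul, add_zero]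
  · refine ⟨0, ?_, fun h => absurd rfl h⟩
    rw [zero_smul, add_zero]
    by_cases h1 : p = lo r
    · rw [h1, simpleT_lo, KLR.rel F (KLRRel.psi_y_ne r i hi')]
    by_cases h2 : p = hi r
    · rw [h2, simpleT_hi, KLR.rel F (KLRRel.y_psi_ne r i hi')]
    · rw [simpleT_of_ne r h1 h2, KLR.rel F (KLRRel.psi_y r p h1 h2)]

variable (F) in
/-- The product of the `ψ_r` along a word. -/
def psiW (l : List (Fin (n - 1))) : KLR F e n := (l.map (KLR.psi F)).prod

@[simp] theorem psiW_nil : psiW F ([] : List (Fin (n - 1))) = (1 : KLR F e n) := rfl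

@[simp] theorem psiW_cons (r : Fin (n - 1)) (l : List (Fin (n - 1))) :
    psiW F (r :: l) = KLR.psi (e := e) F r * psiW F l := by simp [psiW]

theorem psiW_append (l l' : List (Fin (n - 1))) :
    psiW F (l ++ l') = (psiW F l * psiW F l' : KLR F e n) := by simp [psiW]

theorem psiW_mul_idem (l : List (Fin (n - 1))) (k : Fin n → ZMod e) :
    psiW F l * KLR.idem F k = KLR.idem F (act (wprod l) k) * psiW F l := by
  induction l with
  | nil => simp [act_one]
  | cons r l ih =>
    rw [psiW_cons, mul_assoc, ih, ← mul_assoc, psi_mul_idem, act_act, wprod_cons, mul_assoc]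

/-- The degree of `ψ_l e(k)` for a word `l`. -/
def wdeg : List (Fin (n - 1)) → (Fin n → ZMod e) → ℤ
  | [], _ => 0
  | r :: l, k => -cartan (act (wprod l) k (lo r)) (act (wprod l) k (hi r)) + wdeg l k

theorem Red.wdeg_eq {l : List (Fin (n - 1))} {w : Equiv.Perm (Fin n)} (h : Red l w)
    (k : Fin n → ZMod e) : wdeg l k = -∑ p ∈ inv w, cartan (k p.1) (k p.2) := by
  induction h with
  | nil => simp [wdeg, inv_one]
  | @cons r l v h hr ih =>
    rw [wdeg, ih, inv_simpleT_mul hr, Finset.sum_insert (notMem_inv r v), h.wprod_eq, neg_add]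
    rfl

/-- Products of `ℓ` crossings `ψ_r e(i)`, idempotents and differences of the `y_p`, of degree `m`. -/
inductive DMon : ℕ → ℤ → KLR F e n → Prop
  | one : DMon 0 0 1
  | idem_mul {l m x} (i : Fin n → ZMod e) : DMon l m x → DMon l m (KLR.idem F i * x)
  | ydiff_mul {l m x} (p q : Fin n) : DMon l m x → DMon l (2 + m) ((KLR.y F p - KLR.y F q) * x)
  | psi_mul {l m x} (r : Fin (n - 1)) (i : Fin n → ZMod e) : DMon l m x →
      DMon (l + 1) (-cartan (i (lo r)) (i (hi r)) + m) (KLR.psi F r * KLR.idem F i * x)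

theorem DMon.mul {l l' : ℕ} {m m' : ℤ} {x x' : KLR F e n} (h : DMon l m x) (h' : DMon l' m' x') :
    DMon (l + l') (m + m') (x * x') := by
  induction h with
  | one => simpa using h'
  | idem_mul i _ ih => rw [mul_assoc]; exact ih.idem_mul i
  | ydiff_mul p q _ ih => rw [mul_assoc, add_assoc]; exact ih.ydiff_mul p q
  | psi_mul r i _ ih =>
    have := ih.psi_mul r i
    rwa [← mul_assoc, ← add_assoc, Nat.add_right_comm] at this

theorem DMon.cast {l l' : ℕ} {m m' : ℤ} {x : KLR F e n} (h : DMon l m x) (hl : l = l')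
    (hm : m = m') : DMon l' m' x := hl ▸ hm ▸ h

theorem DMon.idem (i : Fin n → ZMod e) : DMon 0 0 (KLR.idem F i) := by
  simpa using DMon.one.idem_mul (F := F) i

theorem DMon.ydiff (p q : Fin n) : DMon 0 2 (KLR.y (e := e) F p - KLR.y F q) := by
  simpa using DMon.one.ydiff_mul (F := F) (e := e) p q

theorem DMon.psi (r : Fin (n - 1)) (i : Fin n → ZMod e) :
    DMon 1 (-cartan (i (lo r)) (i (hi r))) (KLR.psi F r * KLR.idem F i) := by
  simpa using DMon.one.psi_mul (F := F) r i

theorem DMon.psiW (l : List (Fin (n - 1))) (k : Fin n → ZMod e) :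
    DMon l.length (wdeg l k) (psiW F l * KLR.idem F k) := by
  induction l with
  | nil => simpa [wdeg] using DMon.idem (F := F) k
  | cons r l ih =>
    have := ih.psi_mul r (act (wprod l) k)
    rwa [mul_assoc (KLR.psi F r), ← mul_assoc (KLR.idem F _), ← psiW_mul_idem, mul_assoc (KLRTheta.psiW F l),
      idem_mul_self, ← mul_assoc, ← psiW_cons] at this

variable (F e n) in
/-- The span of the products of degree `m` with less than `L` crossings. -/
def Dlt (L : ℕ) (m : ℤ) : Submodule F (KLR F e n) :=
  Submodule.span F {x | ∃ l < L, DMon l m x}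

theorem DMon.mem_Dlt {l L : ℕ} {m : ℤ} {x : KLR F e n} (h : DMon l m x) (hl : l < L) :
    x ∈ Dlt F e n L m := Submodule.subset_span ⟨l, hl, h⟩

theorem Dlt_mono {L L' : ℕ} (h : L ≤ L') (m : ℤ) : Dlt F e n L m ≤ Dlt F e n L' m :=
  Submodule.span_mono fun _ ⟨l, hl, hx⟩ => ⟨l, hl.trans_le h, hx⟩

theorem DMon.mul_mem_Dlt {l L : ℕ} {m m' : ℤ} {x y : KLR F e n} (h : DMon l m x)
    (hy : y ∈ Dlt F e n L m') : x * y ∈ Dlt F e n (l + L) (m + m') :=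
  mul_mem_of_mem_span x (by rintro _ ⟨_, hl, hz⟩; exact (h.mul hz).mem_Dlt (by omega)) hy

theorem DMon.mem_Dlt_mul {l L : ℕ} {m m' : ℤ} {x y : KLR F e n} (h : DMon l m x)
    (hy : y ∈ Dlt F e n L m') : y * x ∈ Dlt F e n (l + L) (m' + m) :=
  mem_mul_of_mem_span x (by rintro _ ⟨_, hl, hz⟩; exact (hz.mul h).mem_Dlt (by omega)) hy

theorem Lval_mem_Dlt (p q : Fin n) (a b : ZMod e) (k : Fin n → ZMod e) {L : ℕ} (hL : 0 < L) :
    Lval a b (KLR.y F p) (KLR.y F q) * KLR.idem F k ∈ Dlt F e n L (-2 * cartan a b) := by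
  unfold Lval cartan
  have hd : ∀ p q : Fin n, DMon 0 2 (KLR.y (e := e) F p - KLR.y F q) := DMon.ydiff
  have hi := DMon.idem (F := F) k
  split_ifs
  all_goals try tauto
  · rw [zero_mul]; exact zero_mem _
  · exact (((hd q p).mul (hd p q)).mul hi).mem_Dlt hL
  · exact ((hd q p).mul hi).mem_Dlt hL
  · exact ((hd p q).mul hi).mem_Dlt hL
  · exact (DMon.one.mul hi).mem_Dlt hL

/-- Braid moves change `ψ_l e(k)` only by terms with fewer crossings. -/
theorem psi_braid_mem [Fact (1 < e)] (r s : Fin (n - 1)) (h : (s : ℕ) = r + 1) (i : Fin n → ZMod e) :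
    KLR.psi F r * KLR.psi F s * KLR.psi F r * KLR.idem F i -
      KLR.psi F s * KLR.psi F r * KLR.psi F s * KLR.idem F i ∈
      Dlt F e n 1 (-(cartan (i (lo r)) (i (hi r)) + cartan (i (lo r)) (i (hi s)) +
        cartan (i (hi r)) (i (hi s)))) := by
  by_cases h0 : i (hi s) = i (lo r) ∧ (Arrow (i (lo r)) (i (hi r)) ∨ Arrow (i (hi r)) (i (lo r)) ∨
        DoubleArrow (i (lo r)) (i (hi r)))
  · obtain ⟨h1, h2⟩ := h0
    have hi' := DMon.idem (F := F) i
    have hne : Arrow (i (lo r)) (i (hi r)) ∨ Arrow (i (hi r)) (i (lo r)) → i (lo r) ≠ i (hi r) := by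
      intro h e1
      rw [e1] at h
      rcases h with h | h <;> exact h.2 h.1
    have hnd : Arrow (i (lo r)) (i (hi r)) ∨ Arrow (i (hi r)) (i (lo r)) →
        ¬ DoubleArrow (i (lo r)) (i (hi r)) := by
      rintro (h | h) h'
      · exact h.2 h'.2
      · exact h.2 h'.1
    rw [h1, cartan_self, cartan_comm (i := i (hi r))]
    rcases h2 with h2 | h2 | h2
    · rw [KLR.rel F (KLRRel.braid_arrow r s i h h1 h2)]
      have hc : cartan (i (lo r)) (i (hi r)) = -1 := by
        simp [cartan, hne (Or.inl h2), hnd (Or.inl h2), h2]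
      rw [hc, add_mul, add_sub_cancel_left, one_mul]
      exact hi'.mem_Dlt one_pos
    · rw [KLR.rel F (KLRRel.braid_arrow' r s i h h1 h2)]
      have hc : cartan (i (lo r)) (i (hi r)) = -1 := by
        simp [cartan, hne (Or.inr h2), hnd (Or.inr h2), h2]
      rw [hc, sub_mul, sub_sub_cancel_left, one_mul]
      exact neg_mem (hi'.mem_Dlt one_pos)
    · rw [KLR.rel F (KLRRel.braid_double r s i h h1 h2)]
      have e1 : KLR.psi F s * KLR.psi F r * KLR.psi F s - 2 * KLR.y F (hi r) + KLR.y F (lo r) +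
        KLR.y F (hi s) = KLR.psi F s * KLR.psi F r * KLR.psi F s +
          ((KLR.y (e := e) F (lo r) - KLR.y F (hi r)) + (KLR.y F (hi s) - KLR.y F (hi r))) := by
        rw [two_mul]; abel
      rw [e1, add_mul, add_sub_cancel_left, add_mul]
      by_cases h3 : i (lo r) = i (hi r)
      · have := h2.1
        rw [h3] at this
        exact absurd this.symm (by simp)
      · have hc : cartan (i (lo r)) (i (hi r)) = -2 := by simp [cartan, h3, h2]
        rw [hc]
        exact add_mem (((DMon.ydiff _ _).mul hi').mem_Dlt one_pos)
          (((DMon.ydiff _ _).mul hi').mem_Dlt one_pos)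
  · rw [KLR.rel F (KLRRel.braid_other r s i h h0), sub_self]
    exact zero_mem _

theorem psiW_mul_idem_eq (l : List (Fin (n - 1))) (k : Fin n → ZMod e) :
    psiW F l * KLR.idem F k = KLR.idem F (act (wprod l) k) * (psiW F l * KLR.idem F k) := by
  rw [psiW_mul_idem, ← mul_assoc, idem_mul_self]

/-- Braid moves change `ψ_l e(k)` only by terms with fewer crossings. -/
theorem BEq.psiW_sub_mem [Fact (1 < e)] {l l' : List (Fin (n - 1))} (h : BEq l l')
    (k : Fin n → ZMod e) : wdeg l k = wdeg l' k ∧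
      psiW F l * KLR.idem F k - psiW F l' * KLR.idem F k ∈ Dlt F e n l.length (wdeg l k) := by
  induction h with
  | refl l => exact ⟨rfl, by rw [sub_self]; exact zero_mem _⟩
  | symm h ih =>
    refine ⟨ih.1.symm, ?_⟩
    rw [← h.length_eq, ← ih.1, ← neg_sub]
    exact neg_mem ih.2
  | trans h1 h2 ih1 ih2 =>
    refine ⟨ih1.1.trans ih2.1, ?_⟩
    rw [← sub_add_sub_cancel]
    refine add_mem ih1.2 ?_
    rw [ih1.1, h1.length_eq]
    exact ih2.2
  | @cons r l l' h ih =>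
    refine ⟨by rw [wdeg, wdeg, ih.1, h.wprod_eq], ?_⟩
    have := (DMon.psi (F := F) r (act (wprod l) k)).mul_mem_Dlt ih.2
    rw [mul_sub, mul_assoc, ← psiW_mul_idem_eq, mul_assoc, h.wprod_eq, ← psiW_mul_idem_eq,
      ← mul_assoc, ← mul_assoc, ← psiW_cons, ← psiW_cons, add_comm 1] at this
    rw [wdeg, h.wprod_eq]
    exact this
  | comm r s l hrs =>
    have f1 : simpleT s (lo r) = lo r := simpleT_of_ne _
      (by rw [Ne, Fin.ext_iff, lo_val, lo_val]; omega) (by rw [Ne, Fin.ext_iff, lo_val, hi_val]; omega)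
    have f2 : simpleT s (hi r) = hi r := simpleT_of_ne _
      (by rw [Ne, Fin.ext_iff, hi_val, lo_val]; omega) (by rw [Ne, Fin.ext_iff, hi_val, hi_val]; omega)
    have f3 : simpleT r (lo s) = lo s := simpleT_of_ne _
      (by rw [Ne, Fin.ext_iff, lo_val, lo_val]; omega) (by rw [Ne, Fin.ext_iff, lo_val, hi_val]; omega)
    have f4 : simpleT r (hi s) = hi s := simpleT_of_ne _
      (by rw [Ne, Fin.ext_iff, hi_val, lo_val]; omega) (by rw [Ne, Fin.ext_iff, hi_val, hi_val]; omega)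
    refine ⟨?_, ?_⟩
    · simp only [wdeg, wprod_cons, act_simpleT_mul, f1, f2, f3, f4]
      ring
    · simp only [psiW_cons, ← mul_assoc]
      rw [KLR.rel F (KLRRel.psi_psi r s hrs), sub_self]
      exact zero_mem _
  | braid r s l h =>
    have hm : lo s = hi r := Fin.ext (by rw [hi_val, lo_val, h])
    have h1 : lo r ≠ hi s := by rw [Ne, Fin.ext_iff, hi_val, lo_val]; omega
    have f1 : simpleT r (hi s) = hi s := simpleT_of_ne _ h1.symm
      (by rw [Ne, Fin.ext_iff, hi_val, hi_val]; omega)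
    have f2 : simpleT s (lo r) = lo r := simpleT_of_ne _
      (by rw [Ne, Fin.ext_iff, lo_val, lo_val]; omega) h1
    have f3 : simpleT s (hi r) = hi s := hm ▸ simpleT_lo s
    have f4 : simpleT s (hi s) = hi r := hm ▸ simpleT_hi s
    have hw : wdeg (r :: s :: r :: l) k = -(cartan (act (wprod l) k (lo r)) (act (wprod l) k (hi r)) +
        cartan (act (wprod l) k (lo r)) (act (wprod l) k (hi s)) +
        cartan (act (wprod l) k (hi r)) (act (wprod l) k (hi s))) + wdeg l k := by
      simp only [wdeg, wprod_cons, act_simpleT_mul, f1, f2, f3, simpleT_hi, simpleT_lo, hm]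
      ring
    refine ⟨?_, ?_⟩
    · rw [hw]
      simp only [wdeg, wprod_cons, act_simpleT_mul, f1, f2, f3, f4, simpleT_hi, hm]
      ring
    · have := (DMon.psiW (F := F) l k).mem_Dlt_mul (psi_braid_mem (F := F) r s h (act (wprod l) k))
      rw [← hw, sub_mul, mul_assoc _ (KLR.idem F _), mul_assoc _ (KLR.idem F _),
        ← psiW_mul_idem_eq] at this
      simp only [psiW_cons, List.length_cons, ← mul_assoc] at this ⊢
      have hle : l.length + 1 ≤ l.length + 1 + 1 + 1 := by omega
      exact Dlt_mono hle _ this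

/-- Moving a `y` past `ψ_l`, up to terms with fewer crossings. -/
theorem y_mul_psiW_sub_mem (p : Fin n) (l : List (Fin (n - 1))) (k : Fin n → ZMod e) :
    KLR.y F p * (psiW F l * KLR.idem F k) -
      psiW F l * KLR.y F ((wprod l)⁻¹ p) * KLR.idem F k ∈ Dlt F e n l.length (2 + wdeg l k) := by
  induction l generalizing p with
  | nil => simp
  | cons r l ih =>
    obtain ⟨c, hc, hc0⟩ := y_mul_psi_mul_idem (F := F) p r (act (wprod l) k)
    have h1 : KLR.y F p * (psiW F (r :: l) * KLR.idem F k) =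
        KLR.psi F r * KLR.idem F (act (wprod l) k) *
          (KLR.y F (simpleT r p) * (psiW F l * KLR.idem F k)) + c • (psiW F l * KLR.idem F k) := by
      rw [psiW_cons, mul_assoc, psiW_mul_idem_eq, ← mul_assoc, ← mul_assoc, hc, add_mul, smul_mul_assoc,
        ← psiW_mul_idem_eq]
      congr 1
      simp only [mul_assoc]
      rw [← mul_assoc (KLR.idem F _) (KLR.y F _), ← y_mul_idem]
      simp only [mul_assoc]
    have h2 : psiW F (r :: l) * KLR.y F ((wprod (r :: l))⁻¹ p) * KLR.idem F k =
        KLR.psi F r * KLR.idem F (act (wprod l) k) *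
          (psiW F l * KLR.y F ((wprod l)⁻¹ (simpleT r p)) * KLR.idem F k) := by
      rw [psiW_cons, wprod_cons, inv_simpleT_mul_apply, mul_assoc (KLR.psi F r) (KLR.idem F _),
        mul_assoc (psiW F l) _ (KLR.idem F k), y_mul_idem, ← mul_assoc (psiW F l) (KLR.idem F k),
        ← mul_assoc (KLR.idem F _), ← psiW_mul_idem_eq]
      simp only [mul_assoc]
      rw [y_mul_idem]
    rw [h1, h2, add_sub_right_comm, ← mul_sub]
    refine add_mem ?_ ?_
    · have := (DMon.psi (F := F) r (act (wprod l) k)).mul_mem_Dlt (ih (simpleT r p))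
      rwa [add_comm 1, add_left_comm] at this
    · by_cases h0 : c = 0
      · rw [h0, zero_smul]; exact zero_mem _
      · refine Submodule.smul_mem _ _ ?_
        have := (DMon.psiW (F := F) l k).mem_Dlt (Nat.lt_succ_self _)
        rw [wdeg, hc0 h0, cartan_self]
        simpa using this

end Relations

/-! ### Coset representatives and the spanning theorem -/

section Cosets

variable {d e : ℕ}

theorem pos_lt_pos_iff {t t' : Fin d} {a a' : Fin e} :
    pos t a < pos t' a' ↔ t < t' ∨ (t = t' ∧ a < a') := by
  constructor
  · intro h
    rcases (pos_lt_pos h.le).lt_or_eq with h1 | h1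
    · exact Or.inl h1
    · refine Or.inr ⟨h1, ?_⟩
      subst h1
      have : (a : ℕ) + e * t < a' + e * t := by simpa [pos, finProdFinEquiv] using h
      rw [Fin.lt_def]; omega
  · rintro (h | ⟨rfl, h⟩)
    · by_contra hc
      exact absurd (pos_lt_pos (not_lt.1 hc)) (not_le.2 h)
    · have : (a : ℕ) + e * t < a' + e * t := by
        rw [Fin.lt_def] at h; omega
      simpa [pos, finProdFinEquiv] using this

/-- The block and the index in it of a position. -/
def blk (p : Fin (d * e)) : Fin d := (finProdFinEquiv.symm p).1

/-- The index of a position in its block. -/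
def idx (p : Fin (d * e)) : Fin e := (finProdFinEquiv.symm p).2

@[simp] theorem pos_blk_idx (p : Fin (d * e)) : pos (blk p) (idx p) = p :=
  finProdFinEquiv.apply_symm_apply p

@[simp] theorem blk_pos (t : Fin d) (a : Fin e) : blk (pos t a) = t := by simp [blk, pos]

@[simp] theorem idx_pos (t : Fin d) (a : Fin e) : idx (pos t a) = a := by simp [idx, pos]

/-- If the letters exchanged by `s_r` come from different blocks, then `s_r x` is again a coset
representative. -/
theorem simpleT_mul_mem {x : Equiv.Perm (Fin (d * e))} (hx : x ∈ minCosetReps d e)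
    {r : Fin (d * e - 1)} (hb : blk (x⁻¹ (lo r)) ≠ blk (x⁻¹ (hi r))) :
    simpleT r * x ∈ minCosetReps d e := by
  intro t a b hab
  have h := hx t a b hab
  rw [Equiv.Perm.mul_apply, Equiv.Perm.mul_apply, Fin.lt_def, simpleT_val, simpleT_val]
  rw [Fin.lt_def] at h
  have h0 : ¬ ((x (pos t a) : ℕ) = r ∧ (x (pos t b) : ℕ) = r + 1) := by
    rintro ⟨h1, h2⟩
    apply hb
    rw [← show x (pos t a) = lo r from Fin.ext h1, ← show x (pos t b) = hi r from Fin.ext h2]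
    simp
  split_ifs <;> omega

/-- If the letters exchanged by `s_r` come from the same block, then they are neighbours there. -/
theorem exists_posPsi {x : Equiv.Perm (Fin (d * e))} (hx : x ∈ minCosetReps d e)
    {r : Fin (d * e - 1)} (hb : blk (x⁻¹ (lo r)) = blk (x⁻¹ (hi r))) :
    ∃ (t : Fin d) (a : Fin (e - 1)), x⁻¹ (lo r) = lo (posPsi t a) ∧ x⁻¹ (hi r) = hi (posPsi t a) := by
  set t := blk (x⁻¹ (lo r)) with ht
  set a := idx (x⁻¹ (lo r)) with ha
  set b := idx (x⁻¹ (hi r)) with hb'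
  have e1 : x⁻¹ (lo r) = pos t a := (pos_blk_idx _).symm
  have e2 : x⁻¹ (hi r) = pos t b := by rw [hb, pos_blk_idx]
  have x1 : x (pos t a) = lo r := by rw [← e1]; simp
  have x2 : x (pos t b) = hi r := by rw [← e2]; simp
  have hab : a < b := by
    rcases lt_trichotomy a b with h | h | h
    · exact h
    · rw [h, x2] at x1
      exact absurd x1.symm (lo_ne_hi r)
    · have := hx t b a h
      rw [x1, x2] at this
      exact absurd this (lo_lt_hi r).not_gt
  have hba : (b : ℕ) = a + 1 := by
    by_contra hne
    rw [Fin.lt_def] at hab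
    let c : Fin e := ⟨a + 1, by omega⟩
    have h1 := hx t a c (by rw [Fin.lt_def]; simp [c])
    have h2 := hx t c b (by rw [Fin.lt_def]; simp only [c]; omega)
    rw [x1, Fin.lt_def, lo_val] at h1
    rw [x2, Fin.lt_def, hi_val] at h2
    omega
  refine ⟨t, ⟨a, by omega⟩, ?_, ?_⟩
  · rw [e1, ← pos_lo]; rfl
  · rw [e2, ← pos_hi]; congr 1; exact Fin.ext hba

theorem simpleT_mul_eq_mul_simpleT {n : ℕ} {x : Equiv.Perm (Fin n)} {r s : Fin (n - 1)}
    (h1 : x⁻¹ (lo r) = lo s) (h2 : x⁻¹ (hi r) = hi s) : simpleT r * x = x * simpleT s := by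
  rw [simpleT, simpleT, Equiv.mul_swap_eq_swap_mul, ← h1, ← h2]
  simp

end Cosets

section Spanning

variable {F : Type*} [Field F] {d e : ℕ} [NeZero e]

/-- Products of idempotents, crossings within blocks and differences of the `y_p`. -/
inductive CMon : ℤ → KLR F e (d * e) → Prop
  | one : CMon 0 1
  | idem_mul {m x} (i : Fin (d * e) → ZMod e) : CMon m x → CMon m (KLR.idem F i * x)
  | ydiff_mul {m x} (p q : Fin (d * e)) : CMon m x → CMon (2 + m) ((KLR.y F p - KLR.y F q) * x)
  | psi_mul {m x} (t : Fin d) (a : Fin (e - 1)) (i : Fin (d * e) → ZMod e) : CMon m x →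
      CMon (-cartan (i (lo (posPsi t a))) (i (hi (posPsi t a))) + m)
        (KLR.psi F (posPsi t a) * KLR.idem F i * x)

theorem CMon.mul {m m' : ℤ} {x x' : KLR F e (d * e)} (h : CMon m x) (h' : CMon m' x') :
    CMon (m + m') (x * x') := by
  induction h with
  | one => simpa using h'
  | idem_mul i _ ih => rw [mul_assoc]; exact ih.idem_mul i
  | ydiff_mul p q _ ih => rw [mul_assoc, add_assoc]; exact ih.ydiff_mul p q
  | psi_mul t a i _ ih => rw [mul_assoc, add_assoc]; exact ih.psi_mul t a i

variable (F) in
/-- The span of the `ψ_x e(k) c` with `x` a coset representative of length less than `L` and `c`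
a product of idempotents, crossings within blocks and differences. -/
def Flt (ω : Equiv.Perm (Fin (d * e)) → List (Fin (d * e - 1))) (L : ℕ) (m : ℤ) :
    Submodule F (KLR F e (d * e)) :=
  Submodule.span F {z | ∃ x ∈ minCosetReps d e, (ω x).length < L ∧ ∃ k c m', CMon m' c ∧
    m = wdeg (ω x) k + m' ∧ z = psiW F (ω x) * KLR.idem F k * c}

variable {ω : Equiv.Perm (Fin (d * e)) → List (Fin (d * e - 1))}

theorem mem_Flt {L : ℕ} {m m' : ℤ} {x} (hx : x ∈ minCosetReps d e) (hL : (ω x).length < L)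
    {k : Fin (d * e) → ZMod e} {c : KLR F e (d * e)} (hc : CMon m' c) (hm : m = wdeg (ω x) k + m') :
    psiW F (ω x) * KLR.idem F k * c ∈ Flt F ω L m :=
  Submodule.subset_span ⟨x, hx, hL, k, c, m', hc, hm, rfl⟩

theorem Flt_mono {L L' : ℕ} (h : L ≤ L') (m : ℤ) : Flt F ω L m ≤ Flt F ω L' m :=
  Submodule.span_mono (by
    rintro _ ⟨x, hx, hL, h'⟩
    exact ⟨x, hx, hL.trans_le h, h'⟩)

theorem Flt_mul {L : ℕ} {m m' : ℤ} {z c : KLR F e (d * e)} (hz : z ∈ Flt F ω L m) (hc : CMon m' c) :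
    z * c ∈ Flt F ω L (m + m') :=
  mem_mul_of_mem_span c (by
    rintro _ ⟨x, hx, hL, k, c', m'', hc', hm, rfl⟩
    rw [mul_assoc]
    exact mem_Flt hx hL (hc'.mul hc) (by rw [hm]; ring)) hz

theorem Flt_mul_of_eq {L : ℕ} {m m' m'' : ℤ} {z c : KLR F e (d * e)} (hz : z ∈ Flt F ω L m)
    (hc : CMon m' c) (h : m + m' = m'') : z * c ∈ Flt F ω L m'' :=
  h ▸ Flt_mul hz hc

theorem Red.psiW_mul_idem {n : ℕ} {l : List (Fin (n - 1))} {w : Equiv.Perm (Fin n)} (h : Red l w)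
    (k : Fin n → ZMod e) :
    psiW F l * KLR.idem F k = KLR.idem F (act w k) * (psiW F l * KLR.idem F k) := by
  have := psiW_mul_idem_eq (F := F) l k
  rwa [h.wprod_eq] at this

theorem psi_mul_mem_Flt [Fact (1 < e)] (hω : ∀ w, Red (ω w) w) {L : ℕ}
    (ih : ∀ m, Dlt F e (d * e) L m ≤ Flt F ω L m) (r : Fin (d * e - 1)) (i : Fin (d * e) → ZMod e)
    {m : ℤ} {z : KLR F e (d * e)} (hz : z ∈ Flt F ω L m) :
    KLR.psi F r * KLR.idem F i * z ∈
      Flt F ω (L + 1) (-cartan (i (lo r)) (i (hi r)) + m) := by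
  refine mul_mem_of_mem_span _ ?_ hz
  rintro _ ⟨x, hx, hL, k, c, m', hc, rfl, rfl⟩
  by_cases hik : i = act x k
  swap
  · have : KLR.psi F r * KLR.idem F i * (psiW F (ω x) * KLR.idem F k * c) = 0 := by
      rw [psiW_mul_idem, (hω x).wprod_eq]
      simp only [mul_assoc]
      rw [← mul_assoc (KLR.idem F i), idem_mul_of_ne hik]
      simp
    rw [this]
    exact zero_mem _
  subst hik
  have hz : KLR.psi F r * KLR.idem F (act x k) * (psiW F (ω x) * KLR.idem F k * c) =
      psiW F (r :: ω x) * KLR.idem F k * c := by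
    rw [psiW_cons, mul_assoc (KLR.psi F r), ← mul_assoc (KLR.idem F _),
      ← (hω x).psiW_mul_idem]
    simp only [mul_assoc]
  have hd : -cartan (act x k (lo r)) (act x k (hi r)) + (wdeg (ω x) k + m') =
      wdeg (r :: ω x) k + m' := by
    rw [wdeg, (hω x).wprod_eq, add_assoc]
  rw [hz, hd]
  rcases inv_lo_lt_or r x with hr | hr
  · have hred : Red (r :: ω x) (simpleT r * x) := (hω x).cons hr
    by_cases hb : blk (x⁻¹ (lo r)) = blk (x⁻¹ (hi r))
    · obtain ⟨t, a, h1, h2⟩ := exists_posPsi hx hb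
      have hs := simpleT_mul_eq_mul_simpleT h1 h2
      have hred' : Red (ω x ++ [posPsi t a]) (simpleT r * x) := red_of_length
        (by rw [wprod_append, (hω x).wprod_eq, hs]; simp)
        (by rw [card_inv_simpleT_mul hr, List.length_append, (hω x).length_eq]; rfl)
      obtain ⟨hw, hmem⟩ := (matsumoto hred hred').psiW_sub_mem (F := F) k
      have hmem' := Flt_mul (Flt_mono (by omega) _ (ih _ (Dlt_mono (L' := L)
        (by simp only [List.length_cons]; omega) _ hmem))) hc (L := L + 1)
      rw [sub_mul] at hmem'
      refine (Submodule.sub_mem_iff_left _ ?_).1 hmem'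
      have e1 : psiW F (ω x ++ [posPsi t a]) * KLR.idem F k * c =
          psiW F (ω x) * KLR.idem F (act (simpleT (posPsi t a)) k) *
            (KLR.psi F (posPsi t a) * KLR.idem F k * c) := by
        rw [psiW_append, psiW_cons, psiW_nil, mul_one, mul_assoc (psiW F _) (KLR.psi F _), psi_mul_idem,
          ← mul_assoc (psiW F _ * _), mul_assoc (psiW F _) (KLR.idem F _), ← mul_assoc (KLR.idem F _),
          idem_mul_self]
      rw [e1]
      refine mem_Flt hx (by omega) (hc.psi_mul t a k) ?_
      have e2 : ∀ l : List (Fin (d * e - 1)), wdeg (l ++ [posPsi t a]) k =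
          wdeg l (act (simpleT (posPsi t a)) k) +
            -cartan (k (lo (posPsi t a))) (k (hi (posPsi t a))) := by
        intro l
        induction l with
        | nil => simp [wdeg, act_one]
        | cons s l ih => simp [wdeg, ih, wprod_append, act_act, add_assoc]
      rw [hw, e2, add_assoc]
    · have hmem := ((matsumoto hred (hω _)).psiW_sub_mem (F := F) k)
      obtain ⟨hw, hmem⟩ := hmem
      have hlen := (matsumoto hred (hω _)).length_eq
      simp only [List.length_cons] at hlen
      have hmem' := Flt_mul (Flt_mono (by omega) _ (ih _ (Dlt_mono (L' := L)
        (by simp only [List.length_cons]; omega) _ hmem))) hc (L := L + 1)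
      rw [sub_mul] at hmem'
      refine (Submodule.sub_mem_iff_left _ ?_).1 hmem'
      exact mem_Flt (simpleT_mul_mem hx hb) (by omega) hc (by rw [hw])
  · set v := simpleT r * x with hv
    have hxv : simpleT r * v = x := simpleT_mul_cancel r x
    have hred : Red (r :: ω v) x := (hω v).cons_of_gt hr
    obtain ⟨hw, hmem⟩ := (matsumoto (hω x) hred).psiW_sub_mem (F := F) k
    have hlen := (matsumoto (hω x) hred).length_eq
    simp only [List.length_cons] at hlen
    have h1 := (DMon.psi (F := F) r (act x k)).mul_mem_Dlt hmem
    refine Flt_mul (Flt_mono (Nat.le_succ L) _ (ih _ ?_)) hc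
    have e1 : psiW F (r :: ω x) * KLR.idem F k =
        KLR.psi F r * KLR.idem F (act x k) * (psiW F (ω x) * KLR.idem F k) := by
      rw [mul_assoc, ← (hω x).psiW_mul_idem, psiW_cons, mul_assoc]
    have e2 : KLR.psi F r * KLR.idem F (act x k) * (psiW F (r :: ω v) * KLR.idem F k) =
        Lval (act v k (lo r)) (act v k (hi r)) (KLR.y F (lo r)) (KLR.y F (hi r)) *
          KLR.idem F (act v k) * (psiW F (ω v) * KLR.idem F k) := by
      rw [mul_assoc, ← hred.psiW_mul_idem, psiW_cons, mul_assoc, (hω v).psiW_mul_idem,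
        ← mul_assoc, ← mul_assoc, KLR.rel F (KLRRel.psi_sq r _)]
      simp only [mul_assoc]
      rw [← (hω v).psiW_mul_idem, ← (hω v).psiW_mul_idem]
    rw [mul_sub, ← e1, e2] at h1
    have hd1 : -cartan (act x k (lo r)) (act x k (hi r)) + wdeg (ω x) k = wdeg (r :: ω x) k := by
      rw [wdeg, (hω x).wprod_eq]
    rw [hd1] at h1
    have h2 : Lval (act v k (lo r)) (act v k (hi r)) (KLR.y F (lo r)) (KLR.y F (hi r)) *
          KLR.idem F (act v k) * (psiW F (ω v) * KLR.idem F k) ∈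
          Dlt F e (d * e) L (wdeg (r :: ω x) k) := by
      have := (DMon.psiW (F := F) (ω v) k).mem_Dlt_mul
        (Lval_mem_Dlt (F := F) (lo r) (hi r) (act v k (lo r)) (act v k (hi r)) (act v k) one_pos)
      have hd2 : -2 * cartan (act v k (lo r)) (act v k (hi r)) + wdeg (ω v) k =
          wdeg (r :: ω x) k := by
        have e3 : act x k (lo r) = act v k (hi r) := by
          rw [hv, act_simpleT_mul, simpleT_hi]
        have e4 : act x k (hi r) = act v k (lo r) := by
          rw [hv, act_simpleT_mul, simpleT_lo]
        rw [wdeg, hw, wdeg, (hω x).wprod_eq, (hω v).wprod_eq, e3, e4,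
          cartan_comm (i := act v k (hi r))]
        ring
      rw [hd2] at this
      exact Dlt_mono (by omega) _ this
    exact (Submodule.sub_mem_iff_left _ h2).1 (Dlt_mono (by omega) _ h1)

/-- The spanning theorem: `R_{de}` is spanned by the products of a `ψ_x`, for `x` a coset
representative, and an element of the parabolic subalgebra, compatibly with all filtrations. -/
theorem Dlt_le_Flt [Fact (1 < e)] (hω : ∀ w, Red (ω w) w) (L : ℕ) (m : ℤ) :
    Dlt F e (d * e) L m ≤ Flt F ω L m := by
  induction L generalizing m with
  | zero =>
    refine Submodule.span_le.2 ?_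
    rintro _ ⟨l, hl, _⟩
    omega
  | succ L ih =>
    refine Submodule.span_le.2 ?_
    rintro x ⟨l, hl, hx⟩
    rw [SetLike.mem_coe]
    induction hx with
    | one =>
      have h1 : (1 : Equiv.Perm (Fin (d * e))) ∈ minCosetReps d e := fun t a b hab =>
        pos_lt_pos_iff.2 (Or.inr ⟨rfl, hab⟩)
      have hl0 : ω 1 = [] := List.length_eq_zero_iff.1 (by rw [(hω 1).length_eq, inv_one]; rfl)
      rw [← sum_idem]
      refine Submodule.sum_mem _ fun i _ => ?_
      have := mem_Flt (F := F) (ω := ω) (L := L + 1) h1 (by rw [hl0]; simp) (k := i) CMon.one (m := 0)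
        (by rw [hl0]; simp [wdeg])
      rwa [hl0, psiW_nil, one_mul, mul_one] at this
    | @idem_mul l m x i _ ih' =>
      refine mul_mem_of_mem_span _ ?_ (ih' hl)
      rintro _ ⟨x, hx, hL, k, c, m', hc, rfl, rfl⟩
      rw [psiW_mul_idem, ← mul_assoc, ← mul_assoc]
      by_cases hi' : i = act (wprod (ω x)) k
      · rw [← hi', idem_mul_self, hi', ← psiW_mul_idem]
        exact mem_Flt hx hL hc rfl
      · rw [idem_mul_of_ne hi', zero_mul, zero_mul]
        exact zero_mem _
    | @ydiff_mul l m x p q _ ih' =>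
      refine mul_mem_of_mem_span _ ?_ (ih' hl)
      rintro _ ⟨x, hx, hL, k, c, m', hc, rfl, rfl⟩
      have h1 := sub_mem (y_mul_psiW_sub_mem (F := F) p (ω x) k) (y_mul_psiW_sub_mem q (ω x) k)
      have h2 := Flt_mul_of_eq (m'' := 2 + (wdeg (ω x) k + m')) (Flt_mono (Nat.le_succ L) _ (ih _ (Dlt_mono (L' := L) (by omega) _ h1))) hc
        (by ring)
      have h3 := mem_Flt (F := F) (L := L + 1) (m := 2 + (wdeg (ω x) k + m')) hx hL (k := k)
        (hc.ydiff_mul ((wprod (ω x))⁻¹ p) ((wprod (ω x))⁻¹ q)) (by ring)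
      have h4 := add_mem h2 h3
      convert h4 using 1
      have : ∀ p, KLR.idem F k * KLR.y F p = KLR.y F p * KLR.idem F k :=
        fun p => (y_mul_idem p k).symm
      simp only [sub_mul, mul_sub, mul_assoc]
      simp only [← mul_assoc (KLR.idem F k), this]
      simp only [mul_assoc]
      abel
    | psi_mul r i hx _ =>
      exact psi_mul_mem_Flt hω ih r i (ih _ (hx.mem_Dlt (by omega)))

end Spanning

/-! ### Representations of the KLR algebra from intertwiners -/

/-- A ring `A` with a family of commuting elements, idempotents and intertwiners `Φ_r` that satisfy
the braid relations exactly, from which the generators of a KLR algebra can be recovered. -/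
structure IntertwinerData (e n : ℕ) [NeZero e] (Z A : Type*) [CommRing Z] [Ring A] where
  /-- the commuting elements -/
  c : Z →+* A
  /-- the idempotents -/
  E : (Fin n → ZMod e) → A
  /-- the intertwiners -/
  Φ : Fin (n - 1) → A
  /-- the action of the simple transpositions on the commuting elements -/
  s : Fin (n - 1) → Z →+* Z
  /-- the elements `y_p` -/
  y : Fin n → Z
  /-- the inverses of `y_p - y_q` -/
  N : Fin n → Fin n → Z
  /-- the factor that relates `ψ_r` to `Φ_r` -/
  q : ZMod e → ZMod e → Fin n → Fin n → Z
  E_idem : ∀ i, E i * E i = E i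
  E_orth : ∀ i j, i ≠ j → E i * E j = 0
  E_sum : ∑ i, E i = 1
  c_E : ∀ z i, c z * E i = E i * c z
  Φ_E : ∀ r i, Φ r * E i = E (act (simpleT r) i) * Φ r
  c_Φ : ∀ r z, c z * Φ r = Φ r * c (s r z)
  s_y : ∀ r p, s r (y p) = y (simpleT r p)
  s_N : ∀ r p p', s r (N p p') = N (simpleT r p) (simpleT r p')
  s_q : ∀ r a b p p', s r (q a b p p') = q a b (simpleT r p) (simpleT r p')
  N_symm : ∀ p p', N p p' = -N p' p
  N_mul : ∀ p p' i, p ≠ p' → i p = i p' → c (N p p' * (y p - y p')) * E i = E i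
  Φ_sq_eq : ∀ r i, i (lo r) = i (hi r) → Φ r * (Φ r * E i) = E i
  Φ_sq_ne : ∀ r i, i (lo r) ≠ i (hi r) →
    Φ r * (Φ r * (c (q (i (hi r)) (i (lo r)) (hi r) (lo r) * q (i (lo r)) (i (hi r)) (lo r) (hi r)) *
      E i)) = c (Lval (i (lo r)) (i (hi r)) (y (lo r)) (y (hi r))) * E i
  Φ_comm : ∀ r s : Fin (n - 1), (r : ℕ) + 1 < s ∨ (s : ℕ) + 1 < r → Φ r * Φ s = Φ s * Φ r
  Φ_braid : ∀ r s : Fin (n - 1), (s : ℕ) = r + 1 → Φ r * (Φ s * Φ r) = Φ s * (Φ r * Φ s)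

namespace IntertwinerData

variable {e n : ℕ} [NeZero e] {Z A : Type*} [CommRing Z] [Ring A] (D : IntertwinerData e n Z A)

/-- The elements `ψ_r`. -/
def psi (r : Fin (n - 1)) : A :=
  ∑ i, (if i (lo r) = i (hi r) then (D.Φ r - 1) * D.c (D.N (lo r) (hi r))
    else D.Φ r * D.c (D.q (i (lo r)) (i (hi r)) (lo r) (hi r))) * D.E i

theorem psi_E (r : Fin (n - 1)) (i : Fin n → ZMod e) : D.psi r * D.E i =
    (if i (lo r) = i (hi r) then (D.Φ r - 1) * D.c (D.N (lo r) (hi r))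
    else D.Φ r * D.c (D.q (i (lo r)) (i (hi r)) (lo r) (hi r))) * D.E i := by
  rw [psi, Finset.sum_mul, Finset.sum_eq_single i]
  · rw [mul_assoc, D.E_idem]
  · intro j _ h
    rw [mul_assoc, D.E_orth j i h, mul_zero]
  · simp

theorem psi_eq {r : Fin (n - 1)} {i : Fin n → ZMod e} (h : i (lo r) = i (hi r)) {x : A}
    (hx : x = D.E i * x) : D.psi r * x = (D.Φ r - 1) * (D.c (D.N (lo r) (hi r)) * x) := by
  rw [hx, ← mul_assoc, psi_E, if_pos h]
  simp only [mul_assoc]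

theorem psi_ne {r : Fin (n - 1)} {i : Fin n → ZMod e} (h : i (lo r) ≠ i (hi r)) {x : A}
    (hx : x = D.E i * x) :
    D.psi r * x = D.Φ r * (D.c (D.q (i (lo r)) (i (hi r)) (lo r) (hi r)) * x) := by
  rw [hx, ← mul_assoc, psi_E, if_neg h]
  simp only [mul_assoc]

theorem E_E (i) : D.E i = D.E i * D.E i := (D.E_idem i).symm

theorem E_Φ {r : Fin (n - 1)} {i : Fin n → ZMod e} {x : A} (hx : x = D.E i * x) :
    D.Φ r * x = D.E (act (simpleT r) i) * (D.Φ r * x) := by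
  conv_lhs => rw [hx, ← mul_assoc, D.Φ_E, mul_assoc]

theorem E_c {i : Fin n → ZMod e} {x : A} (hx : x = D.E i * x) (z : Z) :
    D.c z * x = D.E i * (D.c z * x) := by
  conv_lhs => rw [hx, ← mul_assoc, D.c_E, mul_assoc]

theorem E_sub {i : Fin n → ZMod e} {x y : A} (hx : x = D.E i * x) (hy : y = D.E i * y) :
    x - y = D.E i * (x - y) := by
  rw [mul_sub, ← hx, ← hy]

theorem E_psi {r : Fin (n - 1)} {i : Fin n → ZMod e} {x : A} (hx : x = D.E i * x) :
    D.psi r * x = D.E (act (simpleT r) i) * (D.psi r * x) := by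
  by_cases h : i (lo r) = i (hi r)
  · have h2 : act (simpleT r) i = i := by
      funext p
      rw [act_simpleT]
      by_cases h1 : p = lo r
      · rw [h1, simpleT_lo, h]
      by_cases h2 : p = hi r
      · rw [h2, simpleT_hi, h]
      rw [simpleT_of_ne r h1 h2]
    have h1 := D.E_Φ (r := r) (D.E_c hx (D.N (lo r) (hi r)))
    rw [h2] at h1 ⊢
    rw [D.psi_eq h hx, sub_mul, one_mul]
    exact D.E_sub h1 (D.E_c hx _)
  · rw [D.psi_ne h hx]
    exact D.E_Φ (D.E_c hx _)

theorem c_c (z z' : Z) (x : A) : D.c z * (D.c z' * x) = D.c (z * z') * x := by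
  rw [map_mul, mul_assoc]

theorem c_Φ_mul (r : Fin (n - 1)) (z : Z) (x : A) :
    D.c z * (D.Φ r * x) = D.Φ r * (D.c (D.s r z) * x) := by
  rw [← mul_assoc, D.c_Φ, mul_assoc]

theorem c_mul_E {u : Z} {i : Fin n → ZMod e} (h : D.c u * D.E i = D.E i) (z : Z) :
    D.c (z * u) * D.E i = D.c z * D.E i := by
  rw [map_mul, mul_assoc, h]

theorem Φ_sq_comm (r : Fin (n - 1)) {i : Fin n → ZMod e} (h : i (lo r) = i (hi r)) (z : Z) :
    D.Φ r * (D.Φ r * (D.c z * D.E i)) = D.c z * D.E i := by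
  rw [D.c_E, ← mul_assoc (D.Φ r) (D.E i), ← mul_assoc, D.Φ_sq_eq r i h]

theorem N_three {i : Fin n → ZMod e} {p p' p'' : Fin n} (h1 : p ≠ p') (h2 : p' ≠ p'')
    (h3 : p ≠ p'') (e1 : i p = i p') (e2 : i p' = i p'') :
    D.c (D.N p p' * (D.N p' p'' - D.N p p'')) * D.E i = D.c (D.N p' p'' * D.N p p'') * D.E i := by
  have a1 := D.c_mul_E (D.N_mul p p' i h1 e1)
  have a2 := D.c_mul_E (D.N_mul p' p'' i h2 e2)
  have a3 := D.c_mul_E (D.N_mul p p'' i h3 (e1.trans e2))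
  have b1 : D.c (D.N p p' * D.N p' p'') * D.E i = _ := (a3 _).symm
  have b2 : D.c (D.N p p' * D.N p p'') * D.E i = _ := (a2 _).symm
  have b3 := a1 (D.N p' p'' * D.N p p'')
  rw [mul_sub, map_sub, sub_mul, b1, b2, ← b3, ← sub_mul, ← map_sub]
  congr 2
  ring

/-- The positions of a braid relation. -/
theorem braid_positions {r s : Fin (n - 1)} (h : (s : ℕ) = r + 1) :
    lo s = hi r ∧ lo r ≠ hi s ∧ hi r ≠ hi s ∧ simpleT r (hi s) = hi s ∧ simpleT s (lo r) = lo r ∧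
      simpleT s (hi r) = hi s ∧ simpleT s (hi s) = hi r := by
  have hm : lo s = hi r := Fin.ext (by rw [hi_val, lo_val, h])
  have h1 : lo r ≠ hi s := by rw [Ne, Fin.ext_iff, hi_val, lo_val]; omega
  have h2 : hi r ≠ hi s := by rw [Ne, Fin.ext_iff, hi_val, hi_val]; omega
  refine ⟨hm, h1, h2, simpleT_of_ne _ h1.symm h2.symm, simpleT_of_ne _ ?_ h1, hm ▸ simpleT_lo s,
    hm ▸ simpleT_hi s⟩
  rw [Ne, Fin.ext_iff, lo_val, lo_val]; omega

theorem psi_braid {r s : Fin (n - 1)} (h : (s : ℕ) = r + 1) (i : Fin n → ZMod e) :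
    D.psi r * (D.psi s * (D.psi r * D.E i)) = D.psi s * (D.psi r * (D.psi s * D.E i)) +
      if i (lo r) = i (hi s) ∧ i (lo r) ≠ i (hi r) then
        D.c ((Lval (i (hi r)) (i (lo r)) (D.y (hi r)) (D.y (hi s)) -
          Lval (i (lo r)) (i (hi r)) (D.y (lo r)) (D.y (hi r))) * D.N (lo r) (hi s)) * D.E i
      else 0 := by
  obtain ⟨hm, h13, h23, f1, f2, f3, f4⟩ := braid_positions h
  have h12 := lo_ne_hi r
  have x0 := D.E_E i
  have x1 := D.E_psi (r := r) x0
  have x2 := D.E_psi (r := s) x1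
  have y1 := D.E_psi (r := s) x0
  have y2 := D.E_psi (r := r) y1
  have braid : ∀ x, D.Φ r * (D.Φ s * (D.Φ r * x)) = D.Φ s * (D.Φ r * (D.Φ s * x)) := by
    intro x
    have := congrArg (· * x) (D.Φ_braid r s h)
    simpa only [mul_assoc] using this
  have k1 : act (simpleT r) i (lo s) = i (lo r) := by rw [act_simpleT, hm, simpleT_hi]
  have k2 : act (simpleT r) i (hi s) = i (hi s) := by rw [act_simpleT, f1]
  have k3 : act (simpleT s) (act (simpleT r) i) (lo r) = i (hi r) := by
    rw [act_simpleT, act_simpleT, f2, simpleT_lo]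
  have k4 : act (simpleT s) (act (simpleT r) i) (hi r) = i (hi s) := by
    rw [act_simpleT, act_simpleT, f3, f1]
  have k5 : act (simpleT s) i (lo r) = i (lo r) := by rw [act_simpleT, f2]
  have k6 : act (simpleT s) i (hi r) = i (hi s) := by rw [act_simpleT, f3]
  have k7 : act (simpleT r) (act (simpleT s) i) (lo s) = i (lo r) := by
    rw [act_simpleT, act_simpleT, hm, simpleT_hi, f2]
  have k8 : act (simpleT r) (act (simpleT s) i) (hi s) = i (hi r) := by
    rw [act_simpleT, act_simpleT, f1, f4]
  by_cases c12 : i (lo r) = i (hi r)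
  · rw [if_neg (fun hc => hc.2 c12), add_zero]
    by_cases c23 : i (hi r) = i (hi s)
    · -- all residues equal
      rw [D.psi_eq (k3.trans (c23.trans k4.symm)) x2, D.psi_eq (k1.trans (c12.trans c23 |>.trans k2.symm)) x1,
        D.psi_eq c12 x0, D.psi_eq (k7.trans (c12.trans k8.symm)) y2,
        D.psi_eq (k5.trans ((c12.trans c23).trans k6.symm)) y1, D.psi_eq (hm ▸ c23) x0]
      have t1 := D.N_three h12 h23 h13 c12 c23
      have t2 := D.N_three h23.symm h12.symm h13.symm c23.symm c12.symm
      rw [D.N_symm (hi s) (hi r), D.N_symm (hi r) (lo r), D.N_symm (hi s) (lo r)] at t2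
      have v1 : D.c (D.N (lo r) (hi r) * (D.N (hi r) (hi s) * D.N (lo r) (hi r))) * D.E i =
          D.c (D.N (lo r) (hi r) * (D.N (lo r) (hi s) * D.N (lo r) (hi r))) * D.E i +
          D.c (D.N (lo r) (hi r) * (D.N (lo r) (hi s) * D.N (hi r) (hi s))) * D.E i := by
        have := congrArg (D.c (D.N (lo r) (hi r)) * ·) t1
        rw [D.c_c, D.c_c, ← sub_eq_zero, ← sub_mul, ← map_sub] at this
        rw [← sub_eq_zero, ← add_mul, ← sub_mul, ← map_add, ← map_sub, ← this]
        congr 2; ring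
      have v2 : D.c (D.N (hi r) (hi s) * (D.N (lo r) (hi r) * D.N (hi r) (hi s))) * D.E i =
          D.c (D.N (hi r) (hi s) * (D.N (lo r) (hi s) * D.N (hi r) (hi s))) * D.E i +
          D.c (D.N (lo r) (hi r) * (D.N (lo r) (hi s) * D.N (hi r) (hi s))) * D.E i := by
        have := congrArg (D.c (D.N (hi r) (hi s)) * ·) t2
        rw [D.c_c, D.c_c, ← sub_eq_zero, ← sub_mul, ← map_sub] at this
        rw [← sub_eq_zero, ← add_mul, ← sub_mul, ← map_add, ← map_sub, ← this]
        congr 2; ring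
      have w1 : D.N (hi r) (hi s) * (D.N (lo r) (hi s) * D.N (lo r) (hi r)) =
          D.N (lo r) (hi r) * (D.N (lo r) (hi s) * D.N (hi r) (hi s)) := by ring
      have w2 : D.N (lo r) (hi s) * (D.N (hi r) (hi s) * D.N (lo r) (hi r)) =
          D.N (lo r) (hi r) * (D.N (lo r) (hi s) * D.N (hi r) (hi s)) := by ring
      have w3 : D.N (lo r) (hi s) * (D.N (lo r) (hi r) * D.N (hi r) (hi s)) =
          D.N (lo r) (hi r) * (D.N (lo r) (hi s) * D.N (hi r) (hi s)) := by ring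
      have sq2 := fun z => D.Φ_sq_comm s (i := i) (by rw [hm]; exact c23) z
      simp only [hm, sub_mul, one_mul, mul_sub, D.c_Φ_mul, D.c_c, D.s_N, simpleT_hi,
        simpleT_lo, f1, f2, f3, f4, D.N_symm (hi r) (lo r), D.N_symm (hi s) (hi r), w1, w2, w3, v1, v2,
        D.Φ_sq_comm r c12, sq2, braid, mul_add, neg_mul, map_neg, mul_neg]
      abel
    · rw [D.psi_ne (by rw [k3, k4]; exact c23) x2, D.psi_ne (by rw [k1, k2]; exact fun h => c23 (c12.symm.trans h)) x1,
        D.psi_eq c12 x0, D.psi_eq (k7.trans (c12.trans k8.symm)) y2,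
        D.psi_ne (by rw [k5, k6]; exact fun h => c23 (c12.symm.trans h)) y1, D.psi_ne (hm ▸ c23) x0]
      rw [k1, k2, k3, k4, k5, k6, hm, c12]
      simp only [sub_mul, one_mul, mul_sub, D.c_Φ_mul, D.c_c, D.s_N, D.s_q, simpleT_hi,
        simpleT_lo, f1, f2, f3, f4, braid, mul_comm, mul_left_comm, mul_assoc]
  · by_cases c23 : i (hi r) = i (hi s)
    · rw [D.psi_eq (k3.trans (c23.trans k4.symm)) x2, D.psi_ne (by rw [k1, k2]; exact fun h => c12 (h.trans c23.symm)) x1,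
        D.psi_ne c12 x0, D.psi_ne (by rw [k7, k8]; exact c12) y2,
        D.psi_ne (by rw [k5, k6]; exact fun h => c12 (h.trans c23.symm)) y1, D.psi_eq (hm ▸ c23) x0,
        if_neg (fun hc => c12 (hc.1.trans c23.symm)), add_zero]
      rw [k1, k2, k5, k6, k7, k8, hm, ← c23]
      simp only [sub_mul, one_mul, mul_sub, D.c_Φ_mul, D.c_c, D.s_N, D.s_q, simpleT_hi,
        simpleT_lo, f1, f2, f3, f4, braid, mul_comm, mul_left_comm, mul_assoc]
    have hn1 : act (simpleT s) (act (simpleT r) i) (lo r) ≠ act (simpleT s) (act (simpleT r) i) (hi r) := by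
      rw [k3, k4]; exact c23
    have hn2 : act (simpleT r) (act (simpleT s) i) (lo s) ≠ act (simpleT r) (act (simpleT s) i) (hi s) := by
      rw [k7, k8]; exact c12
    by_cases c13 : i (lo r) = i (hi s)
    · rw [D.psi_ne hn1 x2, D.psi_eq (k1.trans (c13.trans k2.symm)) x1, D.psi_ne c12 x0,
        D.psi_ne hn2 y2, D.psi_eq (k5.trans (c13.trans k6.symm)) y1, D.psi_ne (hm ▸ c23) x0,
        if_pos ⟨c13, c12⟩]
      have sq1 := D.Φ_sq_ne r i c12
      have sq2 := D.Φ_sq_ne s i (hm ▸ c23)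
      rw [k3, k4, k7, k8, hm, ← c13]
      rw [hm, ← c13] at sq2
      have cE : ∀ (t : Fin (n - 1)) (z z' w : Z), D.Φ t * (D.Φ t * (D.c z * D.E i)) = D.c w * D.E i →
          D.Φ t * (D.Φ t * (D.c (z * z') * D.E i)) = D.c (w * z') * D.E i := by
        intro t z z' w ht
        rw [map_mul, map_mul, mul_assoc, D.c_E, ← mul_assoc (D.c z), ← mul_assoc (D.Φ t) (_ * _),
          ← mul_assoc (D.Φ t) (D.Φ t * _), ht, mul_assoc, ← D.c_E, mul_assoc]
      have sq1' := cE r _ (D.N (lo r) (hi s)) _ sq1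
      have sq2' := cE s _ (D.N (lo r) (hi s)) _ sq2
      have e1 : D.q (i (hi r)) (i (lo r)) (hi r) (lo r) * (D.N (lo r) (hi s) *
          D.q (i (lo r)) (i (hi r)) (lo r) (hi r)) = (D.q (i (hi r)) (i (lo r)) (hi r) (lo r) *
          D.q (i (lo r)) (i (hi r)) (lo r) (hi r)) * D.N (lo r) (hi s) := by ring
      have e2 : D.q (i (lo r)) (i (hi r)) (hi s) (hi r) * (D.N (lo r) (hi s) *
          D.q (i (hi r)) (i (lo r)) (hi r) (hi s)) = (D.q (i (lo r)) (i (hi r)) (hi s) (hi r) *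
          D.q (i (hi r)) (i (lo r)) (hi r) (hi s)) * D.N (lo r) (hi s) := by ring
      have e3 : D.q (i (lo r)) (i (hi r)) (lo r) (hi r) * (D.N (lo r) (hi s) *
          D.q (i (hi r)) (i (lo r)) (hi r) (hi s)) = D.q (i (hi r)) (i (lo r)) (hi r) (hi s) *
          (D.N (lo r) (hi s) * D.q (i (lo r)) (i (hi r)) (lo r) (hi r)) := by ring
      simp only [sub_mul, one_mul, mul_sub, D.c_Φ_mul, D.c_c, D.s_N, D.s_q, simpleT_hi,
        simpleT_lo, f1, f2, f3, f4, braid]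
      rw [e1, e2, sq1', sq2', map_sub, sub_mul]
      try rw [e3]
      abel
    · rw [D.psi_ne hn1 x2, D.psi_ne (by rw [k1, k2]; exact c13) x1, D.psi_ne c12 x0,
        D.psi_ne hn2 y2, D.psi_ne (by rw [k5, k6]; exact c13) y1, D.psi_ne (hm ▸ c23) x0,
        if_neg (fun hc => c13 hc.1), add_zero]
      rw [k1, k2, k3, k4, k5, k6, k7, k8, hm]
      simp only [D.c_Φ_mul, D.c_c, D.s_q, simpleT_hi,
        simpleT_lo, f1, f2, f3, f4, braid, mul_comm, mul_left_comm]

theorem psi_act {r : Fin (n - 1)} {i : Fin n → ZMod e} {p : Fin n} (h : p ≠ lo r) (h' : p ≠ hi r) :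
    act (simpleT r) i p = i p := by
  rw [act_simpleT, simpleT_of_ne r h h']

theorem ext_E {x y : A} (h : ∀ i, x * D.E i = y * D.E i) : x = y := by
  rw [← mul_one x, ← mul_one y, ← D.E_sum, Finset.mul_sum, Finset.mul_sum]
  exact Finset.sum_congr rfl fun i _ => h i

theorem s_s_N (r : Fin (n - 1)) : D.s r (D.N (lo r) (hi r)) = -D.N (lo r) (hi r) := by
  rw [D.s_N, simpleT_lo, simpleT_hi, D.N_symm]

theorem psi_comm {r s : Fin (n - 1)} (h : (r : ℕ) + 1 < s) : D.psi r * D.psi s = D.psi s * D.psi r := by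
  have a1 : lo s ≠ lo r := by rw [Ne, Fin.ext_iff, lo_val, lo_val]; omega
  have a2 : lo s ≠ hi r := by rw [Ne, Fin.ext_iff, lo_val, hi_val]; omega
  have a3 : hi s ≠ lo r := by rw [Ne, Fin.ext_iff, lo_val, hi_val]; omega
  have a4 : hi s ≠ hi r := by rw [Ne, Fin.ext_iff, hi_val, hi_val]; omega
  have comm : ∀ x, D.Φ r * (D.Φ s * x) = D.Φ s * (D.Φ r * x) := by
    intro x
    rw [← mul_assoc, D.Φ_comm r s (Or.inl h), mul_assoc]
  refine D.ext_E fun i => ?_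
  have x1 := D.E_psi (r := r) (D.E_E i)
  have x2 := D.E_psi (r := s) (D.E_E i)
  have b1 := psi_act (i := i) a1 a2
  have b2 := psi_act (i := i) a3 a4
  have b3 := psi_act (i := i) a1.symm a3.symm
  have b4 := psi_act (i := i) a2.symm a4.symm
  have f1 := simpleT_of_ne r a1 a2
  have f2 := simpleT_of_ne r a3 a4
  have f3 := simpleT_of_ne s a1.symm a3.symm
  have f4 := simpleT_of_ne s a2.symm a4.symm
  rw [mul_assoc, mul_assoc]
  by_cases c1 : i (lo r) = i (hi r)
  · by_cases c2 : i (lo s) = i (hi s)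
    · rw [D.psi_eq (by rw [b3, b4, c1]) x2, D.psi_eq c2 (D.E_E i), D.psi_eq (by rw [b1, b2, c2]) x1,
        D.psi_eq c1 (D.E_E i)]
      simp only [sub_mul, one_mul, mul_sub, D.c_Φ_mul, D.c_c, D.s_N, f1, f2, f3, f4, comm, mul_comm]
      abel
    · rw [D.psi_eq (by rw [b3, b4, c1]) x2, D.psi_ne c2 (D.E_E i), D.psi_ne (by rw [b1, b2]; exact c2) x1,
        D.psi_eq c1 (D.E_E i), b1, b2]
      simp only [sub_mul, one_mul, mul_sub, D.c_Φ_mul, D.c_c, D.s_N, D.s_q, f1, f2, f3, f4, comm, mul_comm]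
  · by_cases c2 : i (lo s) = i (hi s)
    · rw [D.psi_ne (by rw [b3, b4]; exact c1) x2, D.psi_eq c2 (D.E_E i), D.psi_eq (by rw [b1, b2, c2]) x1,
        D.psi_ne c1 (D.E_E i), b3, b4]
      simp only [sub_mul, one_mul, mul_sub, D.c_Φ_mul, D.c_c, D.s_N, D.s_q, f1, f2, f3, f4, comm, mul_comm]
    · rw [D.psi_ne (by rw [b3, b4]; exact c1) x2, D.psi_ne c2 (D.E_E i), D.psi_ne (by rw [b1, b2]; exact c2) x1,
        D.psi_ne c1 (D.E_E i), b1, b2, b3, b4]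
      simp only [D.c_Φ_mul, D.c_c, D.s_q, f1, f2, f3, f4, comm, mul_comm]

theorem psi_c_of_fixed {r : Fin (n - 1)} {z : Z} (hz : D.s r z = z) :
    D.psi r * D.c z = D.c z * D.psi r := by
  refine D.ext_E fun i => ?_
  rw [mul_assoc, mul_assoc]
  by_cases c1 : i (lo r) = i (hi r)
  · rw [D.psi_eq c1 (D.E_c (D.E_E i) z), D.psi_eq c1 (D.E_E i)]
    simp only [sub_mul, one_mul, mul_sub, D.c_Φ_mul, D.c_c, hz, mul_comm]
  · rw [D.psi_ne c1 (D.E_c (D.E_E i) z), D.psi_ne c1 (D.E_E i)]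
    simp only [D.c_Φ_mul, D.c_c, hz, mul_comm]

theorem psi_sq (r : Fin (n - 1)) (i : Fin n → ZMod e) : D.psi r * (D.psi r * D.E i) =
    D.c (Lval (i (lo r)) (i (hi r)) (D.y (lo r)) (D.y (hi r))) * D.E i := by
  have x1 := D.E_psi (r := r) (D.E_E i)
  have k1 : act (simpleT r) i (lo r) = i (hi r) := by rw [act_simpleT, simpleT_lo]
  have k2 : act (simpleT r) i (hi r) = i (lo r) := by rw [act_simpleT, simpleT_hi]
  by_cases c1 : i (lo r) = i (hi r)
  · rw [D.psi_eq (by rw [k1, k2, c1]) x1, D.psi_eq c1 (D.E_E i), Lval, if_pos c1]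
    simp only [sub_mul, one_mul, mul_sub, D.c_Φ_mul, D.c_c, D.s_s_N, D.Φ_sq_comm r c1, neg_mul,
      map_neg, mul_neg, map_zero, zero_mul]
    abel
  · rw [D.psi_ne (by rw [k1, k2]; exact Ne.symm c1) x1, D.psi_ne c1 (D.E_E i), ← D.Φ_sq_ne r i c1, k1, k2]
    simp only [D.c_Φ_mul, D.c_c, D.s_q, simpleT_lo, simpleT_hi]

theorem N_mul_y {r : Fin (n - 1)} {i : Fin n → ZMod e} (h : i (lo r) = i (hi r)) :
    D.c (D.N (lo r) (hi r) * D.y (hi r)) * D.E i = D.c (D.N (lo r) (hi r) * D.y (lo r)) * D.E i - D.E i := by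
  have := D.N_mul _ _ i (lo_ne_hi r) h
  rw [mul_sub, map_sub, sub_mul] at this
  rw [eq_sub_iff_add_eq, add_comm, ← sub_eq_iff_eq_add.1 this]

theorem psi_y_eq {r : Fin (n - 1)} {i : Fin n → ZMod e} (h : i (lo r) = i (hi r)) :
    D.psi r * (D.c (D.y (hi r)) * D.E i) = D.c (D.y (lo r)) * (D.psi r * D.E i) + D.E i := by
  rw [D.psi_eq h (D.E_c (D.E_E i) _), D.psi_eq h (D.E_E i)]
  simp only [sub_mul, one_mul, mul_sub, D.c_Φ_mul, D.c_c, D.s_y, simpleT_lo, D.N_mul_y h,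
    mul_comm (D.y _)]
  abel

theorem y_psi_eq {r : Fin (n - 1)} {i : Fin n → ZMod e} (h : i (lo r) = i (hi r)) :
    D.c (D.y (hi r)) * (D.psi r * D.E i) = D.psi r * (D.c (D.y (lo r)) * D.E i) + D.E i := by
  rw [D.psi_eq h (D.E_c (D.E_E i) _), D.psi_eq h (D.E_E i)]
  simp only [sub_mul, one_mul, mul_sub, D.c_Φ_mul, D.c_c, D.s_y, simpleT_hi, D.N_mul_y h,
    mul_comm (D.y _)]
  abel

theorem psi_y_ne {r : Fin (n - 1)} {i : Fin n → ZMod e} (h : i (lo r) ≠ i (hi r)) (z : Z) :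
    D.c z * (D.psi r * D.E i) = D.psi r * (D.c (D.s r z) * D.E i) := by
  rw [D.psi_ne h (D.E_c (D.E_E i) _), D.psi_ne h (D.E_E i)]
  simp only [D.c_Φ_mul, D.c_c, mul_comm]

theorem c_N_mul {p p' : Fin n} {i : Fin n → ZMod e} (hp : p ≠ p') (h : i p = i p') (z : Z) :
    D.c (z * (D.y p - D.y p') * D.N p p') * D.E i = D.c z * D.E i := by
  rw [← D.c_mul_E (D.N_mul p p' i hp h) z]
  congr 2
  ring

/-- The elements `E i`, `y_p` and `ψ_r` satisfy the relations of the KLR algebra. -/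
theorem rel [Fact (1 < e)] {a b : A} (h : KLRRel D.E (fun p => D.c (D.y p)) D.psi a b) : a = b := by
  induction h with
  | idem i => exact D.E_idem i
  | orth i j h => exact D.E_orth i j h
  | sum_one => exact D.E_sum
  | y_idem r i => exact D.c_E _ i
  | psi_idem r i =>
    refine D.ext_E fun j => ?_
    by_cases hj : i = j
    · subst hj
      rw [mul_assoc, D.E_idem, mul_assoc]
      exact D.E_psi (D.E_E i)
    · rw [mul_assoc, D.E_orth i j hj, mul_zero, mul_assoc, D.E_psi (D.E_E j), ← mul_assoc,
        D.E_orth, zero_mul]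
      intro h
      apply hj
      rw [← act_simpleT_act_simpleT r i, h, act_simpleT_act_simpleT]
  | y_y r s => rw [← map_mul, ← map_mul, mul_comm]
  | psi_psi r s h =>
    rcases h with h | h
    · exact D.psi_comm h
    · exact (D.psi_comm h).symm
  | psi_y r s h h' => exact D.psi_c_of_fixed (by rw [D.s_y, simpleT_of_ne r h h'])
  | psi_y_eq r i h => rw [mul_assoc, D.psi_y_eq h, add_mul, one_mul, mul_assoc]
  | psi_y_ne r i h => rw [mul_assoc, mul_assoc, D.psi_y_ne h, D.s_y, simpleT_lo]
  | y_psi_eq r i h => rw [mul_assoc, D.y_psi_eq h, add_mul, one_mul, mul_assoc]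
  | y_psi_ne r i h => rw [mul_assoc, mul_assoc, D.psi_y_ne h, D.s_y, simpleT_hi]
  | psi_sq r i => rw [mul_assoc, D.psi_sq, map_Lval]
  | braid_arrow r s i h h1 h2 =>
    have hne : i (lo r) ≠ i (hi r) := fun hc => h2.2 (by have := h2.1; rw [← hc] at this ⊢; exact this)
    obtain ⟨-, h13, -⟩ := braid_positions h
    rw [mul_assoc, mul_assoc, D.psi_braid h i, if_pos ⟨h1.symm, hne⟩, add_mul, one_mul, mul_assoc,
      mul_assoc]
    congr 1
    have n1 : ¬ DoubleArrow (i (lo r)) (i (hi r)) := fun hd => h2.2 hd.2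
    have n2 : ¬ DoubleArrow (i (hi r)) (i (lo r)) := fun hd => h2.2 hd.1
    have n3 : ¬ Arrow (i (hi r)) (i (lo r)) := fun hd => h2.2 hd.1
    simp only [Lval, if_neg hne, if_neg hne.symm, if_neg n1, if_neg n2, if_neg n3, if_pos h2]
    have := D.c_N_mul h13 h1.symm 1
    rw [map_one, one_mul, one_mul] at this
    rw [← this]
    congr 2
    ring
  | braid_arrow' r s i h h1 h2 =>
    have hne : i (lo r) ≠ i (hi r) := fun hc => h2.2 (by have := h2.1; rw [← hc] at this ⊢; exact this)
    obtain ⟨-, h13, -⟩ := braid_positions h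
    rw [mul_assoc, mul_assoc, D.psi_braid h i, if_pos ⟨h1.symm, hne⟩, sub_mul _ 1, one_mul, mul_assoc,
      mul_assoc]
    have n1 : ¬ DoubleArrow (i (lo r)) (i (hi r)) := fun hd => h2.2 hd.1
    have n2 : ¬ DoubleArrow (i (hi r)) (i (lo r)) := fun hd => h2.2 hd.2
    have n3 : ¬ Arrow (i (lo r)) (i (hi r)) := fun hd => h2.2 hd.1
    simp only [Lval, if_neg hne, if_neg hne.symm, if_neg n1, if_neg n2, if_neg n3, if_pos h2]
    have := D.c_N_mul h13 h1.symm 1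
    rw [map_one, one_mul, one_mul] at this
    rw [show (D.y (hi s) - D.y (hi r) - (D.y (lo r) - D.y (hi r))) * D.N (lo r) (hi s) =
      -((D.y (lo r) - D.y (hi s)) * D.N (lo r) (hi s)) by ring, map_neg, neg_mul, this, sub_eq_add_neg]
  | braid_double r s i h h1 h2 =>
    have he : i (lo r) ≠ i (hi r) → DoubleArrow (i (hi r)) (i (lo r)) := fun _ => ⟨h2.2, h2.1⟩
    obtain ⟨-, h13, -⟩ := braid_positions h
    by_cases hne : i (lo r) = i (hi r)
    · exact absurd (hne.trans h2.1) (by simp)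
    rw [mul_assoc, mul_assoc, D.psi_braid h i, if_pos ⟨h1.symm, hne⟩]
    have := D.c_N_mul h13 h1.symm (D.y (lo r) + D.y (hi s) - 2 * D.y (hi r))
    rw [Lval, Lval, if_neg hne, if_neg (Ne.symm hne), if_pos h2, if_pos (he hne)]
    rw [show ((D.y (hi s) - D.y (hi r)) * (D.y (hi r) - D.y (hi s)) - (D.y (hi r) - D.y (lo r)) *
      (D.y (lo r) - D.y (hi r))) * D.N (lo r) (hi s) = (D.y (lo r) + D.y (hi s) - 2 * D.y (hi r)) *
      (D.y (lo r) - D.y (hi s)) * D.N (lo r) (hi s) by ring, this]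
    simp only [map_sub, map_add, map_mul, map_ofNat, add_mul, sub_mul, mul_assoc]
    abel
  | braid_other r s i h h1 =>
    rw [mul_assoc, mul_assoc, mul_assoc, mul_assoc, D.psi_braid h i]
    split_ifs with hc
    · rw [Lval, Lval, if_neg hc.2, if_neg (Ne.symm hc.2), if_neg (fun hd => h1 ⟨hc.1.symm, Or.inr (Or.inr ⟨hd.2, hd.1⟩)⟩),
        if_neg (fun hd => h1 ⟨hc.1.symm, Or.inr (Or.inr hd)⟩),
        if_neg (fun hd => h1 ⟨hc.1.symm, Or.inr (Or.inl hd)⟩),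
        if_neg (fun hd => h1 ⟨hc.1.symm, Or.inl hd⟩),
        if_neg (fun hd => h1 ⟨hc.1.symm, Or.inl hd⟩),
        if_neg (fun hd => h1 ⟨hc.1.symm, Or.inr (Or.inl hd)⟩), sub_self, zero_mul, map_zero, zero_mul, add_zero]
    · rw [add_zero]

variable (F : Type*) [Field F] [Algebra F A] [Fact (1 < e)]

/-- The homomorphism from the KLR algebra given by a family of intertwiners. -/
def hom : KLR F e n →ₐ[F] A := KLR.lift F D.E (fun p => D.c (D.y p)) D.psi fun _ _ => D.rel

@[simp] theorem hom_idem (i : Fin n → ZMod e) : D.hom F (KLR.idem F i) = D.E i := KLR.lift_idem _ _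

@[simp] theorem hom_y (p : Fin n) : D.hom F (KLR.y F p) = D.c (D.y p) := KLR.lift_y _ _

@[simp] theorem hom_psi (r : Fin (n - 1)) : D.hom F (KLR.psi F r) = D.psi r := KLR.lift_psi _ _

theorem hom_phi_eq {r : Fin (n - 1)} {i : Fin n → ZMod e} (h : i (lo r) = i (hi r)) :
    D.hom F (phi F r) * D.E i = D.Φ r * D.E i := by
  rw [phi, map_sum, Finset.sum_mul, Finset.sum_eq_single i]
  · rw [if_pos h]
    simp only [map_sub, map_mul, hom_idem, hom_y, hom_psi]
    rw [mul_assoc, D.E_idem, sub_mul, mul_assoc, mul_assoc, D.psi_eq h (D.E_E i), D.psi_eq h (D.E_c (D.E_E i) _)]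
    have h1 := D.N_mul_y h
    have h2 : D.c (D.N (lo r) (hi r) * D.y (lo r)) * D.E i =
      D.c (D.N (lo r) (hi r) * D.y (hi r)) * D.E i + D.E i := by rw [h1, sub_add_cancel]
    simp only [sub_mul, one_mul, mul_sub, D.c_Φ_mul, D.c_c, D.s_y, simpleT_lo, mul_comm (D.y _), h2, mul_add]
    abel
  · intro j _ hj
    rw [map_mul, hom_idem, mul_assoc, D.E_orth j i hj, mul_zero]
  · simp

theorem hom_phi_ne {r : Fin (n - 1)} {i : Fin n → ZMod e} (h : i (lo r) ≠ i (hi r)) :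
    D.hom F (phi F r) * D.E i = D.Φ r * (D.c (D.q (i (lo r)) (i (hi r)) (lo r) (hi r)) * D.E i) := by
  rw [phi, map_sum, Finset.sum_mul, Finset.sum_eq_single i]
  · rw [if_neg h, map_mul, hom_idem, hom_psi, mul_assoc, D.E_idem, D.psi_ne h (D.E_E i)]
  · intro j _ hj
    rw [map_mul, hom_idem, mul_assoc, D.E_orth j i hj, mul_zero]
  · simp

end IntertwinerData

/-! ### The action on functions on coset representatives -/

section Tr

variable {d e : ℕ}

/-- The block from which the coset representative `x` takes the letter at position `p`. -/
def src (p : Fin (d * e)) (x : minCosetReps d e) : Fin d := blk (x.1⁻¹ p)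

open Classical in
/-- Multiplication by `s_r`, if this gives a coset representative again. -/
def tr (r : Fin (d * e - 1)) (x : minCosetReps d e) : minCosetReps d e :=
  if h : src (lo r) x = src (hi r) x then x else ⟨simpleT r * x.1, simpleT_mul_mem x.2 h⟩

theorem tr_eq {r : Fin (d * e - 1)} {x : minCosetReps d e} (h : src (lo r) x = src (hi r) x) :
    tr r x = x := dif_pos h

theorem tr_val {r : Fin (d * e - 1)} {x : minCosetReps d e} (h : src (lo r) x ≠ src (hi r) x) :
    (tr r x).1 = simpleT r * x.1 := congrArg Subtype.val (dif_neg h)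

theorem tr_inv {r : Fin (d * e - 1)} {x : minCosetReps d e} (h : src (lo r) x ≠ src (hi r) x)
    (p : Fin (d * e)) : (tr r x).1⁻¹ p = x.1⁻¹ (simpleT r p) := by
  rw [tr_val h, mul_inv_rev, simpleT_inv, Equiv.Perm.mul_apply]

theorem src_simpleT (r : Fin (d * e - 1)) (p : Fin (d * e)) (x : minCosetReps d e) :
    src (simpleT r p) x = src p (tr r x) := by
  by_cases h : src (lo r) x = src (hi r) x
  · rw [tr_eq h]
    by_cases h1 : p = lo r
    · rw [h1, simpleT_lo, h]
    by_cases h2 : p = hi r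
    · rw [h2, simpleT_hi, h]
    rw [simpleT_of_ne r h1 h2]
  · rw [src, src, tr_inv h]

theorem src_tr (r : Fin (d * e - 1)) (p : Fin (d * e)) (x : minCosetReps d e) :
    src p (tr r x) = src (simpleT r p) x := (src_simpleT r p x).symm

theorem tr_tr (r : Fin (d * e - 1)) (x : minCosetReps d e) : tr r (tr r x) = x := by
  by_cases h : src (lo r) x = src (hi r) x
  · rw [tr_eq h, tr_eq h]
  · have h' : src (lo r) (tr r x) ≠ src (hi r) (tr r x) := by
      rw [src_tr, src_tr, simpleT_lo, simpleT_hi]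
      exact Ne.symm h
    exact Subtype.ext (by rw [tr_val h', tr_val h, simpleT_mul_cancel])

end Tr

section Q

variable {e : ℕ} {k : Type*} [CommRing k]

/-- Half of the polynomial `L_{ab}`. -/
def Qval (a b : ZMod e) (u v : k) : k := open Classical in if b = a + 1 then v - u else 1

theorem Qval_mul_Qval {a b : ZMod e} (h : a ≠ b) (u v : k) :
    Qval b a v u * Qval a b u v = Lval a b u v := by
  unfold Qval Lval DoubleArrow Arrow
  rw [if_neg h]
  simp only [Ne]
  by_cases h1 : b = a + 1
  · by_cases h2 : a = b + 1
    · rw [if_pos h1, if_pos h2, if_pos ⟨h1, h2⟩, mul_comm]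
    · rw [if_pos h1, if_neg h2, if_neg (fun hc => h2 hc.2), if_pos ⟨h1, h2⟩, one_mul]
  · by_cases h2 : a = b + 1
    · rw [if_neg h1, if_pos h2, if_neg (fun hc => h1 hc.1), if_neg (fun hc => h1 hc.1), if_pos ⟨h2, h1⟩,
        mul_one]
    · rw [if_neg h1, if_neg h2, if_neg (fun hc => h1 hc.1), if_neg (fun hc => h1 hc.1),
        if_neg (fun hc => h2 hc.1), mul_one]

theorem Lval_self_arg {A : Type*} [Ring A] (a b : ZMod e) (u : A) : Lval a b u u = Lval a b (0 : A) 0 := by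
  simp [Lval]

end Q

/-- The data from which a representation of the algebra `R_{de}` on functions on the coset
representatives with values in `Λ` is built. -/
structure BlockRep (d e : ℕ) [NeZero e] (k Λ : Type*) [CommRing k] [Ring Λ] [Algebra k Λ] where
  /-- the value of all `y` in a block -/
  z : Fin d → k
  /-- the inverses of the differences -/
  N : Fin d → Fin d → k
  /-- the idempotents -/
  E : (Fin (d * e) → ZMod e) → Λ
  /-- the values of the `ψ` in a block, indexed by the first of the two positions -/
  P : Fin (d * e) → Λ
  N_mul : ∀ t t', t ≠ t' → N t t' * (z t - z t') = 1
  N_symm : ∀ t t', N t t' = -N t' t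
  E_idem : ∀ j, E j * E j = E j
  E_orth : ∀ i j, i ≠ j → E i * E j = 0
  E_sum : ∑ j, E j = 1
  E_zero : ∀ (j : Fin (d * e) → ZMod e) (p p' : Fin (d * e)), p ≠ p' → blk p = blk p' → j p = j p' → E j = 0
  P_E : ∀ t a j, P (lo (posPsi t a)) * E j = E (act (simpleT (posPsi t a)) j) * P (lo (posPsi t a))
  P_sq : ∀ t a j, P (lo (posPsi t a)) * (P (lo (posPsi t a)) * E j) =
    Lval (j (lo (posPsi t a))) (j (hi (posPsi t a))) (0 : Λ) 0 * E j
  P_comm : ∀ (t a t' a'), (posPsi (d := d) (e := e) t a : ℕ) + 1 < posPsi (d := d) (e := e) t' a' →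
    P (lo (posPsi t a)) * P (lo (posPsi t' a')) = P (lo (posPsi t' a')) * P (lo (posPsi t a))
  P_braid : ∀ (t : Fin d) (a b : Fin (e - 1)), (b : ℕ) = a + 1 →
    P (lo (posPsi t a)) * (P (lo (posPsi t b)) * P (lo (posPsi t a))) =
    P (lo (posPsi t b)) * (P (lo (posPsi t a)) * P (lo (posPsi t b)))

namespace BlockRep

variable {d e : ℕ} [NeZero e] {k Λ : Type*} [CommRing k] [Ring Λ] [Algebra k Λ] (B : BlockRep d e k Λ)

open Classical in
/-- The coefficient of an intertwiner at a coset representative. -/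
def π (r : Fin (d * e - 1)) (x : minCosetReps d e) : Λ :=
  if src (lo r) x = src (hi r) x then B.P (x.1⁻¹ (lo r)) else 1

theorem π_eq {r : Fin (d * e - 1)} {x : minCosetReps d e} (h : src (lo r) x = src (hi r) x) :
    B.π r x = B.P (x.1⁻¹ (lo r)) := if_pos h

theorem π_ne {r : Fin (d * e - 1)} {x : minCosetReps d e} (h : src (lo r) x ≠ src (hi r) x) :
    B.π r x = 1 := if_neg h

variable (F : Type*) [Field F] [Algebra F k] [Algebra F Λ] [IsScalarTower F k Λ]

/-- The operators with coefficients `a` and underlying map `m`. -/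
def op (a : minCosetReps d e → Λ) (m : minCosetReps d e → minCosetReps d e) :
    Module.End F (minCosetReps d e → Λ) where
  toFun f x := a x * f (m x)
  map_add' f g := by funext x; simp [mul_add]
  map_smul' r f := by funext x; simp

@[simp] theorem op_apply (a : minCosetReps d e → Λ) (m : minCosetReps d e → minCosetReps d e)
    (f : minCosetReps d e → Λ) (x : minCosetReps d e) : op F a m f x = a x * f (m x) := rfl

theorem op_mul (a b : minCosetReps d e → Λ) (m m' : minCosetReps d e → minCosetReps d e) :
    op F a m * op F b m' = op F (fun x => a x * b (m x)) (fun x => m' (m x)) := by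
  ext f x
  simp [mul_assoc]

theorem E_comp_tr (r : Fin (d * e - 1)) (i : Fin (d * e) → ZMod e) (x : minCosetReps d e) :
    B.π r x * B.E (i ∘ (tr r x).1) = B.E (act (simpleT r) i ∘ x.1) * B.π r x := by
  by_cases h : src (lo r) x = src (hi r) x
  · rw [tr_eq h, B.π_eq h]
    obtain ⟨t, a, h1, h2⟩ := exists_posPsi x.2 h
    rw [h1, B.P_E]
    congr 2
    have := simpleT_mul_eq_mul_simpleT h1 h2
    funext p
    rw [act_simpleT]
    simp only [Function.comp, act_simpleT]
    rw [← Equiv.Perm.mul_apply (simpleT r), this]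
    rfl
  · rw [B.π_ne h, one_mul, mul_one]
    congr 1
    funext p
    simp only [Function.comp, act_simpleT, tr_val h]
    rfl

theorem E_eq_zero {x : minCosetReps d e} {i : Fin (d * e) → ZMod e} {p p' : Fin (d * e)}
    (hp : p ≠ p') (h : src p x = src p' x) (hi : i p = i p') : B.E (i ∘ x.1) = 0 :=
  B.E_zero _ (x.1⁻¹ p) (x.1⁻¹ p') (fun hc => hp (x.1⁻¹.injective hc)) h (by simpa using hi)

theorem π_comm {r s : Fin (d * e - 1)} (h : (r : ℕ) + 1 < s) (x : minCosetReps d e) :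
    B.π r x * B.π s (tr r x) = B.π s x * B.π r (tr s x) ∧ tr s (tr r x) = tr r (tr s x) := by
  have a1 : lo s ≠ lo r := by rw [Ne, Fin.ext_iff, lo_val, lo_val]; omega
  have a2 : lo s ≠ hi r := by rw [Ne, Fin.ext_iff, lo_val, hi_val]; omega
  have a3 : hi s ≠ lo r := by rw [Ne, Fin.ext_iff, lo_val, hi_val]; omega
  have a4 : hi s ≠ hi r := by rw [Ne, Fin.ext_iff, hi_val, hi_val]; omega
  have f1 := simpleT_of_ne r a1 a2
  have f2 := simpleT_of_ne r a3 a4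
  have f3 := simpleT_of_ne s a1.symm a3.symm
  have f4 := simpleT_of_ne s a2.symm a4.symm
  have g1 := src_tr r (lo s) x
  have g2 := src_tr r (hi s) x
  have g3 := src_tr s (lo r) x
  have g4 := src_tr s (hi r) x
  rw [f1] at g1; rw [f2] at g2; rw [f3] at g3; rw [f4] at g4
  by_cases c1 : src (lo r) x = src (hi r) x
  · by_cases c2 : src (lo s) x = src (hi s) x
    · rw [tr_eq c1, tr_eq c2, tr_eq c1, B.π_eq c1, B.π_eq c2]
      obtain ⟨t, a, h1, h2⟩ := exists_posPsi x.2 c1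
      obtain ⟨t', a', h3, h4⟩ := exists_posPsi x.2 c2
      rw [h1, h3]
      refine ⟨?_, rfl⟩
      have n1 : lo (posPsi t' a') ≠ lo (posPsi t a) := by rw [← h1, ← h3]; exact fun h => a1 (x.1⁻¹.injective h)
      have n2 : lo (posPsi t' a') ≠ hi (posPsi t a) := by rw [← h2, ← h3]; exact fun h => a2 (x.1⁻¹.injective h)
      have n3 : hi (posPsi t' a') ≠ lo (posPsi t a) := by rw [← h1, ← h4]; exact fun h => a3 (x.1⁻¹.injective h)
      rw [Ne, Fin.ext_iff, lo_val, lo_val] at n1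
      rw [Ne, Fin.ext_iff, lo_val, hi_val] at n2
      rw [Ne, Fin.ext_iff, hi_val, lo_val] at n3
      rcases lt_or_gt_of_ne n1 with hlt | hlt
      · exact (B.P_comm t' a' t a (by omega)).symm
      · exact B.P_comm t a t' a' (by omega)
    · have c3 : src (lo r) (tr s x) = src (hi r) (tr s x) := by rw [g3, g4]; exact c1
      rw [tr_eq c3, B.π_eq c3, tr_eq c1, B.π_eq c1, B.π_ne c2, one_mul, mul_one, tr_inv c2, f3]
      exact ⟨rfl, rfl⟩
  · by_cases c2 : src (lo s) x = src (hi s) x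
    · have c3 : src (lo s) (tr r x) = src (hi s) (tr r x) := by rw [g1, g2]; exact c2
      rw [tr_eq c3, B.π_eq c3, tr_eq c2, B.π_eq c2, B.π_ne c1, one_mul, mul_one, tr_inv c1, f1]
      exact ⟨rfl, rfl⟩
    · have c3 : src (lo r) (tr s x) ≠ src (hi r) (tr s x) := by rw [g3, g4]; exact c1
      have c4 : src (lo s) (tr r x) ≠ src (hi s) (tr r x) := by rw [g1, g2]; exact c2
      rw [B.π_ne c1, B.π_ne c2, B.π_ne c3, B.π_ne c4]
      refine ⟨rfl, Subtype.ext ?_⟩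
      rw [tr_val c3, tr_val c4, tr_val c1, tr_val c2, ← mul_assoc, ← mul_assoc, simpleT_comm (Or.inr h)]

theorem π_braid {r s : Fin (d * e - 1)} (h : (s : ℕ) = r + 1) (x : minCosetReps d e) :
    B.π r x * (B.π s (tr r x) * B.π r (tr s (tr r x))) = B.π s x * (B.π r (tr s x) * B.π s (tr r (tr s x)))
      ∧ tr r (tr s (tr r x)) = tr s (tr r (tr s x)) := by
  obtain ⟨hm, h13, h23, f1, f2, f3, f4⟩ := IntertwinerData.braid_positions h
  have braid : ∀ w : Equiv.Perm (Fin (d * e)), simpleT r * (simpleT s * (simpleT r * w)) =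
      simpleT s * (simpleT r * (simpleT s * w)) := by
    intro w
    have := congrArg (· * w) (simpleT_braid h)
    simpa only [mul_assoc] using this
  have g1 : src (lo s) (tr r x) = src (lo r) x := by rw [src_tr, hm, simpleT_hi]
  have g2 : src (hi s) (tr r x) = src (hi s) x := by rw [src_tr, f1]
  have g3 : src (lo r) (tr s x) = src (lo r) x := by rw [src_tr, f2]
  have g4 : src (hi r) (tr s x) = src (hi s) x := by rw [src_tr, f3]
  have g5 : src (lo r) (tr s (tr r x)) = src (hi r) x := by rw [src_tr, f2, src_tr, simpleT_lo]
  have g6 : src (hi r) (tr s (tr r x)) = src (hi s) x := by rw [src_tr, f3, src_tr, f1]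
  have g7 : src (lo s) (tr r (tr s x)) = src (lo r) x := by rw [src_tr, hm, simpleT_hi, src_tr, f2]
  have g8 : src (hi s) (tr r (tr s x)) = src (hi r) x := by rw [src_tr, f1, src_tr, f4]
  have g0 : src (lo s) x = src (hi r) x := by rw [hm]
  by_cases c12 : src (lo r) x = src (hi r) x
  · by_cases c23 : src (hi r) x = src (hi s) x
    · have c23' : src (lo s) x = src (hi s) x := g0.trans c23
      simp only [tr_eq c12, tr_eq c23', B.π_eq c12, B.π_eq c23']
      obtain ⟨t, a, h1, h2⟩ := exists_posPsi x.2 c12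
      obtain ⟨t', a', h3, h4⟩ := exists_posPsi x.2 c23'
      rw [h1, h3]
      refine ⟨?_, trivial⟩
      rw [hm, h2, ← pos_hi, ← pos_lo] at h3
      obtain ⟨rfl, h5⟩ := pos_inj h3
      exact B.P_braid t a a' (by rw [← lo_val a', ← h5, hi_val])
    · have k1 : src (lo s) (tr r x) ≠ src (hi s) (tr r x) := by rw [g1, g2, c12]; exact c23
      have k2 : src (lo r) (tr s (tr r x)) ≠ src (hi r) (tr s (tr r x)) := by rw [g5, g6]; exact c23
      have k3 : src (lo s) x ≠ src (hi s) x := by rw [g0]; exact c23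
      have k4 : src (lo r) (tr s x) ≠ src (hi r) (tr s x) := by rw [g3, g4, c12]; exact c23
      have k5 : src (lo s) (tr r (tr s x)) = src (hi s) (tr r (tr s x)) := by rw [g7, g8, c12]
      rw [B.π_eq c12, B.π_ne k1, B.π_ne k2, B.π_ne k3, B.π_ne k4, B.π_eq k5, tr_eq k5, tr_eq c12,
        tr_inv k4, hm, simpleT_hi, tr_inv k3, f2]
      simp
  · by_cases c23 : src (hi r) x = src (hi s) x
    · have k1 : src (lo s) (tr r x) ≠ src (hi s) (tr r x) := by rw [g1, g2, ← c23]; exact c12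
      have k2 : src (lo r) (tr s (tr r x)) = src (hi r) (tr s (tr r x)) := by rw [g5, g6]; exact c23
      have k3 : src (lo s) x = src (hi s) x := by rw [g0]; exact c23
      have k4 : src (lo r) (tr s x) ≠ src (hi r) (tr s x) := by rw [g3, g4, ← c23]; exact c12
      have k5 : src (lo s) (tr r (tr s x)) ≠ src (hi s) (tr r (tr s x)) := by rw [g7, g8]; exact c12
      rw [B.π_ne c12, B.π_ne k1, B.π_eq k2, B.π_eq k3, B.π_ne k4, B.π_ne k5, tr_eq k2, tr_inv k1, f2,
        tr_inv c12, simpleT_lo, hm, tr_eq k3]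
      simp
    · by_cases c13 : src (lo r) x = src (hi s) x
      · have k1 : src (lo s) (tr r x) = src (hi s) (tr r x) := by rw [g1, g2]; exact c13
        have k2 : src (lo r) (tr s (tr r x)) ≠ src (hi r) (tr s (tr r x)) := by rw [g5, g6]; exact c23
        have k3 : src (lo s) x ≠ src (hi s) x := by rw [g0]; exact c23
        have k4 : src (lo r) (tr s x) = src (hi r) (tr s x) := by rw [g3, g4]; exact c13
        have k5 : src (lo s) (tr r (tr s x)) ≠ src (hi s) (tr r (tr s x)) := by rw [g7, g8]; exact c12
        rw [B.π_ne c12, B.π_eq k1, B.π_ne k2, B.π_ne k3, B.π_eq k4, B.π_ne k5, tr_eq k4, tr_eq k1,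
          tr_inv c12, hm, simpleT_hi, tr_inv k3, f2, tr_tr, tr_tr]
        simp
      · have k1 : src (lo s) (tr r x) ≠ src (hi s) (tr r x) := by rw [g1, g2]; exact c13
        have k2 : src (lo r) (tr s (tr r x)) ≠ src (hi r) (tr s (tr r x)) := by rw [g5, g6]; exact c23
        have k3 : src (lo s) x ≠ src (hi s) x := by rw [g0]; exact c23
        have k4 : src (lo r) (tr s x) ≠ src (hi r) (tr s x) := by rw [g3, g4]; exact c13
        have k5 : src (lo s) (tr r (tr s x)) ≠ src (hi s) (tr r (tr s x)) := by rw [g7, g8]; exact c12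
        rw [B.π_ne c12, B.π_ne k1, B.π_ne k2, B.π_ne k3, B.π_ne k4, B.π_ne k5]
        refine ⟨rfl, Subtype.ext ?_⟩
        rw [tr_val k2, tr_val k1, tr_val c12, tr_val k5, tr_val k4, tr_val k3, braid]

/-- The intertwiners of the representation on functions on the coset representatives. -/
def data : IntertwinerData e (d * e) (minCosetReps d e → k) (Module.End F (minCosetReps d e → Λ)) where
  c :=
    { toFun := fun z => op F (fun x => algebraMap k Λ (z x)) id
      map_one' := by refine LinearMap.ext fun f => funext fun x => ?_; simp
      map_mul' := fun z z' => by rw [op_mul]; congr 1; funext x; simp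
      map_zero' := by refine LinearMap.ext fun f => funext fun x => ?_; simp
      map_add' := fun z z' => by refine LinearMap.ext fun f => funext fun x => ?_; simp [add_mul] }
  E i := op F (fun x => B.E (i ∘ x.1)) id
  Φ r := op F (B.π r) (tr r)
  s r :=
    { toFun := fun z x => z (tr r x)
      map_one' := rfl
      map_mul' := fun _ _ => rfl
      map_zero' := rfl
      map_add' := fun _ _ => rfl }
  y p x := B.z (src p x)
  N p p' x := B.N (src p x) (src p' x)
  q a b p p' x := open Classical in if src p x = src p' x then 1 else Qval a b (B.z (src p x)) (B.z (src p' x))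
  E_idem i := by rw [op_mul]; congr 1; funext x; exact B.E_idem _
  E_orth i j h := by
    rw [op_mul]
    refine LinearMap.ext fun f => funext fun x => ?_
    rw [op_apply, id, B.E_orth, zero_mul]; rfl
    intro hc
    apply h
    funext p
    have := congrFun hc (x.1⁻¹ p)
    simpa using this
  E_sum := by
    refine LinearMap.ext fun f => funext fun x => ?_
    simp only [LinearMap.sum_apply, Finset.sum_apply, op_apply, id, Module.End.one_apply]
    rw [← Finset.sum_mul]
    have := B.E_sum
    rw [← Equiv.sum_comp (Equiv.arrowCongr x.1⁻¹ (Equiv.refl (ZMod e)))] at this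
    rw [show (∑ i : Fin (d * e) → ZMod e, B.E (i ∘ x.1)) = 1 from this, one_mul]
  c_E z i := by
    change op F _ _ * op F _ _ = op F _ _ * op F _ _
    rw [op_mul, op_mul]
    congr 1
    funext x
    exact Algebra.commutes _ _
  Φ_E r i := by
    rw [op_mul, op_mul]
    congr 1
    funext x
    exact B.E_comp_tr r i x
  c_Φ r z := by
    change op F _ _ * op F _ _ = op F _ _ * op F _ _
    rw [op_mul, op_mul]
    congr 1
    funext x
    change algebraMap k Λ (z x) * B.π r x = B.π r x * algebraMap k Λ (z (tr r (tr r x)))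
    rw [tr_tr, Algebra.commutes]
  s_y r p := by funext x; exact congrArg B.z (src_tr r p x)
  s_N r p p' := by funext x; exact congrArg₂ B.N (src_tr r p x) (src_tr r p' x)
  s_q r a b p p' := by
    funext x
    change (if src p (tr r x) = src p' (tr r x) then 1 else
      Qval a b (B.z (src p (tr r x))) (B.z (src p' (tr r x)))) = _
    rw [src_tr, src_tr]
  N_symm p p' := by funext x; exact B.N_symm _ _
  N_mul p p' i hp h := by
    change op F _ _ * op F _ _ = op F _ _
    rw [op_mul]
    congr 1
    funext x
    by_cases hs : src p x = src p' x
    · simp only [id]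
      rw [B.E_eq_zero hp hs h, mul_zero]
    · change algebraMap k Λ (B.N (src p x) (src p' x) * (B.z (src p x) - B.z (src p' x))) * _ = _
      rw [B.N_mul _ _ hs, map_one, one_mul]; rfl
  Φ_sq_eq r i h := by
    rw [op_mul, op_mul]
    refine LinearMap.ext fun f => funext fun x => ?_
    simp only [op_apply, id, tr_tr]
    by_cases hs : src (lo r) x = src (hi r) x
    · rw [B.E_eq_zero (lo_ne_hi r) hs h, mul_zero, mul_zero]
    · have hs' : src (lo r) (tr r x) ≠ src (hi r) (tr r x) := by
        rw [src_tr, src_tr, simpleT_lo, simpleT_hi]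
        exact Ne.symm hs
      rw [B.π_ne hs, B.π_ne hs', one_mul, one_mul]
  Φ_sq_ne r i h := by
    change op F _ _ * (op F _ _ * (op F _ _ * op F _ _)) = op F _ _ * op F _ _
    rw [op_mul, op_mul, op_mul, op_mul]
    refine LinearMap.ext fun f => funext fun x => ?_
    have hL : Lval (i (lo r)) (i (hi r)) (fun x => B.z (src (lo r) x)) (fun x => B.z (src (hi r) x)) x =
        Lval (i (lo r)) (i (hi r)) (B.z (src (lo r) x)) (B.z (src (hi r) x)) :=
      map_Lval (Pi.evalRingHom (fun _ : minCosetReps d e => k) x) _ _ _ _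
    simp only [op_apply, id, tr_tr, Pi.mul_apply]
    rw [hL]
    by_cases hs : src (lo r) x = src (hi r) x
    · rw [tr_eq hs, B.π_eq hs, if_pos hs, if_pos hs.symm]
      rw [hs, Lval_self_arg, map_Lval (algebraMap k Λ), map_zero, one_mul, map_one, one_mul]
      obtain ⟨t, a, h1, h2⟩ := exists_posPsi x.2 hs
      rw [h1, B.P_sq, ← h1, ← h2]
      simp
    · have hs' : src (lo r) (tr r x) ≠ src (hi r) (tr r x) := by
        rw [src_tr, src_tr, simpleT_lo, simpleT_hi]
        exact Ne.symm hs
      rw [B.π_ne hs, B.π_ne hs', one_mul, one_mul, if_neg hs, if_neg (Ne.symm hs), Qval_mul_Qval h]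
  Φ_comm r s h := by
    rw [op_mul, op_mul]
    rcases h with h | h
    · exact congrArg₂ (op F) (funext fun x => (B.π_comm h x).1) (funext fun x => (B.π_comm h x).2)
    · exact congrArg₂ (op F) (funext fun x => (B.π_comm h x).1.symm)
        (funext fun x => (B.π_comm h x).2.symm)
  Φ_braid r s h := by
    rw [op_mul, op_mul, op_mul, op_mul]
    exact congrArg₂ (op F) (funext fun x => (B.π_braid h x).1) (funext fun x => (B.π_braid h x).2)

end BlockRep

open scoped TensorProduct

theorem injective_of_mem_Ialpha {e n : ℕ} {i : Fin n → ZMod e} (h : i ∈ Ialpha n (mdelta e 1)) :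
    Function.Injective i := by
  intro a b hab
  have : Subsingleton {r : Fin n // i r = i b} := (Nat.card_eq_one_iff_unique.1 (h (i b))).1
  exact congrArg Subtype.val (Subsingleton.elim (⟨a, hab⟩ : {r : Fin n // i r = i b}) ⟨b, rfl⟩)

/-- The power of `θ` of exponent `m`, where only the exponents `0` and `1` matter. -/
def tpow {k : Type*} [CommRing k] (θ : k) (m : ℤ) : k := if m = 0 then 1 else if m = 1 then θ else 0

/-! ### A one block representation -/

section OneBlock

variable (F : Type*) [Field F] {e : ℕ} [NeZero e] 

/-- The image of `e(i)` in `RbarDelta`. -/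
abbrev eB (i : Fin e → ZMod e) : RbarDelta F e := RbarDelta.proj F e (KLR.idem F i)

/-- The image of `ψ_a` in `RbarDelta`. -/
abbrev pB (a : Fin (e - 1)) : RbarDelta F e := RbarDelta.proj F e (KLR.psi F a)

/-- The image of `y_a` in `RbarDelta`. -/
abbrev yB (a : Fin e) : RbarDelta F e := RbarDelta.proj F e (KLR.y F a)

theorem eB_eq_zero {i : Fin e → ZMod e} (h : ¬ (i ∈ Ialpha e (mdelta e 1) ∧ i ∈ Iempty1 e)) :
    eB F i = 0 :=
  KLRbar.proj_idem_eq_zero F _ fun h1 h2 => h ⟨h1, h2⟩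

theorem eB_mul_self (i : Fin e → ZMod e) : eB F i * eB F i = eB F i := by
  rw [← map_mul, KLR.rel F (KLRRel.idem i)]

theorem eB_mul_of_ne {i j : Fin e → ZMod e} (h : i ≠ j) : eB F i * eB F j = 0 := by
  rw [← map_mul, KLR.rel F (KLRRel.orth i j h), map_zero]

theorem sum_eB : ∑ i : Fin e → ZMod e, eB F i = 1 := by
  rw [← map_sum, KLR.rel F KLRRel.sum_one, map_one]

theorem pB_mul_eB (a : Fin (e - 1)) (i : Fin e → ZMod e) :
    pB F a * eB F i = eB F (act (simpleT a) i) * pB F a := by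
  rw [← map_mul, ← map_mul, KLR.rel F (KLRRel.psi_idem a i)]

theorem eB_act_pB_eB (a : Fin (e - 1)) (i : Fin e → ZMod e) :
    eB F (act (simpleT a) i) * (pB F a * eB F i) = pB F a * eB F i := by
  rw [pB_mul_eB, ← mul_assoc, eB_mul_self]

theorem eB_mul_pB_of_ne {a : Fin (e - 1)} {i j : Fin e → ZMod e} (h : j ≠ act (simpleT a) i) :
    eB F j * (pB F a * eB F i) = 0 := by
  rw [pB_mul_eB, ← mul_assoc, eB_mul_of_ne F h, zero_mul]

variable {k : Type*} [CommRing k] [Algebra F k] (θ : k)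

/-- The image of `ψ_a` in the one block representation. -/
def pOne (a : Fin (e - 1)) : k ⊗[F] RbarDelta F e :=
  ∑ i : Fin e → ZMod e, tpow θ (-cartan (i (lo a)) (i (hi a))) ⊗ₜ (pB F a * eB F i)

theorem pOne_mul (a : Fin (e - 1)) (i : Fin e → ZMod e) (c : k) (x : RbarDelta F e)
    (hx : x = eB F i * x) : pOne F θ a * (c ⊗ₜ x) =
      (tpow θ (-cartan (i (lo a)) (i (hi a))) * c) ⊗ₜ (pB F a * x) := by
  rw [pOne, Finset.sum_mul, Finset.sum_eq_single i]
  · rw [Algebra.TensorProduct.tmul_mul_tmul, mul_assoc, ← hx]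
  · intro j _ hj
    rw [Algebra.TensorProduct.tmul_mul_tmul, hx, mul_assoc, ← mul_assoc (eB F j),
      eB_mul_of_ne F hj, zero_mul, mul_zero, TensorProduct.tmul_zero]
  · simp

theorem one_tmul_ext {x y : k ⊗[F] RbarDelta F e}
    (h : ∀ i, i ∈ Ialpha e (mdelta e 1) → i ∈ Iempty1 e →
      x * ((1 : k) ⊗ₜ[F] eB F i) = y * ((1 : k) ⊗ₜ[F] eB F i)) : x = y := by
  have h1 : ∑ i : Fin e → ZMod e, (1 : k) ⊗ₜ[F] eB F i = 1 := by
    rw [← TensorProduct.tmul_sum, sum_eB]; rfl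
  rw [← mul_one x, ← mul_one y, ← h1, Finset.mul_sum, Finset.mul_sum]
  refine Finset.sum_congr rfl fun i _ => ?_
  by_cases hi : i ∈ Ialpha e (mdelta e 1) ∧ i ∈ Iempty1 e
  · exact h i hi.1 hi.2
  · rw [eB_eq_zero F hi, TensorProduct.tmul_zero, mul_zero, mul_zero]

theorem pOne_idem (a : Fin (e - 1)) (i : Fin e → ZMod e) :
    pOne F θ a * ((1 : k) ⊗ₜ[F] eB F i) = ((1 : k) ⊗ₜ[F] eB F (act (simpleT a) i)) * pOne F θ a := by
  rw [pOne_mul F θ a i 1 _ (eB_mul_self F i).symm, pOne, Finset.mul_sum, Finset.sum_eq_single i]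
  · rw [Algebra.TensorProduct.tmul_mul_tmul, eB_act_pB_eB, one_mul, mul_one]
  · intro j _ hj
    rw [Algebra.TensorProduct.tmul_mul_tmul, eB_mul_pB_of_ne, TensorProduct.tmul_zero]
    intro h
    apply hj
    rw [← act_simpleT_act_simpleT a i, h, act_simpleT_act_simpleT]
  · simp

theorem cartan_neg_cases {a b : ZMod e} (h : a ≠ b) :
    (cartan a b = 0 ∧ ¬ (a = b + 1 ∨ b = a + 1)) ∨ (cartan a b = -1 ∧ (a = b + 1 ∨ b = a + 1)) ∨
      (cartan a b = -2 ∧ a = b + 1 ∧ b = a + 1) := by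
  unfold cartan
  rw [if_neg h]
  unfold DoubleArrow Arrow
  by_cases h1 : b = a + 1
  · by_cases h2 : a = b + 1
    · rw [if_pos ⟨h1, h2⟩]; exact Or.inr (Or.inr ⟨rfl, h2, h1⟩)
    · rw [if_neg (fun hc => h2 hc.2), if_pos (Or.inl ⟨h1, h2⟩)]; exact Or.inr (Or.inl ⟨rfl, Or.inr h1⟩)
  · by_cases h2 : a = b + 1
    · rw [if_neg (fun hc => h1 hc.1), if_pos (Or.inr ⟨h2, h1⟩)]; exact Or.inr (Or.inl ⟨rfl, Or.inl h2⟩)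
    · rw [if_neg (fun hc => h1 hc.1), if_neg]
      · exact Or.inl ⟨rfl, by tauto⟩
      · rintro (h | h)
        · exact h1 h.1
        · exact h2 h.1

theorem Lval_zero {A : Type*} [Ring A] {a b : ZMod e} (h : a ≠ b) :
    Lval a b (0 : A) 0 = if a = b + 1 ∨ b = a + 1 then 0 else 1 := by
  unfold Lval
  rw [if_neg h]
  unfold DoubleArrow Arrow
  by_cases h1 : b = a + 1
  · by_cases h2 : a = b + 1
    · rw [if_pos ⟨h1, h2⟩, if_pos (Or.inr h1)]; simp
    · rw [if_neg (fun hc => h2 hc.2), if_pos ⟨h1, h2⟩, if_pos (Or.inr h1)]; simp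
  · by_cases h2 : a = b + 1
    · rw [if_neg (fun hc => h1 hc.1), if_neg (fun hc => h1 hc.1), if_pos ⟨h2, h1⟩, if_pos (Or.inl h2)]; simp
    · rw [if_neg (fun hc => h1 hc.1), if_neg (fun hc => h1 hc.1), if_neg (fun hc => h2 hc.1), if_neg]
      tauto

/-- For distinct residues whose Cartan integer is `-2` we have `e = 2`. -/
theorem eq_two_of_double {a b : ZMod e} (h : a = b + 1) (h' : b = a + 1) [Fact (1 < e)] : e = 2 := by
  have h2 : ((2 : ℕ) : ZMod e) = 0 := by
    have : b + (1 + 1) = b := by rw [← add_assoc, ← h, ← h']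
    have := add_eq_left.1 this
    rw [← this]; norm_num
  rw [ZMod.natCast_eq_zero_iff] at h2
  have := Nat.le_of_dvd (by norm_num) h2
  have := (Fact.out : 1 < e)
  omega

theorem pB_eq_zero_of_eq_two (h : e = 2) (a : Fin (e - 1)) : pB F a = 0 :=
  RbarDelta.proj_psi_zero F a (by have := a.isLt; omega)

variable {θ} [Fact (1 < e)]

theorem pOne_sq (hθ : θ * θ = 0) (a : Fin (e - 1)) (i : Fin e → ZMod e) :
    pOne F θ a * (pOne F θ a * ((1 : k) ⊗ₜ[F] eB F i)) =
      Lval (i (lo a)) (i (hi a)) (0 : k ⊗[F] RbarDelta F e) 0 * ((1 : k) ⊗ₜ[F] eB F i) := by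
  by_cases hi : i ∈ Ialpha e (mdelta e 1) ∧ i ∈ Iempty1 e
  swap
  · rw [eB_eq_zero F hi, TensorProduct.tmul_zero, mul_zero, mul_zero, mul_zero]
  have hne : i (lo a) ≠ i (KLRTheta.hi a) := fun h => lo_ne_hi a (injective_of_mem_Ialpha hi.1 h)
  rw [pOne_mul F θ a i 1 _ (eB_mul_self F i).symm, pOne_mul F θ a (act (simpleT a) i) _ _
    (eB_act_pB_eB F a i).symm, act_simpleT, act_simpleT, simpleT_lo, simpleT_hi,
    show cartan (i (KLRTheta.hi a)) (i (lo a)) = cartan (i (lo a)) (i (KLRTheta.hi a)) from cartan_comm, Lval_zero hne]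
  have hsq : pB F a * (pB F a * eB F i) = RbarDelta.proj F e (Lval (i (lo a)) (i (KLRTheta.hi a)) (KLR.y F (lo a))
      (KLR.y F (KLRTheta.hi a))) * eB F i := by
    rw [← mul_assoc, ← map_mul, ← map_mul, ← map_mul, KLR.rel F (KLRRel.psi_sq a i)]
  rcases cartan_neg_cases hne with ⟨h1, h2⟩ | ⟨h1, h2⟩ | ⟨h1, h2, h3⟩
  · rw [h1, if_neg h2, hsq, one_mul]
    have : Lval (i (lo a)) (i (KLRTheta.hi a)) (KLR.y F (lo a) : KLR F e e) (KLR.y F (KLRTheta.hi a)) = 1 := by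
      rw [Lval, if_neg hne, if_neg (fun h => h2 (Or.inr h.1)), if_neg (fun h => h2 (Or.inr h.1)),
        if_neg (fun h => h2 (Or.inl h.1))]
    rw [this, map_one, one_mul]
    simp [tpow]
  · rw [h1, if_pos h2, zero_mul]
    simp [tpow, hθ]
  · rw [if_pos (Or.inl h2), pB_eq_zero_of_eq_two F (eq_two_of_double h2 h3)]
    simp

theorem pOne_comm {a b : Fin (e - 1)} (h : (a : ℕ) + 1 < b) :
    pOne F θ a * pOne F θ b = pOne F θ b * pOne F θ a := by
  refine one_tmul_ext F fun i _ _ => ?_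
  have a1 : lo b ≠ lo a := by rw [Ne, Fin.ext_iff, lo_val, lo_val]; omega
  have a2 : lo b ≠ hi a := by rw [Ne, Fin.ext_iff, lo_val, hi_val]; omega
  have a3 : hi b ≠ lo a := by rw [Ne, Fin.ext_iff, lo_val, hi_val]; omega
  have a4 : hi b ≠ hi a := by rw [Ne, Fin.ext_iff, hi_val, hi_val]; omega
  rw [mul_assoc, mul_assoc, pOne_mul F θ a i 1 _ (eB_mul_self F i).symm,
    pOne_mul F θ b i 1 _ (eB_mul_self F i).symm, pOne_mul F θ b (act (simpleT a) i) _ _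
    (eB_act_pB_eB F a i).symm, pOne_mul F θ a (act (simpleT b) i) _ _ (eB_act_pB_eB F b i).symm]
  simp only [act_simpleT]
  rw [simpleT_of_ne a a1 a2, simpleT_of_ne a a3 a4, simpleT_of_ne b a1.symm a3.symm,
    simpleT_of_ne b a2.symm a4.symm, ← mul_assoc, ← mul_assoc, ← map_mul, ← map_mul,
    KLR.rel F (KLRRel.psi_psi a b (Or.inl h)), mul_one, mul_one, mul_comm, map_mul, map_mul, mul_assoc]

theorem pOne_braid {a b : Fin (e - 1)} (h : (b : ℕ) = a + 1) :
    pOne F θ a * (pOne F θ b * pOne F θ a) = pOne F θ b * (pOne F θ a * pOne F θ b) := by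
  refine one_tmul_ext F fun i hi hi' => ?_
  obtain ⟨hm, h13, h23, f1, f2, f3, f4⟩ := IntertwinerData.braid_positions h
  have e1 : ∀ (c c' : Fin (e - 1)), pB F c * (pB F c' * eB F i) =
      eB F (act (simpleT c) (act (simpleT c') i)) * (pB F c * (pB F c' * eB F i)) := by
    intro c c'
    rw [pB_mul_eB F c', ← mul_assoc (pB F c), pB_mul_eB]
    simp only [← mul_assoc]
    rw [eB_mul_self]
  have hb : pB F a * (pB F b * (pB F a * eB F i)) = pB F b * (pB F a * (pB F b * eB F i)) := by
    simp only [← map_mul]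
    congr 1
    have := KLR.rel F (KLRRel.braid_other a b i h (fun hc => h13 (injective_of_mem_Ialpha hi hc.1.symm)))
    simpa only [mul_assoc] using this
  simp only [mul_assoc]
  rw [pOne_mul F θ a i 1 _ (eB_mul_self F i).symm, pOne_mul F θ b (act (simpleT a) i) _ _
    (eB_act_pB_eB F a i).symm, pOne_mul F θ a _ _ _ (e1 b a),
    pOne_mul F θ b i 1 _ (eB_mul_self F i).symm, pOne_mul F θ a (act (simpleT b) i) _ _
    (eB_act_pB_eB F b i).symm, pOne_mul F θ b _ _ _ (e1 a b), hb]
  simp only [act_simpleT, f1, f2, f3, f4, hm, simpleT_lo, simpleT_hi]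
  congr 1
  ring

end OneBlock

/-! ### The representation with values in the tensor power -/

/-- Scalars for the representation. -/
structure TwistData (d : ℕ) (k : Type*) [CommRing k] where
  /-- the value of all `y` in a block -/
  z : Fin d → k
  /-- the inverses of the differences -/
  N : Fin d → Fin d → k
  /-- the weights of elements of degree `1` -/
  θ : Fin d → k
  N_mul : ∀ t t', t ≠ t' → N t t' * (z t - z t') = 1
  N_symm : ∀ t t', N t t' = -N t' t
  θ_sq : ∀ t, θ t * θ t = 0

section Embed

variable (F : Type*) [Field F] (k : Type*) [CommRing k] [Algebra F k] (A : Type*) [Ring A]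
  [Algebra F A] (d : ℕ)

/-- The tensor power with extended scalars. -/
def Lam : Type _ := k ⊗[F] TPow F A d

instance : Ring (Lam F k A d) := inferInstanceAs (Ring (k ⊗[F] TPow F A d))
instance : Algebra k (Lam F k A d) := inferInstanceAs (Algebra k (k ⊗[F] TPow F A d))
instance : Algebra F (Lam F k A d) := inferInstanceAs (Algebra F (k ⊗[F] TPow F A d))
instance : IsScalarTower F k (Lam F k A d) := inferInstanceAs (IsScalarTower F k (k ⊗[F] TPow F A d))

variable {k A d}

/-- The pure tensors. -/
def Lam.mk (c : k) : TPow F A d →ₗ[F] Lam F k A d := TensorProduct.mk F k (TPow F A d) c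

theorem Lam.mk_mul_mk (c c' : k) (x y : TPow F A d) :
    Lam.mk F c x * Lam.mk F c' y = Lam.mk F (c * c') (x * y) :=
  Algebra.TensorProduct.tmul_mul_tmul c c' x y

theorem Lam.mk_one : Lam.mk F (1 : k) (1 : TPow F A d) = 1 := rfl

variable (k A)

/-- The embedding as the `t`-th factor of the tensor power. -/
def emb (t : Fin d) : k ⊗[F] A →ₐ[k] Lam F k A d :=
  Algebra.TensorProduct.map (AlgHom.id k k) (PiTensorProduct.singleAlgHom (R := F) (A := fun _ => A) t)

variable {k A}

theorem emb_tmul (t : Fin d) (c : k) (x : A) :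
    emb F k A t (c ⊗ₜ[F] x) = Lam.mk F c (PiTensorProduct.tprod F (Pi.mulSingle (M := fun _ => A) t x)) := rfl

theorem emb_commute_tprod {t : Fin d} {f : Fin d → A} (hf : f t = 1) (x : k ⊗[F] A) (c : k) :
    emb F k A t x * Lam.mk F c (PiTensorProduct.tprod F f) =
      Lam.mk F c (PiTensorProduct.tprod F f) * emb F k A t x := by
  induction x using TensorProduct.induction_on with
  | zero => rw [map_zero, zero_mul, mul_zero]
  | add x y hx hy => rw [map_add, add_mul, mul_add, hx, hy]
  | tmul c' x =>
    rw [emb_tmul, Lam.mk_mul_mk, Lam.mk_mul_mk,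
      PiTensorProduct.tprod_mul_tprod, PiTensorProduct.tprod_mul_tprod, mul_comm]
    congr 2
    funext s
    by_cases h : s = t
    · subst h; simp [hf]
    · simp [Pi.mulSingle_eq_of_ne h]

theorem emb_comm {t t' : Fin d} (h : t ≠ t') (x y : k ⊗[F] A) :
    emb F k A t x * emb F k A t' y = emb F k A t' y * emb F k A t x := by
  induction y using TensorProduct.induction_on with
  | zero => rw [map_zero, zero_mul, mul_zero]
  | add y y' hy hy' => rw [map_add, mul_add, add_mul, hy, hy']
  | tmul c y =>
    rw [emb_tmul]
    exact emb_commute_tprod F (Pi.mulSingle_eq_of_ne h _) x c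

end Embed

section Rep

variable (F : Type*) [Field F] {d e : ℕ} [NeZero e] {k : Type*} [CommRing k] [Algebra F k]
  (W : TwistData d k)

/-- The idempotent of the representation that belongs to a residue sequence. -/
def repE (k : Type*) [CommRing k] [Algebra F k] (j : Fin (d * e) → ZMod e) :
    Lam F k (RbarDelta F e) d :=
  Lam.mk F 1 (PiTensorProduct.tprod F fun t => eB F (block t j))

/-- The part of `repE` in all blocks but one. -/
def repErest (k : Type*) [CommRing k] [Algebra F k] (t : Fin d) (j : Fin (d * e) → ZMod e) :
    Lam F k (RbarDelta F e) d :=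
  Lam.mk F 1 (PiTensorProduct.tprod F (Function.update (fun t => eB F (block t j)) t 1))

theorem repE_eq (t : Fin d) (j : Fin (d * e) → ZMod e) :
    repE F k j = emb F k (RbarDelta F e) t (1 ⊗ₜ eB F (block t j)) * repErest F k t j := by
  rw [emb_tmul, repErest, Lam.mk_mul_mk, PiTensorProduct.tprod_mul_tprod, repE,
    one_mul]
  congr 2
  funext s
  by_cases h : s = t
  · subst h; simp
  · simp [Pi.mulSingle_eq_of_ne h, Function.update_of_ne h]

theorem emb_comm_rest (t : Fin d) (j : Fin (d * e) → ZMod e) (x : k ⊗[F] RbarDelta F e) :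
    emb F k (RbarDelta F e) t x * repErest F k t j = repErest F k t j * emb F k (RbarDelta F e) t x :=
  emb_commute_tprod F (Function.update_self _ _ _) x 1

theorem repErest_act (t : Fin d) (a : Fin (e - 1)) (j : Fin (d * e) → ZMod e) :
    repErest F k t (act (simpleT (posPsi t a)) j) = repErest F k t j := by
  rw [repErest, repErest]
  congr 2
  funext s
  by_cases h : s = t
  · subst h; simp
  · rw [Function.update_of_ne h, Function.update_of_ne h, block_act_of_ne h]

theorem repE_eq_zero {j : Fin (d * e) → ZMod e} {t : Fin d}
    (h : ¬ (block t j ∈ Ialpha e (mdelta e 1) ∧ block t j ∈ Iempty1 e)) : repE F k j = 0 := by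
  rw [repE_eq F t, eB_eq_zero F h, TensorProduct.tmul_zero, map_zero, zero_mul]

theorem block_ext {X : Type*} {i j : Fin (d * e) → X} (h : ∀ t, block t i = block t j) : i = j := by
  funext p
  obtain ⟨t, a, rfl⟩ := pos_surj p
  exact congrFun (h t) a

theorem block_concat {X : Type*} (i : Fin d → Fin e → X) (t : Fin d) : block t (concat i) = i t := by
  funext a
  simp [block, concat, pos]

theorem sum_repE : ∑ j : Fin (d * e) → ZMod e, repE F k j = 1 := by
  have h1 : ∑ r : Fin d → Fin e → ZMod e, PiTensorProduct.tprod F (fun t => eB F (r t)) =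
      (1 : TPow F (RbarDelta F e) d) := by
    rw [← MultilinearMap.map_sum (PiTensorProduct.tprod F) fun (_ : Fin d) (i : Fin e → ZMod e) => eB F i]
    simp only [sum_eB]
    rfl
  have : ∑ j : Fin (d * e) → ZMod e, repE F k j =
      ∑ r : Fin d → Fin e → ZMod e, Lam.mk F (1 : k) (PiTensorProduct.tprod F (fun t => eB F (r t))) := by
    refine Fintype.sum_bijective (fun j t => block t j) ⟨fun i j h => block_ext (congrFun h), fun r =>
      ⟨concat r, funext fun t => block_concat r t⟩⟩ _ _ fun j => rfl
  rw [this, ← map_sum, h1]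
  rfl

/-- The values of the `ψ` in a block, indexed by the first of the two positions. -/
def repP (p : Fin (d * e)) : Lam F k (RbarDelta F e) d :=
  if h : (idx p : ℕ) < e - 1 then emb F k (RbarDelta F e) (blk p) (pOne F (W.θ (blk p)) ⟨idx p, h⟩) else 0

theorem repP_lo (t : Fin d) (a : Fin (e - 1)) :
    repP F W (lo (posPsi t a)) = emb F k (RbarDelta F e) t (pOne F (W.θ t) a) := by
  rw [← pos_lo, repP]
  simp only [idx_pos, blk_pos]
  rw [dif_pos (by rw [lo_val]; exact a.isLt)]
  rfl

variable [Fact (1 < e)]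

/-- The representation with values in the tensor power. -/
def blockRep : BlockRep d e k (Lam F k (RbarDelta F e) d) where
  z := W.z
  N := W.N
  E := repE F k
  P := repP F W
  N_mul := W.N_mul
  N_symm := W.N_symm
  E_idem j := by
    rw [repE, Lam.mk_mul_mk, PiTensorProduct.tprod_mul_tprod, mul_one]
    congr 2
    funext t
    exact eB_mul_self F _
  E_orth i j h := by
    obtain ⟨t, ht⟩ : ∃ t, block t i ≠ block t j := by
      by_contra! hc
      exact h (block_ext hc)
    rw [repE, repE, Lam.mk_mul_mk, PiTensorProduct.tprod_mul_tprod,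
      (PiTensorProduct.tprod F).map_coord_zero t (eB_mul_of_ne F ht), map_zero]
  E_sum := sum_repE F
  E_zero j p p' hp hb hj := by
    refine repE_eq_zero F (t := blk p) fun h => hp ?_
    have := injective_of_mem_Ialpha h.1 (a₁ := idx p) (a₂ := idx p') (by
      rw [block, block, pos_blk_idx, hb, pos_blk_idx, hj])
    rw [← pos_blk_idx p, ← pos_blk_idx p', hb, this]
  P_E t a j := by
    rw [repP_lo, repE_eq F t, ← mul_assoc, ← map_mul, pOne_idem, map_mul, mul_assoc, emb_comm_rest,
      repE_eq F t (act _ j), block_act_self, repErest_act, mul_assoc]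
  P_sq t a j := by
    rw [repP_lo, repE_eq F t, ← mul_assoc, ← map_mul, ← mul_assoc, ← map_mul, mul_assoc (pOne F _ _), pOne_sq F (W.θ_sq t), map_mul,
      map_Lval, map_zero, mul_assoc, ← pos_lo, ← pos_hi]
    rfl
  P_comm t a t' a' h := by
    rw [repP_lo, repP_lo]
    by_cases ht : t = t'
    · subst ht
      rw [← map_mul, ← map_mul, pOne_comm]
      rw [posPsi_val, posPsi_val] at h
      omega
    · exact emb_comm F ht _ _
  P_braid t a b h := by
    rw [repP_lo, repP_lo, ← map_mul, ← map_mul, ← map_mul, ← map_mul, pOne_braid F h]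

end Rep

/-! ### Block permutations -/

section BlockPerm

variable {d e : ℕ}

variable (e) in
/-- The block permutation given by a permutation of the blocks. -/
def bperm (u : Equiv.Perm (Fin d)) : Equiv.Perm (Fin (d * e)) :=
  finProdFinEquiv.permCongr (Equiv.prodCongr u (Equiv.refl (Fin e)))

@[simp] theorem bperm_pos (u : Equiv.Perm (Fin d)) (t : Fin d) (a : Fin e) :
    bperm e u (pos t a) = pos (u t) a := by
  simp [bperm, pos]

theorem perm_ext_pos {w w' : Equiv.Perm (Fin (d * e))} (h : ∀ t a, w (pos t a) = w' (pos t a)) :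
    w = w' := by
  ext p
  obtain ⟨t, a, rfl⟩ := pos_surj p
  rw [h]

theorem bperm_mul (u v : Equiv.Perm (Fin d)) : bperm e (u * v) = bperm e u * bperm e v :=
  perm_ext_pos fun t a => by simp

theorem bperm_one : bperm e (1 : Equiv.Perm (Fin d)) = 1 := perm_ext_pos fun t a => by simp

theorem bperm_inv (u : Equiv.Perm (Fin d)) : (bperm e u)⁻¹ = bperm e u⁻¹ := by
  rw [inv_eq_iff_mul_eq_one, ← bperm_mul, mul_inv_cancel, bperm_one]

theorem bperm_inv_pos (u : Equiv.Perm (Fin d)) (t : Fin d) (a : Fin e) :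
    (bperm e u)⁻¹ (pos t a) = pos (u⁻¹ t) a := by
  rw [bperm_inv, bperm_pos]

theorem bperm_injective (he : 0 < e) : Function.Injective (bperm (d := d) e) := by
  intro u v h
  ext t
  have := congrArg (fun w => w (pos t ⟨0, he⟩)) h
  simp only [bperm_pos] at this
  rw [(pos_inj this).1]

theorem blk_bperm (u : Equiv.Perm (Fin d)) (p : Fin (d * e)) : blk (bperm e u p) = u (blk p) := by
  obtain ⟨t, a, rfl⟩ := pos_surj p
  rw [bperm_pos, blk_pos, blk_pos]

theorem bperm_mem (u : Equiv.Perm (Fin d)) : bperm e u ∈ minCosetReps d e := by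
  intro t a b h
  rw [bperm_pos, bperm_pos, pos_lt_pos_iff]
  exact Or.inr ⟨rfl, h⟩

theorem blockSwap_eq (r : Fin (d - 1)) : blockSwap e r = bperm e (simpleT r) := rfl

/-- A coset representative that takes a concatenation of elements of `I^{∅,1}` to a concatenation
of elements of `I^δ` permutes the blocks. -/
theorem exists_bperm (he : 0 < e) {w : Equiv.Perm (Fin (d * e))} (hw : w ∈ minCosetReps d e)
    {k : Fin (d * e) → ZMod e} (hk : k ∈ Idd e d) (hj : ∀ t, block t (k ∘ w) ∈ Iempty1 e) :
    ∃ u, w = bperm e u := by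
  let z : Fin e := ⟨0, he⟩
  have hz : ∀ s, k (w (pos s z)) = 0 := fun s => Iempty1.first (hj s) z rfl
  have hmin : ∀ s a, w (pos s z) ≤ w (pos s a) := fun s a => by
    rcases eq_or_ne a z with rfl | h
    · exact le_rfl
    · refine (hw s z a ?_).le
      rw [Fin.lt_def]
      exact Nat.pos_of_ne_zero fun h0 => h (Fin.ext h0)
  have huniq : ∀ (t : Fin d) (a b : Fin e), k (pos t a) = 0 → k (pos t b) = 0 → a = b :=
    fun t a b ha hb => injective_of_mem_Ialpha (hk t) (ha.trans hb.symm)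
  have claim : ∀ n : ℕ, ∀ t : Fin d, (t : ℕ) = n → ∃ s, ∀ a, w (pos s a) = pos t a := by
    intro n
    induction n using Nat.strong_induction_on with
    | _ n ih =>
      intro t htn
      have key : ∀ a : Fin e, ∃ s a' m, w (pos s a') = pos t a ∧ w (pos s z) = pos t m := by
        intro a
        obtain ⟨s, a', hsa⟩ := pos_surj (d := d) (e := e) (w⁻¹ (pos t a))
        have hsa' : w (pos s a') = pos t a := by rw [← hsa]; simp
        obtain ⟨t', m, hm⟩ := pos_surj (d := d) (e := e) (w (pos s z))
        have hle : t' ≤ t := pos_lt_pos (by rw [← hm, ← hsa']; exact hmin s a')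
        rcases hle.lt_or_eq with hlt | heq
        · obtain ⟨s', hs'⟩ := ih t' (by rw [← htn]; exact hlt) t' rfl
          have h1 := hs' m
          rw [← hm] at h1
          have h2 := (pos_inj (w.injective h1)).1
          subst h2
          have h3 := hs' a'
          rw [hsa'] at h3
          exact absurd (pos_inj h3).1.symm hlt.ne
        · subst heq
          exact ⟨s, a', m, hsa', hm⟩
      choose S f M h1 h2 using key
      have hM : ∀ a b, M a = M b := fun a b =>
        huniq t _ _ (by rw [← h2 a]; exact hz _) (by rw [← h2 b]; exact hz _)
      have hS : ∀ a, S a = S z := fun a => by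
        have : w (pos (S a) z) = w (pos (S z) z) := by rw [h2, h2, hM a z]
        exact (pos_inj (w.injective this)).1
      have h1' : ∀ a, w (pos (S z) (f a)) = pos t a := fun a => by rw [← h1 a, hS a]
      have hf : Function.Injective f := fun a b hab => by
        have := h1' a
        rw [hab, h1' b] at this
        exact (pos_inj this).2.symm
      have hfs := Finite.injective_iff_surjective.1 hf
      have : ∀ a', ∃ a, w (pos (S z) a') = pos t a := fun a' => by
        obtain ⟨a, rfl⟩ := hfs a'
        exact ⟨a, h1' a⟩
      choose g hg using this
      have hgm : StrictMono g := fun a b hab => by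
        have := hw (S z) a b hab
        rw [hg, hg, pos_lt_pos_iff] at this
        exact (this.resolve_left (lt_irrefl _)).2
      have hgr : Set.range g = Set.range (id : Fin e → Fin e) := by
        rw [Set.range_id]
        exact Set.eq_univ_of_forall fun a =>
          ⟨f a, ((pos_inj ((h1' a).symm.trans (hg (f a)))).2).symm⟩
      have hgid : g = id := (hgm.range_inj strictMono_id).1 hgr
      refine ⟨S z, fun a => ?_⟩
      rw [hg, hgid]
      rfl
  choose s hs using fun t : Fin d => claim t t rfl
  have hinj : Function.Injective s := fun t t' h => by
    have := hs t z
    rw [h, hs t' z] at this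
    exact (pos_inj this).1.symm
  let v : Equiv.Perm (Fin d) := Equiv.ofBijective s (Finite.injective_iff_bijective.1 hinj)
  refine ⟨v⁻¹, perm_ext_pos fun t a => ?_⟩
  have h1 : s (v⁻¹ t) = t := v.apply_symm_apply t
  rw [bperm_pos, ← hs (v⁻¹ t) a, h1]

theorem src_bperm (u : Equiv.Perm (Fin d)) (p : Fin (d * e)) :
    src p ⟨bperm e u, bperm_mem u⟩ = u⁻¹ (blk p) := by
  rw [src, bperm_inv, blk_bperm]

theorem block_comp_bperm {X : Type*} (u : Equiv.Perm (Fin d)) (t : Fin d) (k : Fin (d * e) → X) :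
    block t (k ∘ bperm e u) = block (u t) k := by
  funext a
  simp [block]

theorem mem_Idd_comp_bperm (u : Equiv.Perm (Fin d)) (k : Fin (d * e) → ZMod e) :
    k ∘ bperm e u ∈ Idd e d ↔ k ∈ Idd e d := by
  constructor
  · intro h t
    have := h (u⁻¹ t)
    rwa [block_comp_bperm, show u (u⁻¹ t) = t from u.apply_symm_apply t] at this
  · intro h t
    rw [block_comp_bperm]
    exact h _

theorem mem_Ialpha_of_Idd {k : Fin (d * e) → ZMod e} (h : k ∈ Idd e d) :
    k ∈ Ialpha (d * e) (mdelta e d) := by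
  intro c
  have e1 : {p : Fin (d * e) // k p = c} ≃ Σ t : Fin d, {a : Fin e // block t k a = c} :=
    { toFun := fun p => ⟨blk p.1, idx p.1, by rw [block, pos_blk_idx, p.2]⟩
      invFun := fun q => ⟨pos q.1 q.2.1, q.2.2⟩
      left_inv := fun p => by simp
      right_inv := fun q => by
        obtain ⟨t, a, ha⟩ := q
        simp only [Sigma.mk.injEq, blk_pos, true_and]
        have : ∀ (t' : Fin d) (a' : Fin e) (h1 : t' = t) (h2 : a' = a) (h3 : block t' k a' = c),
          HEq (⟨a', h3⟩ : {a : Fin e // block t' k a = c}) (⟨a, ha⟩ : {a : Fin e // block t k a = c}) := by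
          rintro _ _ rfl rfl _; rfl
        exact this _ _ (blk_pos _ _) (idx_pos _ _) _ }
  rw [Nat.card_congr e1, Nat.card_sigma]
  simp only [mdelta]
  rw [Finset.sum_congr rfl fun t _ => h t c]
  simp [mdelta]

theorem inv_blockSwap (r : Fin (d - 1)) : inv (blockSwap e r) =
    (Finset.univ : Finset (Fin e × Fin e)).image fun q => (pos (lo r) q.1, pos (hi r) q.2) := by
  ext ⟨p, q⟩
  obtain ⟨t, a, rfl⟩ := pos_surj p
  obtain ⟨t', a', rfl⟩ := pos_surj q
  rw [mem_inv, blockSwap_eq, bperm_pos, bperm_pos, pos_lt_pos_iff, pos_lt_pos_iff]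
  simp only [Finset.mem_image, Finset.mem_univ, true_and, Prod.exists, Prod.mk.injEq]
  constructor
  · rintro ⟨h1, h2⟩
    have h3 : t < t' := by
      rcases h1 with h1 | ⟨rfl, h1⟩
      · exact h1
      · rcases h2 with h2 | ⟨_, h2⟩
        · exact absurd h2 (lt_irrefl _)
        · exact absurd h1 h2.not_gt
    have h4 : simpleT r t' < simpleT r t := by
      rcases h2 with h2 | ⟨h2, _⟩
      · exact h2
      · exact absurd ((simpleT r).injective h2) h3.ne'
    rw [Fin.lt_def, simpleT_val, simpleT_val] at h4
    rw [Fin.lt_def] at h3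
    have h5 : t = lo r ∧ t' = hi r := by
      rw [Fin.ext_iff, Fin.ext_iff, lo_val, hi_val]
      split_ifs at h4 <;> omega
    exact ⟨a, a', by rw [h5.1], by rw [h5.2]⟩
  · rintro ⟨b, b', h1, h2⟩
    obtain ⟨rfl, rfl⟩ := pos_inj h1
    obtain ⟨rfl, rfl⟩ := pos_inj h2
    rw [simpleT_lo, simpleT_hi]
    exact ⟨Or.inl (lo_lt_hi r), Or.inl (lo_lt_hi r)⟩

theorem prod_inv_blockSwap {M : Type*} [CommMonoid M] (r : Fin (d - 1)) (g : Fin (d * e) → Fin (d * e) → M) :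
    ∏ p ∈ inv (blockSwap e r), g p.1 p.2 = ∏ a : Fin e, ∏ b : Fin e, g (pos (lo r) a) (pos (hi r) b) := by
  rw [inv_blockSwap, Finset.prod_image, ← Finset.univ_product_univ, Finset.prod_product]
  rintro ⟨a, b⟩ _ ⟨a', b'⟩ _ h
  simp only [Prod.mk.injEq] at h
  rw [(pos_inj h.1).2, (pos_inj h.2).2]

theorem blockSwap_inv (r : Fin (d - 1)) : (blockSwap e r)⁻¹ = blockSwap e r := by
  rw [blockSwap_eq, bperm_inv, simpleT_inv]

end BlockPerm

/-! ### Products of intertwiners -/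

namespace IntertwinerData

variable {e n : ℕ} [NeZero e] {Z A : Type*} [CommRing Z] [Ring A] (D : IntertwinerData e n Z A)

/-- The product of the `Φ` along a word. -/
def ΦW (l : List (Fin (n - 1))) : A := (l.map D.Φ).prod

theorem ΦW_cons (r : Fin (n - 1)) (l : List (Fin (n - 1))) : D.ΦW (r :: l) = D.Φ r * D.ΦW l := by
  simp [ΦW]

theorem E_ΦW (l : List (Fin (n - 1))) {i : Fin n → ZMod e} {x : A} (hx : x = D.E i * x) :
    D.ΦW l * x = D.E (act (wprod l) i) * (D.ΦW l * x) := by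
  induction l with
  | nil => simpa [ΦW, wprod_nil, act_one] using hx
  | cons r l ih => rw [ΦW_cons, mul_assoc, wprod_cons, ← act_act]; exact D.E_Φ ih

theorem c_q_ΦW (l : List (Fin (n - 1))) (a b : ZMod e) (p p' : Fin n) :
    D.c (D.q a b p p') * D.ΦW l = D.ΦW l * D.c (D.q a b ((wprod l)⁻¹ p) ((wprod l)⁻¹ p')) := by
  induction l generalizing p p' with
  | nil => simp [ΦW, wprod_nil]
  | cons r l ih =>
    rw [ΦW_cons, ← mul_assoc, D.c_Φ, D.s_q, mul_assoc, ih, ← mul_assoc, wprod_cons, mul_inv_rev, simpleT_inv]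
    rfl

variable (F : Type*) [Field F] [Algebra F A] [Fact (1 < e)]

theorem hom_phi (hq : ∀ a p p', D.q a a p p' = 1) (r : Fin (n - 1)) {i : Fin n → ZMod e} {x : A}
    (hx : x = D.E i * x) : D.hom F (phi F r) * x =
      D.Φ r * (D.c (D.q (i (lo r)) (i (hi r)) (lo r) (hi r)) * x) := by
  rw [hx, ← mul_assoc]
  by_cases h : i (lo r) = i (hi r)
  · rw [D.hom_phi_eq F h, h, hq, map_one, one_mul, mul_assoc]
  · rw [D.hom_phi_ne F h]
    simp only [mul_assoc]

theorem hom_phiW (hq : ∀ a p p', D.q a a p p' = 1) {l : List (Fin (n - 1))} {w : Equiv.Perm (Fin n)}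
    (h : Red l w) (i : Fin n → ZMod e) : D.hom F ((l.map (phi F)).prod) * D.E i =
      D.ΦW l * (D.c (∏ p ∈ inv w, D.q (i p.1) (i p.2) p.1 p.2) * D.E i) := by
  induction h with
  | nil => simp [ΦW, inv_one]
  | @cons r l v hl hr ih =>
    rw [List.map_cons, List.prod_cons, map_mul, mul_assoc, ih,
      Red.prod_inv (fun p p' => D.q (i p) (i p') p p') hr,
      D.hom_phi F hq r (D.E_ΦW l (D.E_c (D.E_E i) _)), ← mul_assoc (D.c _) (D.ΦW l), c_q_ΦW, ΦW_cons,
      hl.wprod_eq, map_mul]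
    simp only [mul_assoc]
    rfl

end IntertwinerData

namespace BlockRep

variable {d e : ℕ} [NeZero e] {k Λ : Type*} [CommRing k] [Ring Λ] [Algebra k Λ] (B : BlockRep d e k Λ)
  (F : Type*) [Field F] [Algebra F k] [Algebra F Λ] [IsScalarTower F k Λ]

theorem data_E (i : Fin (d * e) → ZMod e) (f : minCosetReps d e → Λ) (x : minCosetReps d e) :
    (B.data F).E i f x = B.E (i ∘ x.1) * f x := rfl

theorem data_c (z : minCosetReps d e → k) (f : minCosetReps d e → Λ) (x : minCosetReps d e) :
    (B.data F).c z f x = algebraMap k Λ (z x) * f x := rfl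

theorem data_Φ (r : Fin (d * e - 1)) (f : minCosetReps d e → Λ) (x : minCosetReps d e) :
    (B.data F).Φ r f x = B.π r x * f (tr r x) := rfl

theorem sum_data_E (f : minCosetReps d e → Λ) (x : minCosetReps d e) :
    ∑ i, B.E (i ∘ x.1) * f x = f x := by
  rw [← Finset.sum_mul]
  have := B.E_sum
  rw [← Equiv.sum_comp (Equiv.arrowCongr x.1⁻¹ (Equiv.refl (ZMod e)))] at this
  rw [show (∑ i : Fin (d * e) → ZMod e, B.E (i ∘ x.1)) = 1 from this, one_mul]

theorem data_psi {r : Fin (d * e - 1)} {x : minCosetReps d e} (h : src (lo r) x = src (hi r) x)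
    (f : minCosetReps d e → Λ) : (B.data F).psi r f x = B.P (x.1⁻¹ (lo r)) * f x := by
  conv_rhs => rw [← B.sum_data_E f x, Finset.mul_sum]
  rw [IntertwinerData.psi, LinearMap.sum_apply, Finset.sum_apply]
  refine Finset.sum_congr rfl fun i _ => ?_
  by_cases hi : i (lo r) = i (hi r)
  · rw [if_pos hi, B.E_eq_zero (lo_ne_hi r) h hi, zero_mul, mul_zero]
    simp only [Module.End.mul_apply, LinearMap.sub_apply, Pi.sub_apply, Module.End.one_apply, data_Φ,
      tr_eq h, data_c, data_E, B.E_eq_zero (lo_ne_hi r) h hi, zero_mul, mul_zero, sub_zero]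
  · rw [if_neg hi]
    simp only [Module.End.mul_apply, data_Φ, tr_eq h, data_c, data_E, B.π_eq h]
    congr 1
    have : (B.data F).q (i (lo r)) (i (KLRTheta.hi r)) (lo r) (KLRTheta.hi r) x = 1 := if_pos h
    rw [this, map_one, one_mul]

theorem data_ΦW {l : List (Fin (d * e - 1))} {w : Equiv.Perm (Fin (d * e))} (hl : Red l w) :
    ∀ x : minCosetReps d e, (∀ p q, p < q → w⁻¹ q < w⁻¹ p → src p x ≠ src q x) →
      ∃ y : minCosetReps d e, y.1 = w⁻¹ * x.1 ∧ ∀ f, (B.data F).ΦW l f x = f y := by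
  induction hl with
  | nil => exact fun x _ => ⟨x, by simp, fun f => by simp [IntertwinerData.ΦW]⟩
  | @cons r l v hl hr ih =>
    intro x hx
    have hne : src (lo r) x ≠ src (hi r) x := hx _ _ (lo_lt_hi r) (by
      rw [inv_simpleT_mul_apply, inv_simpleT_mul_apply, simpleT_lo, simpleT_hi]; exact hr)
    obtain ⟨y, hy, hf⟩ := ih (tr r x) (by
      intro p q hpq hv
      rw [src_tr, src_tr]
      apply hx
      · have : ¬ ((p : ℕ) = r ∧ (q : ℕ) = r + 1) := by
          rintro ⟨h1, h2⟩
          rw [show p = lo r from Fin.ext h1, show q = hi r from Fin.ext h2] at hv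
          exact absurd hv hr.not_gt
        rw [Fin.lt_def, simpleT_val, simpleT_val]
        rw [Fin.lt_def] at hpq
        split_ifs <;> omega
      · rw [inv_simpleT_mul_apply, inv_simpleT_mul_apply]
        have hs : ∀ p, simpleT r (simpleT r p) = p := fun p => by
          rw [← Equiv.Perm.mul_apply, simpleT_mul_self, Equiv.Perm.one_apply]
        rwa [hs, hs])
    refine ⟨y, ?_, fun f => ?_⟩
    · rw [hy, tr_val hne, mul_inv_rev, simpleT_inv, mul_assoc]
    · rw [IntertwinerData.ΦW_cons, Module.End.mul_apply, data_Φ, B.π_ne hne, one_mul, hf]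

theorem data_q_self [Fact (1 < e)] (a : ZMod e) (p p' : Fin (d * e)) : (B.data F).q a a p p' = 1 := by
  funext x
  change (if src p x = src p' x then 1 else Qval a a _ _) = _
  split_ifs
  · rfl
  · rw [Qval, if_neg (by simp)]; rfl

end BlockRep

/-! ### The representation of the truncated algebra -/

section Psi

variable (F : Type*) [Field F] {d e : ℕ} [NeZero e] {k : Type*} [CommRing k] [Algebra F k]
  (W : TwistData d k) [Fact (1 < e)]

/-- The representation of the KLR algebra on functions on the coset representatives. -/
abbrev repKLR : KLR F e (d * e) →ₐ[F]
    Module.End F (minCosetReps d e → Lam F k (RbarDelta F e) d) :=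
  ((blockRep F W).data F).hom F

theorem repKLR_idem (i : Fin (d * e) → ZMod e) (f : minCosetReps d e → Lam F k (RbarDelta F e) d)
    (x : minCosetReps d e) : repKLR F W (KLR.idem F i) f x = repE F k (i ∘ x.1) * f x := by
  rw [repKLR, IntertwinerData.hom_idem]; rfl

theorem repKLR_esum (S : Set (Fin (d * e) → ZMod e)) (f : minCosetReps d e → Lam F k (RbarDelta F e) d)
    (x : minCosetReps d e) : repKLR F W (KLR.esum F S) f x =
      open Classical in ∑ i, if i ∈ S then repE F k (i ∘ x.1) * f x else 0 := by
  rw [KLR.esum, map_sum, LinearMap.sum_apply, Finset.sum_apply, Finset.sum_filter]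
  refine Finset.sum_congr rfl fun i _ => ?_
  split_ifs
  · exact repKLR_idem F W i f x
  · rfl

theorem repKLR_esum_eq_self {S : Set (Fin (d * e) → ZMod e)} {x : minCosetReps d e}
    (h : ∀ i, i ∘ x.1 ∈ Idd e d → i ∈ S) (f : minCosetReps d e → Lam F k (RbarDelta F e) d) :
    repKLR F W (KLR.esum F S) f x = f x := by
  conv_rhs => rw [← (blockRep F W).sum_data_E f x]
  rw [repKLR_esum]
  refine Finset.sum_congr rfl fun i _ => ?_
  split_ifs with hi
  · rfl
  · have : ∃ t, ¬ (block t (i ∘ x.1) ∈ Ialpha e (mdelta e 1)) := by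
      by_contra! hc
      exact hi (h i hc)
    obtain ⟨t, ht⟩ := this
    change 0 = repE F k (i ∘ x.1) * f x
    rw [repE_eq_zero F (t := t) (fun h => ht h.1), zero_mul]

theorem repKLR_idem_eq_zero {i : Fin (d * e) → ZMod e} (hi : i ∉ shuffles e d) :
    repKLR F W (KLR.idem F i) = 0 := by
  refine LinearMap.ext fun f => funext fun x => ?_
  rw [repKLR_idem]
  have : ∃ t, ¬ (block t (i ∘ x.1) ∈ Iempty1 e) := by
    by_contra! hc
    refine hi ⟨x.1, x.2, fun t => block t (i ∘ x.1), hc, ?_⟩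
    funext p
    change i p = i (x.1 (pos (blk (x.1⁻¹ p)) (idx (x.1⁻¹ p))))
    rw [pos_blk_idx]
    exact congrArg i (x.1.apply_symm_apply p).symm
  obtain ⟨t, ht⟩ := this
  rw [repE_eq_zero F (t := t) (fun h => ht h.2), zero_mul]
  rfl

theorem repKLR_esum_Ialpha : repKLR F W (KLR.esum F (Ialpha (d * e) (mdelta e d))) = 1 := by
  refine LinearMap.ext fun f => funext fun x => repKLR_esum_eq_self F W (fun i hi => ?_) f
  have := mem_Ialpha_of_Idd hi
  rw [act_mem_Ialpha x.1] at this
  convert this using 1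
  funext p
  simp [act]

/-- The representation of `Rbar` on functions on the coset representatives. -/
def repBar : Rbar F e d →ₐ[F] Module.End F (minCosetReps d e → Lam F k (RbarDelta F e) d) :=
  KLRbar.lift (B := Module.End F (minCosetReps d e → Lam F k (RbarDelta F e) d)) (mdelta e d)
    (shuffles e d) (repKLR F W) (repKLR_esum_Ialpha F W)
    fun _ _ h => repKLR_idem_eq_zero F W h

theorem repBar_proj (x : KLR F e (d * e)) : repBar F W (Rbar.proj F e d x) = repKLR F W x :=
  KLRbar.lift_proj _ _ _ _ _ x

/-- The coset representative that belongs to a block permutation. -/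
def bX (e : ℕ) {d : ℕ} (u : Equiv.Perm (Fin d)) : minCosetReps d e := ⟨bperm e u, bperm_mem u⟩

/-- The restriction of functions to block permutations. -/
def resB (F : Type*) [Field F] (e : ℕ) {d : ℕ} (V : Type*) [AddCommGroup V] [Module F V] :
    (minCosetReps d e → V) →ₗ[F] (Equiv.Perm (Fin d) → V) :=
  LinearMap.funLeft F V (bX e)

open Classical in
/-- The extension by zero of functions on block permutations. -/
def extB (F : Type*) [Field F] (e : ℕ) {d : ℕ} (V : Type*) [AddCommGroup V] [Module F V] :
    (Equiv.Perm (Fin d) → V) →ₗ[F] (minCosetReps d e → V) where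
  toFun f x := if h : ∃ u, x = bX e u then f h.choose else 0
  map_add' f g := by
    funext x
    simp only [Pi.add_apply]
    split_ifs <;> simp
  map_smul' c f := by
    funext x
    simp only [Pi.smul_apply]
    split_ifs <;> simp

theorem bX_injective : Function.Injective (bX (d := d) e) := fun _ _ h =>
  bperm_injective (NeZero.pos e) (congrArg Subtype.val h)

theorem extB_bX {V : Type*} [AddCommGroup V] [Module F V] (f : Equiv.Perm (Fin d) → V)
    (u : Equiv.Perm (Fin d)) : extB F e V f (bX e u) = f u := by
  have h : ∃ v, bX e u = bX e v := ⟨u, rfl⟩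
  change (if h : ∃ v, bX e u = bX e v then f h.choose else 0) = f u
  rw [dif_pos h, ← bX_injective h.choose_spec]

theorem repKLR_esum_Idd (f : minCosetReps d e → Lam F k (RbarDelta F e) d) :
    repKLR F W (KLR.esum F (Idd e d)) f = extB F e _ (resB F e _ f) := by
  funext x
  by_cases h : ∃ u, x = bX e u
  · obtain ⟨u, rfl⟩ := h
    have h1 : ∀ i, i ∘ (bX e u).1 ∈ Idd e d → i ∈ Idd e d := fun i hi => by
      rw [bX] at hi
      exact (mem_Idd_comp_bperm u i).1 hi
    rw [extB_bX, repKLR_esum_eq_self F W h1]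
    rfl
  · rw [repKLR_esum]
    change _ = (if h : ∃ v, x = bX e v then _ else 0)
    rw [dif_neg h]
    refine Finset.sum_eq_zero fun i _ => ?_
    split_ifs with hi
    · have : ∃ t, ¬ (block t (i ∘ x.1) ∈ Iempty1 e) := by
        by_contra! hc
        obtain ⟨u, hu⟩ := exists_bperm (NeZero.pos e) x.2 hi hc
        exact h ⟨u, Subtype.ext hu⟩
      obtain ⟨t, ht⟩ := this
      rw [repE_eq_zero F (t := t) (fun h => ht h.2), zero_mul]
    · rfl

theorem TruncR.val_mul (x y : TruncR F e d) :
    TruncR.val F e d (x * y) = TruncR.val F e d x * TruncR.val F e d y := rfl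

theorem TruncR.val_one : TruncR.val F e d 1 = edd F e d := rfl

theorem TruncR.val_mul_edd (x : TruncR F e d) : TruncR.val F e d x * edd F e d = TruncR.val F e d x :=
  ((Subsemigroup.mem_corner_iff (isIdempotentElem_edd F e d)).1 x.2).2

theorem TruncR.val_proj (x : KLR F e (d * e)) :
    TruncR.val F e d (TruncR.proj F e d x) = edd F e d * Rbar.proj F e d x * edd F e d := rfl

theorem repBar_edd (f : minCosetReps d e → Lam F k (RbarDelta F e) d) :
    repBar F W (edd F e d) f = extB F e _ (resB F e _ f) := by
  rw [edd, repBar_proj, repKLR_esum_Idd]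

theorem resB_extB {V : Type*} [AddCommGroup V] [Module F V] (f : Equiv.Perm (Fin d) → V) :
    resB F e V (extB F e V f) = f := funext fun u => extB_bX F f u

/-- The representation of `e_{δ^d} Rbar e_{δ^d}` on functions on permutations. -/
def Psi : TruncR F e d →ₐ[F]
    Module.End F (Equiv.Perm (Fin d) → Lam F k (RbarDelta F e) d) :=
  AlgHom.ofLinearMap
    { toFun := fun v => resB F e _ ∘ₗ repBar F W (TruncR.val F e d v) ∘ₗ extB F e _
      map_add' := fun v w => by simp only [map_add, LinearMap.add_comp, LinearMap.comp_add]
      map_smul' := fun c v => by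
        simp only [map_smul, LinearMap.smul_comp, LinearMap.comp_smul, RingHom.id_apply] }
    (by
      refine LinearMap.ext fun f => ?_
      change resB F e _ (repBar F W (edd F e d) (extB F e _ f)) = f
      rw [repBar_edd, resB_extB, resB_extB])
    (fun v w => by
      refine LinearMap.ext fun f => ?_
      change resB F e _ (repBar F W (TruncR.val F e d (v * w)) (extB F e _ f)) =
        resB F e _ (repBar F W (TruncR.val F e d v)
          (extB F e _ (resB F e _ (repBar F W (TruncR.val F e d w) (extB F e _ f)))))
      rw [← repBar_edd, ← Module.End.mul_apply, ← map_mul, TruncR.val_mul_edd, TruncR.val_mul, map_mul]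
      rfl)

theorem Psi_proj (x : KLR F e (d * e)) (f : Equiv.Perm (Fin d) → Lam F k (RbarDelta F e) d)
    (u : Equiv.Perm (Fin d)) :
    Psi F W (TruncR.proj F e d x) f u = repKLR F W x (extB F e _ f) (bX e u) := by
  change resB F e _ (repBar F W (edd F e d * Rbar.proj F e d x * edd F e d) (extB F e _ f)) u = _
  rw [map_mul, map_mul, Module.End.mul_apply, Module.End.mul_apply, repBar_edd, repBar_edd, resB_extB,
    resB_extB, repBar_proj]
  rfl

theorem Psi_y (p : Fin (d * e)) (f : Equiv.Perm (Fin d) → Lam F k (RbarDelta F e) d)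
    (u : Equiv.Perm (Fin d)) :
    Psi F W (TruncR.proj F e d (KLR.y F p)) f u = algebraMap k _ (W.z (u⁻¹ (blk p))) * f u := by
  rw [Psi_proj, repKLR, IntertwinerData.hom_y, BlockRep.data_c, extB_bX]
  change algebraMap k _ (W.z (src p (bX e u))) * _ = _
  rw [bX, src_bperm]

theorem repKLR_idem_block (t : Fin d) (i : Fin e → ZMod e) (u : Equiv.Perm (Fin d))
    (f : minCosetReps d e → Lam F k (RbarDelta F e) d) :
    repKLR F W (blockHom F t (KLR.idem F i)) f (bX e u) =
      emb F k (RbarDelta F e) (u⁻¹ t) (1 ⊗ₜ eB F i) * f (bX e u) := by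
  rw [blockHom, KLR.lift_idem, repKLR_esum]
  conv_rhs => rw [← (blockRep F W).sum_data_E f (bX e u), Finset.mul_sum]
  refine Finset.sum_congr rfl fun j _ => ?_
  change _ = emb F k (RbarDelta F e) (u⁻¹ t) (1 ⊗ₜ eB F i) * (repE F k (j ∘ bperm e u) * f (bX e u))
  have hb : block (u⁻¹ t) (j ∘ bperm e u) = block t j := by
    rw [block_comp_bperm, show u (u⁻¹ t) = t from u.apply_symm_apply t]
  rw [repE_eq F (u⁻¹ t) (j ∘ bperm e u), hb, ← mul_assoc, ← mul_assoc, ← map_mul,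
    Algebra.TensorProduct.tmul_mul_tmul, one_mul]
  split_ifs with h
  · rw [show block t j = i from h, eB_mul_self]
    change repE F k (j ∘ bperm e u) * _ = _
    rw [repE_eq F (u⁻¹ t) (j ∘ bperm e u), hb, show block t j = i from h]
  · rw [eB_mul_of_ne F (fun hc => h hc.symm), TensorProduct.tmul_zero, map_zero, zero_mul, zero_mul]

theorem tpow_add {θ : k} (hθ : θ * θ = 0) {a b : ℤ} (ha : 0 ≤ a) (hb : 0 ≤ b) :
    tpow θ a * tpow θ b = tpow θ (a + b) := by
  unfold tpow
  rcases eq_or_lt_of_le ha with rfl | ha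
  · simp
  rcases eq_or_lt_of_le hb with rfl | hb
  · simp
  rw [if_neg ha.ne', if_neg hb.ne', if_neg (by omega : ¬ a + b = 0), if_neg (by omega : ¬ a + b = 1)]
  split_ifs <;> simp [hθ]

theorem repKLR_monomial (t : Fin d) (u : Equiv.Perm (Fin d)) {m : ℤ} {x : KLR F e e}
    (hx : IsMonomial F m x) : (m < 0 → RbarDelta.proj F e x = 0) ∧ (m ≤ 1 →
      ∀ f : minCosetReps d e → Lam F k (RbarDelta F e) d,
      repKLR F W (blockHom F t x) f (bX e u) =
      emb F k (RbarDelta F e) (u⁻¹ t) (tpow (W.θ (u⁻¹ t)) m ⊗ₜ RbarDelta.proj F e x) * f (bX e u)) := by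
  induction hx with
  | one =>
    refine ⟨fun h => absurd h (lt_irrefl _), fun _ f => ?_⟩
    rw [map_one, map_one, map_one, tpow, if_pos rfl]
    exact (show emb F k (RbarDelta F e) (u⁻¹ t) (1 ⊗ₜ 1) * f (bX e u) = f (bX e u) by
      rw [← Algebra.TensorProduct.one_def, map_one, one_mul]).symm
  | @idem_mul m x i _ ih =>
    refine ⟨fun h => by rw [map_mul, ih.1 h, mul_zero], fun h f => ?_⟩
    rw [map_mul, map_mul, Module.End.mul_apply, repKLR_idem_block, ih.2 h, ← mul_assoc, ← map_mul,
      Algebra.TensorProduct.tmul_mul_tmul, one_mul, map_mul]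
  | @y_mul m x r _ ih =>
    refine ⟨fun h => by rw [map_mul, ih.1 (by omega), mul_zero], fun h f => ?_⟩
    rw [map_mul, map_mul, map_mul, Module.End.mul_apply, ih.1 (by omega), mul_zero, TensorProduct.tmul_zero,
      map_zero, zero_mul, blockHom, KLR.lift_y, repKLR, IntertwinerData.hom_y, BlockRep.data_c]
    have := ih.2 (by omega) f
    rw [ih.1 (by omega), TensorProduct.tmul_zero, map_zero, zero_mul] at this
    exact (congrArg _ this).trans (mul_zero _)
  | @psi_mul m x r i _ ih =>
    have hs : src (lo (posPsi t r)) (bX e u) = src (hi (posPsi t r)) (bX e u) := by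
      rw [bX, src_bperm, src_bperm, ← pos_lo, ← pos_hi, blk_pos, blk_pos]
    have hpsi : ∀ f : minCosetReps d e → Lam F k (RbarDelta F e) d,
        repKLR F W (blockHom F t (KLR.psi F r)) f (bX e u) =
        emb F k (RbarDelta F e) (u⁻¹ t) (pOne F (W.θ (u⁻¹ t)) r) * f (bX e u) := by
      intro f
      rw [blockHom, KLR.lift_psi, repKLR, IntertwinerData.hom_psi, BlockRep.data_psi _ _ hs]
      have : (bX e u).1⁻¹ (lo (posPsi t r)) = lo (posPsi (u⁻¹ t) r) := by
        rw [← pos_lo, ← pos_lo]; exact bperm_inv_pos _ _ _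
      rw [this]
      exact congrArg (· * f (bX e u)) (repP_lo F W (u⁻¹ t) r)
    by_cases hi : i ∈ Ialpha e (mdelta e 1) ∧ i ∈ Iempty1 e
    · have hne : i (lo r) ≠ i (KLRTheta.hi r) := fun h => lo_ne_hi r (injective_of_mem_Ialpha hi.1 h)
      have hc : 0 ≤ -cartan (i (lo r)) (i (KLRTheta.hi r)) := by
        rcases cartan_neg_cases hne with ⟨h, _⟩ | ⟨h, _⟩ | ⟨h, _⟩ <;> rw [h] <;> norm_num
      refine ⟨fun h => by rw [map_mul, ih.1 (by omega), mul_zero], fun h f => ?_⟩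
      rw [map_mul, map_mul, map_mul, map_mul, Module.End.mul_apply, Module.End.mul_apply, hpsi,
        repKLR_idem_block, ih.2 (by omega), map_mul, map_mul, ← mul_assoc, ← mul_assoc, ← map_mul,
        pOne_mul F _ r i 1 _ (eB_mul_self F i).symm, ← map_mul, Algebra.TensorProduct.tmul_mul_tmul, mul_one]
      rcases lt_or_ge m 0 with hm | hm
      · rw [ih.1 hm]; simp
      · rw [tpow_add (W.θ_sq _) hc hm]
    · have h0 : RbarDelta.proj F e (KLR.psi F r * KLR.idem F i * x) = 0 := by
        rw [map_mul, map_mul]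
        change _ * eB F i * _ = _
        rw [eB_eq_zero F hi, mul_zero, zero_mul]
      refine ⟨fun _ => h0, fun _ f => ?_⟩
      rw [h0, map_mul, map_mul, map_mul, map_mul, Module.End.mul_apply, Module.End.mul_apply, hpsi,
        repKLR_idem_block, eB_eq_zero F hi]
      simp

theorem iotaAt_proj (t : Fin d) (x : KLR F e e) :
    iotaAt F t (RbarDelta.proj F e x) = TruncR.proj F e d (blockHom F t x) :=
  KLRbar.lift_proj _ _ _ _ _ x

theorem Psi_iotaAt (t : Fin d) {m : ℤ} (hm : m ≤ 1) {a : RbarDelta F e} (ha : a ∈ RbarDelta.deg F e m)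
    (f : Equiv.Perm (Fin d) → Lam F k (RbarDelta F e) d) (u : Equiv.Perm (Fin d)) :
    Psi F W (iotaAt F t a) f u =
      emb F k (RbarDelta F e) (u⁻¹ t) (tpow (W.θ (u⁻¹ t)) m ⊗ₜ a) * f u := by
  obtain ⟨x, hx, rfl⟩ := ha
  change Psi F W (iotaAt F t (RbarDelta.proj F e x)) f u =
      emb F k (RbarDelta F e) (u⁻¹ t) (tpow (W.θ (u⁻¹ t)) m ⊗ₜ RbarDelta.proj F e x) * f u
  induction hx using Submodule.span_induction with
  | mem x hx => rw [iotaAt_proj, Psi_proj, (repKLR_monomial F W t u hx).2 hm, extB_bX]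
  | zero => simp
  | add x y _ _ hx hy =>
    rw [map_add, map_add, map_add, LinearMap.add_apply, Pi.add_apply, hx, hy, TensorProduct.tmul_add,
      map_add, add_mul]
  | smul c x _ hx =>
    rw [map_smul, map_smul, map_smul, LinearMap.smul_apply, Pi.smul_apply, hx, TensorProduct.tmul_smul,
      ← smul_mul_assoc]
    congr 1

theorem Psi_iotaAt_y_sub (t : Fin d) (a b : Fin e) :
    Psi F W (iotaAt F t (RbarDelta.proj F e (KLR.y F a - KLR.y F b))) = 0 := by
  refine LinearMap.ext fun f => funext fun u => ?_
  rw [iotaAt_proj, map_sub, map_sub, map_sub, LinearMap.sub_apply, Pi.sub_apply, blockHom, KLR.lift_y,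
    KLR.lift_y, Psi_y, Psi_y, blk_pos, blk_pos, sub_self]
  rfl

theorem Psi_zElt (t : Fin d) (f : Equiv.Perm (Fin d) → Lam F k (RbarDelta F e) d)
    (u : Equiv.Perm (Fin d)) : Psi F W (zElt F t : TruncR F e d) f u = algebraMap k _ (W.z (u⁻¹ t)) * f u := by
  rw [zElt, Psi_y, blk_pos]

theorem prod_Qval {k' : Type*} [CommRing k'] {i j : Fin e → ZMod e} (hj : j ∈ Ialpha e (mdelta e 1)) (a b : k') :
    ∏ p : Fin e, ∏ q : Fin e, Qval (i p) (j q) a b = (b - a) ^ e := by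
  have : ∀ p : Fin e, ∏ q : Fin e, Qval (i p) (j q) a b = b - a := by
    intro p
    have hb : Function.Bijective j := by
      rw [Fintype.bijective_iff_injective_and_card]
      exact ⟨injective_of_mem_Ialpha hj, by rw [Fintype.card_fin, ZMod.card]⟩
    obtain ⟨q, hq⟩ := hb.2 (i p + 1)
    rw [Finset.prod_eq_single q]
    · rw [Qval, if_pos hq]
    · intro q' _ hne
      rw [Qval, if_neg]
      intro h
      exact hne (hb.1 (h.trans hq.symm))
    · simp
  simp [this]

theorem Psi_phiBlock {ω : Equiv.Perm (Fin (d * e)) → List (Fin (d * e - 1))} (hω : ∀ w, Red (ω w) w)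
    (r : Fin (d - 1)) (f : Equiv.Perm (Fin d) → Lam F k (RbarDelta F e) d)
    (u : Equiv.Perm (Fin d)) : Psi F W (phiBlock F ω r) f u =
      algebraMap k _ ((W.z (u⁻¹ (lo r)) - W.z (u⁻¹ (hi r))) ^ e) * f (simpleT r * u) := by
  rw [phiBlock, Psi_proj]
  set D := (blockRep (e := e) F W).data F
  set g := extB F e _ f
  have h1 : g = ∑ i, D.E i g := by
    conv_lhs => rw [← Module.End.one_apply (R := F) g, ← D.E_sum, LinearMap.sum_apply]
  obtain ⟨y, hy, hyf⟩ := (blockRep F W).data_ΦW F (hω (blockSwap e r)) (bX e u) (by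
    intro p q hpq h
    rw [blockSwap_inv] at h
    have := mem_inv.2 ⟨hpq, h⟩
    rw [inv_blockSwap] at this
    simp only [Finset.mem_image, Finset.mem_univ, true_and, Prod.exists, Prod.mk.injEq] at this
    obtain ⟨a, b, rfl, rfl⟩ := this
    rw [bX, src_bperm, src_bperm, blk_pos, blk_pos]
    exact fun hc => lo_ne_hi r (u⁻¹.injective hc))
  have hy' : y = bX e (simpleT r * u) := Subtype.ext (by
    rw [hy, blockSwap_inv, blockSwap_eq]
    exact (bperm_mul _ _).symm)
  have h2 : ∀ i, repKLR F W (((ω (blockSwap e r)).map (phi F)).prod) (D.E i g) (bX e u) =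
      algebraMap k _ ((W.z (u⁻¹ (lo r)) - W.z (u⁻¹ (hi r))) ^ e) * (repE F k (i ∘ y.1) * f (simpleT r * u)) := by
    intro i
    have := LinearMap.congr_fun (D.hom_phiW F ((blockRep F W).data_q_self F) (hω (blockSwap e r)) i) g
    rw [Module.End.mul_apply, Module.End.mul_apply] at this
    rw [repKLR, this, hyf, Module.End.mul_apply, BlockRep.data_c]
    change _ * (repE F k (i ∘ y.1) * g y) = _
    have hg : g y = f (simpleT r * u) := by rw [hy']; exact extB_bX F f _
    rw [hg]
    by_cases hi : i ∈ Idd e d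
    · congr 2
      rw [prod_inv_blockSwap r fun p q => D.q (i p) (i q) p q, Finset.prod_apply]
      simp only [Finset.prod_apply]
      have hq : ∀ p q, D.q (i (pos (lo r) p)) (i (pos (KLRTheta.hi r) q)) (pos (lo r) p)
          (pos (KLRTheta.hi r) q) y = Qval (block (lo r) i p) (block (KLRTheta.hi r) i q)
            (W.z (u⁻¹ (KLRTheta.hi r))) (W.z (u⁻¹ (lo r))) := by
        intro p q
        have s1 : src (pos (lo r) p) y = u⁻¹ (KLRTheta.hi r) := by
          rw [hy', bX, src_bperm, blk_pos, mul_inv_rev, simpleT_inv, Equiv.Perm.mul_apply, simpleT_lo]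
        have s2 : src (pos (KLRTheta.hi r) q) y = u⁻¹ (lo r) := by
          rw [hy', bX, src_bperm, blk_pos, mul_inv_rev, simpleT_inv, Equiv.Perm.mul_apply, simpleT_hi]
        change (if src (pos (lo r) p) y = src (pos (KLRTheta.hi r) q) y then 1 else
          Qval _ _ (W.z (src (pos (lo r) p) y)) (W.z (src (pos (KLRTheta.hi r) q) y))) = _
        rw [s1, s2, if_neg]
        · rfl
        · exact fun hc => lo_ne_hi r (u⁻¹.injective hc).symm
      simp only [hq]
      exact prod_Qval (hi _) _ _
    · have : repE F k (i ∘ y.1) = 0 := by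
        have h3 : ¬ i ∘ y.1 ∈ Idd e d := by
          rw [hy']; exact fun h => hi ((mem_Idd_comp_bperm _ i).1 h)
        obtain ⟨t, ht⟩ : ∃ t, ¬ (block t (i ∘ y.1) ∈ Ialpha e (mdelta e 1)) := by
          by_contra! hc
          exact h3 hc
        exact repE_eq_zero F (t := t) fun h => ht h.1
      rw [this, zero_mul, mul_zero, mul_zero]
  rw [h1, map_sum, Finset.sum_apply, Finset.sum_congr rfl fun i _ => h2 i, ← Finset.mul_sum]
  congr 1
  exact (blockRep F W).sum_data_E (fun _ => f (simpleT r * u)) y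

end Psi

/-! ### Residue sequences of hooks -/

section Hooks

theorem hook_of_hasCoreWeight {e : ℕ} {lam : YoungDiagram} (h : HasCoreWeight e lam ⊥ 1) :
    lam.cells.card = e ∧ ∀ x ∈ lam, x.1 = 0 ∨ x.2 = 0 := by
  obtain ⟨h, -⟩ := h
  cases h with
  | step h1 h2 =>
    cases h2 with
    | refl =>
      obtain ⟨-, hc, hs, -⟩ := h1
      have hd : lam.cells \ (⊥ : YoungDiagram).cells = lam.cells := by simp
      rw [hd] at hc hs
      refine ⟨hc, ?_⟩
      rintro ⟨p, q⟩ hx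
      by_contra hne
      simp only [not_or] at hne
      refine hs 0 0 ⟨?_, ?_, ?_, ?_⟩ <;> refine lam.up_left_mem ?_ ?_ hx <;> simp <;> omega

theorem IsStandard.hook_prefix {n : ℕ} {lam : YoungDiagram} {t : Fin n → ℕ × ℕ}
    (h : IsStandard lam t) (hl : ∀ x ∈ lam, x.1 = 0 ∨ x.2 = 0) (m : ℕ) (hm : m < n) :
    ∃ a b : ℕ, a + b = m ∧
      ∀ p q, (∃ s : Fin n, (s : ℕ) ≤ m ∧ t s = (p, q)) ↔ (p = 0 ∧ q ≤ a) ∨ (q = 0 ∧ p ≤ b) := by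
  have hmem : ∀ x, x ∈ lam ↔ ∃ a, t a = x := fun x => by
    have := h.range
    rw [Set.ext_iff] at this
    simpa using (this x).symm
  induction m with
  | zero =>
    refine ⟨0, 0, rfl, fun p q => ?_⟩
    have h0 := h.first ⟨0, hm⟩ rfl
    constructor
    · rintro ⟨s, hs, hts⟩
      rw [h.first s (by omega)] at hts
      simp at hts
      omega
    · intro hpq
      refine ⟨⟨0, hm⟩, le_rfl, ?_⟩
      rw [h0]
      ext <;> simp <;> omega
  | succ m ih =>
    obtain ⟨a, b, hab, hset⟩ := ih (by omega)
    set k : Fin n := ⟨m + 1, hm⟩ with hk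
    have hsplit : ∀ x, (∃ s : Fin n, (s : ℕ) ≤ m + 1 ∧ t s = x) ↔
        (∃ s : Fin n, (s : ℕ) ≤ m ∧ t s = x) ∨ t k = x := fun x => by
      constructor
      · rintro ⟨s, hs, hx⟩
        rcases Nat.lt_or_ge m s with h1 | h1
        · right
          rw [← hx]
          congr 1
          ext
          simp [hk]
          omega
        · exact Or.inl ⟨s, h1, hx⟩
      · rintro (⟨s, hs, hx⟩ | hx)
        · exact ⟨s, by omega, hx⟩
        · exact ⟨k, le_rfl, hx⟩
    obtain ⟨⟨p, q⟩, hpq⟩ : ∃ x, t k = x := ⟨_, rfl⟩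
    have hin : (p, q) ∈ lam := (hmem _).2 ⟨k, hpq⟩
    have hnew : ¬ ((p = 0 ∧ q ≤ a) ∨ (q = 0 ∧ p ≤ b)) := by
      rw [← hset]
      rintro ⟨s, hs, hts⟩
      have := congrArg Fin.val (h.inj (hts.trans hpq.symm))
      simp [hk] at this
      omega
    rcases hl _ hin with h0 | h0
    · simp only at h0
      subst h0
      have hq : q = a + 1 := by
        by_contra hq
        obtain ⟨s, hs⟩ := (hmem (0, a + 1)).1 (lam.up_left_mem le_rfl (by omega) hin)
        have hsk : s < k := h.row s k (by rw [hs, hpq]) (by rw [hs, hpq]; simp only; omega)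
        have := (hset 0 (a + 1)).1 ⟨s, by rw [Fin.lt_def] at hsk; simp [hk] at hsk; omega, hs⟩
        omega
      refine ⟨a + 1, b, by omega, fun p' q' => ?_⟩
      rw [hsplit, hset, hpq, Prod.mk.injEq]
      omega
    · simp only at h0
      subst h0
      have hp : p = b + 1 := by
        by_contra hp
        obtain ⟨s, hs⟩ := (hmem (b + 1, 0)).1 (lam.up_left_mem (by omega) le_rfl hin)
        have hsk : s < k := h.col s k (by rw [hs, hpq]) (by rw [hs, hpq]; simp only; omega)
        have := (hset (b + 1) 0).1 ⟨s, by rw [Fin.lt_def] at hsk; simp [hk] at hsk; omega, hs⟩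
        omega
      refine ⟨a, b + 1, by omega, fun p' q' => ?_⟩
      rw [hsplit, hset, hpq, Prod.mk.injEq]
      omega

/-- The residues in the initial segments of an element of `I^{∅,1}` form intervals, and each new
residue extends the interval in one direction. -/
theorem Iempty1.exists_intervals {e : ℕ} {i : Fin e → ZMod e} (h : i ∈ Iempty1 e) :
    ∃ a b : ℕ → ℕ, (∀ m, m < e → a m + b m = m ∧ ∀ c, (∃ s : Fin e, (s : ℕ) ≤ m ∧ i s = c) ↔
        ∃ j : ℤ, -b m ≤ j ∧ j ≤ a m ∧ (j : ZMod e) = c) ∧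
      ∀ m (hm : m + 1 < e), (a (m + 1) = a m + 1 ∧ b (m + 1) = b m ∧
          i ⟨m + 1, hm⟩ = ((a m + 1 : ℤ) : ZMod e)) ∨
        (a (m + 1) = a m ∧ b (m + 1) = b m + 1 ∧ i ⟨m + 1, hm⟩ = ((-b m - 1 : ℤ) : ZMod e)) := by
  obtain ⟨lam, hlam, t, ht, rfl⟩ := h
  obtain ⟨hc, hl⟩ := hook_of_hasCoreWeight hlam
  choose! a b hab hset using ht.hook_prefix hl
  refine ⟨a, b, fun m hm => ⟨hab m hm, fun c => ⟨?_, ?_⟩⟩, fun m hm => ?_⟩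
  · rintro ⟨s, hs, rfl⟩
    have := (hset m hm (t s).1 (t s).2).1 ⟨s, hs, rfl⟩
    refine ⟨(t s).2 - (t s).1, by omega, by omega, by simp [boxRes]⟩
  · rintro ⟨j, h1, h2, rfl⟩
    rcases le_total 0 j with hj | hj
    · obtain ⟨q, rfl⟩ := Int.eq_ofNat_of_zero_le hj
      obtain ⟨s, hs, hts⟩ := (hset m hm 0 q).2 (Or.inl ⟨rfl, by omega⟩)
      exact ⟨s, hs, by simp [boxRes, hts]⟩
    · obtain ⟨q, hq⟩ := Int.eq_ofNat_of_zero_le (neg_nonneg.2 hj)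
      obtain rfl : j = -(q : ℤ) := by omega
      obtain ⟨s, hs, hts⟩ := (hset m hm q 0).2 (Or.inr ⟨rfl, by omega⟩)
      exact ⟨s, hs, by simp [boxRes, hts]⟩
  · have h1 := hab m (by omega)
    have h2 := hab (m + 1) hm
    have mono : ∀ p q, (p = 0 ∧ q ≤ a m) ∨ (q = 0 ∧ p ≤ b m) →
        (p = 0 ∧ q ≤ a (m + 1)) ∨ (q = 0 ∧ p ≤ b (m + 1)) := fun p q hpq => by
      rw [← hset _ hm]
      obtain ⟨s, hs, hts⟩ := (hset m (by omega) p q).2 hpq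
      exact ⟨s, by omega, hts⟩
    have ha := mono 0 (a m) (by simp)
    have hb := mono (b m) 0 (by simp)
    have new : ∀ p q, ((p = 0 ∧ q ≤ a (m + 1)) ∨ (q = 0 ∧ p ≤ b (m + 1))) →
        ¬ ((p = 0 ∧ q ≤ a m) ∨ (q = 0 ∧ p ≤ b m)) → t ⟨m + 1, hm⟩ = (p, q) := fun p q hpq hn => by
      obtain ⟨s, hs, hts⟩ := (hset _ hm p q).2 hpq
      rw [← hset m (by omega)] at hn
      have : ¬ (s : ℕ) ≤ m := fun h => hn ⟨s, h, hts⟩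
      rw [← hts]
      congr 1
      ext
      simp only
      omega
    by_cases hc : a (m + 1) = a m + 1
    · refine Or.inl ⟨hc, by omega, ?_⟩
      simp [boxRes, new 0 (a m + 1) (by omega) (by omega)]
    · refine Or.inr ⟨by omega, by omega, ?_⟩
      simp [boxRes, new (b m + 1) 0 (by omega) (by omega)]
      ring

theorem cast_mem_interval {e : ℕ} {a b : ℕ} (hab : a + b + 1 < e) {j : ℤ} (h1 : -b ≤ j)
    (h2 : j ≤ a) : (j : ZMod e) ≠ ((a + 1 : ℤ) : ZMod e) ∧ (j : ZMod e) ≠ ((-b - 1 : ℤ) : ZMod e) := by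
  constructor <;> intro h3
  · rw [ZMod.intCast_eq_intCast_iff_dvd_sub] at h3
    have := Int.le_of_dvd (by omega) h3
    omega
  · have h3 := h3.symm
    rw [ZMod.intCast_eq_intCast_iff_dvd_sub] at h3
    have := Int.le_of_dvd (by omega) h3
    omega

/-- The last two residues of an element of `I^{∅,1}` are adjacent. -/
theorem Iempty1.adjacent_last {e : ℕ} {i : Fin e → ZMod e} (h : i ∈ Iempty1 e)
    (r : Fin (e - 1)) (hr : (r : ℕ) + 2 = e) : i (lo r) = i (hi r) + 1 ∨ i (hi r) = i (lo r) + 1 := by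
  obtain ⟨a, b, hab, hstep⟩ := Iempty1.exists_intervals h
  have hh : KLRTheta.hi r = ⟨(r : ℕ) + 1, by omega⟩ := rfl
  have h2 := hstep r (by omega)
  rw [← hh] at h2
  have hz : ((e : ℤ) : ZMod e) = 0 := by simp
  by_cases hr0 : (r : ℕ) = 0
  · have h0 := Iempty1.first h (lo r) hr0
    have := (hab 0 (by omega)).1
    have ha : a 0 = 0 := by omega
    have hb : b 0 = 0 := by omega
    rw [hr0] at h2
    rcases h2 with ⟨-, -, h2⟩ | ⟨-, -, h2⟩
    · right; rw [h2, h0, ha]; simp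
    · left; rw [h2, h0, hb]; simp
  · obtain ⟨q, hq⟩ := Nat.exists_eq_succ_of_ne_zero hr0
    have hl : lo r = ⟨q + 1, by omega⟩ := Fin.ext hq
    have h1 := hstep q (by omega)
    rw [← hl] at h1
    rw [hq] at h2
    have hq2 := (hab q (by omega)).1
    have hz : ((a q + b q + 3 : ℤ) : ZMod e) = 0 := by
      rw [← hz]
      congr 1
      omega
    push_cast at hz
    rcases h1 with ⟨h3, h4, h1⟩ | ⟨h3, h4, h1⟩ <;> rcases h2 with ⟨-, -, h2⟩ | ⟨-, -, h2⟩ <;>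
      rw [h1, h2] <;> simp only [Nat.succ_eq_add_one, h3, h4] <;> push_cast
    · right; ring
    · right; linear_combination -hz
    · left; linear_combination -hz
    · left; ring

/-- If a transposition of adjacent residues preserves `I^{∅,1}`, it is the last one. -/
theorem Iempty1.eq_last {e : ℕ} {i : Fin e → ZMod e} (h : i ∈ Iempty1 e)
    (hinj : Function.Injective i) (r : Fin (e - 1)) (h' : act (simpleT r) i ∈ Iempty1 e)
    (hadj : i (lo r) = i (hi r) + 1 ∨ i (hi r) = i (lo r) + 1) : (r : ℕ) + 2 = e := by
  by_contra hne
  have hre : (r : ℕ) + 2 < e := by have := r.isLt; omega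
  have hr0 : (r : ℕ) ≠ 0 := fun hr0 => by
    have h1 := Iempty1.first h (lo r) hr0
    have h2 := Iempty1.first h' (lo r) hr0
    rw [act_simpleT, simpleT_lo] at h2
    exact lo_ne_hi r (hinj (h1.trans h2.symm))
  obtain ⟨q, hq⟩ := Nat.exists_eq_succ_of_ne_zero hr0
  have hl : lo r = ⟨q + 1, by omega⟩ := Fin.ext hq
  obtain ⟨a, b, hab, hstep⟩ := Iempty1.exists_intervals h
  obtain ⟨a', b', hab', hstep'⟩ := Iempty1.exists_intervals h'
  obtain ⟨h1, hset⟩ := hab q (by omega)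
  obtain ⟨h1', hset'⟩ := hab' q (by omega)
  have hs := hstep q (by omega)
  have hs' := hstep' q (by omega)
  rw [← hl] at hs hs'
  rw [act_simpleT, simpleT_lo] at hs'
  have hsame : ∀ s : Fin e, (s : ℕ) ≤ q → act (simpleT r) i s = i s := fun s hs => by
    rw [act_simpleT, simpleT_of_ne r (fun h => ?_) (fun h => ?_)]
    · have := congrArg Fin.val h; rw [lo_val] at this; omega
    · have := congrArg Fin.val h; rw [hi_val] at this; omega
  have hiff : ∀ c, (∃ j : ℤ, -b q ≤ j ∧ j ≤ a q ∧ (j : ZMod e) = c) ↔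
      ∃ j : ℤ, -b' q ≤ j ∧ j ≤ a' q ∧ (j : ZMod e) = c := fun c => by
    rw [← hset, ← hset']
    refine exists_congr fun s => and_congr_right fun hs => ?_
    rw [hsame s hs]
  have haa : a q = a' q := by
    rcases lt_trichotomy (a q) (a' q) with hlt | heq | hgt
    · obtain ⟨j, h2, h3, h4⟩ := (hiff ((a q + 1 : ℤ) : ZMod e)).2 ⟨a q + 1, by omega, by omega, rfl⟩
      exact absurd h4 (cast_mem_interval (by omega) h2 h3).1
    · exact heq
    · obtain ⟨j, h2, h3, h4⟩ := (hiff ((a' q + 1 : ℤ) : ZMod e)).1 ⟨a' q + 1, by omega, by omega, rfl⟩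
      exact absurd h4 (cast_mem_interval (by omega) h2 h3).1
  have hbb : b q = b' q := by omega
  rw [← haa, ← hbb] at hs'
  have hne' : i (lo r) ≠ i (KLRTheta.hi r) := fun h => lo_ne_hi r (hinj h)
  have no : ∀ x : ℤ, 0 < x → x < e → (x : ZMod e) ≠ 0 := fun x hx hx' h0 => by
    rw [ZMod.intCast_zmod_eq_zero_iff_dvd] at h0
    have := Int.le_of_dvd hx h0
    omega
  rcases hs with ⟨-, -, hs⟩ | ⟨-, -, hs⟩ <;> rcases hs' with ⟨-, -, hs'⟩ | ⟨-, -, hs'⟩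
  · exact hne' (hs.trans hs'.symm)
  · rw [hs, hs'] at hadj
    rcases hadj with hadj | hadj
    · refine no (a q + b q + 1) (by omega) (by omega) ?_
      push_cast at hadj ⊢
      linear_combination hadj
    · refine no (a q + b q + 3) (by omega) (by omega) ?_
      push_cast at hadj ⊢
      linear_combination -hadj
  · rw [hs, hs'] at hadj
    rcases hadj with hadj | hadj
    · refine no (a q + b q + 3) (by omega) (by omega) ?_
      push_cast at hadj ⊢
      linear_combination -hadj
    · refine no (a q + b q + 1) (by omega) (by omega) ?_
      push_cast at hadj ⊢
      linear_combination hadj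
  · exact hne' (hs.trans hs'.symm)

end Hooks

/-! ### The structure of the quotient of `R_δ` in low degrees -/

section LowDegrees

variable (F : Type*) [Field F] {e : ℕ} [NeZero e]

theorem pB_mul_eB_cases [Fact (1 < e)] (a : Fin (e - 1)) (i : Fin e → ZMod e) :
    pB F a * eB F i = 0 ∨ (Function.Injective i ∧
      (((a : ℕ) + 2 < e ∧ cartan (i (lo a)) (i (hi a)) = 0 ∧
        ¬ (i (lo a) = i (hi a) + 1 ∨ i (hi a) = i (lo a) + 1)) ∨
      ((a : ℕ) + 2 = e ∧ cartan (i (lo a)) (i (hi a)) = -1 ∧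
        (i (lo a) = i (hi a) + 1 ∨ i (hi a) = i (lo a) + 1)))) := by
  by_cases he : e = 2
  · left
    rw [pB_eq_zero_of_eq_two F he, zero_mul]
  by_cases h : i ∈ Ialpha e (mdelta e 1) ∧ i ∈ Iempty1 e
  · by_cases h' : act (simpleT a) i ∈ Iempty1 e
    · have hinj := injective_of_mem_Ialpha h.1
      have hne : i (lo a) ≠ i (hi a) := fun h0 => lo_ne_hi a (hinj h0)
      refine Or.inr ⟨hinj, ?_⟩
      rcases cartan_neg_cases hne with ⟨h1, h2⟩ | ⟨h1, h2⟩ | ⟨-, h2, h3⟩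
      · refine Or.inl ⟨?_, h1, h2⟩
        have := a.isLt
        by_contra hc
        exact h2 (Iempty1.adjacent_last h.2 a (by omega))
      · exact Or.inr ⟨Iempty1.eq_last h.2 hinj a h' h2, h1, h2⟩
      · exact absurd (eq_two_of_double h2 h3) he
    · left
      rw [pB_mul_eB, eB_eq_zero F fun h0 => h' h0.2, zero_mul]
  · left
    rw [eB_eq_zero F h, mul_zero]

theorem eB_mul_pB (a : Fin (e - 1)) (i : Fin e → ZMod e) :
    eB F i * pB F a = pB F a * eB F (act (simpleT a) i) := by
  rw [pB_mul_eB, act_simpleT_act_simpleT]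

theorem ext_eB {x y : RbarDelta F e} (h : ∀ i, x * eB F i = y * eB F i) : x = y := by
  rw [← mul_one x, ← mul_one y, ← sum_eB, Finset.mul_sum, Finset.mul_sum]
  exact Finset.sum_congr rfl fun i _ => h i

theorem pB_comm {a b : Fin (e - 1)} (h : (a : ℕ) + 1 < b) : pB F a * pB F b = pB F b * pB F a := by
  rw [← map_mul, ← map_mul, KLR.rel F (KLRRel.psi_psi a b (Or.inl h))]

theorem pB_braid {a b : Fin (e - 1)} (h : (b : ℕ) = a + 1) :
    pB F a * pB F b * pB F a = pB F b * pB F a * pB F b := by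
  refine ext_eB F fun i => ?_
  by_cases hi : i (KLRTheta.hi b) = i (lo a)
  · rw [eB_eq_zero, mul_zero, mul_zero]
    intro h'
    have := congrArg Fin.val (injective_of_mem_Ialpha h'.1 hi)
    rw [hi_val, lo_val] at this
    omega
  · simp only [pB, eB, ← map_mul]
    rw [KLR.rel F (KLRRel.braid_other a b i h fun h' => hi h'.1)]

theorem pB_sq_eB (a : Fin (e - 1)) (i : Fin e → ZMod e) : pB F a * pB F a * eB F i =
    Lval (i (lo a)) (i (hi a)) (yB F (lo a)) (yB F (hi a)) * eB F i := by
  have := congrArg (RbarDelta.proj F e) (KLR.rel F (KLRRel.psi_sq a i))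
  rwa [map_mul, map_mul, map_mul, map_Lval] at this

/-- The subalgebra of `RbarDelta` generated by the idempotents and the first `N` crossings. -/
def crossAlg (e : ℕ) [NeZero e] (N : ℕ) : Subalgebra F (RbarDelta F e) :=
  Algebra.adjoin F (Set.range (eB F) ∪ {x | ∃ a : Fin (e - 1), (a : ℕ) < N ∧ x = pB F a})

theorem eB_mem_crossAlg (N : ℕ) (i : Fin e → ZMod e) : eB F i ∈ crossAlg F e N :=
  Algebra.subset_adjoin (Or.inl ⟨i, rfl⟩)

theorem pB_mem_crossAlg {N : ℕ} {a : Fin (e - 1)} (h : (a : ℕ) < N) : pB F a ∈ crossAlg F e N :=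
  Algebra.subset_adjoin (Or.inr ⟨a, h, rfl⟩)

theorem crossAlg_mono {N N' : ℕ} (h : N ≤ N') : crossAlg F e N ≤ crossAlg F e N' :=
  Algebra.adjoin_mono (Set.union_subset_union_right _ fun _ ⟨a, ha, hx⟩ => ⟨a, ha.trans_le h, hx⟩)

variable {F}

theorem exists_pB_mul_eq {N : ℕ} {c : Fin (e - 1)} (hc : ∀ a, a < N → a + 1 < (c : ℕ))
    {b : RbarDelta F e} (hb : b ∈ crossAlg F e N) :
    (∃ b' ∈ crossAlg F e N, pB F c * b = b' * pB F c) ∧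
      ∃ b' ∈ crossAlg F e N, b * pB F c = pB F c * b' := by
  induction hb using Algebra.adjoin_induction with
  | mem x hx =>
    rcases hx with ⟨i, rfl⟩ | ⟨a, ha, rfl⟩
    · exact ⟨⟨_, eB_mem_crossAlg F N _, pB_mul_eB F c i⟩, ⟨_, eB_mem_crossAlg F N _, eB_mul_pB F c i⟩⟩
    · exact ⟨⟨_, pB_mem_crossAlg F ha, (pB_comm F (hc a ha)).symm⟩,
        ⟨_, pB_mem_crossAlg F ha, pB_comm F (hc a ha)⟩⟩
  | algebraMap r =>
    exact ⟨⟨_, Subalgebra.algebraMap_mem _ r, (Algebra.commutes r _).symm⟩,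
      ⟨_, Subalgebra.algebraMap_mem _ r, Algebra.commutes r _⟩⟩
  | add x y _ _ hx hy =>
    obtain ⟨⟨x1, h1, h1'⟩, x2, h2, h2'⟩ := hx
    obtain ⟨⟨y1, h3, h3'⟩, y2, h4, h4'⟩ := hy
    exact ⟨⟨_, add_mem h1 h3, by rw [mul_add, add_mul, h1', h3']⟩,
      ⟨_, add_mem h2 h4, by rw [mul_add, add_mul, h2', h4']⟩⟩
  | mul x y _ _ hx hy =>
    obtain ⟨⟨x1, h1, h1'⟩, x2, h2, h2'⟩ := hx
    obtain ⟨⟨y1, h3, h3'⟩, y2, h4, h4'⟩ := hy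
    exact ⟨⟨_, mul_mem h1 h3, by rw [← mul_assoc, h1', mul_assoc, h3', mul_assoc]⟩,
      ⟨_, mul_mem h2 h4, by rw [mul_assoc, h4', ← mul_assoc, h2', mul_assoc]⟩⟩

theorem pB_sq_mem_crossAlg [Fact (1 < e)] (N : ℕ) {c : Fin (e - 1)} (hc : (c : ℕ) + 2 < e) :
    pB F c * pB F c ∈ crossAlg F e N := by
  rw [← mul_one (pB F c * pB F c), ← sum_eB, Finset.mul_sum]
  refine sum_mem fun i _ => ?_
  rcases pB_mul_eB_cases F c i with h | ⟨hinj, ⟨-, -, h⟩ | ⟨h, -⟩⟩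
  · rw [mul_assoc, h, mul_zero]
    exact zero_mem _
  · have hne : i (lo c) ≠ i (hi c) := fun h0 => lo_ne_hi c (hinj h0)
    have : pB F c * pB F c * eB F i = eB F i := by
      rw [pB_sq_eB]
      have : Lval (i (lo c)) (i (hi c)) (yB F (lo c)) (yB F (hi c)) = 1 := by
        rw [Lval, if_neg hne, if_neg fun h1 => h (Or.inr h1.1), if_neg fun h1 => h (Or.inr h1.1),
          if_neg fun h1 => h (Or.inl h1.1)]
      rw [this, one_mul]
    rw [this]
    exact eB_mem_crossAlg F N i
  · omega

/-- The span of `crossAlg N` and `crossAlg N * ψ_c * crossAlg N`. -/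
def crossSpan (F : Type*) [Field F] (N : ℕ) (c : Fin (e - 1)) : Submodule F (RbarDelta F e) :=
  Submodule.span F ((crossAlg F e N : Set (RbarDelta F e)) ∪
    {x | ∃ b ∈ crossAlg F e N, ∃ b' ∈ crossAlg F e N, x = b * pB F c * b'})

theorem mem_crossSpan {N : ℕ} {c : Fin (e - 1)} {b b' : RbarDelta F e} (hb : b ∈ crossAlg F e N)
    (hb' : b' ∈ crossAlg F e N) : b * pB F c * b' ∈ crossSpan F N c :=
  Submodule.subset_span (Or.inr ⟨b, hb, b', hb', rfl⟩)

theorem crossAlg_le_crossSpan_of {N : ℕ} {c : Fin (e - 1)} (hN : (c : ℕ) = N)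
    (h : ∀ b ∈ crossAlg F e N, ∀ b' ∈ crossAlg F e N,
      pB F c * (b * pB F c * b') ∈ crossSpan F N c) {x : RbarDelta F e}
    (hx : x ∈ crossAlg F e (N + 1)) : x ∈ crossSpan F N c := by
  have h1 : (1 : RbarDelta F e) ∈ crossSpan F N c := Submodule.subset_span (Or.inl (one_mem _))
  have hl : ∀ a ∈ crossAlg F e N, ∀ y ∈ crossSpan F N c, a * y ∈ crossSpan F N c := by
    intro a ha y hy
    refine mul_mem_of_mem_span a ?_ hy
    rintro _ (hb | ⟨b, hb, b', hb', rfl⟩)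
    · exact Submodule.subset_span (Or.inl (mul_mem ha hb))
    · rw [← mul_assoc, ← mul_assoc]
      exact mem_crossSpan (mul_mem ha hb) hb'
  suffices ∀ y ∈ crossSpan F N c, x * y ∈ crossSpan F N c by simpa using this 1 h1
  induction hx using Algebra.adjoin_induction with
  | mem x hx =>
    intro y hy
    rcases hx with ⟨i, rfl⟩ | ⟨a, ha, rfl⟩
    · exact hl _ (eB_mem_crossAlg F N i) y hy
    · rcases Nat.lt_succ_iff_lt_or_eq.1 ha with ha | ha
      · exact hl _ (pB_mem_crossAlg F ha) y hy
      · obtain rfl : a = c := Fin.ext (ha.trans hN.symm)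
        refine mul_mem_of_mem_span _ ?_ hy
        rintro _ (hb | ⟨b, hb, b', hb', rfl⟩)
        · have := mem_crossSpan (c := a) (one_mem (crossAlg F e N)) hb
          rwa [one_mul] at this
        · exact h b hb b' hb'
  | algebraMap r =>
    intro y hy
    rw [← Algebra.smul_def]
    exact Submodule.smul_mem _ r hy
  | add a b _ _ ha hb => exact fun y hy => by rw [add_mul]; exact add_mem (ha y hy) (hb y hy)
  | mul a b _ _ ha hb => exact fun y hy => by rw [mul_assoc]; exact ha _ (hb y hy)

theorem crossAlg_le_crossSpan [Fact (1 < e)] (N : ℕ) (c : Fin (e - 1)) (hN : (c : ℕ) = N)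
    (hc : N + 2 < e) {x : RbarDelta F e} (hx : x ∈ crossAlg F e (N + 1)) : x ∈ crossSpan F N c := by
  induction N generalizing c x with
  | zero =>
    refine crossAlg_le_crossSpan_of hN (fun b hb b' hb' => ?_) hx
    obtain ⟨⟨b1, h1, h1'⟩, -⟩ := exists_pB_mul_eq (c := c) (fun a ha => by omega) hb
    refine Submodule.subset_span (Or.inl ?_)
    rw [← mul_assoc, ← mul_assoc, h1', mul_assoc b1]
    exact mul_mem (mul_mem h1 (pB_sq_mem_crossAlg _ (by omega))) hb'
  | succ N ih =>
    refine crossAlg_le_crossSpan_of hN (fun b hb b' hb' => ?_) hx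
    set g : Fin (e - 1) := ⟨N, by omega⟩ with hg
    have hgc : (c : ℕ) = g + 1 := hN
    have hmono := crossAlg_mono F (e := e) (Nat.le_succ N)
    rw [← mul_assoc, ← mul_assoc]
    have key : crossSpan F N g ≤ (crossSpan F (N + 1) c).comap
        ((LinearMap.mulRight F b' ∘ₗ LinearMap.mulRight F (pB F c)) ∘ₗ
          LinearMap.mulLeft F (pB F c)) := by
      refine Submodule.span_le.2 ?_
      rintro _ (h | ⟨b1, h1, b2, h2, rfl⟩)
      · obtain ⟨⟨b1, h1, h1'⟩, -⟩ := exists_pB_mul_eq (c := c) (fun a ha => by omega) h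
        refine Submodule.subset_span (Or.inl ?_)
        simp only [LinearMap.coe_comp, Function.comp_apply, LinearMap.mulLeft_apply,
          LinearMap.mulRight_apply]
        rw [h1', mul_assoc b1]
        exact mul_mem (mul_mem (hmono h1) (pB_sq_mem_crossAlg _ (by omega))) hb'
      · obtain ⟨⟨b3, h3, h3'⟩, -⟩ := exists_pB_mul_eq (c := c) (fun a ha => by omega) h1
        obtain ⟨-, b4, h4, h4'⟩ := exists_pB_mul_eq (c := c) (fun a ha => by omega) h2
        have h5 : pB F g ∈ crossAlg F e (N + 1) := pB_mem_crossAlg F (Nat.lt_succ_self N)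
        have := mem_crossSpan (c := c) (mul_mem (hmono h3) h5) (mul_mem (mul_mem h5 (hmono h4)) hb')
        have e1 : pB F c * (b1 * pB F g * b2) * pB F c * b' =
            b3 * pB F g * pB F c * (pB F g * b4 * b') := by
          calc _ = (pB F c * b1) * pB F g * (b2 * pB F c) * b' := by simp only [mul_assoc]
            _ = b3 * (pB F c * pB F g * pB F c) * b4 * b' := by
                rw [h3', h4']
                simp only [mul_assoc]
            _ = _ := by
                rw [← pB_braid F hgc]
                simp only [mul_assoc]
        rw [← e1] at this
        exact this
    exact key (ih g rfl (by omega) hb)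

/-! ### The left ideal `K` -/

theorem yB_sub_mem (p q : Fin e) : yB F p - yB F q ∈ Kideal F e :=
  Submodule.subset_span ⟨p, q, (map_sub _ _ _).symm⟩

theorem mul_mem_Kideal (a : RbarDelta F e) {x : RbarDelta F e} (hx : x ∈ Kideal F e) :
    a * x ∈ Kideal F e := Submodule.smul_mem _ a hx

theorem yB_mul_eB (p : Fin e) (i : Fin e → ZMod e) : yB F p * eB F i = eB F i * yB F p := by
  rw [← map_mul, ← map_mul, y_mul_idem]

theorem yB_mul_pB_eB [Fact (1 < e)] (p : Fin e) (a : Fin (e - 1)) (i : Fin e → ZMod e) :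
    yB F p * (pB F a * eB F i) = pB F a * yB F (simpleT a p) * eB F i := by
  rcases pB_mul_eB_cases F a i with h | ⟨hinj, -⟩
  · rw [h, mul_zero, mul_assoc, yB_mul_eB, ← mul_assoc, h, zero_mul]
  · obtain ⟨c, h, h'⟩ := y_mul_psi_mul_idem (F := F) p a i
    have hc : c = 0 := by
      by_contra hc
      exact lo_ne_hi a (hinj (h' hc))
    rw [hc, zero_smul, add_zero, mul_assoc] at h
    have := congrArg (RbarDelta.proj F e) h
    simpa only [map_mul] using this

theorem KLRbar.proj_surjective {n : ℕ} (α : ZMod e → ℕ) (X : Set (Fin n → ZMod e)) :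
    Function.Surjective (KLRbar.proj F n α X) := by
  intro x
  obtain ⟨⟨_, a, rfl⟩, rfl⟩ := RingQuot.mkAlgHom_surjective F _ x
  exact ⟨a, rfl⟩

/-- The left ideal `K` is two-sided. -/
theorem mem_Kideal_mul [Fact (1 < e)] {x : RbarDelta F e} (hx : x ∈ Kideal F e) (a : RbarDelta F e) :
    x * a ∈ Kideal F e := by
  obtain ⟨a, rfl⟩ := KLRbar.proj_surjective _ _ a
  suffices ∀ y ∈ Kideal F e, y * RbarDelta.proj F e a ∈ Kideal F e from this x hx
  have red : ∀ z : RbarDelta F e, (∀ p q, (yB F p - yB F q) * z ∈ Kideal F e) →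
      ∀ y ∈ Kideal F e, y * z ∈ Kideal F e := by
    intro z hz y hy
    induction hy using Submodule.span_induction with
    | mem y hy =>
      obtain ⟨p, q, rfl⟩ := hy
      rw [map_sub]
      exact hz p q
    | zero => rw [zero_mul]; exact zero_mem _
    | add y y' _ _ h h' => rw [add_mul]; exact add_mem h h'
    | smul b y _ h => rw [smul_eq_mul, mul_assoc]; exact mul_mem_Kideal b h
  let S : Subalgebra F (KLR F e e) :=
    { carrier := {a | ∀ y ∈ Kideal F e, y * RbarDelta.proj F e a ∈ Kideal F e}
      mul_mem' := fun {a b} ha hb y hy => by rw [map_mul, ← mul_assoc]; exact hb _ (ha y hy)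
      add_mem' := fun {a b} ha hb y hy => by rw [map_add, mul_add]; exact add_mem (ha y hy) (hb y hy)
      algebraMap_mem' := fun r y hy => by
        rw [AlgHom.commutes, ← Algebra.commutes]
        exact mul_mem_Kideal _ hy }
  refine KLR.induction (S := S) (fun i => red _ fun p q => ?_) (fun r => red _ fun p q => ?_)
    (fun r => red _ fun p q => ?_) a
  · change _ * eB F i ∈ _
    rw [sub_mul, yB_mul_eB, yB_mul_eB, ← mul_sub]
    exact mul_mem_Kideal _ (yB_sub_mem p q)
  · change _ * yB F r ∈ _
    have : ∀ p, yB F p * yB F r = yB F r * yB F p := fun p => by rw [← map_mul, ← map_mul, y_mul_y]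
    rw [sub_mul, this, this, ← mul_sub]
    exact mul_mem_Kideal _ (yB_sub_mem p q)
  · change _ * pB F r ∈ _
    rw [← mul_one (pB F r), ← sum_eB, Finset.mul_sum, Finset.mul_sum]
    refine sum_mem fun i _ => ?_
    rw [sub_mul, yB_mul_pB_eB, yB_mul_pB_eB, mul_assoc, mul_assoc, yB_mul_eB, yB_mul_eB, ← mul_sub,
      ← mul_sub]
    exact mul_mem_Kideal _ (mul_mem_Kideal _ (yB_sub_mem _ _))

variable (F) in
/-- The span of the products with one last crossing and no other crossings of degree `1`. -/
def crossOne (e : ℕ) [NeZero e] : Submodule F (RbarDelta F e) :=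
  Submodule.span F {x | ∃ a : Fin (e - 1), (a : ℕ) + 2 = e ∧ ∃ b ∈ crossAlg F e (e - 2),
    ∃ b' ∈ crossAlg F e (e - 2), x = b * pB F a * b'}

theorem pB_sq_mem_Kideal [Fact (1 < e)] {a : Fin (e - 1)} (ha : (a : ℕ) + 2 = e) :
    pB F a * pB F a ∈ Kideal F e := by
  rw [← mul_one (pB F a * pB F a), ← sum_eB, Finset.mul_sum]
  refine sum_mem fun i _ => ?_
  rcases pB_mul_eB_cases F a i with h | ⟨hinj, ⟨h, -⟩ | ⟨-, hc, h⟩⟩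
  · rw [mul_assoc, h, mul_zero]
    exact zero_mem _
  · omega
  · refine mem_Kideal_mul ?_ _ |> (pB_sq_eB F a i ▸ ·)
    have hne : i (lo a) ≠ i (hi a) := fun h0 => lo_ne_hi a (hinj h0)
    rw [Lval, if_neg hne]
    split_ifs
    · exact mul_mem_Kideal _ (yB_sub_mem _ _)
    · exact yB_sub_mem _ _
    · exact yB_sub_mem _ _
    · exfalso
      rw [cartan, if_neg hne] at hc
      simp_all

theorem pB_mul_pB_mul_pB_eq_zero [Fact (1 < e)] {a c : Fin (e - 1)} (ha : (a : ℕ) + 2 = e)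
    (hca : (a : ℕ) = c + 1) : pB F a * pB F c * pB F a = 0 := by
  refine ext_eB F fun i => ?_
  rw [zero_mul]
  by_contra h0
  obtain ⟨hm, h13, h23, f1, f2, f3, f4⟩ := IntertwinerData.braid_positions hca
  have e1 : pB F a * pB F c * pB F a * eB F i =
      pB F a * eB F (act (simpleT c) (act (simpleT a) i)) * pB F c * pB F a := by
    rw [mul_assoc, pB_mul_eB, mul_assoc, ← mul_assoc (pB F c), pB_mul_eB]
    simp only [mul_assoc]
  have e2 : pB F a * pB F c * pB F a * eB F i = pB F c * pB F a * (pB F c * eB F i) := by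
    rw [← pB_braid F hca, mul_assoc]
  rcases pB_mul_eB_cases F a (act (simpleT c) (act (simpleT a) i)) with h | ⟨-, ⟨h, -⟩ | ⟨-, -, h⟩⟩
  · rw [e1, h, zero_mul, zero_mul] at h0
    exact h0 rfl
  · omega
  · rcases pB_mul_eB_cases F c i with h' | ⟨-, ⟨-, -, h'⟩ | ⟨h', -⟩⟩
    · rw [e2, h', mul_zero] at h0
      exact h0 rfl
    · apply h'
      simp only [act_simpleT, f1, f2, f4, hm, simpleT_hi] at h
      exact h
    · omega

theorem pB_mul_mul_pB_mem_Kideal [Fact (1 < e)] {a : Fin (e - 1)} (ha : (a : ℕ) + 2 = e)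
    {b : RbarDelta F e} (hb : b ∈ crossAlg F e (e - 2)) : pB F a * b * pB F a ∈ Kideal F e := by
  by_cases he : e = 2
  · rw [pB_eq_zero_of_eq_two F he, mul_zero]
    exact zero_mem _
  obtain ⟨N, hN⟩ : ∃ N, e - 2 = N + 1 := ⟨e - 3, by have := a.isLt; omega⟩
  rw [hN] at hb
  set c : Fin (e - 1) := ⟨N, by omega⟩ with hc
  have hac : (a : ℕ) = c + 1 := by simp [hc]; omega
  have key : crossSpan F N c ≤ ((Kideal F e).restrictScalars F).comap
      (LinearMap.mulRight F (pB F a) ∘ₗ LinearMap.mulLeft F (pB F a)) := by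
    refine Submodule.span_le.2 ?_
    rintro _ (h | ⟨b1, h1, b2, h2, rfl⟩)
    · obtain ⟨⟨b1, h1, h1'⟩, -⟩ := exists_pB_mul_eq (c := a) (fun a ha => by omega) h
      change pB F a * _ * pB F a ∈ Kideal F e
      rw [h1', mul_assoc]
      exact mul_mem_Kideal _ (pB_sq_mem_Kideal ha)
    · obtain ⟨⟨b3, h3, h3'⟩, -⟩ := exists_pB_mul_eq (c := a) (fun a ha => by omega) h1
      obtain ⟨-, b4, h4, h4'⟩ := exists_pB_mul_eq (c := a) (fun a ha => by omega) h2
      change pB F a * (b1 * pB F c * b2) * pB F a ∈ Kideal F e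
      have e1 : pB F a * (b1 * pB F c * b2) * pB F a = 0 := by
        calc _ = (pB F a * b1) * pB F c * (b2 * pB F a) := by simp only [mul_assoc]
          _ = b3 * (pB F a * pB F c * pB F a) * b4 := by
              rw [h3', h4']
              simp only [mul_assoc]
          _ = 0 := by rw [pB_mul_pB_mul_pB_eq_zero ha hac, mul_zero, zero_mul]
      rw [e1]
      exact zero_mem _
  exact key (crossAlg_le_crossSpan N c rfl (by omega) hb)

theorem mul_mem_Kideal_of_crossOne [Fact (1 < e)] {x y : RbarDelta F e} (hx : x ∈ crossOne F e)
    (hy : y ∈ crossOne F e) : x * y ∈ Kideal F e := by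
  have key : crossOne F e ≤ ((Kideal F e).restrictScalars F).comap (LinearMap.mulLeft F x) := by
    refine Submodule.span_le.2 ?_
    rintro _ ⟨a, ha, b, hb, b', hb', rfl⟩
    have key : crossOne F e ≤ ((Kideal F e).restrictScalars F).comap
        (LinearMap.mulRight F (b * pB F a * b')) := by
      refine Submodule.span_le.2 ?_
      rintro _ ⟨a2, ha2, b2, hb2, b2', hb2', rfl⟩
      obtain rfl : a = a2 := Fin.ext (by omega)
      change b2 * pB F a * b2' * (b * pB F a * b') ∈ Kideal F e
      have : b2 * pB F a * b2' * (b * pB F a * b') = b2 * ((pB F a * (b2' * b) * pB F a) * b') := by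
        simp only [mul_assoc]
      rw [this]
      exact mul_mem_Kideal _ (mem_Kideal_mul (pB_mul_mul_pB_mem_Kideal ha (mul_mem hb2' hb)) _)
    exact key hx
  exact key hy

theorem proj_monomial_mem [Fact (1 < e)] {m : ℤ} {x : KLR F e e} (h : IsMonomial F m x) :
    (m < 0 → RbarDelta.proj F e x = 0) ∧ (m = 0 → RbarDelta.proj F e x ∈ crossAlg F e (e - 2)) ∧
      (m = 1 → RbarDelta.proj F e x ∈ crossOne F e) := by
  have hl : ∀ a ∈ crossAlg F e (e - 2), ∀ y ∈ crossOne F e, a * y ∈ crossOne F e := by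
    intro a ha y hy
    refine mul_mem_of_mem_span a ?_ hy
    rintro _ ⟨c, hc, b, hb, b', hb', rfl⟩
    exact Submodule.subset_span ⟨c, hc, a * b, mul_mem ha hb, b', hb', by simp only [mul_assoc]⟩
  induction h with
  | one => exact ⟨by omega, fun _ => by rw [map_one]; exact one_mem _, by omega⟩
  | idem_mul i _ ih =>
    rw [map_mul]
    refine ⟨fun hm => by rw [ih.1 hm, mul_zero], fun hm => mul_mem (eB_mem_crossAlg F _ i) (ih.2.1 hm),
      fun hm => hl _ (eB_mem_crossAlg F _ i) _ (ih.2.2 hm)⟩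
  | y_mul r _ ih =>
    rw [map_mul]
    refine ⟨fun hm => by rw [ih.1 (by omega), mul_zero],
      fun hm => by rw [ih.1 (by omega), mul_zero]; exact zero_mem _,
      fun hm => by rw [ih.1 (by omega), mul_zero]; exact zero_mem _⟩
  | @psi_mul m x r i _ ih =>
    rw [map_mul, map_mul]
    change (_ → pB F r * eB F i * _ = 0) ∧ (_ → pB F r * eB F i * _ ∈ _) ∧
      (_ → pB F r * eB F i * _ ∈ _)
    rcases pB_mul_eB_cases F r i with h | ⟨-, ⟨h, hc, -⟩ | ⟨h, hc, -⟩⟩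
    · rw [h, zero_mul]
      exact ⟨fun _ => rfl, fun _ => zero_mem _, fun _ => zero_mem _⟩
    · rw [hc, neg_zero, zero_add]
      have hm : pB F r * eB F i ∈ crossAlg F e (e - 2) :=
        mul_mem (pB_mem_crossAlg F (by omega)) (eB_mem_crossAlg F _ i)
      exact ⟨fun hm => by rw [ih.1 hm, mul_zero], fun h0 => mul_mem hm (ih.2.1 h0),
        fun h0 => hl _ hm _ (ih.2.2 h0)⟩
    · rw [hc, neg_neg]
      refine ⟨fun hm => by rw [ih.1 (by omega), mul_zero],
        fun hm => by rw [ih.1 (by omega), mul_zero]; exact zero_mem _, fun hm => ?_⟩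
      refine Submodule.subset_span ⟨r, h, 1, one_mem _, eB F i * RbarDelta.proj F e x,
        mul_mem (eB_mem_crossAlg F _ i) (ih.2.1 (by omega)), ?_⟩
      rw [one_mul, mul_assoc]

theorem deg_one_le [Fact (1 < e)] : RbarDelta.deg F e 1 ≤ crossOne F e := by
  rintro _ ⟨y, hy, rfl⟩
  have : KLR.deg F 1 ≤ (crossOne F e).comap (RbarDelta.proj F e).toLinearMap :=
    Submodule.span_le.2 fun y hy => (proj_monomial_mem hy).2.2 rfl
  exact this hy

theorem deg_one_mul_deg_one [Fact (1 < e)] {x y : RbarDelta F e} (hx : x ∈ RbarDelta.deg F e 1)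
    (hy : y ∈ RbarDelta.deg F e 1) : x * y ∈ Kideal F e :=
  mul_mem_Kideal_of_crossOne (deg_one_le hx) (deg_one_le hy)

theorem IsMonomial.mul {n : ℕ} {m m' : ℤ} {x x' : KLR F e n} (h : IsMonomial F m x)
    (h' : IsMonomial F m' x') : IsMonomial F (m + m') (x * x') := by
  induction h with
  | one => simpa using h'
  | idem_mul i _ ih => rw [mul_assoc]; exact ih.idem_mul i
  | y_mul r _ ih => rw [mul_assoc, add_assoc]; exact ih.y_mul r
  | psi_mul r i _ ih => rw [mul_assoc, add_assoc]; exact ih.psi_mul r i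

theorem KLR.deg_mul {n : ℕ} {m m' : ℤ} {x x' : KLR F e n} (h : x ∈ KLR.deg F m)
    (h' : x' ∈ KLR.deg F m') : x * x' ∈ KLR.deg F (m + m') := by
  have := Submodule.mul_mem_mul h h'
  rw [KLR.deg, KLR.deg, Submodule.span_mul_span] at this
  refine Submodule.span_mono ?_ this
  rintro _ ⟨a, ha, b, hb, rfl⟩
  exact IsMonomial.mul ha hb

theorem KLRbar.deg_mul {n : ℕ} {α : ZMod e → ℕ} {X : Set (Fin n → ZMod e)} {m m' : ℤ}
    {x x' : KLRbar F n α X} (h : x ∈ KLRbar.deg F α X m) (h' : x' ∈ KLRbar.deg F α X m') :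
    x * x' ∈ KLRbar.deg F α X (m + m') := by
  obtain ⟨y, hy, rfl⟩ := h
  obtain ⟨y', hy', rfl⟩ := h'
  exact ⟨y * y', KLR.deg_mul hy hy', map_mul (KLRbar.proj F n α X) _ _⟩

theorem KLRbar.one_mem_deg {n : ℕ} (α : ZMod e → ℕ) (X : Set (Fin n → ZMod e)) :
    (1 : KLRbar F n α X) ∈ KLRbar.deg F α X 0 :=
  ⟨1, Submodule.subset_span IsMonomial.one, map_one (KLRbar.proj F n α X)⟩

theorem eB_mem_deg (i : Fin e → ZMod e) : eB F i ∈ RbarDelta.deg F e 0 :=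
  ⟨_, Submodule.subset_span (IsMonomial.one.idem_mul i), by simp⟩

theorem pB_mul_eB_mem_deg (a : Fin (e - 1)) (i : Fin e → ZMod e) :
    pB F a * eB F i ∈ RbarDelta.deg F e (-cartan (i (lo a)) (i (hi a))) :=
  ⟨_, Submodule.subset_span (by simpa using IsMonomial.one.psi_mul a i), map_mul (RbarDelta.proj F e) _ _⟩

end LowDegrees

/-! ### Multiplicativity of the truncation and of `ι` -/

section Lists

theorem list_prod_ofFn_mul {M : Type*} [Monoid M] {n : ℕ} (f g : Fin n → M)
    (h : ∀ s t, s ≠ t → Commute (f s) (g t)) :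
    (List.ofFn fun t => f t * g t).prod = (List.ofFn f).prod * (List.ofFn g).prod := by
  induction n with
  | zero => simp
  | succ n ih =>
    rw [List.ofFn_succ, List.ofFn_succ, List.ofFn_succ, List.prod_cons, List.prod_cons,
      List.prod_cons, ih _ _ fun s t hst => h _ _ fun h => hst (Fin.succ_injective _ h)]
    have : Commute (g 0) (List.ofFn fun i : Fin n => f i.succ).prod := by
      refine Commute.list_prod_right _ _ fun x hx => ?_
      obtain ⟨i, rfl⟩ := (List.mem_ofFn' _ _).1 hx
      exact (h i.succ 0 (Fin.succ_ne_zero i)).symm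
    simp only [mul_assoc]
    rw [← mul_assoc (g 0), this.eq]
    simp only [mul_assoc]

theorem list_prod_ofFn_mulSingle {M : Type*} [Monoid M] {n : ℕ} (t : Fin n) (x : M) :
    (List.ofFn (Pi.mulSingle t x : Fin n → M)).prod = x := by
  induction n with
  | zero => exact t.elim0
  | succ n ih =>
    rw [List.ofFn_succ, List.prod_cons]
    refine Fin.cases ?_ (fun t => ?_) t
    · have : (fun i : Fin n => (Pi.mulSingle 0 x : Fin (n + 1) → M) i.succ) = fun _ => 1 :=
        funext fun i => Pi.mulSingle_eq_of_ne (Fin.succ_ne_zero i) x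
      rw [Pi.mulSingle_eq_same, this]
      simp
    · have : (fun i : Fin n => (Pi.mulSingle t.succ x : Fin (n + 1) → M) i.succ) =
          Pi.mulSingle t x := by
        funext i
        by_cases h : i = t
        · subst h; simp
        · rw [Pi.mulSingle_eq_of_ne h, Pi.mulSingle_eq_of_ne fun h' => h (Fin.succ_injective _ h')]
      rw [Pi.mulSingle_eq_of_ne (Fin.succ_ne_zero t).symm, this, ih, one_mul]

end Lists

section Truncation

variable (F : Type*) [Field F] {d e : ℕ} [NeZero e] [Fact (1 < e)]

/-- The property to commute with the idempotent `e_{δ^d}`. -/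
def CommIdd (x : KLR F e (d * e)) : Prop :=
  KLR.esum F (Idd e d) * x = x * KLR.esum F (Idd e d)

variable {F}

theorem CommIdd.mul {x y : KLR F e (d * e)} (hx : CommIdd F x) (hy : CommIdd F y) :
    CommIdd F (x * y) := by
  rw [CommIdd, ← mul_assoc, hx, mul_assoc, hy, mul_assoc]

theorem CommIdd.esum (S : Set (Fin (d * e) → ZMod e)) : CommIdd F (KLR.esum F S) := by
  rw [CommIdd, KLR.esum_mul_esum, KLR.esum_mul_esum, Set.inter_comm]

theorem CommIdd.blockHom (t : Fin d) (x : KLR F e e) : CommIdd F (blockHom F t x) :=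
  esum_Idd_comm F t x

theorem KLR.esum_singleton {n : ℕ} (i : Fin n → ZMod e) : KLR.esum F {i} = KLR.idem F i := by
  classical
  rw [KLR.esum, Finset.sum_eq_single i]
  · intro j hj hne
    simp at hj
    exact absurd hj hne
  · simp

theorem CommIdd.idem (i : Fin (d * e) → ZMod e) : CommIdd F (KLR.idem F i) := by
  rw [← KLR.esum_singleton]
  exact CommIdd.esum _

theorem CommIdd.y (p : Fin (d * e)) : CommIdd F (KLR.y F p) := (KLR.y_mul_esum p _).symm

theorem CommIdd.sub {x y : KLR F e (d * e)} (hx : CommIdd F x) (hy : CommIdd F y) :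
    CommIdd F (x - y) := by
  rw [CommIdd, mul_sub, sub_mul, hx, hy]

theorem CommIdd.one : CommIdd F (1 : KLR F e (d * e)) := by rw [CommIdd, mul_one, one_mul]

theorem CommIdd.psi (t : Fin d) (a : Fin (e - 1)) : CommIdd F (KLR.psi F (posPsi t a)) := by
  have := CommIdd.blockHom t (KLR.psi F a)
  rwa [KLRTheta.blockHom, KLR.lift_psi] at this

theorem edd_comm {x : KLR F e (d * e)} (hx : CommIdd F x) :
    edd F e d * Rbar.proj F e d x = Rbar.proj F e d x * edd F e d := by
  have := congrArg (Rbar.proj F e d) hx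
  rwa [map_mul, map_mul] at this

theorem edd_mul_edd : edd F e d * edd F e d = edd F e d := isIdempotentElem_edd F e d

theorem proj_mul {x y : KLR F e (d * e)} (h : CommIdd F x ∨ CommIdd F y) :
    TruncR.proj F e d (x * y) = TruncR.proj F e d x * TruncR.proj F e d y := by
  apply TruncR.ext
  rw [TruncR.val_mul, TruncR.val_proj, TruncR.val_proj, TruncR.val_proj, map_mul]
  rcases h with h | h
  · rw [edd_comm h]
    simp only [mul_assoc]
    rw [← mul_assoc (edd F e d) (edd F e d), edd_mul_edd, ← mul_assoc (edd F e d) (edd F e d),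
      edd_mul_edd, ← mul_assoc (edd F e d) (Rbar.proj F e d x), edd_comm h]
    simp only [mul_assoc]
  · simp only [mul_assoc]
    have h3 : ∀ z, edd F e d * (edd F e d * z) = edd F e d * z := fun z => by
      rw [← mul_assoc, edd_mul_edd]
    rw [← edd_comm h, h3, h3]

theorem proj_one : TruncR.proj F e d 1 = 1 := by
  apply TruncR.ext
  rw [TruncR.val_proj, TruncR.val_one, map_one, mul_one, edd_mul_edd]

theorem proj_esum_mul_Idd (S : Set (Fin (d * e) → ZMod e)) :
    TruncR.proj F e d (KLR.esum F (S ∩ Idd e d)) = TruncR.proj F e d (KLR.esum F S) := by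
  apply TruncR.ext
  rw [TruncR.val_proj, TruncR.val_proj, ← KLR.esum_mul_esum, map_mul]
  change edd F e d * (_ * edd F e d) * edd F e d = _
  simp only [mul_assoc]
  rw [edd_mul_edd]

theorem proj_esum_Idd : TruncR.proj F e d (KLR.esum F (Idd e d)) = 1 := by
  have := proj_esum_mul_Idd (F := F) (d := d) (e := e) Set.univ
  rwa [KLR.esum_univ, Set.univ_inter, proj_one] at this

theorem proj_esum_eq_zero {S : Set (Fin (d * e) → ZMod e)}
    (h : ∀ k ∈ S, k ∈ Idd e d → ¬ ∀ t, block t k ∈ Iempty1 e) :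
    TruncR.proj F e d (KLR.esum F S) = 0 := by
  rw [← proj_esum_mul_Idd]
  apply TruncR.ext
  rw [TruncR.val_proj, KLRbar.proj_esum_eq_zero, mul_zero, zero_mul, map_zero]
  exact fun k hk _ hE => h k hk.1 hk.2 fun t => block_mem_of_shuffle (NeZero.pos e) hk.2 hE t

theorem proj_idem_eq_zero {k : Fin (d * e) → ZMod e}
    (h : ¬ (k ∈ Idd e d ∧ ∀ t, block t k ∈ Iempty1 e)) : TruncR.proj F e d (KLR.idem F k) = 0 := by
  rw [← KLR.esum_singleton]
  refine proj_esum_eq_zero ?_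
  rintro _ rfl h1 h2
  exact h ⟨h1, h2⟩

theorem blockHom_commute {t t' : Fin d} (h : t ≠ t') (x y : KLR F e e) :
    blockHom F t x * blockHom F t' y = blockHom F t' y * blockHom F t x := by
  have hset : ∀ (s s' : Fin d), s ≠ s' → ∀ (i : Fin e → ZMod e) (r : Fin (e - 1)),
      KLR.psi F (posPsi s r) * KLR.esum F (blockEq s' i) =
        KLR.esum F (blockEq s' i) * KLR.psi F (posPsi s r) := fun s s' hs i r => by
    refine KLR.psi_mul_esum _ _ _ fun k => ?_
    change block s' k = i ↔ block s' _ = i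
    rw [block_act_of_ne hs.symm]
  have hpy : ∀ (s s' : Fin d), s ≠ s' → ∀ (a : Fin e) (r : Fin (e - 1)),
      KLR.psi (e := e) F (posPsi s r) * KLR.y F (pos s' a) = KLR.y F (pos s' a) * KLR.psi F (posPsi s r) :=
    fun s s' hs a r => by
      refine KLR.rel F (KLRRel.psi_y _ _ ?_ ?_)
      · rw [← pos_lo]; exact fun h1 => hs (pos_inj h1).1.symm
      · rw [← pos_hi]; exact fun h1 => hs (pos_inj h1).1.symm
  have key : ∀ z, (∀ i, z * KLR.esum F (blockEq t' i) = KLR.esum F (blockEq t' i) * z) →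
      (∀ a, z * KLR.y F (pos t' a) = KLR.y F (pos t' a) * z) →
      (∀ r, z * KLR.psi F (posPsi t' r) = KLR.psi F (posPsi t' r) * z) →
      z * blockHom F t' y = blockHom F t' y * z := by
    intro z h1 h2 h3
    have := KLR.induction (S := (Subalgebra.centralizer F {z}).comap (blockHom F t')) ?_ ?_ ?_ y
    · exact (Subalgebra.mem_centralizer_iff F).1 this _ rfl
    all_goals
      intro r
      rw [Subalgebra.mem_comap, Subalgebra.mem_centralizer_iff]
      rintro _ rfl
      simp only [blockHom, KLR.lift_idem, KLR.lift_y, KLR.lift_psi]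
    · exact h1 r
    · exact h2 r
    · exact h3 r
  have := KLR.induction (S := (Subalgebra.centralizer F {blockHom F t' y}).comap (blockHom F t))
    ?_ ?_ ?_ x
  · exact ((Subalgebra.mem_centralizer_iff F).1 this _ rfl).symm
  all_goals
    intro r
    rw [Subalgebra.mem_comap, Subalgebra.mem_centralizer_iff]
    rintro _ rfl
    refine (key _ (fun i => ?_) (fun a => ?_) fun s => ?_).symm
    all_goals simp only [blockHom, KLR.lift_idem, KLR.lift_y, KLR.lift_psi]
  · rw [KLR.esum_mul_esum, KLR.esum_mul_esum, Set.inter_comm]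
  · exact (KLR.y_mul_esum _ _).symm
  · exact (hset _ _ h.symm _ _).symm
  · exact KLR.y_mul_esum _ _
  · exact y_mul_y _ _
  · exact (hpy _ _ h.symm _ _).symm
  · exact hset _ _ h _ _
  · exact hpy _ _ h _ _
  · refine KLR.rel F (KLRRel.psi_psi _ _ ?_)
    rw [posPsi_val, posPsi_val]
    have h1 := r.isLt
    have h2 := s.isLt
    rcases lt_or_gt_of_ne h with h | h
    · have : e * (t : ℕ) + e ≤ e * t' := by
        rw [← Nat.mul_succ]
        exact Nat.mul_le_mul_left _ h
      omega
    · have : e * (t' : ℕ) + e ≤ e * t := by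
        rw [← Nat.mul_succ]
        exact Nat.mul_le_mul_left _ h
      omega

theorem iotaAt_commute {t t' : Fin d} (h : t ≠ t') (x y : RbarDelta F e) :
    Commute (iotaAt F t x) (iotaAt F t' y) := by
  obtain ⟨x, rfl⟩ := KLRbar.proj_surjective _ _ x
  obtain ⟨y, rfl⟩ := KLRbar.proj_surjective _ _ y
  change iotaAt F t (RbarDelta.proj F e x) * iotaAt F t' (RbarDelta.proj F e y) =
    iotaAt F t' (RbarDelta.proj F e y) * iotaAt F t (RbarDelta.proj F e x)
  rw [iotaAt_proj, iotaAt_proj, ← proj_mul (Or.inl (CommIdd.blockHom t x)),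
    ← proj_mul (Or.inl (CommIdd.blockHom t' y)), blockHom_commute h]

theorem iota_tprod (a : Fin d → RbarDelta F e) :
    iota F e d (PiTensorProduct.tprod F a) = (List.ofFn fun t => iotaAt F t (a t)).prod := by
  simp [iota, MultilinearMap.mkPiAlgebraFin_apply]

theorem iota_one : iota F e d 1 = 1 := by
  rw [PiTensorProduct.one_def, iota_tprod]
  simp

theorem iota_mul (x y : TPow F (RbarDelta F e) d) : iota F e d (x * y) = iota F e d x * iota F e d y := by
  induction x using PiTensorProduct.induction_on with
  | smul_tprod r f =>
    induction y using PiTensorProduct.induction_on with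
    | smul_tprod s g =>
      rw [smul_mul_assoc, mul_smul_comm, PiTensorProduct.tprod_mul_tprod, map_smul, map_smul, map_smul,
        map_smul, smul_mul_assoc, mul_smul_comm, iota_tprod, iota_tprod, iota_tprod,
        ← list_prod_ofFn_mul _ _ fun s t hst => iotaAt_commute hst _ _]
      simp only [Pi.mul_apply, map_mul]
    | add a b ha hb => rw [mul_add, map_add, map_add, mul_add, ha, hb]
  | add a b ha hb => rw [add_mul, map_add, map_add, add_mul, ha, hb]

/-- The map `ι` as a homomorphism of algebras. -/
def iotaHom (F : Type*) [Field F] (e d : ℕ) [NeZero e] [Fact (1 < e)] : TPow F (RbarDelta F e) d →ₐ[F] TruncR F e d :=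
  AlgHom.ofLinearMap (iota F e d) iota_one iota_mul

theorem iota_mulSingle (t : Fin d) (x : RbarDelta F e) :
    iota F e d (PiTensorProduct.tprod F (Pi.mulSingle t x)) = iotaAt F t x := by
  rw [iota_tprod]
  have : (fun s => iotaAt F s ((Pi.mulSingle t x : Fin d → RbarDelta F e) s)) =
      Pi.mulSingle t (iotaAt F t x) := by
    funext s
    by_cases h : s = t
    · subst h; simp
    · rw [Pi.mulSingle_eq_of_ne h, Pi.mulSingle_eq_of_ne h, map_one]
  rw [this, list_prod_ofFn_mulSingle]

theorem iotaAt_mul_iota (t : Fin d) (x : RbarDelta F e) (a : Fin d → RbarDelta F e) :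
    iotaAt F t x * iota F e d (PiTensorProduct.tprod F a) =
      iota F e d (PiTensorProduct.tprod F (Function.update a t (x * a t))) := by
  rw [← iota_mulSingle, ← iota_mul, PiTensorProduct.tprod_mul_tprod]
  congr 2
  funext s
  by_cases h : s = t
  · subst h; simp
  · simp [h]

theorem zElt_eq (t : Fin d) : zElt F t = iotaAt F t (yB F ⟨0, NeZero.pos e⟩) := by
  rw [iotaAt_proj, blockHom, KLR.lift_y]
  rfl

theorem yB_zero_central (x : RbarDelta F e) :
    yB F ⟨0, NeZero.pos e⟩ * x = x * yB F ⟨0, NeZero.pos e⟩ := by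
  obtain ⟨x, rfl⟩ := KLRbar.proj_surjective _ _ x
  have := KLR.induction (S := (Subalgebra.centralizer F {yB F (⟨0, NeZero.pos e⟩ : Fin e)}).comap
    (RbarDelta.proj F e)) ?_ ?_ ?_ x
  · exact (Subalgebra.mem_centralizer_iff F).1 this _ rfl
  all_goals
    intro r
    rw [Subalgebra.mem_comap, Subalgebra.mem_centralizer_iff]
    rintro _ rfl
  · exact yB_mul_eB _ _
  · rw [← map_mul, ← map_mul, y_mul_y]
  · exact RbarDelta.y_zero_psi F r

theorem zElt_commute_iotaAt (t s : Fin d) (x : RbarDelta F e) : Commute (zElt F t) (iotaAt F s x) := by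
  rw [zElt_eq]
  by_cases h : t = s
  · subst h
    rw [Commute, SemiconjBy, ← map_mul, ← map_mul, yB_zero_central]
  · exact iotaAt_commute h _ _

theorem zElt_commute_iota (t : Fin d) (x : TPow F (RbarDelta F e) d) :
    Commute (zElt F t) (iota F e d x) := by
  induction x using PiTensorProduct.induction_on with
  | smul_tprod r f =>
    rw [map_smul, iota_tprod]
    refine Commute.smul_right (Commute.list_prod_right _ _ fun x hx => ?_) r
    obtain ⟨i, rfl⟩ := (List.mem_ofFn' _ _).1 hx
    exact zElt_commute_iotaAt _ _ _
  | add a b ha hb => rw [map_add]; exact ha.add_right hb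

theorem zElt_mem_range (t : Fin d) : ∃ x, iota F e d x = zElt F t :=
  ⟨_, (iota_mulSingle t _).trans (zElt_eq t).symm⟩

theorem iota_mul_mem_calK {c : TruncR F e d} (hc : c ∈ calK F e d) (x : TPow F (RbarDelta F e) d) :
    iota F e d x * c ∈ calK F e d := by
  obtain ⟨y, hy, rfl⟩ := hc
  rw [← iota_mul]
  refine Submodule.mem_map_of_mem ?_
  refine mul_mem_of_mem_span x ?_ hy
  rintro _ ⟨a, ⟨t, ht⟩, rfl⟩
  induction x using PiTensorProduct.induction_on with
  | smul_tprod r f =>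
    rw [smul_mul_assoc, PiTensorProduct.tprod_mul_tprod]
    exact Submodule.smul_mem _ r (Submodule.subset_span ⟨_, ⟨t, mul_mem_Kideal _ ht⟩, rfl⟩)
  | add a b ha hb => rw [add_mul]; exact add_mem ha hb

theorem mul_iota_mem_calK {c : TruncR F e d} (hc : c ∈ calK F e d) (x : TPow F (RbarDelta F e) d) :
    c * iota F e d x ∈ calK F e d := by
  obtain ⟨y, hy, rfl⟩ := hc
  rw [← iota_mul]
  refine Submodule.mem_map_of_mem ?_
  refine mem_mul_of_mem_span x ?_ hy
  rintro _ ⟨a, ⟨t, ht⟩, rfl⟩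
  induction x using PiTensorProduct.induction_on with
  | smul_tprod r f =>
    rw [mul_smul_comm, PiTensorProduct.tprod_mul_tprod]
    exact Submodule.smul_mem _ r (Submodule.subset_span ⟨_, ⟨t, mem_Kideal_mul ht _⟩, rfl⟩)
  | add a b ha hb => rw [mul_add]; exact add_mem ha hb

theorem iotaAt_mem_calK (t : Fin d) {x : RbarDelta F e} (hx : x ∈ Kideal F e) :
    iotaAt F t x ∈ calK F e d := by
  rw [← iota_mulSingle]
  exact Submodule.mem_map_of_mem (Submodule.subset_span ⟨_, ⟨t, by simpa using hx⟩, rfl⟩)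

end Truncation

/-! ### Elements of low degree in the image of `ι` -/

section LowTensors

variable (F : Type*) [Field F] {d e : ℕ} [NeZero e] [Fact (1 < e)]

/-- The span of the differences of the `z_t` with `t ∈ B`. -/
def zSpan (B : Set (Fin d)) : Submodule F (TruncR F e d) :=
  Submodule.span F {x | ∃ t ∈ B, ∃ t' ∈ B, x = zElt F t - zElt F t'}

variable {F}

/-- The tensors of degree `m` with factors of degree `0` and `1`, and factors `1` outside `B`. -/
def IsLow (B : Set (Fin d)) (m : ℤ) (a : Fin d → RbarDelta F e) : Prop :=
  ∃ p : Fin d → ℤ, (∀ t, p t = 0 ∨ p t = 1) ∧ ∑ t, p t = m ∧ (∀ t, a t ∈ RbarDelta.deg F e (p t)) ∧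
    ∀ t, t ∉ B → a t = 1 ∧ p t = 0

theorem IsLow.nonneg {B : Set (Fin d)} {m : ℤ} {a : Fin d → RbarDelta F e} (h : IsLow B m a) :
    0 ≤ m := by
  obtain ⟨p, hp, rfl, -⟩ := h
  exact Finset.sum_nonneg fun t _ => by rcases hp t with h | h <;> omega

theorem IsLow.one (B : Set (Fin d)) : IsLow (F := F) (e := e) B 0 1 :=
  ⟨0, fun _ => Or.inl rfl, by simp, fun _ => KLRbar.one_mem_deg _ _, fun _ _ => ⟨rfl, rfl⟩⟩

/-- Multiplication of one factor by an element of degree `0` or `1`. -/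
theorem IsLow.update {B : Set (Fin d)} {m p : ℤ} {a : Fin d → RbarDelta F e} (h : IsLow B m a)
    {t : Fin d} (ht : t ∈ B) (hp : p = 0 ∨ p = 1) {x : RbarDelta F e}
    (hx : x ∈ RbarDelta.deg F e p) :
    IsLow B (p + m) (Function.update a t (x * a t)) ∨ (2 ≤ p + m ∧ x * a t ∈ Kideal F e) := by
  obtain ⟨q, hq, hm, ha, hB⟩ := h
  have hdeg := KLRbar.deg_mul hx (ha t)
  by_cases h2 : p + q t = 0 ∨ p + q t = 1
  · left
    refine ⟨Function.update q t (p + q t), fun s => ?_, ?_, fun s => ?_, fun s hs => ?_⟩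
    · by_cases h : s = t
      · subst h; simpa using h2
      · simpa [h] using hq s
    · have h1 := Finset.add_sum_erase Finset.univ (Function.update q t (p + q t)) (Finset.mem_univ t)
      have h2 := Finset.add_sum_erase Finset.univ q (Finset.mem_univ t)
      have h3 : ∑ s ∈ Finset.univ.erase t, Function.update q t (p + q t) s =
          ∑ s ∈ Finset.univ.erase t, q s := Finset.sum_congr rfl fun s hs => by
        rw [Function.update_of_ne (Finset.ne_of_mem_erase hs)]
      rw [Function.update_self] at h1
      omega
    · by_cases h : s = t
      · subst h; simpa using hdeg
      · simpa [h] using ha s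
    · have h : s ≠ t := fun h => hs (h ▸ ht)
      simpa [h] using hB s hs
  · right
    have hqt := hq t
    have hp1 : p = 1 := by omega
    have hq1 : q t = 1 := by omega
    refine ⟨?_, deg_one_mul_deg_one (hp1 ▸ hx) (hq1 ▸ ha t)⟩
    have : q t ≤ ∑ s, q s := Finset.single_le_sum (f := q) (fun s _ => by
      rcases hq s with h | h <;> omega) (Finset.mem_univ t)
    omega

/-- The span of the products of differences of the `z_t` with tensors with factors of degree `0`
and `1`, of total degree `m`, together with `𝒦` if `m ≥ 2`. -/
def lowFilt (B : Set (Fin d)) (m : ℤ) : Submodule F (TruncR F e d) :=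
  Submodule.span F ({w | ∃ j : ℕ, ∃ z ∈ zSpan F B ^ j, ∃ a, IsLow B (m - 2 * j) a ∧
    w = z * iota F e d (PiTensorProduct.tprod F a)} ∪ {w | 2 ≤ m ∧ w ∈ calK F e d})

theorem pow_le_toSubmodule {R A : Type*} [CommSemiring R] [Semiring A] [Algebra R A]
    {N : Submodule R A} {S : Subalgebra R A} (h : N ≤ Subalgebra.toSubmodule S) (j : ℕ) :
    N ^ j ≤ Subalgebra.toSubmodule S := by
  induction j with
  | zero =>
    rw [pow_zero, Submodule.one_le]
    exact S.one_mem
  | succ j ih =>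
    rw [pow_succ, Submodule.mul_le]
    exact fun a ha b hb => S.mul_mem (ih ha) (h hb)

theorem zSpan_pow_commute {B : Set (Fin d)} {j : ℕ} {z : TruncR F e d} (hz : z ∈ zSpan F B ^ j)
    (x : TPow F (RbarDelta F e) d) : z * iota F e d x = iota F e d x * z := by
  have h1 : zSpan F B ≤ Subalgebra.toSubmodule (Subalgebra.centralizer F {iota F e d x}) := by
    refine Submodule.span_le.2 ?_
    rintro _ ⟨t, -, t', -, rfl⟩
    refine (Subalgebra.mem_centralizer_iff F).2 ?_
    rintro _ rfl
    exact ((zElt_commute_iota t x).sub_left (zElt_commute_iota t' x)).symm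
  have h2 := pow_le_toSubmodule h1 j
  exact ((Subalgebra.mem_centralizer_iff F).1 (h2 hz) _ rfl).symm

theorem zSpan_pow_mem_range {B : Set (Fin d)} {j : ℕ} {z : TruncR F e d} (hz : z ∈ zSpan F B ^ j) :
    ∃ x, iota F e d x = z := by
  have h1 : zSpan F B ≤ Subalgebra.toSubmodule (iotaHom F e d).range := by
    refine Submodule.span_le.2 ?_
    rintro _ ⟨t, -, t', -, rfl⟩
    obtain ⟨x, hx⟩ := zElt_mem_range (F := F) (e := e) t
    obtain ⟨x', hx'⟩ := zElt_mem_range (F := F) (e := e) t'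
    exact ⟨x - x', (map_sub (iota F e d) _ _).trans (by rw [hx, hx'])⟩
  have h2 := pow_le_toSubmodule h1 j
  exact h2 hz

theorem calK_le_lowFilt {B : Set (Fin d)} {m : ℤ} (hm : 2 ≤ m) {x : TruncR F e d}
    (hx : x ∈ calK F e d) : x ∈ lowFilt B m := Submodule.subset_span (Or.inr ⟨hm, hx⟩)

theorem one_mem_lowFilt (B : Set (Fin d)) : (1 : TruncR F e d) ∈ lowFilt B 0 :=
  Submodule.subset_span (Or.inl ⟨0, 1, by rw [pow_zero]; exact Submodule.one_le.1 le_rfl, 1,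
    by simpa using IsLow.one B, by
      rw [one_mul]
      exact iota_one.symm⟩)

theorem iotaAt_mul_mem_lowFilt {B : Set (Fin d)} {m p : ℤ} {t : Fin d} (ht : t ∈ B)
    (hp : p = 0 ∨ p = 1) {x : RbarDelta F e} (hx : x ∈ RbarDelta.deg F e p) {w : TruncR F e d}
    (hw : w ∈ lowFilt B m) : iotaAt F t x * w ∈ lowFilt B (p + m) := by
  refine mul_mem_of_mem_span _ ?_ hw
  rintro _ (⟨j, z, hz, a, ha, rfl⟩ | ⟨hm, hc⟩)
  · rw [← mul_assoc, ← iota_mulSingle, ← zSpan_pow_commute hz, mul_assoc, iota_mulSingle,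
      iotaAt_mul_iota]
    rcases ha.update ht hp hx with h | ⟨h2, hK⟩
    · exact Submodule.subset_span (Or.inl ⟨j, z, hz, _, by rwa [add_sub_assoc], rfl⟩)
    · refine calK_le_lowFilt (by omega) ?_
      obtain ⟨y, rfl⟩ := zSpan_pow_mem_range hz
      refine iota_mul_mem_calK ?_ _
      exact Submodule.mem_map_of_mem (Submodule.subset_span ⟨_, ⟨t, by simpa using hK⟩, rfl⟩)
  · refine calK_le_lowFilt (by omega) ?_
    rw [← iota_mulSingle]
    exact iota_mul_mem_calK hc _

theorem iotaAt_K_mul_mem_lowFilt {B : Set (Fin d)} {m : ℤ} (t : Fin d)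
    {x : RbarDelta F e} (hx : x ∈ Kideal F e) {w : TruncR F e d}
    (hw : w ∈ lowFilt B m) : iotaAt F t x * w ∈ lowFilt B (2 + m) := by
  refine mul_mem_of_mem_span _ ?_ hw
  rintro _ (⟨j, z, hz, a, ha, rfl⟩ | ⟨hm, hc⟩)
  · have := ha.nonneg
    refine calK_le_lowFilt (by omega) ?_
    obtain ⟨y, rfl⟩ := zSpan_pow_mem_range hz
    rw [← iota_mul]
    exact mul_iota_mem_calK (iotaAt_mem_calK t hx) _
  · refine calK_le_lowFilt (by omega) ?_
    rw [← iota_mulSingle]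
    exact iota_mul_mem_calK hc _

theorem zSub_mul_mem_lowFilt {B : Set (Fin d)} {m : ℤ} {t t' : Fin d} (ht : t ∈ B) (ht' : t' ∈ B)
    {w : TruncR F e d} (hw : w ∈ lowFilt B m) : (zElt F t - zElt F t') * w ∈ lowFilt B (2 + m) := by
  have hz0 : zElt F t - zElt F t' ∈ zSpan F (e := e) B := Submodule.subset_span ⟨t, ht, t', ht', rfl⟩
  refine mul_mem_of_mem_span _ ?_ hw
  rintro _ (⟨j, z, hz, a, ha, rfl⟩ | ⟨hm, hc⟩)
  · rw [← mul_assoc]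
    refine Submodule.subset_span (Or.inl ⟨j + 1, _, ?_, a, ?_, rfl⟩)
    · rw [pow_succ']
      exact Submodule.mul_mem_mul hz0 hz
    · convert ha using 1
      push_cast
      ring
  · refine calK_le_lowFilt (by omega) ?_
    rw [← pow_one (zSpan F B)] at hz0
    obtain ⟨y, hy⟩ := zSpan_pow_mem_range hz0
    rw [← hy]
    exact iota_mul_mem_calK hc _

theorem ysub_mul_mem_lowFilt {B : Set (Fin d)} {m : ℤ} {t t' : Fin d} (ht : t ∈ B) (ht' : t' ∈ B)
    (a a' : Fin e) {w : TruncR F e d} (hw : w ∈ lowFilt B m) :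
    (iotaAt F t (yB F a) - iotaAt F t' (yB F a')) * w ∈ lowFilt B (2 + m) := by
  have h : iotaAt F t (yB F a) - iotaAt F t' (yB F a') =
      iotaAt F t (yB F a - yB F ⟨0, NeZero.pos e⟩) - iotaAt F t' (yB F a' - yB F ⟨0, NeZero.pos e⟩) +
        (zElt F t - zElt F t') := by
    rw [zElt_eq, zElt_eq, map_sub, map_sub]
    abel
  rw [h, add_mul, sub_mul]
  exact add_mem (sub_mem (iotaAt_K_mul_mem_lowFilt t (yB_sub_mem _ _) hw)
    (iotaAt_K_mul_mem_lowFilt t' (yB_sub_mem _ _) hw)) (zSub_mul_mem_lowFilt ht ht' hw)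

theorem psi_eB_mul_mem_lowFilt {B : Set (Fin d)} {m : ℤ} {t : Fin d} (ht : t ∈ B) (a : Fin (e - 1))
    (i : Fin e → ZMod e) {w : TruncR F e d} (hw : w ∈ lowFilt B m) :
    iotaAt F t (pB F a * eB F i) * w ∈ lowFilt B (-cartan (i (lo a)) (i (hi a)) + m) := by
  rcases pB_mul_eB_cases F a i with h | ⟨-, ⟨-, h, -⟩ | ⟨-, h, -⟩⟩
  · rw [h, map_zero, zero_mul]
    exact zero_mem _
  all_goals
    refine iotaAt_mul_mem_lowFilt ht (by rw [h]; decide) (pB_mul_eB_mem_deg a i) hw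

theorem proj_blockEq (t : Fin d) (i : Fin e → ZMod e) :
    TruncR.proj F e d (KLR.esum F (blockEq t i)) = iotaAt F t (eB F i) := by
  rw [iotaAt_proj, blockHom, KLR.lift_idem]

theorem iotaAt_mul_proj_idem (t : Fin d) (i : Fin (d * e) → ZMod e) :
    iotaAt F t (eB F (block t i)) * TruncR.proj F e d (KLR.idem F i) =
      TruncR.proj F e d (KLR.idem F i) := by
  classical
  rw [← proj_blockEq, ← proj_mul (Or.inl (CommIdd.esum _)), KLR.esum_mul_idem]
  simp [blockEq]

theorem list_prod_esum {T : Type*} (l : List T) (S : T → Set (Fin (d * e) → ZMod e)) :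
    (l.map fun t => TruncR.proj F e d (KLR.esum F (S t))).prod =
      TruncR.proj F e d (KLR.esum F {k | ∀ t ∈ l, k ∈ S t}) := by
  induction l with
  | nil => simp [KLR.esum_univ, proj_one]
  | cons t l ih =>
    rw [List.map_cons, List.prod_cons, ih, ← proj_mul (Or.inl (CommIdd.esum _)), KLR.esum_mul_esum]
    congr 2
    ext k
    simp

theorem proj_idem_eq_prod (i : Fin (d * e) → ZMod e) : TruncR.proj F e d (KLR.idem F i) =
    ((List.finRange d).map fun t => iotaAt F t (eB F (block t i))).prod := by
  have := list_prod_esum (F := F) (List.finRange d) fun t => blockEq t (block t i)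
  simp only [proj_blockEq] at this
  rw [this, ← KLR.esum_singleton]
  congr 2
  ext k
  simp only [Set.mem_singleton_iff, List.mem_finRange, blockEq, Set.mem_ofPred_eq, true_imp_iff]
  exact ⟨fun h t => by rw [h], fun h => block_ext h⟩

theorem proj_idem_mul_mem_lowFilt (i : Fin (d * e) → ZMod e) {m : ℤ} {w : TruncR F e d}
    (hw : w ∈ lowFilt Set.univ m) : TruncR.proj F e d (KLR.idem F i) * w ∈ lowFilt Set.univ m := by
  rw [proj_idem_eq_prod]
  induction List.finRange d with
  | nil => simpa using hw
  | cons t l ih =>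
    rw [List.map_cons, List.prod_cons, mul_assoc]
    simpa using iotaAt_mul_mem_lowFilt (Set.mem_univ t) (Or.inl rfl) (eB_mem_deg _) ih

theorem proj_y (t : Fin d) (a : Fin e) : TruncR.proj F e d (KLR.y F (pos t a)) = iotaAt F t (yB F a) := by
  rw [iotaAt_proj, blockHom, KLR.lift_y]

theorem proj_psi (t : Fin d) (a : Fin (e - 1)) :
    TruncR.proj F e d (KLR.psi F (posPsi t a)) = iotaAt F t (pB F a) := by
  rw [iotaAt_proj, blockHom, KLR.lift_psi]

theorem CMon.comm {m : ℤ} {c : KLR F e (d * e)} (h : CMon m c) : CommIdd F c := by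
  induction h with
  | one => exact CommIdd.one
  | idem_mul i _ ih => exact (CommIdd.idem i).mul ih
  | ydiff_mul p q _ ih => exact ((CommIdd.y p).sub (CommIdd.y q)).mul ih
  | psi_mul t a i _ ih => exact ((CommIdd.psi t a).mul (CommIdd.idem i)).mul ih

theorem CMon.proj_mem {m : ℤ} {c : KLR F e (d * e)} (h : CMon m c) :
    TruncR.proj F e d c ∈ lowFilt Set.univ m := by
  induction h with
  | one => rw [proj_one]; exact one_mem_lowFilt _
  | idem_mul i _ ih =>
    rw [proj_mul (Or.inl (CommIdd.idem i))]
    exact proj_idem_mul_mem_lowFilt i ih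
  | ydiff_mul p q _ ih =>
    rw [proj_mul (Or.inl ((CommIdd.y p).sub (CommIdd.y q))), map_sub]
    obtain ⟨t, a, rfl⟩ := pos_surj (d := d) (e := e) p
    obtain ⟨t', a', rfl⟩ := pos_surj (d := d) (e := e) q
    rw [proj_y, proj_y]
    exact ysub_mul_mem_lowFilt (Set.mem_univ _) (Set.mem_univ _) _ _ ih
  | psi_mul t a i _ ih =>
    rw [proj_mul (Or.inl ((CommIdd.psi t a).mul (CommIdd.idem i))), proj_mul (Or.inl (CommIdd.psi t a)),
      proj_psi, ← iotaAt_mul_proj_idem t, ← mul_assoc, ← map_mul, mul_assoc, ← pos_lo, ← pos_hi]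
    exact psi_eB_mul_mem_lowFilt (Set.mem_univ t) a (block t i) (proj_idem_mul_mem_lowFilt i ih)

variable (F e) in
/-- The span of the `ι(x_1 ⊗ ⋯ ⊗ x_d)` of degree `m` with all `x_t` of degree `0` or `1`. -/
def lowSpan (d : ℕ) (m : ℤ) : Submodule F (TruncR F e d) :=
  Submodule.span F {w | ∃ a, IsLow Set.univ m a ∧ w = iota F e d (PiTensorProduct.tprod F a)}

theorem lowFilt_le_lowSpan {m : ℤ} (hm : m < 2) :
    lowFilt Set.univ m ≤ lowSpan F e d m := by
  refine Submodule.span_le.2 ?_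
  rintro _ (⟨j, z, hz, a, ha, rfl⟩ | ⟨h, -⟩)
  · have := ha.nonneg
    obtain rfl : j = 0 := by omega
    rw [pow_zero] at hz
    obtain ⟨r, rfl⟩ := Submodule.mem_one.1 hz
    rw [← Algebra.smul_def]
    exact Submodule.smul_mem _ r (Submodule.subset_span ⟨a, by simpa using ha, rfl⟩)
  · omega

theorem lowFilt_two_le :
    lowFilt Set.univ 2 ≤ (lowSpan F e d 2 ⊔ calK F e d) ⊔ zSpan F Set.univ * lowSpan F e d 0 := by
  refine Submodule.span_le.2 ?_
  rintro _ (⟨j, z, hz, a, ha, rfl⟩ | ⟨-, h⟩)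
  · have := ha.nonneg
    obtain rfl | rfl : j = 0 ∨ j = 1 := by omega
    · rw [pow_zero] at hz
      obtain ⟨r, rfl⟩ := Submodule.mem_one.1 hz
      rw [← Algebra.smul_def]
      exact Submodule.mem_sup_left (Submodule.mem_sup_left
        (Submodule.smul_mem _ r (Submodule.subset_span ⟨a, by simpa using ha, rfl⟩)))
    · rw [pow_one] at hz
      exact Submodule.mem_sup_right (Submodule.mul_mem_mul hz
        (Submodule.subset_span ⟨a, by simpa using ha, rfl⟩))
  · exact Submodule.mem_sup_left (Submodule.mem_sup_right h)

theorem IsLow.sum_iota_mem_calS {m : ℤ} {w : TruncR F e d} (hw : w ∈ lowSpan F e d m) :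
    w ∈ (calS F e d).map (iota F e d) := by
  refine (Submodule.span_le.2 ?_ : lowSpan F e d m ≤ _) hw
  rintro _ ⟨a, ⟨p, hp, -, ha, -⟩, rfl⟩
  refine Submodule.mem_map_of_mem (Submodule.subset_span ⟨a, fun t => ?_, rfl⟩)
  rcases hp t with h | h
  · exact Or.inl (h ▸ ha t)
  · exact Or.inr (h ▸ ha t)

end LowTensors

/-! ### Words for block permutations -/

section BlockWords

variable {d e : ℕ}

theorem inv_bperm (u : Equiv.Perm (Fin d)) : inv (bperm e u) =
    (inv u ×ˢ (Finset.univ : Finset (Fin e × Fin e))).image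
      fun q => (pos q.1.1 q.2.1, pos q.1.2 q.2.2) := by
  ext ⟨p, q⟩
  obtain ⟨t, a, rfl⟩ := pos_surj p
  obtain ⟨t', a', rfl⟩ := pos_surj q
  rw [mem_inv, bperm_pos, bperm_pos, pos_lt_pos_iff, pos_lt_pos_iff]
  simp only [Finset.mem_image, Finset.mem_product, Finset.mem_univ, and_true, Prod.exists,
    Prod.mk.injEq, mem_inv]
  constructor
  · rintro ⟨h1, h2⟩
    refine ⟨t, t', a, a', ?_, rfl, rfl⟩
    rcases h1 with h1 | ⟨rfl, h1⟩
    · refine ⟨h1, ?_⟩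
      rcases h2 with h2 | ⟨h2, _⟩
      · exact h2
      · exact absurd (u.injective h2) h1.ne'
    · rcases h2 with h2 | ⟨_, h2⟩
      · exact absurd h2 (lt_irrefl _)
      · exact absurd h1 h2.not_gt
  · rintro ⟨s, s', b, b', ⟨h3, h4⟩, h1, h2⟩
    obtain ⟨rfl, rfl⟩ := pos_inj h1
    obtain ⟨rfl, rfl⟩ := pos_inj h2
    exact ⟨Or.inl h3, Or.inl h4⟩

theorem sum_inv_bperm {M : Type*} [AddCommMonoid M] (u : Equiv.Perm (Fin d))
    (g : Fin (d * e) → Fin (d * e) → M) : ∑ p ∈ inv (bperm e u), g p.1 p.2 =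
      ∑ s ∈ inv u, ∑ a : Fin e, ∑ b : Fin e, g (pos s.1 a) (pos s.2 b) := by
  rw [inv_bperm, Finset.sum_image, Finset.sum_product]
  · simp only [← Finset.univ_product_univ, Finset.sum_product]
  · rintro ⟨⟨s, s'⟩, a, b⟩ _ ⟨⟨t, t'⟩, a', b'⟩ _ h
    simp only [Prod.mk.injEq] at h
    rw [(pos_inj h.1).1, (pos_inj h.1).2, (pos_inj h.2).1, (pos_inj h.2).2]

theorem card_inv_bperm (u : Equiv.Perm (Fin d)) :
    (inv (bperm e u)).card = e * e * (inv u).card := by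
  rw [Finset.card_eq_sum_ones, sum_inv_bperm u fun _ _ => 1]
  simp
  ring

theorem card_inv_simpleT {n : ℕ} (r : Fin (n - 1)) : (inv (simpleT r)).card = 1 := by
  have := card_inv_simpleT_mul (r := r) (v := 1) (by simpa using lo_lt_hi r)
  simpa [inv_one] using this

theorem sum_cartan [NeZero e] [Fact (1 < e)] (c : ZMod e) : ∑ c' : ZMod e, cartan c c' = 0 := by
  have h : ∀ c' : ZMod e, cartan c c' = (if c' = c then 2 else 0) - (if c' = c + 1 then 1 else 0) -
      (if c' = c - 1 then 1 else 0) := fun c' => by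
    have e1 : c' = c - 1 ↔ c = c' + 1 := by
      rw [eq_sub_iff_add_eq]
      exact eq_comm
    have h1 : (1 : ZMod e) ≠ 0 := one_ne_zero
    by_cases hc : c = c'
    · subst hc
      have : c ≠ c - 1 := fun h => h1 (by linear_combination h)
      simp [cartan_self, this]
    · rw [if_neg (Ne.symm hc)]
      simp only [e1]
      rcases cartan_neg_cases hc with ⟨h1, h2⟩ | ⟨h1, h2⟩ | ⟨h1, h2, h3⟩
      · rw [not_or] at h2
        rw [h1, if_neg h2.1, if_neg h2.2]
        rfl
      · have hn : ¬ (c = c' + 1 ∧ c' = c + 1) := by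
          rintro ⟨h3, h4⟩
          have hd : DoubleArrow c c' := ⟨h4, h3⟩
          rw [cartan, if_neg hc, if_pos hd] at h1
          omega
        rw [h1]
        rcases h2 with h2 | h2
        · rw [if_neg fun h => hn ⟨h2, h⟩, if_pos h2]; rfl
        · rw [if_pos h2, if_neg fun h => hn ⟨h, h2⟩]; rfl
      · rw [h1, if_pos h3, if_pos h2]
        rfl
  simp only [h, Finset.sum_sub_distrib, Finset.sum_ite_eq', Finset.mem_univ, if_true]
  rfl

theorem bijective_of_mem_Ialpha [NeZero e] {i : Fin e → ZMod e} (h : i ∈ Ialpha e (mdelta e 1)) :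
    Function.Bijective i :=
  (Fintype.bijective_iff_injective_and_card i).2 ⟨injective_of_mem_Ialpha h, by simp [ZMod.card]⟩

theorem sum_cartan_block [NeZero e] [Fact (1 < e)] {i : Fin e → ZMod e}
    (h : i ∈ Ialpha e (mdelta e 1)) (c : ZMod e) : ∑ b, cartan c (i b) = 0 := by
  rw [(bijective_of_mem_Ialpha h).sum_comp (fun c' => cartan c c'), sum_cartan]

theorem wdeg_bperm [NeZero e] [Fact (1 < e)] {l : List (Fin (d * e - 1))} {u : Equiv.Perm (Fin d)}
    (hl : Red l (bperm e u)) {k : Fin (d * e) → ZMod e} (hk : k ∈ Idd e d) : wdeg l k = 0 := by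
  rw [hl.wdeg_eq, sum_inv_bperm u fun p q => cartan (k p) (k q), neg_eq_zero]
  exact Finset.sum_eq_zero fun s _ => Finset.sum_eq_zero fun a _ => sum_cartan_block (hk s.2) _

/-- The concatenation of the words for the block transpositions in a word. -/
def blockWord (ω : Equiv.Perm (Fin (d * e)) → List (Fin (d * e - 1))) (l : List (Fin (d - 1))) :
    List (Fin (d * e - 1)) := l.flatMap fun r => ω (blockSwap e r)

variable {ω : Equiv.Perm (Fin (d * e)) → List (Fin (d * e - 1))}

theorem blockWord_cons (r : Fin (d - 1)) (l : List (Fin (d - 1))) :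
    blockWord ω (r :: l) = ω (blockSwap e r) ++ blockWord ω l := List.flatMap_cons

theorem wprod_blockWord (hω : ∀ w, Red (ω w) w) (l : List (Fin (d - 1))) :
    wprod (blockWord ω l) = bperm e (wprod l) := by
  induction l with
  | nil => simp [blockWord, bperm_one]
  | cons r l ih => rw [blockWord_cons, wprod_append, (hω _).wprod_eq, ih, wprod_cons, bperm_mul,
      blockSwap_eq]

theorem length_blockWord (hω : ∀ w, Red (ω w) w) (l : List (Fin (d - 1))) :
    (blockWord ω l).length = e * e * l.length := by
  induction l with
  | nil => simp [blockWord]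
  | cons r l ih => 
    rw [blockWord_cons, List.length_append, ih, (hω _).length_eq, blockSwap_eq, card_inv_bperm,
      card_inv_simpleT, List.length_cons]
    ring

theorem red_blockWord (hω : ∀ w, Red (ω w) w) {l : List (Fin (d - 1))} {u : Equiv.Perm (Fin d)}
    (hl : Red l u) : Red (blockWord ω l) (bperm e u) :=
  red_of_length (by rw [wprod_blockWord hω, hl.wprod_eq])
    (by rw [length_blockWord hω, card_inv_bperm, hl.length_eq])

open Classical in
/-- Reduced words that are concatenations of words for block transpositions in the case of block
permutations. -/
def adaptedWord (ω : Equiv.Perm (Fin (d * e)) → List (Fin (d * e - 1)))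
    (ν : Equiv.Perm (Fin d) → List (Fin (d - 1))) (w : Equiv.Perm (Fin (d * e))) :
    List (Fin (d * e - 1)) :=
  if h : ∃ u, w = bperm e u then blockWord ω (ν h.choose) else ω w

theorem adaptedWord_bperm (he : 0 < e) (ν : Equiv.Perm (Fin d) → List (Fin (d - 1)))
    (u : Equiv.Perm (Fin d)) : adaptedWord ω ν (bperm e u) = blockWord ω (ν u) := by
  have h : ∃ v, bperm e u = bperm e v := ⟨u, rfl⟩
  rw [adaptedWord, dif_pos h]
  congr 2
  exact (bperm_injective he h.choose_spec).symm

theorem red_adaptedWord (he : 0 < e) (hω : ∀ w, Red (ω w) w)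
    {ν : Equiv.Perm (Fin d) → List (Fin (d - 1))} (hν : ∀ u, Red (ν u) u)
    (w : Equiv.Perm (Fin (d * e))) : Red (adaptedWord ω ν w) w := by
  by_cases h : ∃ u, w = bperm e u
  · obtain ⟨u, rfl⟩ := h
    rw [adaptedWord_bperm he]
    exact red_blockWord hω (hν u)
  · rw [adaptedWord, dif_neg h]
    exact hω w

end BlockWords

/-! ### Spanning sets of the truncated algebra -/

section Spanning

variable {F : Type*} [Field F] {d e : ℕ} [NeZero e] [Fact (1 < e)]
  {ω : Equiv.Perm (Fin (d * e)) → List (Fin (d * e - 1))}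

theorem CommIdd.psiW {l : List (Fin (d * e - 1))} {u : Equiv.Perm (Fin d)}
    (hl : wprod l = bperm e u) : CommIdd F (psiW F l) := by
  classical
  have hiff : ∀ k, act (bperm e u) k ∈ Idd e d ↔ k ∈ Idd e d := fun k => by
    have : act (bperm e u) k = k ∘ bperm e u⁻¹ := by rw [← bperm_inv]; rfl
    rw [this, mem_Idd_comp_bperm]
  have hk : ∀ k, KLR.esum F (Idd e d) * (KLRTheta.psiW F l * KLR.idem F k) =
      KLRTheta.psiW F l * KLR.esum F (Idd e d) * KLR.idem F k := fun k => by
    rw [psiW_mul_idem, ← mul_assoc, KLR.esum_mul_idem, mul_assoc, KLR.esum_mul_idem, hl]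
    by_cases h : k ∈ Idd e d
    · rw [if_pos h, if_pos ((hiff k).2 h), psiW_mul_idem, hl]
    · rw [if_neg h, if_neg fun h' => h ((hiff k).1 h'), zero_mul, mul_zero]
  rw [CommIdd, ← mul_one (KLR.esum F (Idd e d) * KLRTheta.psiW F l), ← sum_idem, Finset.mul_sum,
    ← mul_one (KLRTheta.psiW F l * KLR.esum F (Idd e d)), ← sum_idem, Finset.mul_sum]
  exact Finset.sum_congr rfl fun k _ => by rw [mul_assoc, hk]

variable (F ω) in
/-- The product of the `σ_r` along a word. -/
def sigmaW (l : List (Fin (d - 1))) : TruncR F e d := (l.map (sigma F ω)).prod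

theorem sigma_eq (r : Fin (d - 1)) : sigma F ω r = TruncR.proj F e d (psiW F (ω (blockSwap e r))) := rfl

theorem CommIdd.sigma (hω : ∀ w, Red (ω w) w) (r : Fin (d - 1)) :
    CommIdd F (KLRTheta.psiW F (ω (blockSwap e r))) := CommIdd.psiW (hω _).wprod_eq

theorem sigmaW_eq (hω : ∀ w, Red (ω w) w) (l : List (Fin (d - 1))) :
    sigmaW F ω l = TruncR.proj F e d (psiW F (blockWord ω l)) := by
  induction l with
  | nil => simp [sigmaW, blockWord, proj_one]
  | cons r l ih =>
    rw [blockWord_cons, psiW_append, proj_mul (Or.inl (CommIdd.sigma hω r)), ← ih, ← sigma_eq]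
    simp [sigmaW]

variable (ω) in
/-- The span of the products of `σ_u` and elements of `lowFilt`. -/
def sigmaSpan (ν : Equiv.Perm (Fin d) → List (Fin (d - 1))) (m : ℤ) : Submodule F (TruncR F e d) :=
  Submodule.span F {w | ∃ u, ∃ y : TruncR F e d, y ∈ lowFilt Set.univ m ∧
    w = sigmaW F ω (ν u) * y}

theorem proj_Dlt_mem (hω : ∀ w, Red (ω w) w) {ν : Equiv.Perm (Fin d) → List (Fin (d - 1))}
    (hν : ∀ u, Red (ν u) u) {L : ℕ} {m : ℤ} {x : KLR F e (d * e)} (hx : x ∈ Dlt F e (d * e) L m) :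
    TruncR.proj F e d x ∈ sigmaSpan ω ν m := by
  have he : 0 < e := NeZero.pos e
  have key : Flt F (adaptedWord ω ν) L m ≤ (sigmaSpan ω ν m).comap (TruncR.proj F e d) := by
    refine Submodule.span_le.2 ?_
    rintro _ ⟨x, hxm, -, k, c, m', hc, hm, rfl⟩
    have hred := red_adaptedWord he hω hν x
    change TruncR.proj F e d _ ∈ sigmaSpan ω ν m
    rw [proj_mul (Or.inr hc.comm)]
    by_cases h : (k ∈ Idd e d ∧ ∀ t, block t k ∈ Iempty1 e) ∧ act x k ∈ Idd e d
    · obtain ⟨⟨hk, hk'⟩, hxk⟩ := h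
      obtain ⟨u, rfl⟩ := exists_bperm he hxm hxk (by
        have : act x k ∘ x = k := by funext p; simp [act]
        rwa [this])
      rw [wdeg_bperm hred hk, zero_add] at hm
      subst hm
      rw [adaptedWord_bperm he,
        proj_mul (Or.inr (CommIdd.idem k)), ← sigmaW_eq hω, mul_assoc]
      exact Submodule.subset_span ⟨u, _, proj_idem_mul_mem_lowFilt k hc.proj_mem, rfl⟩
    · have : TruncR.proj F e d (psiW F (adaptedWord ω ν x) * KLR.idem F k) = 0 := by
        rw [not_and_or] at h
        rcases h with h | h
        · rw [proj_mul (Or.inr (CommIdd.idem k)), proj_idem_eq_zero h, mul_zero]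
        · rw [hred.psiW_mul_idem, proj_mul (Or.inl (CommIdd.idem _)),
            proj_idem_eq_zero fun h' => h h'.1, zero_mul]
      rw [this, zero_mul]
      exact zero_mem _
  exact key (Dlt_le_Flt (red_adaptedWord he hω hν) L m hx)

theorem sigmaSpan_exists_sum {ν : Equiv.Perm (Fin d) → List (Fin (d - 1))} {m : ℤ}
    {x : TruncR F e d} (hx : x ∈ sigmaSpan ω ν m) : ∃ y : Equiv.Perm (Fin d) → TruncR F e d,
      (∀ u, y u ∈ lowFilt Set.univ m) ∧ x = ∑ u, sigmaW F ω (ν u) * y u := by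
  classical
  induction hx using Submodule.span_induction with
  | mem x hx =>
    obtain ⟨u, y, hy, rfl⟩ := hx
    refine ⟨fun v => if v = u then y else 0, fun v => ?_, ?_⟩
    · dsimp only
      split_ifs
      · exact hy
      · exact zero_mem _
    · simp
  | zero => exact ⟨0, fun _ => zero_mem _, by simp⟩
  | add x y _ _ hx hy =>
    obtain ⟨a, ha, rfl⟩ := hx
    obtain ⟨b, hb, rfl⟩ := hy
    exact ⟨a + b, fun u => add_mem (ha u) (hb u), by simp [mul_add, Finset.sum_add_distrib]⟩
  | smul r x _ hx =>
    obtain ⟨a, ha, rfl⟩ := hx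
    exact ⟨r • a, fun u => Submodule.smul_mem _ r (ha u), by simp [Finset.smul_sum]⟩

variable (F) in
/-- The images of the products of crossings, idempotents and differences of degree `m`. -/
def monSpan (d e : ℕ) [NeZero e] (m : ℤ) : Submodule F (TruncR F e d) :=
  Submodule.span F {w | ∃ l x, DMon l m x ∧ w = TruncR.proj F e d x}

theorem DMon.mem_monSpan {l : ℕ} {m : ℤ} {x : KLR F e (d * e)} (h : DMon l m x) :
    TruncR.proj F e d x ∈ monSpan F d e m := Submodule.subset_span ⟨l, x, h, rfl⟩

theorem monSpan_le_sigmaSpan (hω : ∀ w, Red (ω w) w) {ν : Equiv.Perm (Fin d) → List (Fin (d - 1))}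
    (hν : ∀ u, Red (ν u) u) (m : ℤ) : monSpan F d e m ≤ sigmaSpan ω ν m := by
  refine Submodule.span_le.2 ?_
  rintro _ ⟨l, x, hx, rfl⟩
  exact proj_Dlt_mem hω hν (hx.mem_Dlt (Nat.lt_succ_self l))

theorem proj_mul_idem_mul {k : Fin (d * e) → ZMod e} (hk : k ∈ Idd e d) (x y : KLR F e (d * e)) :
    TruncR.proj F e d x * TruncR.proj F e d (KLR.idem F k * y) =
      TruncR.proj F e d (x * (KLR.idem F k * y)) := by
  classical
  have h : edd F e d * Rbar.proj F e d (KLR.idem F k) = Rbar.proj F e d (KLR.idem F k) := by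
    rw [edd, ← map_mul, KLR.esum_mul_idem, if_pos hk]
  apply TruncR.ext
  rw [TruncR.val_mul, TruncR.val_proj, TruncR.val_proj, TruncR.val_proj, map_mul, map_mul, map_mul]
  simp only [mul_assoc]
  rw [← mul_assoc (edd F e d) (edd F e d), edd_mul_edd, 
    ← mul_assoc (edd F e d) (Rbar.proj F e d (KLR.idem F k)), h]

theorem proj_mul_proj (x y : KLR F e (d * e)) : TruncR.proj F e d x * TruncR.proj F e d y =
    open Classical in ∑ k ∈ Finset.univ.filter (· ∈ Idd e d),
      TruncR.proj F e d (x * (KLR.idem F k * y)) := by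
  classical
  have h1 : TruncR.proj F e d y = TruncR.proj F e d (KLR.esum F (Idd e d) * y) := by
    rw [proj_mul (Or.inl (CommIdd.esum _)), proj_esum_Idd, one_mul]
  rw [h1, KLR.esum, Finset.sum_mul, map_sum, Finset.mul_sum]
  exact Finset.sum_congr rfl fun k hk => proj_mul_idem_mul (by simpa using hk) x y

theorem mul_mem_monSpan {m m' : ℤ} {x y : TruncR F e d} (hx : x ∈ monSpan F d e m)
    (hy : y ∈ monSpan F d e m') : x * y ∈ monSpan F d e (m + m') := by
  classical
  refine mul_mem_of_mem_span x ?_ hy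
  rintro _ ⟨l', y, hy, rfl⟩
  refine mem_mul_of_mem_span _ ?_ hx
  rintro _ ⟨l, x, hx, rfl⟩
  rw [proj_mul_proj]
  refine sum_mem fun k _ => ?_
  exact DMon.mem_monSpan (hx.mul (hy.idem_mul k))

theorem one_mem_monSpan : (1 : TruncR F e d) ∈ monSpan F d e 0 := by
  rw [← proj_one]
  exact DMon.mem_monSpan DMon.one

theorem mul_mem_monSpan_of_eq {m m' m'' : ℤ} {x y : TruncR F e d} (hx : x ∈ monSpan F d e m)
    (hy : y ∈ monSpan F d e m') (h : m + m' = m'') : x * y ∈ monSpan F d e m'' :=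
  h ▸ mul_mem_monSpan hx hy

theorem sigma_mem_monSpan (hω : ∀ w, Red (ω w) w) (r : Fin (d - 1)) :
    sigma F ω r ∈ monSpan F d e 0 := by
  classical
  have : sigma F ω r = ∑ k ∈ Finset.univ.filter (fun k => open Classical in k ∈ Idd e d),
      TruncR.proj F e d (psiW F (ω (blockSwap e r)) * KLR.idem F k) := by
    have := proj_mul_proj (psiW F (ω (blockSwap e r))) (1 : KLR F e (d * e))
    rw [proj_one, mul_one] at this
    rw [sigma_eq]
    simpa only [mul_one] using this
  rw [this]
  refine sum_mem fun k hk => ?_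
  have h := (DMon.psiW (F := F) (ω (blockSwap e r)) k).mem_monSpan
  rwa [wdeg_bperm (hω (blockSwap e r)) (by simpa using hk)] at h

theorem iotaAt_mem_monSpan (t : Fin d) {m : ℤ} (hm : m ≤ 1) {a : RbarDelta F e}
    (ha : a ∈ RbarDelta.deg F e m) : iotaAt F t a ∈ monSpan F d e m := by
  have mon : ∀ {m : ℤ} {x : KLR F e e}, IsMonomial F m x → m ≤ 1 →
      iotaAt F t (RbarDelta.proj F e x) ∈ monSpan F d e m := by
    intro m x hx
    have hneg : ∀ {m' : ℤ} {x : KLR F e e}, IsMonomial F m' x → m' < 0 → RbarDelta.proj F e x = 0 :=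
      fun h => (proj_monomial_mem h).1
    induction hx with
    | one => intro _; rw [map_one, map_one]; exact one_mem_monSpan
    | @idem_mul m x i _ ih =>
      intro hm
      rw [map_mul, map_mul]
      refine mul_mem_monSpan_of_eq (m := 0) ?_ (ih hm) (zero_add m)
      rw [iotaAt_proj, blockHom, KLR.lift_idem, KLR.esum, map_sum]
      exact sum_mem fun k _ => (DMon.idem k).mem_monSpan
    | @y_mul m x r hx _ =>
      intro hm
      rw [map_mul, hneg hx (by omega), mul_zero, map_zero]
      exact zero_mem _
    | @psi_mul m x r i hx ih =>
      intro hm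
      rw [map_mul, map_mul (RbarDelta.proj F e) (KLR.psi F r)]
      rcases pB_mul_eB_cases F r i with h | ⟨-, h⟩
      · rw [show RbarDelta.proj F e (KLR.psi F r) * RbarDelta.proj F e (KLR.idem F i) = 0 from h,
          zero_mul, map_zero]
        exact zero_mem _
      · have hc : cartan (i (lo r)) (i (hi r)) ≤ 0 := by
          rcases h with ⟨-, h, -⟩ | ⟨-, h, -⟩ <;> omega
        rw [← map_mul, map_mul (iotaAt F t)]
        refine mul_mem_monSpan ?_ (ih (by omega))
        rw [iotaAt_proj, map_mul, blockHom, KLR.lift_idem, KLR.lift_psi, KLR.esum, Finset.mul_sum,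
          map_sum]
        refine sum_mem fun k hk => ?_
        have hk : k ∈ blockEq t i := by simpa using hk
        rw [← blockEq_lo hk, ← blockEq_hi hk]
        exact (DMon.psi (posPsi t r) k).mem_monSpan
  obtain ⟨x, hx, rfl⟩ := ha
  have : KLR.deg F m ≤ (monSpan F d e m).comap
      ((iotaAt F t).toLinearMap ∘ₗ (RbarDelta.proj F e).toLinearMap) :=
    Submodule.span_le.2 fun x hx => mon hx hm
  exact this hx

end Spanning

/-! ### The embedding of `R_{2e}` at two adjacent blocks -/

section Pair

variable {d e : ℕ}

/-- The blocks `r` and `r + 1`. -/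
def shiftBlk (r : Fin (d - 1)) (t : Fin 2) : Fin d := ⟨t + r, by omega⟩

theorem shiftPos_lt (r : Fin (d - 1)) (p : Fin (2 * e)) : (p : ℕ) + e * r < d * e := by
  have h1 := p.isLt
  have h2 := r.isLt
  have : e * (r + 2) ≤ e * d := Nat.mul_le_mul_left _ (by omega)
  rw [Nat.mul_comm d e]
  rw [Nat.mul_add] at this
  omega

/-- The positions in the blocks `r` and `r + 1`. -/
def shiftPos (r : Fin (d - 1)) (p : Fin (2 * e)) : Fin (d * e) := ⟨p + e * r, shiftPos_lt r p⟩

/-- The crossings in the blocks `r` and `r + 1`. -/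
def shiftPsi (r : Fin (d - 1)) (s : Fin (2 * e - 1)) : Fin (d * e - 1) :=
  ⟨s + e * r, by
    have := shiftPos_lt r (hi s)
    rw [hi_val] at this
    omega⟩

theorem shiftBlk_zero (r : Fin (d - 1)) : shiftBlk r 0 = lo r := Fin.ext (by simp [shiftBlk, lo])
theorem shiftBlk_one (r : Fin (d - 1)) : shiftBlk r 1 = hi r :=
  Fin.ext (by simp [shiftBlk, hi, Nat.add_comm])

theorem shiftPos_lo (r : Fin (d - 1)) (s : Fin (2 * e - 1)) :
    lo (shiftPsi r s) = shiftPos r (lo s) := rfl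

theorem shiftPos_hi (r : Fin (d - 1)) (s : Fin (2 * e - 1)) :
    hi (shiftPsi r s) = shiftPos r (hi s) := by
  ext
  simp [shiftPsi, shiftPos, hi]
  omega

theorem shiftPos_lt_iff (r : Fin (d - 1)) {p q : Fin (2 * e)} :
    shiftPos r p < shiftPos r q ↔ p < q := by
  simp [shiftPos]

theorem shiftPos_injective (r : Fin (d - 1)) : Function.Injective (shiftPos (e := e) r) := by
  intro p q h
  have := congrArg Fin.val h
  simp only [shiftPos] at this
  ext
  omega

theorem shiftPos_pos (r : Fin (d - 1)) (t : Fin 2) (a : Fin e) :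
    shiftPos r (pos t a) = pos (shiftBlk r t) a := by
  ext
  simp [shiftPos, pos, shiftBlk, finProdFinEquiv]
  ring

theorem shiftPsi_posPsi (r : Fin (d - 1)) (t : Fin 2) (a : Fin (e - 1)) :
    shiftPsi r (posPsi t a) = posPsi (shiftBlk r t) a := by
  ext
  simp [shiftPsi, posPsi, shiftBlk]
  ring

theorem simpleT_shift (r : Fin (d - 1)) (s : Fin (2 * e - 1)) (p : Fin (2 * e)) :
    simpleT (shiftPsi r s) (shiftPos r p) = shiftPos r (simpleT s p) := by
  rw [simpleT, simpleT, shiftPos_lo, shiftPos_hi]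
  exact (shiftPos_injective r).swap_apply _ _ _

theorem act_shift {X : Type*} (r : Fin (d - 1)) (s : Fin (2 * e - 1)) (k : Fin (d * e) → X) :
    act (simpleT (shiftPsi r s)) k ∘ shiftPos r = act (simpleT s) (k ∘ shiftPos r) := by
  funext p
  simp only [Function.comp_apply, act_simpleT, simpleT_shift]

theorem wprod_map_shift (r : Fin (d - 1)) (l : List (Fin (2 * e - 1))) (p : Fin (2 * e)) :
    wprod (l.map (shiftPsi r)) (shiftPos r p) = shiftPos r (wprod l p) := by
  induction l with
  | nil => rfl
  | cons s l ih =>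
    rw [List.map_cons, wprod_cons, wprod_cons, Equiv.Perm.mul_apply, Equiv.Perm.mul_apply, ih,
      simpleT_shift]

/-- A reduced word of a permutation with all inversions in two blocks only involves crossings
in these blocks. -/
theorem Red.exists_map_shift {r : Fin (d - 1)} {l : List (Fin (d * e - 1))}
    {w : Equiv.Perm (Fin (d * e))} (h : Red l w)
    (hw : ∀ p q, (p, q) ∈ inv w → ∃ p' q', p = shiftPos (e := e) r p' ∧ q = shiftPos r q') :
    ∃ l', l = l'.map (shiftPsi r) ∧ Red l' (wprod l') := by
  induction h with
  | nil => exact ⟨[], rfl, Red.nil⟩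
  | @cons s l v h hv ih =>
    rw [inv_simpleT_mul hv] at hw
    obtain ⟨l', rfl, hl'⟩ := ih fun p q hpq => hw p q (Finset.mem_insert_of_mem hpq)
    obtain ⟨p, q, hp, hq⟩ := hw _ _ (Finset.mem_insert_self _ _)
    rw [hp, hq, shiftPos_lt_iff] at hv
    have hp' : lo s = shiftPos r (wprod l' p) := by
      rw [← wprod_map_shift, h.wprod_eq, ← hp]
      exact (v.apply_symm_apply _).symm
    have hq' : hi s = shiftPos r (wprod l' q) := by
      rw [← wprod_map_shift, h.wprod_eq, ← hq]
      exact (v.apply_symm_apply _).symm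
    have hpv := congrArg Fin.val hp'
    have hqv := congrArg Fin.val hq'
    simp only [lo_val, hi_val, shiftPos] at hpv hqv
    set s' : Fin (2 * e - 1) := ⟨wprod l' p, by have := (wprod l' q).isLt; omega⟩ with hs'
    have h1 : lo s' = wprod l' p := Fin.ext (by rw [lo_val])
    have h2 : hi s' = wprod l' q := Fin.ext (by rw [hi_val]; simp only [hs']; omega)
    refine ⟨s' :: l', ?_, ?_⟩
    · rw [List.map_cons]
      congr 1
      ext
      simp [shiftPsi, hs']
      omega
    · rw [wprod_cons]
      refine hl'.cons ?_
      rw [h1, h2]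
      simpa using hv

theorem exists_shift_word {r : Fin (d - 1)} {l : List (Fin (d * e - 1))}
    (h : Red l (blockSwap e r)) :
    ∃ l' : List (Fin (2 * e - 1)), l = l'.map (shiftPsi r) ∧ Red l' (blockSwap e (0 : Fin (2 - 1))) := by
  obtain ⟨l', hl, hl'⟩ := h.exists_map_shift (r := r) fun p q hpq => by
    rw [inv_blockSwap] at hpq
    simp only [Finset.mem_image, Finset.mem_univ, true_and, Prod.exists, Prod.mk.injEq] at hpq
    obtain ⟨a, b, rfl, rfl⟩ := hpq
    exact ⟨pos 0 a, pos 1 b, by rw [shiftPos_pos, shiftBlk_zero], by rw [shiftPos_pos, shiftBlk_one]⟩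
  refine ⟨l', hl, ?_⟩
  have : wprod l' = blockSwap e (0 : Fin (2 - 1)) := by
    refine perm_ext_pos fun t a => shiftPos_injective r ?_
    rw [← wprod_map_shift, ← hl, h.wprod_eq, shiftPos_pos, blockSwap_eq, blockSwap_eq, bperm_pos,
      bperm_pos, shiftPos_pos]
    congr 1
    have h0 : (lo (0 : Fin (2 - 1)) : Fin 2) = 0 := rfl
    have h1 : (hi (0 : Fin (2 - 1)) : Fin 2) = 1 := rfl
    fin_cases t
    · change simpleT r (shiftBlk r 0) = shiftBlk r (simpleT 0 (lo (0 : Fin (2 - 1))))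
      rw [shiftBlk_zero, simpleT_lo, simpleT_lo, h1, shiftBlk_one]
    · change simpleT r (shiftBlk r 1) = shiftBlk r (simpleT 0 (hi (0 : Fin (2 - 1))))
      rw [shiftBlk_one, simpleT_hi, simpleT_hi, h0, shiftBlk_zero]
  rwa [← this]

variable (F : Type*) [Field F] [NeZero e]

/-- The sequences with given blocks `r` and `r + 1`. -/
def pairEq (r : Fin (d - 1)) (i : Fin (2 * e) → ZMod e) : Set (Fin (d * e) → ZMod e) :=
  {k | k ∘ shiftPos r = i}

theorem pairEq_lo {r : Fin (d - 1)} {i : Fin (2 * e) → ZMod e} {k : Fin (d * e) → ZMod e}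
    (h : k ∈ pairEq r i) (s : Fin (2 * e - 1)) : k (lo (shiftPsi r s)) = i (lo s) := by
  rw [shiftPos_lo]
  exact congrFun h _

theorem pairEq_act {r : Fin (d - 1)} {i : Fin (2 * e) → ZMod e} (k : Fin (d * e) → ZMod e)
    (s : Fin (2 * e - 1)) : act (simpleT (shiftPsi r s)) k ∈ pairEq r (act (simpleT s) i) ↔
      k ∈ pairEq r i := by
  change _ ∘ shiftPos r = _ ↔ k ∘ shiftPos r = i
  rw [act_shift]
  refine ⟨fun h => ?_, fun h => by rw [h]⟩
  rw [← act_simpleT_act_simpleT s i, ← h, act_simpleT_act_simpleT]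

theorem shiftPsi_val (r : Fin (d - 1)) (s : Fin (2 * e - 1)) :
    (shiftPsi r s : ℕ) = s + e * r := rfl

theorem pairEq_hi {r : Fin (d - 1)} {i : Fin (2 * e) → ZMod e} {k : Fin (d * e) → ZMod e}
    (h : k ∈ pairEq r i) (s : Fin (2 * e - 1)) : k (hi (shiftPsi r s)) = i (hi s) := by
  rw [shiftPos_hi]
  exact congrFun h _

theorem sum_esum_pairEq (r : Fin (d - 1)) :
    ∑ i : Fin (2 * e) → ZMod e, KLR.esum F (pairEq (e := e) r i) = 1 := by
  classical
  have h : ∀ i : Fin (2 * e) → ZMod e, KLR.esum F (pairEq (e := e) r i) =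
      ∑ k : Fin (d * e) → ZMod e, if k ∘ shiftPos r = i then KLR.idem F k else 0 := fun i => by
    rw [KLR.esum, Finset.sum_filter]
    exact Finset.sum_congr rfl fun _ _ => if_congr Iff.rfl rfl rfl
  simp only [h]
  rw [Finset.sum_comm]
  simp only [Finset.sum_ite_eq, Finset.mem_univ, if_true]
  exact sum_idem

/-- The embedding of `R_{2e}` into `R_{de}` at the blocks `r` and `r + 1`. -/
def pairHom (r : Fin (d - 1)) : KLR F e (2 * e) →ₐ[F] KLR F e (d * e) :=
  KLR.lift F (fun i => KLR.esum F (pairEq r i)) (fun a => KLR.y F (shiftPos r a))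
    (fun s => KLR.psi F (shiftPsi r s)) (by
    intro a b h
    have hpp : ∀ s s' : Fin (2 * e - 1), (s' : ℕ) = s + 1 → (shiftPsi r s' : ℕ) = shiftPsi r s + 1 :=
      fun s s' h => by rw [shiftPsi_val, shiftPsi_val, h]; omega
    induction h with
    | idem i => exact KLR.isIdempotentElem_esum _
    | orth i j h =>
      rw [KLR.esum_mul_esum, ← KLR.esum_empty]
      congr 1
      exact Set.eq_empty_of_forall_notMem fun k hk =>
        h ((show k ∘ shiftPos r = i from hk.1).symm.trans hk.2)
    | sum_one => exact sum_esum_pairEq F r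
    | y_idem r i => exact KLR.y_mul_esum _ _
    | psi_idem s i =>
      exact KLR.psi_mul_esum _ _ _ fun k => (pairEq_act k s).symm
    | y_y r s => exact KLR.rel F (KLRRel.y_y _ _)
    | psi_psi s s' h =>
      refine KLR.rel F (KLRRel.psi_psi _ _ ?_)
      rw [shiftPsi_val, shiftPsi_val]
      omega
    | psi_y s p h h' =>
      refine KLR.rel F (KLRRel.psi_y _ _ ?_ ?_)
      · rw [shiftPos_lo]; exact fun h1 => h (shiftPos_injective r h1)
      · rw [shiftPos_hi]; exact fun h1 => h' (shiftPos_injective r h1)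
    | psi_y_eq s i h =>
      refine KLR.mul_esum_congr fun k hk => ?_
      rw [← shiftPos_lo, ← shiftPos_hi]
      exact KLR.rel F (KLRRel.psi_y_eq _ _ (by rw [pairEq_lo hk, pairEq_hi hk, h]))
    | psi_y_ne s i h =>
      refine KLR.mul_esum_congr fun k hk => ?_
      rw [← shiftPos_lo, ← shiftPos_hi]
      exact KLR.rel F (KLRRel.psi_y_ne _ _ (by rwa [pairEq_lo hk, pairEq_hi hk]))
    | y_psi_eq s i h =>
      refine KLR.mul_esum_congr fun k hk => ?_
      rw [← shiftPos_lo, ← shiftPos_hi]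
      exact KLR.rel F (KLRRel.y_psi_eq _ _ (by rw [pairEq_lo hk, pairEq_hi hk, h]))
    | y_psi_ne s i h =>
      refine KLR.mul_esum_congr fun k hk => ?_
      rw [← shiftPos_lo, ← shiftPos_hi]
      exact KLR.rel F (KLRRel.y_psi_ne _ _ (by rwa [pairEq_lo hk, pairEq_hi hk]))
    | psi_sq s i =>
      refine KLR.mul_esum_congr fun k hk => ?_
      rw [← shiftPos_lo, ← shiftPos_hi, ← pairEq_lo hk, ← pairEq_hi hk]
      exact KLR.rel F (KLRRel.psi_sq _ _)
    | braid_arrow s s' i h h1 h2 =>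
      refine KLR.mul_esum_congr fun k hk => ?_
      rw [← pairEq_lo hk, ← pairEq_hi hk] at h1 h2
      exact KLR.rel F (KLRRel.braid_arrow _ _ _ (hpp s s' h) h1 h2)
    | braid_arrow' s s' i h h1 h2 =>
      refine KLR.mul_esum_congr fun k hk => ?_
      rw [← pairEq_lo hk, ← pairEq_hi hk] at h1 h2
      exact KLR.rel F (KLRRel.braid_arrow' _ _ _ (hpp s s' h) h1 h2)
    | braid_double s s' i h h1 h2 =>
      refine KLR.mul_esum_congr fun k hk => ?_
      rw [← pairEq_lo hk, ← pairEq_hi hk] at h1 h2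
      rw [← shiftPos_lo, ← shiftPos_hi, ← shiftPos_hi]
      exact KLR.rel F (KLRRel.braid_double _ _ _ (hpp s s' h) h1 h2)
    | braid_other s s' i h h1 =>
      refine KLR.mul_esum_congr fun k hk => ?_
      rw [← pairEq_lo hk, ← pairEq_hi hk, ← pairEq_hi hk] at h1
      exact KLR.rel F (KLRRel.braid_other _ _ _ (hpp s s' h) h1))

theorem pairHom_esum (r : Fin (d - 1)) (S : Set (Fin (2 * e) → ZMod e)) :
    pairHom F r (KLR.esum F S) = KLR.esum F {k | k ∘ shiftPos r ∈ S} := by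
  classical
  rw [KLR.esum, map_sum]
  have hmem : ∀ i k, k ∈ pairEq (e := e) r i ↔ k ∘ shiftPos r = i := fun _ _ => Iff.rfl
  simp only [pairHom, KLR.lift_idem, KLR.esum, hmem, Set.mem_ofPred_eq]
  rw [← Finset.sum_fiberwise_of_maps_to
    (s := Finset.univ.filter fun k : Fin (d * e) → ZMod e => k ∘ shiftPos r ∈ S)
    (t := Finset.univ.filter (· ∈ S)) (g := fun k => k ∘ shiftPos r) (by simp)]
  refine Finset.sum_congr rfl fun i hi => Finset.sum_congr ?_ fun _ _ => rfl
  ext k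
  simp only [Finset.mem_filter, Finset.mem_univ, true_and] at hi ⊢
  exact ⟨fun h => ⟨h ▸ hi, h⟩, fun h => h.2⟩

theorem phi_eq_esum {n : ℕ} (r : Fin (n - 1)) : phi (e := e) F r =
    (KLR.psi F r * KLR.y F (lo r) - KLR.y F (lo r) * KLR.psi F r) *
        KLR.esum F {i | i (lo r) = i (hi r)} +
      KLR.psi F r * KLR.esum F {i | ¬ i (lo r) = i (hi r)} := by
  classical
  rw [phi, KLR.esum, KLR.esum, Finset.mul_sum, Finset.mul_sum,
    ← Finset.sum_filter_add_sum_filter_not Finset.univ fun i : Fin n → ZMod e => i (lo r) = i (hi r)]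
  congr 1
  · refine Finset.sum_congr (by ext; simp) fun i hi => ?_
    rw [if_pos (by simpa using hi)]
  · refine Finset.sum_congr (by ext; simp) fun i hi => ?_
    rw [if_neg (by simpa using hi)]

theorem pairHom_phi (r : Fin (d - 1)) (s : Fin (2 * e - 1)) :
    pairHom F r (phi F s) = phi F (shiftPsi r s) := by
  rw [phi_eq_esum, phi_eq_esum]
  simp only [map_add, map_mul, map_sub, pairHom_esum]
  simp only [pairHom, KLR.lift_psi, KLR.lift_y, shiftPos_hi, shiftPos_lo]
  rfl

variable {F}

/-- The product of the differences of the `y` for the crossings of equal residues in a word. -/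
def ydiffW {n : ℕ} (k : Fin n → ZMod e) : List (Fin (n - 1)) → KLR F e n
  | [] => 1
  | r :: l => (if k ((wprod l)⁻¹ (lo r)) = k ((wprod l)⁻¹ (hi r)) then
      KLR.y F ((wprod l)⁻¹ (lo r)) - KLR.y F ((wprod l)⁻¹ (hi r)) else 1) * ydiffW k l

/-- The number of crossings of equal residues in a word. -/
def eqCross {n : ℕ} (k : Fin n → ZMod e) : List (Fin (n - 1)) → ℕ
  | [] => 0
  | r :: l => (if k ((wprod l)⁻¹ (lo r)) = k ((wprod l)⁻¹ (hi r)) then 1 else 0) + eqCross k l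

theorem Red.eqCross_eq {n : ℕ} {l : List (Fin (n - 1))} {w : Equiv.Perm (Fin n)} (h : Red l w)
    (k : Fin n → ZMod e) : eqCross k l = ∑ p ∈ inv w, if k p.1 = k p.2 then 1 else 0 := by
  induction h with
  | nil => simp [eqCross, inv_one]
  | @cons r l v h hr ih =>
    rw [eqCross, ih, inv_simpleT_mul hr, Finset.sum_insert (notMem_inv r v), h.wprod_eq]

theorem ydiffW_dmon {n : ℕ} (k : Fin n → ZMod e) (l : List (Fin (n - 1))) :
    DMon 0 (2 * eqCross k l) (ydiffW (F := F) k l) := by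
  induction l with
  | nil => exact DMon.one
  | cons r l ih =>
    rw [ydiffW, eqCross]
    split_ifs
    · have := ih.ydiff_mul ((wprod l)⁻¹ (lo r)) ((wprod l)⁻¹ (hi r))
      refine this.cast rfl ?_
      push_cast
      ring
    · rw [one_mul, zero_add]
      exact ih

theorem ydiffW_mul_idem {n : ℕ} (k i : Fin n → ZMod e) (l : List (Fin (n - 1))) :
    ydiffW (F := F) k l * KLR.idem F i = KLR.idem F i * ydiffW k l := by
  induction l with
  | nil => simp [ydiffW]
  | cons r l ih =>
    rw [ydiffW, mul_assoc, ih, ← mul_assoc, ← mul_assoc]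
    congr 1
    split_ifs
    · rw [sub_mul, mul_sub, y_mul_idem, y_mul_idem]
    · rw [one_mul, mul_one]

theorem phi_mul_idem_eq {n : ℕ} (r : Fin (n - 1)) {i : Fin n → ZMod e} (h : i (lo r) = i (hi r)) :
    phi F r * KLR.idem F i = (KLR.psi F r * (KLR.y F (lo r) - KLR.y F (hi r)) + 1) * KLR.idem F i := by
  classical
  have h1 := KLR.rel F (KLRRel.psi_y_eq r i h)
  rw [phi_eq_esum, add_mul, mul_assoc, KLR.esum_mul_idem, mul_assoc, KLR.esum_mul_idem, 
    if_pos (show i ∈ {i : Fin n → ZMod e | i (lo r) = i (hi r)} from h),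
    if_neg (show ¬ i ∈ {i : Fin n → ZMod e | ¬ i (lo r) = i (hi r)} from not_not.2 h), mul_zero, add_zero, mul_sub, add_mul, sub_mul, sub_mul, h1, add_mul]
  abel

theorem phi_mul_idem_ne {n : ℕ} (r : Fin (n - 1)) {i : Fin n → ZMod e} (h : i (lo r) ≠ i (hi r)) :
    phi F r * KLR.idem F i = KLR.psi F r * KLR.idem F i := by
  classical
  rw [phi_eq_esum, add_mul, mul_assoc, KLR.esum_mul_idem, mul_assoc, KLR.esum_mul_idem, 
    if_neg (show ¬ i ∈ {i : Fin n → ZMod e | i (lo r) = i (hi r)} from h),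
    if_pos (show i ∈ {i : Fin n → ZMod e | ¬ i (lo r) = i (hi r)} from h), mul_zero, zero_add]

theorem phiW_mul_idem_sub_mem [Fact (1 < e)] {n : ℕ} (l : List (Fin (n - 1))) (k : Fin n → ZMod e) :
    (l.map (phi F)).prod * KLR.idem F k = KLR.idem F (act (wprod l) k) * ((l.map (phi F)).prod * KLR.idem F k) ∧
    (l.map (phi F)).prod * KLR.idem F k - psiW F l * (ydiffW k l * KLR.idem F k) ∈
      Dlt F e n l.length (wdeg l k + 2 * eqCross k l) := by
  induction l with
  | nil => simp [ydiffW, act_one, idem_mul_self]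
  | cons r l ih =>
    obtain ⟨ih1, ih2⟩ := ih
    set k' := act (wprod l) k with hk'
    set A := (l.map (phi F)).prod * KLR.idem F k with hA
    set Y := ydiffW (F := F) k l with hY
    have hlo : k ((wprod l)⁻¹ (lo r)) = k' (lo r) := rfl
    have hhi : k ((wprod l)⁻¹ (hi r)) = k' (hi r) := rfl
    have hprod : ((r :: l).map (phi F)).prod * KLR.idem F k = phi F r * KLR.idem F k' * A := by
      rw [List.map_cons, List.prod_cons, mul_assoc, ← hA, mul_assoc, ← ih1]
    have hW : psiW F l * (Y * KLR.idem F k) = KLR.idem F k' * (psiW F l * (Y * KLR.idem F k)) := by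
      rw [ydiffW_mul_idem, ← mul_assoc, psiW_mul_idem]
      simp only [← mul_assoc]
      rw [idem_mul_self]
    rw [hprod, psiW_cons, wprod_cons, ← act_act, ← hk', ydiffW, eqCross, wdeg, hlo, hhi, ← hk', ← hY,
      List.length_cons]
    by_cases h : k' (lo r) = k' (hi r)
    · rw [if_pos h, if_pos h, phi_mul_idem_eq r h, h, cartan_self]
      have hp : KLR.psi F r * KLR.idem F k' = KLR.idem F k' * KLR.psi F r := by
        rw [psi_mul_idem]
        congr 2
        funext p
        rw [act_simpleT, simpleT]
        by_cases h1 : p = lo r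
        · rw [h1, Equiv.swap_apply_left, h]
        by_cases h2 : p = hi r
        · rw [h2, Equiv.swap_apply_right, h]
        · rw [Equiv.swap_apply_of_ne_of_ne h1 h2]
      have hk2 : act (simpleT r) k' = k' := by
        funext p
        rw [act_simpleT, simpleT]
        by_cases h1 : p = lo r
        · rw [h1, Equiv.swap_apply_left, h]
        by_cases h2 : p = hi r
        · rw [h2, Equiv.swap_apply_right, h]
        · rw [Equiv.swap_apply_of_ne_of_ne h1 h2]
      have hY2 := ydiffW_dmon (F := F) k l
      have hYk := ydiffW_mul_idem (F := F) k k l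
      have e1 := y_mul_psiW_sub_mem (F := F) (lo r) l k
      have e2 := y_mul_psiW_sub_mem (F := F) (hi r) l k
      have e6 := ((DMon.psiW (F := F) l k).mul hY2).mem_Dlt (Nat.lt_succ_self _)
      have hya : KLR.y F (lo r) * KLR.idem F k' = KLR.idem F k' * KLR.y F (lo r) := y_mul_idem _ _
      have hyb : KLR.y F (hi r) * KLR.idem F k' = KLR.idem F k' * KLR.y F (hi r) := y_mul_idem _ _
      have hWe := psiW_mul_idem_eq (F := F) l k
      have hza : KLR.y F ((wprod l)⁻¹ (lo r)) * KLR.idem F k = KLR.idem F k * KLR.y F ((wprod l)⁻¹ (lo r)) :=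
        y_mul_idem _ _
      have hzb : KLR.y F ((wprod l)⁻¹ (hi r)) * KLR.idem F k = KLR.idem F k * KLR.y F ((wprod l)⁻¹ (hi r)) :=
        y_mul_idem _ _
      have hee : KLR.idem F k' * KLR.idem F k' = KLR.idem F k' := idem_mul_self k'
      have e3 := (DMon.psi (F := F) r k').mul_mem_Dlt (hY2.mem_Dlt_mul (Submodule.sub_mem _ e1 e2))
      have e4 := ((DMon.psi (F := F) r k').mul (DMon.ydiff (lo r) (hi r))).mul_mem_Dlt ih2
      have e5 := Dlt_mono (Nat.le_succ _) _ ih2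
      rw [← hk'] at hWe
      rw [h, cartan_self] at e3 e4
      rw [hk2]
      clear_value A
      rw [← hY] at hY2 hYk e3 e6
      clear_value Y
      clear hlo hhi hprod hA hk2 e1 e2
      refine ⟨?_, ?_⟩
      · generalize (KLR.y F (lo r) : KLR F e n) = a at *
        generalize (KLR.y F (hi r) : KLR F e n) = b at *
        generalize (KLR.psi F r : KLR F e n) = P at *
        generalize KLR.idem F k' = E at *
        have : (P * (a - b) + 1) * E = E * (P * (a - b) + 1) := by
          simp only [add_mul, mul_add, mul_sub, sub_mul, mul_assoc, hya, hyb, one_mul, mul_one]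
          rw [← mul_assoc P E, ← mul_assoc P E, hp]
          simp only [mul_assoc]
        rw [this, ← mul_assoc, ← mul_assoc, hee]
      · generalize (KLR.y F (lo r) : KLR F e n) = a at *
        generalize (KLR.y F (hi r) : KLR F e n) = b at *
        generalize (KLR.y F ((wprod l)⁻¹ (lo r)) : KLR F e n) = a' at *
        generalize (KLR.y F ((wprod l)⁻¹ (hi r)) : KLR F e n) = b' at *
        have key : (KLR.psi F r * (a - b) + 1) * KLR.idem F k' * A -
            KLR.psi F r * psiW F l * ((a' - b') * Y * KLR.idem F k) =
            KLR.psi F r * KLR.idem F k' * (a - b) * (A - psiW F l * (Y * KLR.idem F k)) +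
            KLR.psi F r * KLR.idem F k' * ((a * (psiW F l * KLR.idem F k) - psiW F l * a' * KLR.idem F k -
              (b * (psiW F l * KLR.idem F k) - psiW F l * b' * KLR.idem F k)) * Y) +
            (A - psiW F l * (Y * KLR.idem F k)) + psiW F l * KLR.idem F k * Y := by
          generalize (psiW F l : KLR F e n) = W at *
          generalize (KLR.psi F r : KLR F e n) = P at *
          generalize KLR.idem F k' = E at *
          generalize KLR.idem F k = G at *
          have hW' : ∀ x, W * (G * x) = E * (W * (G * x)) := fun x => by
            rw [← mul_assoc W, ← mul_assoc E, ← hWe]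
          have h1 : ∀ x, a * (E * x) = E * (a * x) := fun x => by rw [← mul_assoc, hya, mul_assoc]
          have h2 : ∀ x, b * (E * x) = E * (b * x) := fun x => by rw [← mul_assoc, hyb, mul_assoc]
          have h5 : E * (a * A) = a * A := by rw [← h1, ← ih1]
          have h6 : E * (b * A) = b * A := by rw [← h2, ← ih1]
          have h3 : ∀ x, a' * (G * x) = G * (a' * x) := fun x => by rw [← mul_assoc, hza, mul_assoc]
          have h4 : ∀ x, b' * (G * x) = G * (b' * x) := fun x => by rw [← mul_assoc, hzb, mul_assoc]
          simp only [add_mul, mul_sub, sub_mul, mul_assoc, one_mul, ← ih1, hYk, h3, h4,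
            hza, hzb, ← hW', h5, h6]
          abel
        rw [key]
        refine Submodule.add_mem _ (Submodule.add_mem _ (Submodule.add_mem _ ?_ ?_) ?_) ?_
        · convert e4 using 2 <;> push_cast <;> ring
        · convert e3 using 2 <;> push_cast <;> ring
        · convert e5 using 2 <;> push_cast <;> ring
        · convert e6 using 2 <;> push_cast <;> ring
    · rw [if_neg h, if_neg h, phi_mul_idem_ne r h, one_mul, zero_add]
      refine ⟨?_, ?_⟩
      · rw [psi_mul_idem, mul_assoc (KLR.idem F _) _ A, ← mul_assoc (KLR.idem F _) (KLR.idem F _),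
          idem_mul_self]
      · have e1 : KLR.psi F r * KLR.idem F k' * A - KLR.psi F r * psiW F l * (Y * KLR.idem F k) =
            KLR.psi F r * KLR.idem F k' * (A - psiW F l * (Y * KLR.idem F k)) := by
          rw [mul_sub, mul_assoc _ (psiW F l), hW]
          simp only [mul_assoc]
          rw [← mul_assoc (KLR.idem F k') (KLR.idem F k'), idem_mul_self]
        rw [e1]
        have := (DMon.psi (F := F) r k').mul_mem_Dlt ih2
        rw [add_assoc, add_comm _ 1]
        exact this

end Pair

/-! ### The existence of `τ_r` and `ε_r` -/

section Existence

variable {F : Type*} [Field F] {d e : ℕ} [NeZero e] [Fact (1 < e)]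

theorem esum_pairEq (r : Fin (d - 1)) (i : Fin (2 * e) → ZMod e) :
    KLR.esum F (pairEq r i) = KLR.esum F (blockEq (lo r) (block 0 i)) *
      KLR.esum F (blockEq (hi r) (block 1 i)) := by
  rw [KLR.esum_mul_esum]
  congr 1
  ext k
  change k ∘ shiftPos r = i ↔ block (lo r) k = block 0 i ∧ block (hi r) k = block 1 i
  have h0 : ∀ a, (k ∘ shiftPos r) (pos 0 a) = k (pos (lo r) a) := fun a => by
    rw [Function.comp_apply, shiftPos_pos, shiftBlk_zero]
  have h1 : ∀ a, (k ∘ shiftPos r) (pos 1 a) = k (pos (hi r) a) := fun a => by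
    rw [Function.comp_apply, shiftPos_pos, shiftBlk_one]
  constructor
  · rintro rfl
    exact ⟨funext fun a => (h0 a).symm, funext fun a => (h1 a).symm⟩
  · rintro ⟨h2, h3⟩
    refine block_ext fun t => funext fun a => ?_
    fin_cases t
    · exact (h0 a).trans (congrFun h2 a)
    · exact (h1 a).trans (congrFun h3 a)

theorem lo_mem_pair (r : Fin (d - 1)) : lo r ∈ ({lo r, hi r} : Set (Fin d)) := by simp
theorem hi_mem_pair (r : Fin (d - 1)) : hi r ∈ ({lo r, hi r} : Set (Fin d)) := by simp

theorem proj_esum_pairEq_mul_mem {r : Fin (d - 1)} (i : Fin (2 * e) → ZMod e) {m : ℤ}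
    {w : TruncR F e d} (hw : w ∈ lowFilt {lo r, hi r} m) :
    TruncR.proj F e d (KLR.esum F (pairEq r i)) * w ∈ lowFilt {lo r, hi r} m := by
  rw [esum_pairEq, proj_mul (Or.inl (CommIdd.esum _)), proj_blockEq, proj_blockEq, mul_assoc]
  have h1 := iotaAt_mul_mem_lowFilt (t := hi r) (hi_mem_pair r) (Or.inl rfl)
    (eB_mem_deg (F := F) (block 1 i)) hw
  have h2 := iotaAt_mul_mem_lowFilt (t := lo r) (lo_mem_pair r) (Or.inl rfl)
    (eB_mem_deg (F := F) (block 0 i)) h1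
  rwa [zero_add, zero_add] at h2

theorem proj_esum_pairEq_eq_zero {r : Fin (d - 1)} {i : Fin (2 * e) → ZMod e}
    (h : ¬ (i ∈ Idd e 2 ∧ ∀ t, block t i ∈ Iempty1 e)) :
    TruncR.proj F e d (KLR.esum F (pairEq r i)) = 0 := by
  refine proj_esum_eq_zero fun k hk hk1 hk2 => h ?_
  have hb : ∀ t, block t i = block (shiftBlk r t) k := fun t => by
    rw [← (show k ∘ shiftPos r = i from hk)]
    funext a
    exact congrArg k (shiftPos_pos r t a)
  exact ⟨fun t => by rw [hb]; exact hk1 _, fun t => by rw [hb]; exact hk2 _⟩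

theorem pairHom_idem (r : Fin (d - 1)) (i : Fin (2 * e) → ZMod e) :
    pairHom F r (KLR.idem F i) = KLR.esum F (pairEq r i) := by
  rw [pairHom, KLR.lift_idem]

theorem pairHom_y (r : Fin (d - 1)) (p : Fin (2 * e)) :
    pairHom F r (KLR.y F p) = KLR.y F (shiftPos r p) := by
  rw [pairHom, KLR.lift_y]

theorem pairHom_psi (r : Fin (d - 1)) (s : Fin (2 * e - 1)) :
    pairHom F r (KLR.psi F s) = KLR.psi F (shiftPsi r s) := by
  rw [pairHom, KLR.lift_psi]

theorem pairHom_y_zero (r : Fin (d - 1)) (a : Fin e) :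
    pairHom F r (KLR.y F (pos 0 a)) = KLR.y F (pos (lo r) a) := by
  rw [pairHom_y, shiftPos_pos, shiftBlk_zero]

theorem pairHom_y_one (r : Fin (d - 1)) (a : Fin e) :
    pairHom F r (KLR.y F (pos 1 a)) = KLR.y F (pos (hi r) a) := by
  rw [pairHom_y, shiftPos_pos, shiftBlk_one]

theorem shiftBlk_mem (r : Fin (d - 1)) (t : Fin 2) : shiftBlk r t ∈ ({lo r, hi r} : Set (Fin d)) := by
  fin_cases t
  · exact Or.inl (shiftBlk_zero r)
  · exact Or.inr (shiftBlk_one r)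

theorem pairHom_psiW (r : Fin (d - 1)) (l : List (Fin (2 * e - 1))) :
    pairHom F r (psiW F l) = psiW F (l.map (shiftPsi r)) := by
  induction l with
  | nil => simp [psiW]
  | cons s l ih => rw [List.map_cons, psiW_cons, psiW_cons, map_mul, ih, pairHom_psi]

theorem CMon.comm_pairHom (r : Fin (d - 1)) {m : ℤ} {c : KLR F e (2 * e)} (h : CMon m c) :
    CommIdd F (pairHom F r c) := by
  induction h with
  | one => rw [map_one]; exact CommIdd.one
  | idem_mul i _ ih => rw [map_mul, pairHom_idem]; exact (CommIdd.esum _).mul ih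
  | ydiff_mul p q _ ih =>
    rw [map_mul, map_sub, pairHom_y, pairHom_y]
    exact ((CommIdd.y _).sub (CommIdd.y _)).mul ih
  | psi_mul t a i _ ih =>
    rw [map_mul, map_mul, pairHom_idem, pairHom_psi, shiftPsi_posPsi]
    exact ((CommIdd.psi _ _).mul (CommIdd.esum _)).mul ih

theorem block_eq_of_pairEq {r : Fin (d - 1)} (i : Fin (2 * e) → ZMod e) (t : Fin 2) :
    TruncR.proj F e d (KLR.esum F (pairEq r i)) = iotaAt F (shiftBlk r t) (eB F (block t i)) *
      TruncR.proj F e d (KLR.esum F (pairEq r i)) := by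
  rw [← proj_blockEq, ← proj_mul (Or.inl (CommIdd.esum _)), KLR.esum_mul_esum]
  congr 2
  symm
  refine Set.inter_eq_right.2 fun k hk => ?_
  change block _ k = _
  rw [← (show k ∘ shiftPos r = i from hk)]
  funext a
  exact (congrArg k (shiftPos_pos r t a)).symm

theorem CMon.proj_pairHom_mem (r : Fin (d - 1)) {m : ℤ} {c : KLR F e (2 * e)} (h : CMon m c) :
    TruncR.proj F e d (pairHom F r c) ∈ lowFilt {lo r, hi r} m := by
  induction h with
  | one => rw [map_one, proj_one]; exact one_mem_lowFilt _
  | idem_mul i h ih =>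
    rw [map_mul, pairHom_idem, proj_mul (Or.inl (CommIdd.esum _))]
    exact proj_esum_pairEq_mul_mem i ih
  | ydiff_mul p q h ih =>
    obtain ⟨t, a, rfl⟩ := pos_surj p
    obtain ⟨t', a', rfl⟩ := pos_surj q
    rw [map_mul, map_sub, pairHom_y, pairHom_y,
      proj_mul (Or.inl ((CommIdd.y _).sub (CommIdd.y _))), map_sub, shiftPos_pos, shiftPos_pos,
      proj_y, proj_y]
    exact ysub_mul_mem_lowFilt (shiftBlk_mem r t) (shiftBlk_mem r t') a a' ih
  | psi_mul t a i h ih =>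
    rw [map_mul (pairHom F r), map_mul (pairHom F r), pairHom_idem, pairHom_psi, shiftPsi_posPsi,
      proj_mul (Or.inl ((CommIdd.psi _ _).mul (CommIdd.esum _))), proj_mul (Or.inl (CommIdd.psi _ _)),
      proj_psi, block_eq_of_pairEq i t, ← mul_assoc, ← map_mul (iotaAt F _), mul_assoc, ← pos_lo, ← pos_hi]
    exact psi_eB_mul_mem_lowFilt (shiftBlk_mem r t) a (block t i) (proj_esum_pairEq_mul_mem i ih)

theorem proj_pairHom_Dlt_mem (r : Fin (d - 1)) {L : ℕ} (hL : L ≤ e * e) {m : ℤ}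
    {x : KLR F e (2 * e)} (hx : x ∈ Dlt F e (2 * e) L m) :
    TruncR.proj F e d (pairHom F r x) ∈ lowFilt {lo r, hi r} m := by
  have he : 0 < e := NeZero.pos e
  choose ω hω using fun w : Equiv.Perm (Fin (2 * e)) => exists_red w
  have key : Flt F ω L m ≤ (lowFilt {lo r, hi r} m).comap
      (TruncR.proj F e d ∘ₗ (pairHom F r).toLinearMap) := by
    refine Submodule.span_le.2 ?_
    rintro _ ⟨x, hxm, hlen, k, c, m', hc, hm, rfl⟩
    have hred := hω x
    change TruncR.proj F e d (pairHom F r _) ∈ lowFilt {lo r, hi r} m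
    by_cases h : (k ∈ Idd e 2 ∧ ∀ t, block t k ∈ Iempty1 e) ∧ act x k ∈ Idd e 2
    · obtain ⟨⟨hk, hk'⟩, hxk⟩ := h
      obtain ⟨u, rfl⟩ := exists_bperm he hxm hxk (by
        have : act x k ∘ x = k := by funext p; simp [act]
        rwa [this])
      have h0 : (inv u).card = 0 := by
        rw [hred.length_eq, card_inv_bperm] at hlen
        by_contra h0
        have := Nat.mul_le_mul_left (e * e) (Nat.one_le_iff_ne_zero.2 h0)
        omega
      have hnil : ω (bperm e u) = [] := by
        rw [← List.length_eq_zero_iff, hred.length_eq, card_inv_bperm, h0, mul_zero]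
      rw [hnil] at hm ⊢
      rw [wdeg, zero_add] at hm
      subst hm
      rw [psiW, List.map_nil, List.prod_nil, one_mul]
      exact (CMon.idem_mul k hc).proj_pairHom_mem r
    · have : TruncR.proj F e d (pairHom F r (psiW F (ω x) * KLR.idem F k)) = 0 := by
        rw [not_and_or] at h
        rcases h with h | h
        · rw [map_mul, pairHom_idem, proj_mul (Or.inr (CommIdd.esum _)), proj_esum_pairEq_eq_zero h,
            mul_zero]
        · rw [hred.psiW_mul_idem, map_mul, pairHom_idem, proj_mul (Or.inl (CommIdd.esum _)),
            proj_esum_pairEq_eq_zero fun h' => h h'.1, zero_mul]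
      rw [map_mul, proj_mul (Or.inr (hc.comm_pairHom r)), this, zero_mul]
      exact zero_mem _
  exact key (Dlt_le_Flt hω L m hx)

/-- The difference `z_r - z_{r+1}`. -/
abbrev zDiff (F : Type*) [Field F] (e : ℕ) [NeZero e] (r : Fin (d - 1)) : TruncR F e d :=
  zElt F (lo r) - zElt F (hi r)

theorem zDiff_commute_iota (r : Fin (d - 1)) (x : TPow F (RbarDelta F e) d) :
    Commute (zDiff F e r) (iota F e d x) :=
  (zElt_commute_iota _ _).sub_left (zElt_commute_iota _ _)

theorem zDiff_mem_range (r : Fin (d - 1)) : ∃ x, iota F e d x = zDiff F e r := by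
  obtain ⟨x, hx⟩ := zElt_mem_range (F := F) (e := e) (lo r)
  obtain ⟨y, hy⟩ := zElt_mem_range (F := F) (e := e) (hi r)
  exact ⟨x - y, by rw [map_sub, hx, hy]⟩

theorem zDiff_pow_mem_range (r : Fin (d - 1)) (j : ℕ) : ∃ x, iota F e d x = zDiff F e r ^ j := by
  obtain ⟨x, hx⟩ := zDiff_mem_range (F := F) (e := e) r
  exact ⟨x ^ j, by rw [← hx]; exact map_pow (iotaHom F e d) x j⟩

theorem ydiffW_sub_mem_calK (r : Fin (d - 1)) (k : Fin (2 * e) → ZMod e) {l : List (Fin (2 * e - 1))}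
    {w : Equiv.Perm (Fin (2 * e))} (hl : Red l w)
    (hw : ∀ p ∈ inv w, ∃ a b, p = (pos 0 a, pos 1 b)) :
    CommIdd F (pairHom F r (ydiffW k l)) ∧
    TruncR.proj F e d (pairHom F r (ydiffW k l)) - zDiff F e r ^ eqCross k l ∈ calK F e d := by
  induction hl with
  | nil =>
    rw [ydiffW, eqCross, map_one, proj_one, pow_zero, sub_self]
    exact ⟨CommIdd.one, zero_mem _⟩
  | @cons s l v h hr ih =>
    rw [inv_simpleT_mul hr] at hw
    obtain ⟨ih1, ih2⟩ := ih fun p hp => hw p (Finset.mem_insert_of_mem hp)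
    obtain ⟨a, b, hab⟩ := hw _ (Finset.mem_insert_self _ _)
    obtain ⟨ha, hb⟩ := Prod.mk.inj hab
    rw [ydiffW, eqCross, h.wprod_eq, ha, hb]
    by_cases hk : k (pos 0 a) = k (pos 1 b)
    · rw [if_pos hk, if_pos hk]
      have hc := (CommIdd.y (F := F) (pos (lo r) a)).sub (CommIdd.y (pos (hi r) b))
      rw [map_mul, map_sub, pairHom_y_zero, pairHom_y_one]
      refine ⟨hc.mul ih1, ?_⟩
      rw [proj_mul (Or.inl hc), map_sub, proj_y, proj_y, add_comm, pow_succ']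
      have e1 : (iotaAt F (lo r) (yB F a) - iotaAt F (hi r) (yB F b) : TruncR F e d) =
          zDiff F e r + (iotaAt F (lo r) (yB F a - yB F ⟨0, NeZero.pos e⟩) -
            iotaAt F (hi r) (yB F b - yB F ⟨0, NeZero.pos e⟩)) := by
        rw [zDiff, zElt_eq, zElt_eq, map_sub, map_sub]
        abel
      have e2 : (iotaAt F (lo r) (yB F a - yB F ⟨0, NeZero.pos e⟩) -
            iotaAt F (hi r) (yB F b - yB F ⟨0, NeZero.pos e⟩) : TruncR F e d) ∈ calK F e d :=
        Submodule.sub_mem _ (iotaAt_mem_calK _ (yB_sub_mem _ _)) (iotaAt_mem_calK _ (yB_sub_mem _ _))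
      rw [e1]
      generalize iotaAt F (lo r) (yB F a - yB F ⟨0, NeZero.pos e⟩) -
            iotaAt F (hi r) (yB F b - yB F ⟨0, NeZero.pos e⟩) = κ at e2
      generalize TruncR.proj F e d (pairHom F r (ydiffW k l)) = X at ih2
      have e3 : (zDiff F e r + κ) * X - zDiff F e r * zDiff F e r ^ eqCross k l =
          zDiff F e r * (X - zDiff F e r ^ eqCross k l) + κ * (X - zDiff F e r ^ eqCross k l) +
            κ * zDiff F e r ^ eqCross k l := by noncomm_ring
      rw [e3]
      obtain ⟨x, hx⟩ := zDiff_mem_range (F := F) (e := e) r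
      obtain ⟨y, hy⟩ := zDiff_pow_mem_range (F := F) (e := e) r (eqCross k l)
      obtain ⟨z, -, hz⟩ := id e2
      refine Submodule.add_mem _ (Submodule.add_mem _ ?_ ?_) ?_
      · have := iota_mul_mem_calK ih2 x
        rwa [hx] at this
      · have := iota_mul_mem_calK ih2 z
        rwa [hz] at this
      · have := mul_iota_mem_calK e2 y
        rwa [hy] at this
    · rw [if_neg hk, if_neg hk, one_mul, zero_add]
      exact ⟨ih1, ih2⟩

theorem eqCross_blockSwap {k : Fin (2 * e) → ZMod e} (hk : k ∈ Idd e 2) {l : List (Fin (2 * e - 1))}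
    (hl : Red l (blockSwap e (0 : Fin (2 - 1)))) : eqCross k l = e := by
  classical
  rw [hl.eqCross_eq, blockSwap_eq, sum_inv_bperm (simpleT (0 : Fin (2 - 1)))
    (fun p q => if k p = k q then 1 else 0)]
  have h1 : inv (simpleT (0 : Fin (2 - 1))) = {((0 : Fin 2), (1 : Fin 2))} := by
    rw [← mul_one (simpleT _), inv_simpleT_mul (by decide), inv_one]
    rfl
  rw [h1, Finset.sum_singleton]
  have hb := bijective_of_mem_Ialpha (hk 1)
  have h2 : ∀ a : Fin e, ∑ b : Fin e, (if k (pos 0 a) = k (pos 1 b) then 1 else 0) = 1 := fun a => by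
    obtain ⟨b, hb1⟩ := hb.2 (k (pos 0 a))
    have hb1 : k (pos 1 b) = k (pos 0 a) := hb1
    rw [Finset.sum_eq_single b]
    · rw [if_pos hb1.symm]
    · intro b' _ hne
      rw [if_neg fun h => hne (hb.1 (h.symm.trans hb1.symm))]
    · simp
  rw [Finset.sum_congr rfl fun a _ => h2 a]
  simp

theorem lowFilt_pair_le (r : Fin (d - 1)) {w : TruncR F e d}
    (hw : w ∈ lowFilt {lo r, hi r} (2 * e)) : ∃ x ∈ (calSr F r 0).map (iota F e d),
      ∃ y ∈ (calSr F r 2).map (iota F e d),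
        w - (x * zDiff F e r ^ e + y * zDiff F e r ^ (e - 1)) ∈ calJ F e d := by
  have he : 1 < e := Fact.out
  have hz : zSpan F {lo r, hi r} ≤ Submodule.span F {zDiff F e r} := by
    refine Submodule.span_le.2 ?_
    have h1 := Submodule.mem_span_singleton_self (R := F) (zDiff F e r)
    rintro _ ⟨t, rfl | ht, t', rfl | ht', rfl⟩
    · rw [sub_self]; exact zero_mem _
    · rw [Set.mem_singleton_iff.1 ht']; exact h1
    · rw [Set.mem_singleton_iff.1 ht, ← neg_sub]; exact Submodule.neg_mem _ h1
    · rw [Set.mem_singleton_iff.1 ht, Set.mem_singleton_iff.1 ht', sub_self]; exact zero_mem _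
  have hlow : ∀ {m : ℤ} {a : Fin d → RbarDelta F e}, IsLow {lo r, hi r} m a →
      (m = 0 ∨ m = 1 ∨ m = 2) ∧ PiTensorProduct.tprod F a ∈ calSr F r m := by
    rintro m a ⟨p, hp, rfl, ha, hB⟩
    have hne : lo r ≠ hi r := fun h => by
      have := congrArg Fin.val h
      simp [lo, hi] at this
    have hsum : ∑ t, p t = p (lo r) + p (hi r) := by
      rw [← Finset.sum_pair hne]
      symm
      refine Finset.sum_subset (Finset.subset_univ _) fun t _ ht => (hB t ?_).2
      simpa using ht
    rw [hsum]
    refine ⟨by have := hp (lo r); have := hp (hi r); omega, Submodule.subset_span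
      ⟨a, p (lo r), p (hi r), hp _, hp _, rfl, ha _, ha _, fun t h1 h2 => (hB t ?_).1, rfl⟩⟩
    simp [h1, h2]
  induction hw using Submodule.span_induction with
  | mem w hw =>
    rcases hw with ⟨j, z, hzj, a, ha, rfl⟩ | ⟨-, hw⟩
    · have h2 : zSpan F {lo r, hi r} ^ j ≤ Submodule.span F {zDiff F e r ^ j} := by
        refine (pow_le_pow_left' hz j).trans ?_
        rw [Submodule.span_pow, Set.singleton_pow]
      obtain ⟨c, rfl⟩ := Submodule.mem_span_singleton.1 (h2 hzj)
      obtain ⟨h3, h4⟩ := hlow ha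
      have h5 : (c • zDiff F e r ^ j) * iota F e d (PiTensorProduct.tprod F a) =
          iota F e d (c • PiTensorProduct.tprod F a) * zDiff F e r ^ j := by
        rw [map_smul, smul_mul_assoc, smul_mul_assoc, ((zDiff_commute_iota r _).pow_left j).eq]
      have h6 : (j = e ∧ (2 : ℤ) * e - 2 * j = 0) ∨ (j = e - 1 ∧ (2 : ℤ) * e - 2 * j = 2) := by omega
      rw [h5]
      rcases h6 with ⟨rfl, h6⟩ | ⟨rfl, h6⟩
      · rw [h6] at h4
        exact ⟨_, Submodule.mem_map_of_mem (Submodule.smul_mem _ c h4), 0, zero_mem _, by simp⟩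
      · rw [h6] at h4
        exact ⟨0, zero_mem _, _, Submodule.mem_map_of_mem (Submodule.smul_mem _ c h4), by simp⟩
    · exact ⟨0, zero_mem _, 0, zero_mem _, by
        rw [zero_mul, zero_mul, add_zero, sub_zero]
        exact Submodule.subset_span hw⟩
  | zero => exact ⟨0, zero_mem _, 0, zero_mem _, by simp⟩
  | add w w' _ _ h h' =>
    obtain ⟨x, hx, y, hy, h⟩ := h
    obtain ⟨x', hx', y', hy', h'⟩ := h'
    refine ⟨_, add_mem hx hx', _, add_mem hy hy', ?_⟩
    convert add_mem h h' using 1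
    rw [add_mul, add_mul]
    abel
  | smul c w _ h =>
    obtain ⟨x, hx, y, hy, h⟩ := h
    refine ⟨_, Submodule.smul_mem _ c hx, _, Submodule.smul_mem _ c hy, ?_⟩
    have := Submodule.smul_mem ((calJ F e d).restrictScalars F) c h
    rwa [smul_sub, smul_add, ← smul_mul_assoc, ← smul_mul_assoc] at this

theorem pairHom_phiW_mem {ω : Equiv.Perm (Fin (d * e)) → List (Fin (d * e - 1))} (r : Fin (d - 1))
    {l : List (Fin (2 * e - 1))} (hl : Red l (blockSwap e (0 : Fin (2 - 1))))
    (hl' : ω (blockSwap e r) = l.map (shiftPsi r)) (k : Fin (2 * e) → ZMod e) :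
    TruncR.proj F e d (pairHom F r ((l.map (phi F)).prod * KLR.idem F k)) -
      sigma F ω r * zDiff F e r ^ e * TruncR.proj F e d (KLR.esum F (pairEq r k)) ∈
        lowFilt {lo r, hi r} (2 * e) ⊔ (calJ F e d).restrictScalars F := by
  by_cases hk : k ∈ Idd e 2
  · have hdeg : wdeg l k = 0 := by
      rw [blockSwap_eq] at hl
      exact wdeg_bperm hl hk
    have hcr := eqCross_blockSwap hk hl
    have hlen : l.length = e * e := by
      rw [hl.length_eq, blockSwap_eq, card_inv_bperm, card_inv_simpleT, mul_one]
    have h1 := (phiW_mul_idem_sub_mem (F := F) l k).2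
    rw [hdeg, hcr, zero_add] at h1
    have h2 := proj_pairHom_Dlt_mem r hlen.le h1
    obtain ⟨hc, h3⟩ := ydiffW_sub_mem_calK (F := F) r k hl (fun p hp => by
      rw [inv_blockSwap] at hp
      simp only [Finset.mem_image, Finset.mem_univ, true_and, Prod.exists] at hp
      obtain ⟨a, b, rfl⟩ := hp
      exact ⟨a, b, rfl⟩)
    rw [hcr] at h3
    rw [map_sub, map_sub] at h2
    have h4 : TruncR.proj F e d (pairHom F r (psiW F l * (ydiffW k l * KLR.idem F k))) =
        sigma F ω r * TruncR.proj F e d (pairHom F r (ydiffW k l)) *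
          TruncR.proj F e d (KLR.esum F (pairEq r k)) := by
      rw [map_mul, map_mul (pairHom F r) (ydiffW k l), pairHom_idem,
        proj_mul (Or.inr (hc.mul (CommIdd.esum _))), proj_mul (Or.inl hc), pairHom_psiW, ← hl',
        ← sigma_eq, mul_assoc]
    obtain ⟨x, hx⟩ : ∃ x, iota F e d x = TruncR.proj F e d (KLR.esum F (pairEq r k)) := by
      rw [esum_pairEq, proj_mul (Or.inl (CommIdd.esum _)), proj_blockEq, proj_blockEq,
        ← iota_mulSingle, ← iota_mulSingle, ← iota_mul]
      exact ⟨_, rfl⟩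
    have h5 := mul_iota_mem_calK h3 x
    rw [hx] at h5
    have h6 : sigma F ω r * ((TruncR.proj F e d (pairHom F r (ydiffW k l)) - zDiff F e r ^ e) *
        TruncR.proj F e d (KLR.esum F (pairEq r k))) ∈ calJ F e d :=
      (calJ F e d).smul_mem _ (Submodule.subset_span h5)
    refine Submodule.mem_sup.2 ⟨_, h2, _, h6, ?_⟩
    rw [h4]
    noncomm_ring
  · have h0 := proj_esum_pairEq_eq_zero (F := F) (r := r) (i := k) fun h => hk h.1
    rw [map_mul, pairHom_idem, proj_mul (Or.inr (CommIdd.esum _)), h0, mul_zero, mul_zero, sub_zero]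
    exact zero_mem _

theorem exists_isTau {ω : Equiv.Perm (Fin (d * e)) → List (Fin (d * e - 1))}
    (hω : ∀ w, Red (ω w) w) (r : Fin (d - 1)) : ∃ τ ε : TruncR F e d, IsTau F ω r τ ε := by
  obtain ⟨l, hl', hl⟩ := exists_shift_word (hω (blockSwap e r))
  have h1 : phiBlock F ω r - sigma F ω r * zDiff F e r ^ e ∈
      lowFilt {lo r, hi r} (2 * e) ⊔ (calJ F e d).restrictScalars F := by
    have h2 : phiBlock F ω r - sigma F ω r * zDiff F e r ^ e = ∑ k : Fin (2 * e) → ZMod e,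
        (TruncR.proj F e d (pairHom F r ((l.map (phi F)).prod * KLR.idem F k)) -
          sigma F ω r * zDiff F e r ^ e * TruncR.proj F e d (KLR.esum F (pairEq r k))) := by
      rw [Finset.sum_sub_distrib, ← map_sum, ← map_sum, ← Finset.mul_sum, sum_idem, mul_one,
        ← Finset.mul_sum, ← map_sum, sum_esum_pairEq, proj_one, mul_one, map_list_prod, List.map_map,
        phiBlock, hl', List.map_map]
      congr 4
      funext s
      exact (pairHom_phi F r s).symm
    rw [h2]
    exact Submodule.sum_mem _ fun k _ => pairHom_phiW_mem r hl hl' k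
  obtain ⟨w, hw, j, hj, hwj⟩ := Submodule.mem_sup.1 h1
  obtain ⟨x, hx, y, hy, hxy⟩ := lowFilt_pair_le r hw
  refine ⟨sigma F ω r + x, y, ⟨by rwa [add_sub_cancel_left], hy, ?_⟩⟩
  have := add_mem hxy (show j ∈ calJ F e d from hj)
  convert this using 1
  rw [← sub_eq_zero] at hwj
  rw [← sub_eq_zero, ← neg_eq_zero, ← hwj]
  noncomm_ring

end Existence

/-! ### The action of `τ_r` -/

section Action

variable {F : Type*} [Field F] {d e : ℕ} [NeZero e] {k : Type*} [CommRing k] [Algebra F k]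
  (W : TwistData d k) [Fact (1 < e)]

theorem Psi_eq_zero_of_calK {x : TruncR F e d} (hx : x ∈ calK F e d) : Psi F W x = 0 := by
  obtain ⟨x, hx, rfl⟩ := hx
  have hK : ∀ (t : Fin d), ∀ a ∈ Kideal F e, Psi F W (iotaAt F t a) = 0 := fun t a ha => by
    induction ha using Submodule.span_induction with
    | mem x hx =>
      obtain ⟨p, q, rfl⟩ := hx
      exact Psi_iotaAt_y_sub F W t p q
    | zero => rw [map_zero, map_zero]
    | add x y _ _ hx hy => rw [map_add, map_add, hx, hy, add_zero]
    | smul b x _ hx => rw [smul_eq_mul, map_mul, map_mul, hx, mul_zero]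
  induction hx using Submodule.span_induction with
  | mem x hx =>
    obtain ⟨a, ⟨t, ht⟩, rfl⟩ := hx
    rw [iota_tprod, map_list_prod]
    exact List.prod_eq_zero (List.mem_map.2 ⟨_, List.mem_ofFn.2 ⟨t, rfl⟩, hK t _ ht⟩)
  | zero => rw [map_zero, map_zero]
  | add x y _ _ hx hy => rw [map_add, map_add, hx, hy, add_zero]
  | smul c x _ hx => rw [map_smul, map_smul, hx, smul_zero]

theorem Psi_eq_zero_of_calJ {x : TruncR F e d} (hx : x ∈ calJ F e d) : Psi F W x = 0 := by
  induction hx using Submodule.span_induction with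
  | mem x hx => exact Psi_eq_zero_of_calK W hx
  | zero => rw [map_zero]
  | add x y _ _ hx hy => rw [map_add, hx, hy, add_zero]
  | smul b x _ hx => rw [smul_eq_mul, map_mul, hx, mul_zero]

/-- The elements that act diagonally. -/
def diagAlg : Subalgebra F (TruncR F e d) where
  carrier := {x | ∃ c : Equiv.Perm (Fin d) → Lam F k (RbarDelta F e) d,
    ∀ f v, Psi F W x f v = c v * f v}
  mul_mem' := by
    rintro x y ⟨c, hc⟩ ⟨c', hc'⟩
    exact ⟨fun v => c v * c' v, fun f v => by rw [map_mul, Module.End.mul_apply, hc, hc', mul_assoc]⟩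
  add_mem' := by
    rintro x y ⟨c, hc⟩ ⟨c', hc'⟩
    exact ⟨fun v => c v + c' v, fun f v => by
      rw [map_add, LinearMap.add_apply, Pi.add_apply, hc, hc', add_mul]⟩
  algebraMap_mem' r := ⟨fun _ => algebraMap F _ r, fun f v => by
    rw [AlgHom.commutes, Module.algebraMap_end_apply, Pi.smul_apply, Algebra.smul_def]⟩

/-- The value at `1` of the image of the delta function at `1`. -/
def ev (x : TruncR F e d) : Lam F k (RbarDelta F e) d := Psi F W x (Pi.single 1 1) 1

theorem ev_add (x y : TruncR F e d) : ev W (x + y) = ev W x + ev W y := by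
  simp [ev]

theorem ev_smul (c : F) (x : TruncR F e d) : ev W (c • x) = c • ev W x := by
  simp [ev]

theorem ev_zero : ev W (0 : TruncR F e d) = 0 := by simp [ev]

theorem ev_one : ev W (1 : TruncR F e d) = 1 := by simp [ev]

variable {W}

theorem Psi_apply_one {x : TruncR F e d} (hx : x ∈ diagAlg W)
    (f : Equiv.Perm (Fin d) → Lam F k (RbarDelta F e) d) : Psi F W x f 1 = ev W x * f 1 := by
  obtain ⟨c, hc⟩ := hx
  rw [ev, hc, hc, Pi.single_eq_same, mul_one]

theorem Psi_single {x : TruncR F e d} (hx : x ∈ diagAlg W) :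
    Psi F W x (Pi.single 1 1) = Pi.single (1 : Equiv.Perm (Fin d)) (ev W x) := by
  obtain ⟨c, hc⟩ := hx
  funext v
  rw [hc, ev, hc]
  by_cases h : v = 1
  · subst h; simp
  · simp [h]

theorem ev_mul {x : TruncR F e d} (hx : x ∈ diagAlg W) (y : TruncR F e d) :
    ev W (x * y) = ev W x * ev W y := by
  rw [ev, map_mul, Module.End.mul_apply, Psi_apply_one hx]
  rfl

theorem calK_le_diagAlg {x : TruncR F e d} (hx : x ∈ calK F e d) : x ∈ diagAlg W :=
  ⟨0, fun f v => by rw [Psi_eq_zero_of_calK W hx]; simp⟩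

theorem iotaAt_mem_diagAlg (t : Fin d) {m : ℤ} (hm : m ≤ 1) {a : RbarDelta F e}
    (ha : a ∈ RbarDelta.deg F e m) : iotaAt F t a ∈ diagAlg W :=
  ⟨_, fun f v => Psi_iotaAt F W t hm ha f v⟩

theorem zElt_mem_diagAlg (t : Fin d) : (zElt F t : TruncR F e d) ∈ diagAlg W :=
  ⟨_, fun f v => Psi_zElt F W t f v⟩

theorem iota_mem_diagAlg {a : Fin d → RbarDelta F e} {p : Fin d → ℤ} (hp : ∀ t, p t ≤ 1)
    (ha : ∀ t, a t ∈ RbarDelta.deg F e (p t)) : iota F e d (PiTensorProduct.tprod F a) ∈ diagAlg W := by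
  rw [iota_tprod]
  refine Subalgebra.list_prod_mem _ fun x hx => ?_
  obtain ⟨t, rfl⟩ := List.mem_ofFn.1 hx
  exact iotaAt_mem_diagAlg t (hp t) (ha t)

theorem tprod_eq_list_prod {A : Type*} [Ring A] [Algebra F A] (a : Fin d → A) :
    (List.ofFn fun t => PiTensorProduct.tprod F (Pi.mulSingle (M := fun _ => A) t (a t))).prod =
      PiTensorProduct.tprod F a := by
  have h : ∀ x : Fin d → A, PiTensorProduct.tprod F x = PiTensorProduct.tprodMonoidHom F x := fun _ => rfl
  have h2 : (List.ofFn fun t => Pi.mulSingle (M := fun _ => A) t (a t)).prod = a := by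
    funext s
    rw [Pi.list_prod_apply, List.map_ofFn]
    have : ((fun f : Fin d → A => f s) ∘ fun t => Pi.mulSingle (M := fun _ => A) t (a t)) =
        Pi.mulSingle s (a s) := by
      funext t
      by_cases h : t = s
      · subst h; simp
      · rw [Function.comp_apply, Pi.mulSingle_eq_of_ne (Ne.symm h), Pi.mulSingle_eq_of_ne h]
    rw [this, list_prod_ofFn_mulSingle]
  conv_rhs => rw [← h2, h, map_list_prod, List.map_ofFn]
  rfl

theorem ev_iotaAt (t : Fin d) {m : ℤ} (hm : m ≤ 1) {a : RbarDelta F e}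
    (ha : a ∈ RbarDelta.deg F e m) : ev W (iotaAt F t a) =
      Lam.mk F (tpow (W.θ t) m) (PiTensorProduct.tprod F (Pi.mulSingle (M := fun _ => RbarDelta F e) t a)) := by
  rw [ev, Psi_iotaAt F W t hm ha, Pi.single_eq_same, mul_one, _root_.inv_one, Equiv.Perm.one_apply, emb_tmul]

theorem ev_iota {a : Fin d → RbarDelta F e} {p : Fin d → ℤ} (hp : ∀ t, p t ≤ 1)
    (ha : ∀ t, a t ∈ RbarDelta.deg F e (p t)) : ev W (iota F e d (PiTensorProduct.tprod F a)) =
      Lam.mk F (∏ t, tpow (W.θ t) (p t)) (PiTensorProduct.tprod F a) := by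
  rw [iota_tprod, ← List.prod_ofFn, ← tprod_eq_list_prod a, List.ofFn_eq_map, List.ofFn_eq_map,
    List.ofFn_eq_map]
  induction List.finRange d with
  | nil => simp only [List.map_nil, List.prod_nil, ev_one, Lam.mk_one]
  | cons t l ih =>
    simp only [List.map_cons, List.prod_cons]
    rw [ev_mul (iotaAt_mem_diagAlg t (hp t) (ha t)), ih, ev_iotaAt t (hp t) (ha t), Lam.mk_mul_mk]

theorem prod_tpow {θ : k} (hθ : θ * θ = 0) {p : Fin d → ℤ} (hp : ∀ t, 0 ≤ p t) (s : Finset (Fin d)) :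
    ∏ t ∈ s, tpow θ (p t) = tpow θ (∑ t ∈ s, p t) := by
  classical
  induction s using Finset.induction_on with
  | empty => simp [tpow]
  | insert t s h ih =>
    rw [Finset.prod_insert h, Finset.sum_insert h, ih,
      tpow_add hθ (hp t) (Finset.sum_nonneg fun t _ => hp t)]

theorem lowSpan_le_diagAlg {m : ℤ} {w : TruncR F e d} (hw : w ∈ lowSpan F e d m) : w ∈ diagAlg W := by
  refine (Submodule.span_le.2 ?_ : lowSpan F e d m ≤ Subalgebra.toSubmodule (diagAlg W)) hw
  rintro _ ⟨a, ⟨p, hp, -, ha, -⟩, rfl⟩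
  exact iota_mem_diagAlg (fun t => by rcases hp t with h | h <;> omega) ha

theorem exists_ev_eq {θ : k} (hθ2 : θ * θ = 0) (hθ : ∀ t, W.θ t = θ) {m : ℤ} {w : TruncR F e d} (hw : w ∈ lowSpan F e d m) :
    ∃ x, iota F e d x = w ∧ ev W w = Lam.mk F (tpow θ m) x := by
  induction hw using Submodule.span_induction with
  | mem w hw =>
    obtain ⟨a, ⟨p, hp, rfl, ha, -⟩, rfl⟩ := hw
    refine ⟨_, rfl, ?_⟩
    rw [ev_iota (fun t => by rcases hp t with h | h <;> omega) ha]
    simp only [hθ]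
    rw [prod_tpow hθ2 fun t => by rcases hp t with h | h <;> omega]
  | zero => exact ⟨0, map_zero _, by rw [ev_zero, map_zero]⟩
  | add w w' _ _ h h' =>
    obtain ⟨x, hx, hx'⟩ := h
    obtain ⟨y, hy, hy'⟩ := h'
    exact ⟨x + y, by rw [map_add, hx, hy], by rw [ev_add, hx', hy', map_add]⟩
  | smul c w _ h =>
    obtain ⟨x, hx, hx'⟩ := h
    exact ⟨c • x, by rw [map_smul, hx], by rw [ev_smul, hx', map_smul]⟩

theorem exists_ev_eq_zSpan {θ : k} (hθ2 : θ * θ = 0) (hθ : ∀ t, W.θ t = θ) {w : TruncR F e d}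
    (hw : w ∈ zSpan F Set.univ * lowSpan F e d 0) : w ∈ diagAlg W ∧ ∃ x : Fin d → TPow F (RbarDelta F e) d,
      w = ∑ t, zElt F t * iota F e d (x t) ∧ ev W w = ∑ t, Lam.mk F (W.z t) (x t) := by
  classical
  have hz : zSpan F Set.univ ≤ Submodule.span F (Set.range (zElt F : Fin d → TruncR F e d)) := by
    refine Submodule.span_le.2 ?_
    rintro _ ⟨t, -, t', -, rfl⟩
    exact Submodule.sub_mem _ (Submodule.subset_span ⟨t, rfl⟩) (Submodule.subset_span ⟨t', rfl⟩)
  have hevz : ∀ t, ev W (zElt F t : TruncR F e d) = Lam.mk F (W.z t) 1 := fun t => by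
    rw [ev, Psi_zElt, Pi.single_eq_same, mul_one, _root_.inv_one]
    rfl
  induction hw using Submodule.mul_induction_on' with
  | mem_mul_mem z hzm y hy =>
    have hyd := lowSpan_le_diagAlg (W := W) hy
    obtain ⟨x, rfl, hx⟩ := exists_ev_eq hθ2 hθ hy
    have h := hz hzm
    clear hzm
    induction h using Submodule.span_induction with
    | mem z hz =>
      obtain ⟨t, rfl⟩ := hz
      refine ⟨mul_mem (zElt_mem_diagAlg t) hyd, Pi.single t x, ?_, ?_⟩
      · rw [Finset.sum_eq_single t]
        · simp
        · intro s _ hs; simp [hs]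
        · simp
      · rw [Finset.sum_eq_single t]
        · rw [ev_mul (zElt_mem_diagAlg t), hevz, hx, Pi.single_eq_same, Lam.mk_mul_mk, one_mul]
          simp [tpow]
        · intro s _ hs; simp [hs]
        · simp
    | zero => rw [zero_mul]; exact ⟨zero_mem _, 0, by simp, by simp [ev_zero]⟩
    | add z z' _ _ h h' =>
      obtain ⟨h0, x1, h1, h2⟩ := h
      obtain ⟨h0', x1', h1', h2'⟩ := h'
      rw [add_mul]
      exact ⟨add_mem h0 h0', x1 + x1', by rw [h1, h1']; simp [mul_add, Finset.sum_add_distrib],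
        by rw [ev_add, h2, h2']; simp [Finset.sum_add_distrib]⟩
    | smul c z _ h =>
      obtain ⟨h0, x1, h1, h2⟩ := h
      rw [smul_mul_assoc]
      exact ⟨Subalgebra.smul_mem _ h0 c, c • x1, by rw [h1]; simp [Finset.smul_sum],
        by rw [ev_smul, h2]; simp [Finset.smul_sum]⟩
  | add z _ z' _ h h' =>
    obtain ⟨h0, x1, h1, h2⟩ := h
    obtain ⟨h0', x1', h1', h2'⟩ := h'
    exact ⟨add_mem h0 h0', x1 + x1', by rw [h1, h1']; simp [mul_add, Finset.sum_add_distrib],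
      by rw [ev_add, h2, h2']; simp [Finset.sum_add_distrib]⟩

theorem tprod_pair {r : Fin (d - 1)} {a : Fin d → RbarDelta F e}
    (h : ∀ t, t ≠ lo r → t ≠ hi r → a t = 1) : PiTensorProduct.tprod F a =
      PiTensorProduct.tprod F (Pi.mulSingle (M := fun _ => RbarDelta F e) (lo r) (a (lo r))) *
        PiTensorProduct.tprod F (Pi.mulSingle (M := fun _ => RbarDelta F e) (hi r) (a (hi r))) := by
  rw [PiTensorProduct.tprod_mul_tprod]
  congr 1
  funext t
  by_cases h1 : t = hi r
  · subst h1
    rw [Pi.mul_apply, Pi.mulSingle_eq_same, Pi.mulSingle_eq_of_ne (lo_ne_hi r).symm, one_mul]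
  · rw [Pi.mul_apply, Pi.mulSingle_eq_of_ne h1, mul_one]
    by_cases h2 : t = lo r
    · subst h2; rw [Pi.mulSingle_eq_same]
    · rw [Pi.mulSingle_eq_of_ne h2, h t h2 h1]

theorem iota_pair {r : Fin (d - 1)} {a : Fin d → RbarDelta F e}
    (h : ∀ t, t ≠ lo r → t ≠ hi r → a t = 1) : iota F e d (PiTensorProduct.tprod F a) =
      iotaAt F (lo r) (a (lo r)) * iotaAt F (hi r) (a (hi r)) := by
  rw [tprod_pair h, iota_mul, iota_mulSingle, iota_mulSingle]

theorem calSr_le_diagAlg {r : Fin (d - 1)} {m : ℤ} {w : TruncR F e d}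
    (hw : w ∈ (calSr F r m).map (iota F e d)) : w ∈ diagAlg W := by
  obtain ⟨x, hx, rfl⟩ := hw
  refine (Submodule.span_le.2 ?_ : calSr F r m ≤
    (Subalgebra.toSubmodule (diagAlg W)).comap (iota F e d)) hx
  rintro _ ⟨a, p, q, hp, hq, -, h1, h2, h3, rfl⟩
  change iota F e d _ ∈ diagAlg W
  rw [iota_pair h3]
  exact mul_mem (iotaAt_mem_diagAlg _ (by omega) h1) (iotaAt_mem_diagAlg _ (by omega) h2)

theorem Psi_calSr_two {θ : k} (hθ : ∀ t, W.θ t = θ) {r : Fin (d - 1)} {w : TruncR F e d}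
    (hw : w ∈ (calSr F r 2).map (iota F e d)) : Psi F W w = 0 := by
  obtain ⟨x, hx, rfl⟩ := hw
  refine (Submodule.span_le.2 ?_ : calSr F r 2 ≤
    LinearMap.ker ((Psi F W).toLinearMap ∘ₗ iota F e d)) hx
  rintro _ ⟨a, p, q, hp, hq, hpq, h1, h2, h3, rfl⟩
  change Psi F W (iota F e d _) = 0
  obtain rfl : p = 1 := by omega
  obtain rfl : q = 1 := by omega
  have hemb : ∀ (t : Fin d) (x : RbarDelta F e), emb F k (RbarDelta F e) t (θ ⊗ₜ x) =
      θ • emb F k (RbarDelta F e) t (1 ⊗ₜ x) := fun t x => by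
    rw [← map_smul, TensorProduct.smul_tmul', smul_eq_mul, mul_one]
  rw [iota_pair h3, map_mul]
  refine LinearMap.ext fun f => funext fun v => ?_
  rw [Module.End.mul_apply, Psi_iotaAt F W _ le_rfl h1, Psi_iotaAt F W _ le_rfl h2]
  have h4 : tpow θ 1 = θ := by simp [tpow]
  rw [hθ, hθ, h4, hemb, hemb, smul_mul_assoc, smul_mul_assoc, mul_smul_comm, smul_smul,
    ← hθ (lo r), W.θ_sq, zero_smul]
  rfl

theorem Psi_zDiff_pow (r : Fin (d - 1)) (j : ℕ) (f : Equiv.Perm (Fin d) → Lam F k (RbarDelta F e) d)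
    (u : Equiv.Perm (Fin d)) : Psi F W (zDiff F e r ^ j) f u =
      algebraMap k _ ((W.z (u⁻¹ (lo r)) - W.z (u⁻¹ (hi r))) ^ j) * f u := by
  induction j generalizing f with
  | zero => simp
  | succ j ih =>
    rw [pow_succ, map_mul, Module.End.mul_apply, ih, map_sub, LinearMap.sub_apply, Pi.sub_apply,
      Psi_zElt, Psi_zElt, ← sub_mul, ← map_sub, ← mul_assoc, ← map_mul, pow_succ]

theorem zDiff_mul_N (W : TwistData d k) (r : Fin (d - 1)) (v : Equiv.Perm (Fin d)) :
    (W.z (v⁻¹ (lo r)) - W.z (v⁻¹ (hi r))) * W.N (v⁻¹ (lo r)) (v⁻¹ (hi r)) = 1 := by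
  rw [mul_comm]
  exact W.N_mul _ _ fun h => lo_ne_hi r (v⁻¹.injective h)

theorem Psi_zDiff_pow_surj (r : Fin (d - 1)) (j : ℕ)
    (f : Equiv.Perm (Fin d) → Lam F k (RbarDelta F e) d) : Psi F W (zDiff F e r ^ j)
      (fun v => algebraMap k _ (W.N (v⁻¹ (lo r)) (v⁻¹ (hi r)) ^ j) * f v) = f := funext fun v => by
  rw [Psi_zDiff_pow, ← mul_assoc, ← map_mul, ← mul_pow, zDiff_mul_N, one_pow, map_one, one_mul]

theorem Psi_tau {θ : k} (hθ : ∀ t, W.θ t = θ) {ω : Equiv.Perm (Fin (d * e)) → List (Fin (d * e - 1))}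
    (hω : ∀ w, Red (ω w) w) {r : Fin (d - 1)} {τ ε : TruncR F e d} (h : IsTau F ω r τ ε)
    (f : Equiv.Perm (Fin d) → Lam F k (RbarDelta F e) d) (u : Equiv.Perm (Fin d)) :
    Psi F W τ f u = (-1 : F) ^ e • f (simpleT r * u) := by
  have h1 := Psi_eq_zero_of_calJ W h.eq_mod
  rw [map_sub, map_add, map_mul, map_mul, Psi_calSr_two hθ h.eps_mem, zero_mul, add_zero,
    sub_eq_zero] at h1
  have h2 := congrFun (LinearMap.congr_fun h1
    fun v => algebraMap k _ (W.N (v⁻¹ (lo r)) (v⁻¹ (hi r)) ^ e) * f v) u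
  rw [Module.End.mul_apply, Psi_zDiff_pow_surj, Psi_phiBlock F W hω] at h2
  rw [← h2]
  have h3 := zDiff_mul_N W r u
  rw [simpleT_mul_inv_lo, simpleT_mul_inv_hi, W.N_symm, ← mul_assoc, ← map_mul, ← mul_pow, mul_neg, h3,
    Algebra.smul_def, map_pow, map_pow, map_neg, map_neg, map_one, map_one]

end Action

/-! ### Faithfulness in low degrees -/

section Faithful

variable {F : Type*} [Field F] {d e : ℕ} [NeZero e] {k : Type*} [CommRing k] [Algebra F k]
  {W : TwistData d k} [Fact (1 < e)] {ω : Equiv.Perm (Fin (d * e)) → List (Fin (d * e - 1))}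

theorem Psi_sigma {θ : k} (hθ : ∀ t, W.θ t = θ) (hω : ∀ w, Red (ω w) w) (r : Fin (d - 1)) :
    ∃ c : Equiv.Perm (Fin d) → Lam F k (RbarDelta F e) d, ∀ f v,
      Psi F W (sigma F ω r) f v = (-1 : F) ^ e • f (simpleT r * v) - c v * f v := by
  obtain ⟨τ, ε, h⟩ := exists_isTau (F := F) hω r
  obtain ⟨c, hc⟩ := calSr_le_diagAlg (W := W) h.tau_mem
  refine ⟨c, fun f v => ?_⟩
  rw [← Psi_tau hθ hω h, ← hc, map_sub, LinearMap.sub_apply, Pi.sub_apply, sub_sub_cancel]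

theorem Psi_sigmaW_single {θ : k} (hθ : ∀ t, W.θ t = θ) (hω : ∀ w, Red (ω w) w)
    (c : Lam F k (RbarDelta F e) d) (l : List (Fin (d - 1))) {v : Equiv.Perm (Fin d)}
    (hv : l.length ≤ (inv v).card) : Psi F W (sigmaW F ω l) (Pi.single 1 c) v =
      if v = wprod l then ((-1 : F) ^ e) ^ l.length • c else 0 := by
  induction l generalizing v with
  | nil =>
    have : sigmaW F ω [] = 1 := by simp [sigmaW]
    rw [this, map_one, Module.End.one_apply, Pi.single_apply]
    simp [wprod]
  | cons r l ih =>
    obtain ⟨b, hb⟩ := Psi_sigma (F := F) hθ hω r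
    have : sigmaW F ω (r :: l) = sigma F ω r * sigmaW F ω l := by simp [sigmaW]
    rw [List.length_cons] at hv
    have h1 : l.length ≤ (inv (simpleT r * v)).card := by
      rcases inv_lo_lt_or r v with h | h
      · rw [card_inv_simpleT_mul h]; omega
      · have := card_inv_simpleT_mul' h; omega
    have h2 : v ≠ wprod l := by
      rintro rfl
      have := card_inv_wprod_le l
      omega
    rw [this, map_mul, Module.End.mul_apply, hb, ih h1, ih (Nat.le_of_succ_le hv), if_neg h2, mul_zero,
      sub_zero, wprod_cons, List.length_cons]
    have h3 : simpleT r * v = wprod l ↔ v = simpleT r * wprod l :=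
      ⟨fun h => by rw [← h, simpleT_mul_cancel], fun h => by rw [h, simpleT_mul_cancel]⟩
    by_cases h : v = simpleT r * wprod l
    · rw [if_pos (h3.2 h), if_pos h, smul_smul, pow_succ']
    · rw [if_neg fun h' => h (h3.1 h'), if_neg h, smul_zero]

/-- The coefficients of a combination of the `σ_u` can be recovered from its action. -/
theorem ev_eq_zero_of_Psi_eq_zero {θ : k} (hθ : ∀ t, W.θ t = θ) (hω : ∀ w, Red (ω w) w)
    {ν : Equiv.Perm (Fin d) → List (Fin (d - 1))} (hν : ∀ u, Red (ν u) u)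
    {y : Equiv.Perm (Fin d) → TruncR F e d} (hy : ∀ u, y u ∈ diagAlg W)
    (h : Psi F W (∑ u, sigmaW F ω (ν u) * y u) = 0) (u : Equiv.Perm (Fin d)) : ev W (y u) = 0 := by
  obtain ⟨N, hN⟩ : ∃ N, ∀ u : Equiv.Perm (Fin d), (inv u).card ≤ N :=
    ⟨Finset.univ.sup fun u : Equiv.Perm (Fin d) => (inv u).card,
      fun u => Finset.le_sup (f := fun u : Equiv.Perm (Fin d) => (inv u).card) (Finset.mem_univ u)⟩
  have key : ∀ n, ∀ u : Equiv.Perm (Fin d), N - (inv u).card = n → ev W (y u) = 0 := by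
    intro n
    induction n using Nat.strong_induction_on with
    | _ n ih =>
      intro v hv
      have h1 := congrFun (LinearMap.congr_fun h (Pi.single 1 1)) v
      rw [map_sum, LinearMap.sum_apply, Finset.sum_apply, Finset.sum_eq_single v] at h1
      · rw [map_mul, Module.End.mul_apply, Psi_single (hy v),
          Psi_sigmaW_single hθ hω _ _ (hν v).length_eq.le, (hν v).wprod_eq, if_pos rfl] at h1
        exact (smul_eq_zero_iff_right
          (pow_ne_zero _ (pow_ne_zero _ (neg_ne_zero.2 one_ne_zero)))).1 h1
      · intro u _ hu
        rw [map_mul, Module.End.mul_apply, Psi_single (hy u)]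
        by_cases hc : (inv u).card ≤ (inv v).card
        · rw [Psi_sigmaW_single hθ hω _ _ ((hν u).length_eq.trans_le hc), (hν u).wprod_eq,
            if_neg hu.symm]
        · have := hN u
          rw [ih (N - (inv u).card) (by omega) u rfl]
          have h0 : (Pi.single 1 0 : Equiv.Perm (Fin d) → Lam F k (RbarDelta F e) d) = 0 :=
            Pi.single_zero _
          rw [h0, map_zero]
          rfl
      · simp
  exact key _ u rfl

/-- Tensors with linearly independent scalars are independent. -/
theorem Lam.eq_zero_of_sum {A : Type*} [Ring A] [Algebra F A] {ι : Type*} [Fintype ι] {v : ι → k}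
    (hv : LinearIndependent F v) {x : ι → TPow F A d} (h : ∑ i, Lam.mk F (v i) (x i) = 0) (i : ι) :
    x i = 0 := by
  classical
  obtain ⟨g, hg⟩ := (Finsupp.linearCombination F v).exists_leftInverse_of_injective
    (LinearMap.ker_eq_bot.2 hv)
  have hgi : ∀ j, g (v j) = Finsupp.single j 1 := fun j => by
    have := LinearMap.congr_fun hg (Finsupp.single j 1)
    simpa using this
  have h1 := congrArg (TensorProduct.lid F (TPow F A d) ∘ₗ
    TensorProduct.map (Finsupp.lapply i ∘ₗ g) LinearMap.id : k ⊗[F] TPow F A d →ₗ[F] TPow F A d) h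
  change _ = (_ : k ⊗[F] TPow F A d →ₗ[F] TPow F A d) (0 : k ⊗[F] TPow F A d) at h1
  rw [map_zero] at h1
  rw [← h1]
  symm
  change (_ : k ⊗[F] TPow F A d →ₗ[F] TPow F A d) (∑ j, v j ⊗ₜ[F] x j : k ⊗[F] TPow F A d) = x i
  rw [map_sum, Finset.sum_eq_single i]
  · simp [hgi]
  · intro j _ hj
    simp [hgi, hj]
  · simp

theorem Lam.mk_zero {A : Type*} [Ring A] [Algebra F A] (x : TPow F A d) : Lam.mk F (0 : k) x = 0 :=
  TensorProduct.zero_tmul _ x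

theorem Lam.mk_eq_zero {A : Type*} [Ring A] [Algebra F A] {c : k} (hc : c ≠ 0) {x : TPow F A d}
    (h : Lam.mk F c x = 0) : x = 0 :=
  Lam.eq_zero_of_sum (F := F) (k := k) (ι := Unit) (v := fun _ => c) (x := fun _ => x)
    (linearIndependent_unique_iff.2 hc) (by simpa using h) ()

theorem lowFilt_two_eq {θ : k} (hθ2 : θ * θ = 0) (hθ : ∀ t, W.θ t = θ) (hz : LinearIndependent F W.z)
    {y : TruncR F e d} (hy : y ∈ lowFilt Set.univ 2) :
    y ∈ diagAlg W ∧ (ev W y = 0 → y ∈ lowSpan F e d 2 ⊔ calK F e d) := by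
  obtain ⟨a, ha, b, hb, rfl⟩ := Submodule.mem_sup.1 (lowFilt_two_le hy)
  obtain ⟨hbd, x, hx, hx'⟩ := exists_ev_eq_zSpan hθ2 hθ hb
  have ha0 : a ∈ diagAlg W ∧ ev W a = 0 := by
    obtain ⟨p, hp, q, hq, rfl⟩ := Submodule.mem_sup.1 ha
    obtain ⟨x, -, hx⟩ := exists_ev_eq hθ2 hθ hp
    refine ⟨add_mem (lowSpan_le_diagAlg hp) (calK_le_diagAlg hq), ?_⟩
    have : tpow θ 2 = 0 := by simp [tpow]
    rw [ev_add, hx, this, Lam.mk_zero, zero_add, ev, Psi_eq_zero_of_calK _ hq]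
    rfl
  refine ⟨add_mem ha0.1 hbd, fun h => ?_⟩
  rw [ev_add, ha0.2, zero_add, hx'] at h
  have h3 := Lam.eq_zero_of_sum hz h
  have hb0 : b = 0 := by
    rw [hx]
    exact Finset.sum_eq_zero fun t _ => by rw [h3 t, map_zero, mul_zero]
  rwa [hb0, add_zero]

variable (F d) in
/-- The field of rational functions in the `z_t`. -/
abbrev RatF : Type _ := FractionRing (MvPolynomial (Fin d) F)

variable (F d) in
/-- The variables. -/
def ratX (t : Fin d) : RatF F d := algebraMap (MvPolynomial (Fin d) F) _ (MvPolynomial.X t)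

theorem ratX_injective : Function.Injective (ratX F d) := fun _ _ h =>
  MvPolynomial.X_injective (IsFractionRing.injective _ _ h)

theorem linearIndependent_ratX : LinearIndependent F (ratX F d) :=
  (MvPolynomial.linearIndependent_X _ _ :
    LinearIndependent F (MvPolynomial.X : Fin d → MvPolynomial (Fin d) F)).map'
    (IsScalarTower.toAlgHom F (MvPolynomial (Fin d) F) (RatF F d)).toLinearMap
    (LinearMap.ker_eq_bot.2 (IsFractionRing.injective _ _))

/-- The scalars for which the blocks have independent values. -/
def ratTwist {k : Type*} [CommRing k] (g : RatF F d →+* k) (θ : Fin d → k) (hθ : ∀ t, θ t * θ t = 0) :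
    TwistData d k where
  z t := g (ratX F d t)
  N t t' := g (ratX F d t - ratX F d t')⁻¹
  θ := θ
  N_mul t t' h := by
    rw [← map_sub, ← map_mul, inv_mul_cancel₀ (sub_ne_zero.2 fun h' => h (ratX_injective h')), map_one]
  N_symm t t' := by rw [← map_neg, neg_inv, neg_sub]
  θ_sq := hθ

variable (F d) in
/-- The scalars with all weights equal. -/
def twistOne : TwistData d (DualNumber (RatF F d)) :=
  ratTwist (TrivSqZeroExt.inlHom _ _) (fun _ => DualNumber.eps) fun _ => DualNumber.eps_mul_eps

theorem eps_ne_zero {K : Type*} [CommRing K] [Nontrivial K] : (DualNumber.eps : DualNumber K) ≠ 0 :=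
  fun h => one_ne_zero (α := K) (by simpa using congrArg TrivSqZeroExt.snd h)

theorem twistOne_θ (t : Fin d) : (twistOne F d).θ t = DualNumber.eps := rfl

theorem linearIndependent_twistOne : LinearIndependent F (twistOne F d).z := by
  refine linearIndependent_ratX.map' (TrivSqZeroExt.inlAlgHom F (RatF F d) (RatF F d)).toLinearMap
    (LinearMap.ker_eq_bot.2 TrivSqZeroExt.inl_injective)

theorem tpow_eps_ne_zero {m : ℤ} (hm : m = 0 ∨ m = 1) :
    tpow (DualNumber.eps : DualNumber (RatF F d)) m ≠ 0 := by
  rcases hm with rfl | rfl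
  · simp [tpow]
  · simpa [tpow] using eps_ne_zero

/-- The action of the elements of degree `0` and `1` is faithful. -/
theorem monSpan_eq_zero (hω : ∀ w, Red (ω w) w) {m : ℤ} (hm : m = 0 ∨ m = 1)
    {x : TruncR F e d} (hx : x ∈ monSpan F d e m) (h : Psi F (twistOne F d) x = 0) : x = 0 := by
  choose ν hν using fun u : Equiv.Perm (Fin d) => exists_red u
  obtain ⟨y, hy, rfl⟩ := sigmaSpan_exists_sum (monSpan_le_sigmaSpan hω hν m hx)
  have hy' := fun u => lowFilt_le_lowSpan (by omega) (hy u)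
  have h1 := ev_eq_zero_of_Psi_eq_zero twistOne_θ hω hν (fun u => lowSpan_le_diagAlg (hy' u)) h
  refine Finset.sum_eq_zero fun u _ => ?_
  obtain ⟨x, hx, hx'⟩ := exists_ev_eq (W := twistOne F d) DualNumber.eps_mul_eps twistOne_θ (hy' u)
  rw [h1 u] at hx'
  rw [← hx, Lam.mk_eq_zero (tpow_eps_ne_zero hm) hx'.symm, map_zero, mul_zero]

theorem monSpan_ext (hω : ∀ w, Red (ω w) w) {m : ℤ} (hm : m = 0 ∨ m = 1) {x y : TruncR F e d}
    (hx : x ∈ monSpan F d e m) (hy : y ∈ monSpan F d e m)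
    (h : ∀ f v, Psi F (twistOne F d) x f v = Psi F (twistOne F d) y f v) : x = y := by
  rw [← sub_eq_zero]
  refine monSpan_eq_zero hω hm (Submodule.sub_mem _ hx hy) ?_
  rw [map_sub, sub_eq_zero]
  exact LinearMap.ext fun f => funext fun v => h f v

/-- An element of degree `2` that acts by `0` lies in the sum of the `σ_u (lowSpan 2 + 𝒦)`. -/
theorem sigmaSpan_two_of_Psi_eq_zero (hω : ∀ w, Red (ω w) w)
    {ν : Equiv.Perm (Fin d) → List (Fin (d - 1))} (hν : ∀ u, Red (ν u) u) {x : TruncR F e d}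
    (hx : x ∈ sigmaSpan ω ν 2) (h : Psi F (twistOne F d) x = 0) :
    ∃ y : Equiv.Perm (Fin d) → TruncR F e d, (∀ u, y u ∈ lowSpan F e d 2 ⊔ calK F e d) ∧
      x = ∑ u, sigmaW F ω (ν u) * y u := by
  obtain ⟨y, hy, hxy⟩ := sigmaSpan_exists_sum hx
  rw [hxy] at h
  have h1 := fun u => lowFilt_two_eq (W := twistOne F d) DualNumber.eps_mul_eps twistOne_θ
    linearIndependent_twistOne (hy u)
  exact ⟨y, fun u => (h1 u).2 (ev_eq_zero_of_Psi_eq_zero twistOne_θ hω hν (fun u => (h1 u).1) h u), hxy⟩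

end Faithful

/-! ### Relations of the `τ_r` -/

section Relations

variable {F : Type*} [Field F] {d e : ℕ} [NeZero e] [Fact (1 < e)]
  {ω : Equiv.Perm (Fin (d * e)) → List (Fin (d * e - 1))}

theorem calSr_zero_mem_monSpan {r : Fin (d - 1)} {m : ℤ} {w : TruncR F e d}
    (hw : w ∈ (calSr F r m).map (iota F e d)) : w ∈ monSpan F d e m := by
  obtain ⟨x, hx, rfl⟩ := hw
  refine (Submodule.span_le.2 ?_ : calSr F r m ≤ (monSpan F d e m).comap (iota F e d)) hx
  rintro _ ⟨a, p, q, hp, hq, hpq, h1, h2, h3, rfl⟩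
  change iota F e d _ ∈ monSpan F d e m
  rw [iota_pair h3]
  exact mul_mem_monSpan_of_eq (iotaAt_mem_monSpan _ (by omega) h1)
    (iotaAt_mem_monSpan _ (by omega) h2) hpq

theorem IsTau.mem_monSpan (hω : ∀ w, Red (ω w) w) {r : Fin (d - 1)} {τ ε : TruncR F e d}
    (h : IsTau F ω r τ ε) : τ ∈ monSpan F d e 0 := by
  have := Submodule.add_mem _ (calSr_zero_mem_monSpan h.tau_mem) (sigma_mem_monSpan hω r)
  rwa [sub_add_cancel] at this

theorem IsTau.Psi (hω : ∀ w, Red (ω w) w) {r : Fin (d - 1)} {τ ε : TruncR F e d}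
    (h : IsTau F ω r τ ε) (f : Equiv.Perm (Fin d) → Lam F (DualNumber (RatF F d)) (RbarDelta F e) d)
    (u : Equiv.Perm (Fin d)) :
    KLRTheta.Psi F (twistOne F d) τ f u = (-1 : F) ^ e • f (simpleT r * u) :=
  Psi_tau twistOne_θ hω h f u

theorem IsTau.tau_unique (hω : ∀ w, Red (ω w) w) {r : Fin (d - 1)} {τ ε τ' ε' : TruncR F e d}
    (h : IsTau F ω r τ ε) (h' : IsTau F ω r τ' ε') : τ' = τ :=
  monSpan_ext hω (Or.inl rfl) (h'.mem_monSpan hω) (h.mem_monSpan hω) fun f v => by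
    rw [h.Psi hω, h'.Psi hω]

theorem ev_calSr_two {k : Type*} [CommRing k] [Algebra F k] {W : TwistData d k} {r : Fin (d - 1)}
    {x : TPow F (RbarDelta F e) d} (hx : x ∈ calSr F r 2) :
    ev W (iota F e d x) = Lam.mk F (W.θ (lo r) * W.θ (hi r)) x := by
  induction hx using Submodule.span_induction with
  | mem x hx =>
    obtain ⟨a, p, q, hp, hq, hpq, h1, h2, h3, rfl⟩ := hx
    obtain rfl : p = 1 := by omega
    obtain rfl : q = 1 := by omega
    have h4 : ∀ θ : k, tpow θ 1 = θ := fun θ => by simp [tpow]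
    rw [iota_pair h3, ev_mul (iotaAt_mem_diagAlg _ le_rfl h1), ev_iotaAt _ le_rfl h1,
      ev_iotaAt _ le_rfl h2, Lam.mk_mul_mk, ← tprod_pair h3, h4, h4]
  | zero => rw [map_zero, map_zero, ev_zero]
  | add x y _ _ hx hy => rw [map_add, map_add, ev_add, hx, hy]
  | smul c x _ hx => rw [map_smul, map_smul, ev_smul, hx]

theorem eps_mul_inl_eps_ne_zero {K : Type*} [CommRing K] [Nontrivial K] :
    (DualNumber.eps : DualNumber (DualNumber K)) * TrivSqZeroExt.inl DualNumber.eps ≠ 0 := by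
  intro h
  have := congrArg TrivSqZeroExt.snd h
  rw [TrivSqZeroExt.snd_mul] at this
  simp at this
  exact eps_ne_zero this

theorem IsTau.eps_unique_of_twist (hω : ∀ w, Red (ω w) w) {k : Type*} [CommRing k] [Algebra F k]
    {r : Fin (d - 1)} (W : TwistData d k) (hW : W.θ (lo r) * W.θ (hi r) ≠ 0)
    {τ ε τ' ε' : TruncR F e d} (h : IsTau F ω r τ ε) (h' : IsTau F ω r τ' ε') : ε' = ε := by
  have h1 := h.tau_unique hω h'
  subst h1
  obtain ⟨x, hx, hxe⟩ := Submodule.sub_mem _ h'.eps_mem h.eps_mem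
  have h2 : iota F e d x * zDiff F e r ^ (e - 1) ∈ calJ F e d := by
    rw [hxe]
    convert Submodule.sub_mem _ h.eq_mod h'.eq_mod using 1
    rw [zDiff, sub_mul]
    abel
  have h3 := Psi_eq_zero_of_calJ W h2
  rw [map_mul] at h3
  have h4 := Psi_zDiff_pow_surj (F := F) (e := e) (W := W) r (e - 1) (Pi.single (1 : Equiv.Perm (Fin d)) 1)
  generalize (fun v : Equiv.Perm (Fin d) => _ : Equiv.Perm (Fin d) → Lam F k (RbarDelta F e) d) = g at h4
  have h5 : ev W (iota F e d x) = 0 := by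
    have h6 := congrFun (LinearMap.congr_fun h3 g) 1
    rw [Module.End.mul_apply, h4] at h6
    exact h6
  rw [ev_calSr_two hx] at h5
  rw [← sub_eq_zero, ← hxe, Lam.mk_eq_zero hW h5, map_zero]

theorem exists_twist_ne_zero {K : Type*} [CommRing K] [Nontrivial K] (g : RatF F d →+* K)
    (r : Fin (d - 1)) : ∃ W : TwistData d (DualNumber (DualNumber K)), W.θ (lo r) * W.θ (hi r) ≠ 0 := by
  classical
  refine ⟨ratTwist ((TrivSqZeroExt.inlHom _ _).comp ((TrivSqZeroExt.inlHom _ _).comp g))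
    (fun t => if t = lo r then DualNumber.eps else TrivSqZeroExt.inl DualNumber.eps) fun t => ?_, ?_⟩
  · split_ifs
    · exact DualNumber.eps_mul_eps
    · exact (TrivSqZeroExt.inl_mul _ _ _).symm.trans
        ((congrArg _ DualNumber.eps_mul_eps).trans (TrivSqZeroExt.inl_zero _))
  · change (if lo r = lo r then (DualNumber.eps : DualNumber (DualNumber K)) else _) *
      (if hi r = lo r then (DualNumber.eps : DualNumber (DualNumber K)) else _) ≠ 0
    rw [if_pos rfl, if_neg (lo_ne_hi r).symm]
    exact eps_mul_inl_eps_ne_zero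

theorem IsTau.eps_unique (hω : ∀ w, Red (ω w) w) {r : Fin (d - 1)} {τ ε τ' ε' : TruncR F e d}
    (h : IsTau F ω r τ ε) (h' : IsTau F ω r τ' ε') : ε' = ε := by
  obtain ⟨W, hW⟩ := exists_twist_ne_zero (RingHom.id (RatF F d)) r
  exact h.eps_unique_of_twist hω W hW h'

/-- The product of the `τ_r` along a word. -/
def tauW (τ : Fin (d - 1) → TruncR F e d) (l : List (Fin (d - 1))) : TruncR F e d := (l.map τ).prod

theorem tauW_append (τ : Fin (d - 1) → TruncR F e d) (l l' : List (Fin (d - 1))) :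
    tauW τ (l ++ l') = tauW τ l * tauW τ l' := by
  rw [tauW, List.map_append, List.prod_append, tauW, tauW]

theorem tauW_mem_monSpan {τ : Fin (d - 1) → TruncR F e d} (h : ∀ r, τ r ∈ monSpan F d e 0)
    (l : List (Fin (d - 1))) : tauW τ l ∈ monSpan F d e 0 := by
  induction l with
  | nil => exact one_mem_monSpan
  | cons r l ih =>
    rw [tauW, List.map_cons, List.prod_cons]
    exact mul_mem_monSpan_of_eq (h r) ih (add_zero 0)

theorem Psi_tauW (hω : ∀ w, Red (ω w) w) {τ ε : Fin (d - 1) → TruncR F e d}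
    (h : ∀ r, IsTau F ω r (τ r) (ε r)) (l : List (Fin (d - 1)))
    (f : Equiv.Perm (Fin d) → Lam F (DualNumber (RatF F d)) (RbarDelta F e) d)
    (u : Equiv.Perm (Fin d)) : Psi F (twistOne F d) (tauW τ l) f u =
      (((Equiv.Perm.sign (wprod l) : ℤˣ) : ℤ) : F) ^ e • f ((wprod l)⁻¹ * u) := by
  induction l generalizing f u with
  | nil => simp [tauW, wprod]
  | cons r l ih =>
    have h1 : tauW τ (r :: l) = τ r * tauW τ l := by simp [tauW]
    rw [h1, map_mul, Module.End.mul_apply, (h r).Psi hω, ih, smul_smul, ← mul_pow, wprod_cons, map_mul,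
      mul_inv_rev, simpleT_inv, mul_assoc, simpleT, Equiv.Perm.sign_swap (lo_ne_hi r)]
    simp

theorem tauW_eq (hω : ∀ w, Red (ω w) w) {τ ε : Fin (d - 1) → TruncR F e d}
    (h : ∀ r, IsTau F ω r (τ r) (ε r)) {l l' : List (Fin (d - 1))} (hl : wprod l = wprod l') :
    tauW τ l = tauW τ l' :=
  monSpan_ext hω (Or.inl rfl) (tauW_mem_monSpan (fun r => (h r).mem_monSpan hω) l)
    (tauW_mem_monSpan (fun r => (h r).mem_monSpan hω) l') fun f v => by
      rw [Psi_tauW hω h, Psi_tauW hω h, hl]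

theorem tau_mul_self (hω : ∀ w, Red (ω w) w) {τ ε : Fin (d - 1) → TruncR F e d}
    (h : ∀ r, IsTau F ω r (τ r) (ε r)) (r : Fin (d - 1)) : τ r * τ r = 1 := by
  have := tauW_eq hω h (l := [r, r]) (l' := []) (by simp [wprod, simpleT_mul_self])
  simpa [tauW] using this

theorem tau_braid (hω : ∀ w, Red (ω w) w) {τ ε : Fin (d - 1) → TruncR F e d}
    (h : ∀ r, IsTau F ω r (τ r) (ε r)) {r s : Fin (d - 1)} (hrs : (s : ℕ) = r + 1) :
    τ r * τ s * τ r = τ s * τ r * τ s := by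
  have := tauW_eq hω h (l := [r, s, r]) (l' := [s, r, s]) (by simp [wprod, simpleT_braid hrs])
  simpa [tauW, mul_assoc] using this

theorem tau_comm (hω : ∀ w, Red (ω w) w) {τ ε : Fin (d - 1) → TruncR F e d}
    (h : ∀ r, IsTau F ω r (τ r) (ε r)) {r s : Fin (d - 1)}
    (hrs : (r : ℕ) + 1 < s ∨ (s : ℕ) + 1 < r) : τ r * τ s = τ s * τ r := by
  have := tauW_eq hω h (l := [r, s]) (l' := [s, r]) (by simp [wprod, simpleT_comm hrs])
  simpa [tauW] using this

/-- The `τ_r` define a homomorphism from the symmetric group. -/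
def tauHom (hω : ∀ w, Red (ω w) w) {τ ε : Fin (d - 1) → TruncR F e d}
    (h : ∀ r, IsTau F ω r (τ r) (ε r)) : Equiv.Perm (Fin d) →* TruncR F e d where
  toFun u := tauW τ (exists_red u).choose
  map_one' := tauW_eq hω h (l' := []) (exists_red (1 : Equiv.Perm (Fin d))).choose_spec.wprod_eq
  map_mul' u v := by
    rw [← tauW_append]
    refine tauW_eq hω h ?_
    rw [wprod_append, (exists_red u).choose_spec.wprod_eq, (exists_red v).choose_spec.wprod_eq,
      (exists_red (u * v)).choose_spec.wprod_eq]

theorem tauHom_simpleT (hω : ∀ w, Red (ω w) w) {τ ε : Fin (d - 1) → TruncR F e d}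
    (h : ∀ r, IsTau F ω r (τ r) (ε r)) (r : Fin (d - 1)) : tauHom hω h (simpleT r) = τ r := by
  have := tauW_eq hω h (l' := [r]) ((exists_red (simpleT r)).choose_spec.wprod_eq.trans (by simp [wprod]))
  exact this.trans (by simp [tauW])

theorem IsTau.mem_scrT (hω : ∀ w, Red (ω w) w) {ν : Equiv.Perm (Fin d) → List (Fin (d - 1))}
    (hν : ∀ u, Red (ν u) u) {r : Fin (d - 1)} {τ ε : TruncR F e d} (h : IsTau F ω r τ ε) :
    τ ∈ scrT F ω ν := by
  obtain ⟨y, hy, rfl⟩ := sigmaSpan_exists_sum (monSpan_le_sigmaSpan hω hν 0 (h.mem_monSpan hω))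
  refine sum_mem fun u _ => Algebra.subset_adjoin (Or.inl ?_)
  exact Submodule.mem_iSup_of_mem u (Submodule.mem_map_of_mem
    (IsLow.sum_iota_mem_calS (lowFilt_le_lowSpan (by norm_num) (hy u))))

theorem sigmaW_mul_mem_calT {ν : Equiv.Perm (Fin d) → List (Fin (d - 1))} {m : ℤ}
    (u : Equiv.Perm (Fin d)) {y : TruncR F e d} (hy : y ∈ lowSpan F e d m) :
    sigmaW F ω (ν u) * y ∈ scrT F ω ν :=
  Algebra.subset_adjoin (Or.inl (Submodule.mem_iSup_of_mem u (Submodule.mem_map_of_mem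
    (IsLow.sum_iota_mem_calS hy))))

theorem zElt_sigma_sub_mem (hω : ∀ w, Red (ω w) w) {ν : Equiv.Perm (Fin d) → List (Fin (d - 1))}
    (hν : ∀ u, Red (ν u) u) (r : Fin (d - 1)) :
    zElt F (hi r) * sigma F ω r - sigma F ω r * zElt F (lo r) ∈ sigmaSpan ω ν 2 := by
  have hw : wprod (ω (blockSwap e r)) = bperm e (simpleT r) := by
    rw [(hω _).wprod_eq, blockSwap_eq]
  have hp : (wprod (ω (blockSwap e r)))⁻¹ (pos (hi r) ⟨0, NeZero.pos e⟩) = pos (lo r) ⟨0, NeZero.pos e⟩ := by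
    rw [hw, bperm_inv_pos, simpleT_inv, simpleT_hi]
  have h1 : zElt F (hi r) * sigma F ω r - sigma F ω r * zElt F (lo r) =
      ∑ k : Fin (d * e) → ZMod e, TruncR.proj F e d
        (KLR.y F (pos (hi r) ⟨0, NeZero.pos e⟩) * (psiW F (ω (blockSwap e r)) * KLR.idem F k) -
          psiW F (ω (blockSwap e r)) * KLR.y F (pos (lo r) ⟨0, NeZero.pos e⟩) * KLR.idem F k) := by
    rw [← map_sum, Finset.sum_sub_distrib, ← Finset.mul_sum, ← Finset.mul_sum, ← Finset.mul_sum, sum_idem,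
      mul_one, mul_one, map_sub, proj_mul (Or.inl (CommIdd.y _)), proj_mul (Or.inr (CommIdd.y _)),
      ← sigma_eq]
    rfl
  rw [h1]
  refine Submodule.sum_mem _ fun k _ => ?_
  by_cases hk : k ∈ Idd e d
  · have h2 := y_mul_psiW_sub_mem (F := F) (pos (hi r) ⟨0, NeZero.pos e⟩) (ω (blockSwap e r)) k
    have h3 : wdeg (ω (blockSwap e r)) k = 0 :=
      wdeg_bperm (by rw [← blockSwap_eq]; exact hω _) hk
    rw [h3, hp, add_zero] at h2
    exact proj_Dlt_mem hω hν h2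
  · rw [← mul_assoc, ← sub_mul, proj_mul (Or.inr (CommIdd.idem k)), proj_idem_eq_zero fun h => hk h.1,
      mul_zero]
    exact zero_mem _

theorem zDiff_mem_monSpan (r : Fin (d - 1)) : zDiff F e r ∈ monSpan F d e 2 := by
  have := (DMon.ydiff (F := F) (pos (lo r) ⟨0, NeZero.pos e⟩) (pos (hi r) ⟨0, NeZero.pos e⟩)).mem_monSpan
  rw [map_sub] at this
  exact this

theorem zElt_tau_sub_mem (hω : ∀ w, Red (ω w) w) {ν : Equiv.Perm (Fin d) → List (Fin (d - 1))}
    (hν : ∀ u, Red (ν u) u) {r : Fin (d - 1)} {τ ε : TruncR F e d} (h : IsTau F ω r τ ε) :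
    zElt F (hi r) * τ - τ * zElt F (lo r) ∈ sigmaSpan ω ν 2 := by
  obtain ⟨x, hx, hxe⟩ := h.tau_mem
  have h2 : zElt F (hi r) * τ - τ * zElt F (lo r) =
      (zElt F (hi r) * sigma F ω r - sigma F ω r * zElt F (lo r)) - zDiff F e r * iota F e d x := by
    have h3 := (zElt_commute_iota (lo r) x).eq
    rw [hxe, mul_sub, sub_mul] at h3
    rw [zDiff, hxe, sub_mul, mul_sub, mul_sub]
    rw [← sub_eq_zero] at h3 ⊢
    rw [← h3]
    abel
  rw [h2]
  refine Submodule.sub_mem _ (zElt_sigma_sub_mem hω hν r) (monSpan_le_sigmaSpan hω hν 2 ?_)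
  exact mul_mem_monSpan_of_eq (zDiff_mem_monSpan r)
    (calSr_zero_mem_monSpan (Submodule.mem_map_of_mem hx)) (add_zero 2)

theorem Psi_zElt_mul_sub {k : Type*} [CommRing k] [Algebra F k] {W : TwistData d k} {r : Fin (d - 1)}
    {x : TruncR F e d} {c : F}
    (h : ∀ (f : Equiv.Perm (Fin d) → Lam F k (RbarDelta F e) d) u, Psi F W x f u = c • f (simpleT r * u)) :
    Psi F W (zElt F (hi r) * x - x * zElt F (lo r)) = 0 := by
  refine LinearMap.ext fun f => funext fun v => ?_
  rw [map_sub, map_mul, map_mul, LinearMap.sub_apply, Pi.sub_apply, Module.End.mul_apply,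
    Module.End.mul_apply, Psi_zElt, h, h, Psi_zElt, mul_inv_rev, Equiv.Perm.mul_apply, simpleT_inv,
    simpleT_lo]
  exact sub_eq_zero.2 (mul_smul_comm _ _ _)

theorem zElt_sub_mem_scrT (hω : ∀ w, Red (ω w) w) {ν : Equiv.Perm (Fin d) → List (Fin (d - 1))}
    (hν : ∀ u, Red (ν u) u) {τ ε : Fin (d - 1) → TruncR F e d}
    (h : ∀ r, IsTau F ω r (τ r) (ε r)) (r : Fin (d - 1)) :
    zElt F (hi r) - τ r * zElt F (lo r) * τ r ∈ scrT F ω ν := by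
  have h1 := zElt_tau_sub_mem hω hν (h r)
  have h3 := Psi_zElt_mul_sub (h r |>.Psi hω)
  obtain ⟨y, hy, hxy⟩ := sigmaSpan_two_of_Psi_eq_zero hω hν h1 h3
  have h4 : zElt F (hi r) * τ r - τ r * zElt F (lo r) ∈ scrT F ω ν := by
    rw [hxy]
    refine sum_mem fun u _ => ?_
    obtain ⟨p, hp, q, hq, hpq⟩ := Submodule.mem_sup.1 (hy u)
    rw [← hpq, mul_add]
    refine add_mem (sigmaW_mul_mem_calT u hp) (mul_mem ?_ (Algebra.subset_adjoin (Or.inr hq)))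
    have := sigmaW_mul_mem_calT (F := F) (ω := ω) (ν := ν) (m := 0) u
      (y := 1) (Submodule.subset_span ⟨1, IsLow.one _, iota_one.symm⟩)
    rwa [mul_one] at this
  have h5 := mul_mem h4 ((h r).mem_scrT hω hν)
  rwa [sub_mul, mul_assoc, tau_mul_self hω h, mul_one] at h5

end Relations

/-! ### The `τ_r` intertwine the block factors -/

section Intertwine

variable {F : Type*} [Field F] {d e : ℕ} [NeZero e] [Fact (1 < e)]
  {ω : Equiv.Perm (Fin (d * e)) → List (Fin (d * e - 1))}

theorem iotaAt_mul_tau_of_deg (hω : ∀ w, Red (ω w) w) {r : Fin (d - 1)} {τ ε : TruncR F e d}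
    (h : IsTau F ω r τ ε) {m : ℤ} (hm : m = 0 ∨ m = 1) {a : RbarDelta F e}
    (ha : a ∈ RbarDelta.deg F e m) (t : Fin d) :
    iotaAt F (simpleT r t) a * τ = τ * iotaAt F t a := by
  have hm1 : m ≤ 1 := by omega
  refine monSpan_ext hω hm (mul_mem_monSpan_of_eq (iotaAt_mem_monSpan _ hm1 ha) (h.mem_monSpan hω)
    (add_zero m)) (mul_mem_monSpan_of_eq (h.mem_monSpan hω) (iotaAt_mem_monSpan _ hm1 ha) (zero_add m))
    fun f v => ?_
  rw [map_mul, map_mul, Module.End.mul_apply, Module.End.mul_apply, Psi_iotaAt _ _ _ hm1 ha, h.Psi hω,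
    h.Psi hω, Psi_iotaAt _ _ _ hm1 ha, inv_simpleT_mul_apply]
  exact mul_smul_comm _ _ _

/-- The elements of `RbarDelta` that the `τ_r` move between the blocks. -/
def interAlg (τ : Fin (d - 1) → TruncR F e d) : Subalgebra F (RbarDelta F e) where
  carrier := {a | ∀ r t, iotaAt F (simpleT r t) a * τ r = τ r * iotaAt F t a}
  mul_mem' {a b} ha hb r t := by
    rw [map_mul, map_mul, mul_assoc, hb, ← mul_assoc, ha, mul_assoc]
  add_mem' {a b} ha hb r t := by rw [map_add, map_add, add_mul, mul_add, ha, hb]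
  algebraMap_mem' c r t := by
    rw [AlgHom.commutes, AlgHom.commutes, Algebra.commutes]

variable {τ ε : Fin (d - 1) → TruncR F e d}

theorem eB_mem_interAlg (hω : ∀ w, Red (ω w) w) (h : ∀ r, IsTau F ω r (τ r) (ε r))
    (i : Fin e → ZMod e) : eB F i ∈ interAlg τ := fun r =>
  iotaAt_mul_tau_of_deg hω (h r) (Or.inl rfl) (eB_mem_deg i)

theorem pB_mem_interAlg (hω : ∀ w, Red (ω w) w) (h : ∀ r, IsTau F ω r (τ r) (ε r)) (a : Fin (e - 1)) :
    pB F a ∈ interAlg τ := by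
  rw [← mul_one (pB F a), ← sum_eB, Finset.mul_sum]
  refine sum_mem fun i _ => ?_
  have h1 := pB_mul_eB_mem_deg (F := F) a i
  rcases pB_mul_eB_cases F a i with h0 | ⟨-, ⟨-, h2, -⟩ | ⟨-, h2, -⟩⟩
  · rw [h0]; exact zero_mem _
  · rw [h2] at h1
    exact fun r => iotaAt_mul_tau_of_deg hω (h r) (Or.inl rfl) h1
  · rw [h2] at h1
    exact fun r => iotaAt_mul_tau_of_deg hω (h r) (Or.inr rfl) h1

theorem crossAlg_le_interAlg (hω : ∀ w, Red (ω w) w) (h : ∀ r, IsTau F ω r (τ r) (ε r)) (N : ℕ) :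
    crossAlg F e N ≤ interAlg τ := by
  refine Algebra.adjoin_le ?_
  rintro _ (⟨i, rfl⟩ | ⟨a, -, rfl⟩)
  · exact eB_mem_interAlg hω h i
  · exact pB_mem_interAlg hω h a

/-- For `e ≥ 3` the differences of the `y_p` are polynomials in the crossings and idempotents. -/
theorem yB_sub_mem_crossAlg (he : e ≠ 2) (p : Fin e) :
    yB F p - yB F ⟨0, NeZero.pos e⟩ ∈ crossAlg F e e := by
  obtain ⟨p, hp⟩ := p
  induction p with
  | zero => rw [sub_self]; exact zero_mem _
  | succ p ih =>
    specialize ih (by omega)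
    have hp1 : p < e - 1 := by omega
    obtain ⟨a, ha⟩ : ∃ a : Fin (e - 1), a = ⟨p, hp1⟩ := ⟨_, rfl⟩
    have h1 : (⟨p, by omega⟩ : Fin e) = lo a := by rw [ha]; rfl
    have h2 : (⟨p + 1, hp⟩ : Fin e) = hi a := by rw [ha]; rfl
    rw [h1] at ih
    rw [h2]
    have hpa : pB F a ∈ crossAlg F e e := pB_mem_crossAlg F (by omega)
    rw [← mul_one (yB F (hi a) - _), ← sum_eB, Finset.mul_sum]
    refine sum_mem fun i _ => ?_
    have he' := eB_mem_crossAlg F e i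
    by_cases hi0 : i ∈ Ialpha e (mdelta e 1) ∧ i ∈ Iempty1 e
    swap
    · rw [eB_eq_zero F hi0, mul_zero]; exact zero_mem _
    have hne : i (lo a) ≠ i (hi a) := fun h => lo_ne_hi a (injective_of_mem_Ialpha hi0.1 h)
    have hsq := pB_sq_eB F a i
    have hsm : pB F a * pB F a * eB F i ∈ crossAlg F e e := mul_mem (mul_mem hpa hpa) he'
    have h3 : yB F (hi a) - yB F ⟨0, NeZero.pos e⟩ =
      (yB F (hi a) - yB F (lo a)) + (yB F (lo a) - yB F ⟨0, NeZero.pos e⟩) := by abel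
    unfold Lval at hsq
    rw [if_neg hne] at hsq
    split_ifs at hsq with g1 g2 g3
    · exact absurd (eq_two_of_double g1.2 g1.1) he
    · rw [h3, add_mul, ← hsq]
      exact add_mem hsm (mul_mem ih he')
    · rw [h3, add_mul, ← neg_sub (yB F (lo a)), neg_mul, ← hsq]
      exact add_mem (neg_mem hsm) (mul_mem ih he')
    · rw [one_mul] at hsq
      have h4 := yB_mul_pB_eB (F := F) (hi a) a (act (simpleT a) i)
      rw [simpleT_hi, ← eB_mul_pB] at h4
      have h5 : (yB F (hi a) - yB F ⟨0, NeZero.pos e⟩) * eB F i =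
          pB F a * (yB F (lo a) - yB F ⟨0, NeZero.pos e⟩) * pB F a * eB F i := by
        have h6 : pB F a * yB F (lo a) * pB F a * eB F i = yB F (hi a) * eB F i := by
          conv_rhs => rw [← hsq]
          rw [mul_assoc (pB F a) (pB F a), pB_mul_eB, ← mul_assoc (pB F a) (eB F _), mul_assoc _ (pB F a) (eB F i), pB_mul_eB,
            ← mul_assoc, ← mul_assoc (yB F _)]
          rw [yB_mul_pB_eB, simpleT_hi]
        have h7 : pB F a * yB F ⟨0, NeZero.pos e⟩ * pB F a * eB F i = yB F ⟨0, NeZero.pos e⟩ * eB F i := by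
          rw [← yB_zero_central, mul_assoc _ (pB F a) (pB F a), mul_assoc _ (pB F a * pB F a), hsq]
        rw [sub_mul, mul_sub, sub_mul, sub_mul, h6, h7]
      rw [h5]
      exact mul_mem (mul_mem (mul_mem hpa ih) hpa) he'

/-- The `y` of the other blocks commute with `σ_r`. -/
theorem iotaAt_yB_mul_sigma (hω : ∀ w, Red (ω w) w) {r : Fin (d - 1)} {t : Fin d} (h1 : t ≠ lo r)
    (h2 : t ≠ hi r) (a : Fin e) :
    iotaAt F t (yB F a) * sigma F ω r = sigma F ω r * iotaAt F t (yB F a) := by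
  obtain ⟨l, hl, -⟩ := exists_shift_word (hω (blockSwap e r))
  have key : ∀ l : List (Fin (2 * e - 1)), (KLR.y F (pos t a) : KLR F e (d * e)) * psiW F (l.map (shiftPsi r)) =
      psiW F (l.map (shiftPsi r)) * KLR.y F (pos t a) := by
    intro l
    induction l with
    | nil => simp [psiW]
    | cons s l ih =>
      have hs : ∀ p : Fin (2 * e), pos t a ≠ shiftPos r p := by
        intro p hp
        obtain ⟨b, a', rfl⟩ := pos_surj p
        rw [shiftPos_pos] at hp
        have := (pos_inj hp).1
        fin_cases b
        · exact h1 (this.trans (shiftBlk_zero r))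
        · exact h2 (this.trans (shiftBlk_one r))
      have h3 : (KLR.psi F (shiftPsi r s) * KLR.y F (pos t a) : KLR F e (d * e)) =
          KLR.y F (pos t a) * KLR.psi F (shiftPsi r s) :=
        KLR.rel F (KLRRel.psi_y _ _ (by rw [shiftPos_lo]; exact hs _) (by rw [shiftPos_hi]; exact hs _))
      have h4 : (psiW F ((s :: l).map (shiftPsi r)) : KLR F e (d * e)) =
          KLR.psi F (shiftPsi r s) * psiW F (l.map (shiftPsi r)) := by
        simp [psiW]
      rw [h4, ← mul_assoc, ← h3, mul_assoc, ih, mul_assoc]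
  have hc : CommIdd F (KLR.y F (pos t a) : KLR F e (d * e)) := CommIdd.y _
  rw [← proj_y, sigma_eq, ← proj_mul (Or.inl hc), ← proj_mul (Or.inr hc), hl, key]

theorem iotaAt_commute_iota_pair {r : Fin (d - 1)} {t : Fin d} (h1 : t ≠ lo r) (h2 : t ≠ hi r)
    (a : RbarDelta F e) {m : ℤ} {x : TruncR F e d} (hx : x ∈ (calSr F r m).map (iota F e d)) :
    Commute (iotaAt F t a) x := by
  obtain ⟨x, hx, rfl⟩ := hx
  induction hx using Submodule.span_induction with
  | mem x hx =>
    obtain ⟨b, p, q, -, -, -, -, -, h3, rfl⟩ := hx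
    rw [iota_pair h3]
    exact (iotaAt_commute h1 _ _).mul_right (iotaAt_commute h2 _ _)
  | zero => rw [map_zero]; exact Commute.zero_right _
  | add x y _ _ hx hy => rw [map_add]; exact hx.add_right hy
  | smul c x _ hx => rw [map_smul]; exact hx.smul_right c

theorem IsTau.iotaAt_yB_mul (hω : ∀ w, Red (ω w) w) {r : Fin (d - 1)} {τ ε : TruncR F e d}
    (h : IsTau F ω r τ ε) {t : Fin d} (h1 : t ≠ lo r) (h2 : t ≠ hi r) (a : Fin e) :
    iotaAt F t (yB F a) * τ = τ * iotaAt F t (yB F a) := by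
  have h3 := (iotaAt_commute_iota_pair h1 h2 (yB F a) h.tau_mem).eq
  rwa [mul_sub, sub_mul, iotaAt_yB_mul_sigma hω h1 h2, sub_left_inj] at h3

end Intertwine

section Two

theorem mul_swap_word_lo {A : Type*} [Ring A] {pa pb pc y1 y2 y3 D ei ej : A} (h1 : y1 * pb = pb * y1)
    (h2 : pb * ei = ej * pb) (h3 : pc * ej = ej * pc) (h4 : y1 * pa * ej = (pa * y2 - 1) * ej)
    (h5 : y2 * pc = pc * y2) (h6 : y2 * pb * ei = pb * y3 * ei) (h7 : pb * pc * pb * ei = D * ei) :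
    y1 * (pb * pa * pc * pb) * ei = (pb * pa * pc * pb * y3 - D) * ei := by
  have e1 : y1 * (pb * pa * pc * pb) * ei = pb * (y1 * pa * ej) * pc * pb := by
    calc _ = (y1 * pb) * pa * pc * (pb * ei) := by noncomm_ring
      _ = pb * y1 * pa * (pc * ej) * pb := by rw [h1, h2]; noncomm_ring
      _ = _ := by rw [h3]; noncomm_ring
  have e2 : pb * ((pa * y2 - 1) * ej) * pc * pb = pb * pa * (y2 * pc) * pb * ei - pb * pc * pb * ei := by
    calc _ = pb * (pa * y2 - 1) * (ej * pc) * pb := by noncomm_ring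
      _ = pb * (pa * y2 - 1) * pc * (ej * pb) := by rw [← h3]; noncomm_ring
      _ = _ := by rw [← h2]; noncomm_ring
  rw [e1, h4, e2, h5, h7, sub_mul]
  congr 1
  calc _ = pb * pa * pc * (y2 * pb * ei) := by noncomm_ring
    _ = _ := by rw [h6]; noncomm_ring

theorem mul_swap_word_hi {A : Type*} [Ring A] {pa pb pc y2 y3 y4 D ei ej : A}
    (h1 : y2 * pb * ej = pb * y3 * ej) (h2 : pb * ei = ej * pb) (h3 : pc * ej = ej * pc)
    (h3' : pa * ej = ej * pa) (h4 : y3 * pa = pa * y3) (h5 : y3 * pc * ej = (pc * y4 - 1) * ej)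
    (h6 : y4 * pb = pb * y4) (h7 : pb * pa * pb * ei = D * ei) :
    y2 * (pb * pa * pc * pb) * ei = (pb * pa * pc * pb * y4 - D) * ei := by
  have e1 : y2 * (pb * pa * pc * pb) * ei = (y2 * pb * ej) * pa * pc * pb := by
    calc _ = y2 * pb * pa * pc * (pb * ei) := by noncomm_ring
      _ = y2 * pb * pa * (pc * ej) * pb := by rw [h2]; noncomm_ring
      _ = y2 * pb * (pa * ej) * pc * pb := by rw [h3]; noncomm_ring
      _ = _ := by rw [h3']; noncomm_ring
  have e2 : (pb * y3 * ej) * pa * pc * pb = pb * pa * (y3 * pc * ej) * pb := by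
    calc _ = pb * y3 * (ej * pa) * pc * pb := by noncomm_ring
      _ = pb * (y3 * pa) * (ej * pc) * pb := by rw [← h3']; noncomm_ring
      _ = _ := by rw [← h3, h4]; noncomm_ring
  have e3 : pb * pa * ((pc * y4 - 1) * ej) * pb = pb * pa * pc * (y4 * pb) * ei - pb * pa * pb * ei := by
    calc _ = pb * pa * (pc * y4 - 1) * (ej * pb) := by noncomm_ring
      _ = _ := by rw [← h2]; noncomm_ring
  rw [e1, h1, e2, h5, e3, h6, h7]
  noncomm_ring

variable {F : Type*} [Field F] {e : ℕ} [NeZero e]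

theorem act_simpleT_of_eq {n : ℕ} {X : Type*} {r : Fin (n - 1)} {i : Fin n → X} (h : i (lo r) = i (hi r)) :
    act (simpleT r) i = i := by
  funext p
  rw [act, simpleT_inv]
  by_cases h1 : p = lo r
  · rw [h1, simpleT_lo, h]
  by_cases h2 : p = hi r
  · rw [h2, simpleT_hi, h]
  · rw [simpleT_of_ne r h1 h2]

/-- The commutation of `y` with the crossing of two blocks of size two. -/
theorem y_mul_swap_word {n : ℕ} {a b c : Fin (n - 1)} (hab : (b : ℕ) = a + 1) (hbc : (c : ℕ) = b + 1)
    {i : Fin n → ZMod e} (h1 : i (lo a) = i (hi b)) (h2 : i (hi a) = i (hi c))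
    (h3 : DoubleArrow (i (lo a)) (i (hi a))) (hne : i (lo a) ≠ i (hi a)) :
    KLR.y F (lo a) * (KLR.psi F b * KLR.psi F a * KLR.psi F c * KLR.psi F b) * KLR.idem F i =
      (KLR.psi F b * KLR.psi F a * KLR.psi F c * KLR.psi F b * KLR.y F (hi b) -
        (KLR.psi F c * KLR.psi F b * KLR.psi F c - 2 * KLR.y F (hi b) + KLR.y F (hi a) + KLR.y F (hi c))) *
          KLR.idem F i ∧
    KLR.y F (hi a) * (KLR.psi F b * KLR.psi F a * KLR.psi F c * KLR.psi F b) * KLR.idem F i =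
      (KLR.psi F b * KLR.psi F a * KLR.psi F c * KLR.psi F b * KLR.y F (hi c) -
        (KLR.psi F a * KLR.psi F b * KLR.psi F a + 2 * KLR.y F (hi a) - KLR.y F (lo a) - KLR.y F (hi b))) *
          KLR.idem F i := by
  have l1 : lo b = hi a := Fin.ext hab
  have l2 : lo c = hi b := Fin.ext hbc
  have n1 : lo a ≠ lo b := fun h => by have := congrArg Fin.val h; rw [lo_val, lo_val] at this; omega
  have n2 : lo a ≠ hi b := fun h => by have := congrArg Fin.val h; rw [lo_val, hi_val] at this; omega
  have n3 : hi a ≠ lo c := fun h => by have := congrArg Fin.val h; rw [lo_val, hi_val] at this; omega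
  have n4 : hi a ≠ hi c := fun h => by have := congrArg Fin.val h; rw [hi_val, hi_val] at this; omega
  have n5 : hi c ≠ lo b := fun h => by have := congrArg Fin.val h; rw [lo_val, hi_val] at this; omega
  have n6 : hi c ≠ hi b := fun h => by have := congrArg Fin.val h; rw [hi_val, hi_val] at this; omega
  have n7 : hi b ≠ lo a := n2.symm
  have n8 : hi b ≠ hi a := fun h => by have := congrArg Fin.val h; rw [hi_val, hi_val] at this; omega
  obtain ⟨j, hj⟩ : ∃ j, j = act (simpleT b) i := ⟨_, rfl⟩
  have j1 : j (lo a) = i (lo a) := by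
    rw [hj, act, simpleT_inv, simpleT_of_ne b n1 n2]
  have j2 : j (hi a) = i (hi b) := by
    rw [hj, act, simpleT_inv, ← l1, simpleT_lo]
  have j3 : j (hi b) = i (hi a) := by
    rw [hj, act, simpleT_inv, simpleT_hi, l1]
  have j4 : j (hi c) = i (hi c) := by
    rw [hj, act, simpleT_inv, simpleT_of_ne b n5 n6]
  have q2 : KLR.psi F b * KLR.idem F i = KLR.idem F j * KLR.psi F b := by
    rw [hj]; exact KLR.rel F (KLRRel.psi_idem b i)
  have q3 : KLR.psi F c * KLR.idem F j = KLR.idem F j * KLR.psi F c := by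
    have := KLR.rel F (KLRRel.psi_idem c j)
    rwa [act_simpleT_of_eq (by rw [l2, j3, j4, h2])] at this
  have q3' : KLR.psi F a * KLR.idem F j = KLR.idem F j * KLR.psi F a := by
    have := KLR.rel F (KLRRel.psi_idem a j)
    rwa [act_simpleT_of_eq (by rw [j1, j2, h1])] at this
  have yp : ∀ (r : Fin (n - 1)) (k : Fin n → ZMod e), k (lo r) = k (hi r) →
      KLR.y F (lo r) * KLR.psi F r * KLR.idem F k = (KLR.psi F r * KLR.y F (hi r) - 1) * KLR.idem F k := by
    intro r k hk
    rw [sub_mul, KLR.rel F (KLRRel.psi_y_eq r k hk), add_mul, add_sub_cancel_right]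
  constructor
  · refine mul_swap_word_lo (KLR.rel F (KLRRel.psi_y b _ n1 n2)).symm q2 q3
      (yp a j (by rw [j1, j2, h1])) (KLR.rel F (KLRRel.psi_y c _ n3 n4)).symm ?_ ?_
    · rw [← l1]
      exact (KLR.rel F (KLRRel.psi_y_ne b i (by rw [l1, ← h1]; exact hne.symm))).symm
    · have := KLR.rel F (KLRRel.braid_double b c i hbc (by rw [l1, h2]) (by
        rw [l1, ← h1]; exact ⟨h3.2, h3.1⟩))
      rwa [l1] at this
  · refine mul_swap_word_hi ?_ q2 q3 q3' (KLR.rel F (KLRRel.psi_y a _ n7 n8)).symm ?_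
      (KLR.rel F (KLRRel.psi_y b _ n5 n6)).symm ?_
    · rw [← l1]
      exact (KLR.rel F (KLRRel.psi_y_ne b j (by rw [l1, j2, j3, ← h1]; exact hne))).symm
    · rw [← l2]
      exact yp c j (by rw [l2, j3, j4, h2])
    · have := KLR.rel F (KLRRel.braid_double a b i hab h1.symm h3)
      rw [add_mul, add_mul, sub_mul] at this
      rw [sub_mul, sub_mul, add_mul, this]
      abel

variable {d : ℕ} [Fact (1 < e)] {ω : Equiv.Perm (Fin (d * e)) → List (Fin (d * e - 1))}

set_option maxRecDepth 10000 in
theorem wprod_eq_blockSwap_two : ∀ a b c f : Fin (2 * 2 - 1),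
    wprod [a, b, c, f] = blockSwap 2 (0 : Fin (2 - 1)) →
      (a : ℕ) = 1 ∧ (f : ℕ) = 1 ∧ ((b : ℕ) = 0 ∧ (c : ℕ) = 2 ∨ (b : ℕ) = 2 ∧ (c : ℕ) = 0) := by
  decide

theorem psiW_blockSwap_two (he : e = 2) {l : List (Fin (2 * e - 1))}
    (hl : Red l (blockSwap e (0 : Fin (2 - 1)))) {a b c : Fin (2 * e - 1)} (ha : (a : ℕ) = 0)
    (hb : (b : ℕ) = 1) (hc : (c : ℕ) = 2) :
    (psiW F l : KLR F e (2 * e)) = KLR.psi F b * KLR.psi F a * KLR.psi F c * KLR.psi F b := by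
  subst he
  have h1 : l.length = 4 := by
    rw [hl.length_eq, blockSwap_eq, card_inv_bperm, card_inv_simpleT]
  obtain ⟨p, q, s, t, rfl⟩ : ∃ p q s t, l = [p, q, s, t] := by
    match l, h1 with
    | [p, q, s, t], _ => exact ⟨p, q, s, t, rfl⟩
  obtain ⟨h2, h3, h4⟩ := wprod_eq_blockSwap_two p q s t hl.wprod_eq
  obtain rfl : p = b := Fin.ext (by omega)
  obtain rfl : t = p := Fin.ext (by omega)
  have hac : (KLR.psi F c * KLR.psi F a : KLR F 2 (2 * 2)) = KLR.psi F a * KLR.psi F c :=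
    KLR.rel F (KLRRel.psi_psi c a (Or.inr (by omega)))
  rcases h4 with ⟨h4, h5⟩ | ⟨h4, h5⟩
  · obtain rfl : q = a := Fin.ext (by omega)
    obtain rfl : s = c := Fin.ext (by omega)
    simp [psiW, mul_assoc]
  · obtain rfl : q = c := Fin.ext (by omega)
    obtain rfl : s = a := Fin.ext (by omega)
    rw [mul_assoc (KLR.psi F t), ← hac]
    simp [psiW, mul_assoc]

theorem proj_pairHom_congr (he : e = 2) (r : Fin (d - 1)) {x y : KLR F e (2 * e)}
    (h : x * KLR.idem F (fun p => ((p : ℕ) : ZMod e)) = y * KLR.idem F (fun p => ((p : ℕ) : ZMod e))) :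
    TruncR.proj F e d (pairHom F r x) = TruncR.proj F e d (pairHom F r y) := by
  have key : ∀ z : KLR F e (2 * e), TruncR.proj F e d (pairHom F r z) =
      TruncR.proj F e d (pairHom F r (z * KLR.idem F (fun p => ((p : ℕ) : ZMod e)))) := by
    intro z
    conv_lhs => rw [← mul_one z, ← sum_idem, Finset.mul_sum, map_sum, map_sum]
    refine Finset.sum_eq_single _ (fun i _ hi0 => ?_) (by simp)
    rw [map_mul, pairHom_idem, proj_mul (Or.inr (CommIdd.esum _)), proj_esum_pairEq_eq_zero, mul_zero]
    rintro ⟨-, h1⟩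
    refine hi0 (funext fun p => ?_)
    obtain ⟨t, a, rfl⟩ := pos_surj p
    subst he
    have h2 := Iempty1.first (h1 t) 0 rfl
    have h3 := Iempty1.second (h1 t) 1 rfl
    have h4 : ((pos t a : Fin (2 * 2)) : ℕ) = a + 2 * t := rfl
    rw [h4]
    have h5 : ((2 : ℕ) : ZMod 2) = 0 := rfl
    rw [Nat.cast_add, Nat.cast_mul, h5, zero_mul, add_zero]
    fin_cases a
    · exact h2
    · have : ∀ z : ZMod 2, z ≠ 0 → z = 1 := by decide
      exact (this _ h3).trans (by simp)
  rw [key x, key y, h]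

theorem pairHom_psi_hi (he : e = 2) (r : Fin (d - 1)) (t : Fin 2) (a : Fin (e - 1)) :
    CommIdd F (pairHom F r (KLR.psi F (posPsi t a))) ∧
      TruncR.proj F e d (pairHom F r (KLR.psi F (posPsi t a))) = 0 := by
  rw [pairHom_psi, shiftPsi_posPsi]
  exact ⟨CommIdd.psi _ _, by rw [proj_psi, pB_eq_zero_of_eq_two F he, map_zero]⟩

theorem iotaAt_yB_mul_sigma_of_eq_two (he : e = 2) (hω : ∀ w, Red (ω w) w) (r : Fin (d - 1)) {p q : Fin e}
    (hp : (p : ℕ) = 0) (hq : (q : ℕ) = 1) :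
    iotaAt F (lo r) (yB F p) * sigma F ω r = sigma F ω r * iotaAt F (hi r) (yB F p) -
      (iotaAt F (lo r) (yB F q) + iotaAt F (hi r) (yB F q) - 2 * iotaAt F (hi r) (yB F p)) ∧
    iotaAt F (lo r) (yB F q) * sigma F ω r = sigma F ω r * iotaAt F (hi r) (yB F q) -
      (2 * iotaAt F (lo r) (yB F q) - iotaAt F (lo r) (yB F p) - iotaAt F (hi r) (yB F p)) := by
  obtain ⟨l, hl, hl'⟩ := exists_shift_word (hω (blockSwap e r))
  obtain ⟨a, ha⟩ : ∃ a : Fin (2 * e - 1), (a : ℕ) = 0 := ⟨⟨0, by omega⟩, rfl⟩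
  obtain ⟨b, hb⟩ : ∃ a : Fin (2 * e - 1), (a : ℕ) = 1 := ⟨⟨1, by omega⟩, rfl⟩
  obtain ⟨c, hc⟩ : ∃ a : Fin (2 * e - 1), (a : ℕ) = 2 := ⟨⟨2, by omega⟩, rfl⟩
  have hval : ∀ (t : Fin 2) (x : Fin e), ((pos t x : Fin (2 * e)) : ℕ) = x + e * t := fun t x => rfl
  have p1 : lo a = pos 0 p := Fin.ext (by rw [hval, lo_val, ha, hp]; rfl)
  have p2 : hi a = pos 0 q := Fin.ext (by rw [hval, hi_val, ha, hq]; rfl)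
  have p3 : hi b = pos 1 p := Fin.ext (by rw [hval, hi_val, hb, hp, he]; rfl)
  have p4 : hi c = pos 1 q := Fin.ext (by rw [hval, hi_val, hc, hq, he]; rfl)
  obtain ⟨a', ha'⟩ : ∃ a' : Fin (e - 1), (a' : ℕ) = 0 := ⟨⟨0, by omega⟩, rfl⟩
  have q1 : a = posPsi 0 a' := Fin.ext (by rw [ha]; change 0 = (a' : ℕ) + e * 0; omega)
  have q2 : c = posPsi 1 a' := Fin.ext (by rw [hc]; change 2 = (a' : ℕ) + e * 1; omega)
  have z1 := pairHom_psi_hi (F := F) he r 0 a'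
  have z2 := pairHom_psi_hi (F := F) he r 1 a'
  rw [← q1] at z1
  rw [← q2] at z2
  have hW := psiW_blockSwap_two (F := F) he hl' ha hb hc
  have hσ : TruncR.proj F e d (pairHom F r (psiW F l)) = sigma F ω r := by
    rw [sigma_eq, hl, pairHom_psiW]
  have main := y_mul_swap_word (F := F) (a := a) (b := b) (c := c)
    (i := fun p : Fin (2 * e) => ((p : ℕ) : ZMod e)) (by omega) (by omega) ?_ ?_ ?_ ?_
  · rw [← hW, p1, p2, p3, p4] at main
    have m1 := proj_pairHom_congr he r main.1
    have m2 := proj_pairHom_congr he r main.2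
    have two : ∀ x : KLR F e (2 * e), TruncR.proj F e d (pairHom F r (2 * x)) =
        2 * TruncR.proj F e d (pairHom F r x) := fun x => by
      rw [two_mul x, map_add, map_add, two_mul (TruncR.proj F e d _)]
    have y0 : ∀ x : Fin e, CommIdd F (pairHom F r (KLR.y F (pos 0 x))) := fun x => by
      rw [pairHom_y]; exact CommIdd.y _
    have y1 : ∀ x : Fin e, CommIdd F (pairHom F r (KLR.y F (pos 1 x))) := fun x => by
      rw [pairHom_y]; exact CommIdd.y _
    have c1 : TruncR.proj F e d (pairHom F r (KLR.psi F c * KLR.psi F b * KLR.psi F c)) = 0 := by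
      rw [map_mul, proj_mul (Or.inr z2.1), z2.2, mul_zero]
    have c2 : TruncR.proj F e d (pairHom F r (KLR.psi F a * KLR.psi F b * KLR.psi F a)) = 0 := by
      rw [map_mul, proj_mul (Or.inr z1.1), z1.2, mul_zero]
    simp only [map_sub, map_add] at m1
    rw [c1, two, map_mul (pairHom F r),
      map_mul (pairHom F r),
      proj_mul (Or.inl (y0 _)), proj_mul (Or.inr (y1 _)), hσ] at m1
    simp only [map_sub, map_add] at m2
    rw [c2, two, map_mul (pairHom F r),
      map_mul (pairHom F r),
      proj_mul (Or.inl (y0 _)), proj_mul (Or.inr (y1 _)), hσ] at m2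
    simp only [pairHom_y_zero, pairHom_y_one, proj_y] at m1 m2
    refine ⟨m1.trans ?_, m2.trans ?_⟩
    · congr 1; abel
    · congr 1; abel
  all_goals
    subst he
    simp only [lo_val, hi_val, ha, hb, hc]
    first | decide | exact ⟨by decide, by decide⟩

theorem Psi_iotaAt_yB {k : Type*} [CommRing k] [Algebra F k] {W : TwistData d k} (t : Fin d) (a : Fin e)
    (f : Equiv.Perm (Fin d) → Lam F k (RbarDelta F e) d) (u : Equiv.Perm (Fin d)) :
    Psi F W (iotaAt F t (yB F a)) f u = algebraMap k _ (W.z (u⁻¹ t)) * f u := by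
  rw [iotaAt_proj, blockHom, KLR.lift_y, Psi_y, blk_pos]

theorem sigma_coeff_eq_one (he : e = 2) (hω : ∀ w, Red (ω w) w) {k : Type*} [CommRing k]
    [Algebra F k] {W : TwistData d k} {r : Fin (d - 1)}
    {c : Equiv.Perm (Fin d) → Lam F k (RbarDelta F e) d}
    (hc : ∀ f v, Psi F W (sigma F ω r) f v = (-1 : F) ^ e • f (simpleT r * v) - c v * f v)
    (v : Equiv.Perm (Fin d)) : c v = 1 := by
  obtain ⟨p, hp⟩ : ∃ p : Fin e, (p : ℕ) = 0 := ⟨⟨0, by omega⟩, rfl⟩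
  obtain ⟨q, hq⟩ : ∃ p : Fin e, (p : ℕ) = 1 := ⟨⟨1, by omega⟩, rfl⟩
  have h1 := (iotaAt_yB_mul_sigma_of_eq_two (F := F) he hω r hp hq).1
  have h2 := congrArg (fun x => Psi F W x 1 v) h1
  simp only [map_sub, map_add, map_mul, LinearMap.sub_apply, LinearMap.add_apply, Pi.sub_apply,
    Pi.add_apply, Module.End.mul_apply, two_mul, Psi_iotaAt_yB, hc, Pi.one_apply, mul_one] at h2
  rw [inv_simpleT_mul_apply, simpleT_hi] at h2
  have h3 : c v * algebraMap k _ (W.z (v⁻¹ (lo r)) - W.z (v⁻¹ (hi r))) =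
      algebraMap k _ (W.z (v⁻¹ (lo r)) - W.z (v⁻¹ (hi r))) := by
    rw [map_sub, mul_sub, ← Algebra.commutes (W.z (v⁻¹ (lo r)))]
    rw [mul_sub, mul_smul_comm, mul_one, ← sub_eq_zero] at h2
    rw [← sub_eq_zero, ← neg_eq_zero, ← h2]
    abel
  calc c v = c v * algebraMap k _ ((W.z (v⁻¹ (lo r)) - W.z (v⁻¹ (hi r))) * W.N (v⁻¹ (lo r)) (v⁻¹ (hi r))) := by
        rw [zDiff_mul_N, map_one, mul_one]
    _ = 1 := by rw [map_mul, ← mul_assoc, h3, ← map_mul, zDiff_mul_N, map_one]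

theorem IsTau.eq_sigma_add_one (he : e = 2) (hω : ∀ w, Red (ω w) w) {r : Fin (d - 1)}
    {τ ε : TruncR F e d} (h : IsTau F ω r τ ε) : τ = sigma F ω r + 1 := by
  obtain ⟨c, hc⟩ := Psi_sigma (F := F) (W := twistOne F d) twistOne_θ hω r
  refine monSpan_ext hω (Or.inl rfl) (h.mem_monSpan hω)
    (Submodule.add_mem _ (sigma_mem_monSpan hω r) one_mem_monSpan) fun f v => ?_
  rw [h.Psi hω, map_add, LinearMap.add_apply, Pi.add_apply, hc, map_one, Module.End.one_apply,
    sigma_coeff_eq_one he hω hc, one_mul, sub_add_cancel]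

end Two

section Intertwine

variable {F : Type*} [Field F] {d e : ℕ} [NeZero e] [Fact (1 < e)]
  {ω : Equiv.Perm (Fin (d * e)) → List (Fin (d * e - 1))} {τ ε : Fin (d - 1) → TruncR F e d}

theorem yB_sub_mem_interAlg_of_eq_two (he : e = 2) (hω : ∀ w, Red (ω w) w)
    (h : ∀ r, IsTau F ω r (τ r) (ε r)) (p : Fin e) : yB F p - yB F ⟨0, NeZero.pos e⟩ ∈ interAlg τ := by
  obtain ⟨o, ho⟩ : ∃ o : Fin e, o = ⟨0, NeZero.pos e⟩ := ⟨_, rfl⟩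
  rw [← ho]
  have ho0 : (o : ℕ) = 0 := by rw [ho]
  by_cases hp : (p : ℕ) = 0
  · obtain rfl : p = o := Fin.ext (by omega)
    rw [sub_self]; exact zero_mem _
  intro r t
  obtain ⟨m1, m2⟩ := iotaAt_yB_mul_sigma_of_eq_two (F := F) he hω r ho0 (show (p : ℕ) = 1 by omega)
  have hτ := (h r).eq_sigma_add_one he hω
  have key : iotaAt F (lo r) (yB F p - yB F o) * τ r = τ r * iotaAt F (hi r) (yB F p - yB F o) := by
    rw [hτ, map_sub, map_sub, sub_mul, mul_add, mul_add, m1, m2]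
    noncomm_ring
  by_cases h1 : t = hi r
  · rw [h1, simpleT_hi, key]
  by_cases h2 : t = lo r
  · rw [h2, simpleT_lo]
    have h3 := tau_mul_self hω h r
    calc _ = (τ r * τ r) * iotaAt F (hi r) (yB F p - yB F o) * τ r := by rw [h3, one_mul]
      _ = τ r * (τ r * iotaAt F (hi r) (yB F p - yB F o)) * τ r := by rw [mul_assoc (τ r) (τ r)]
      _ = τ r * iotaAt F (lo r) (yB F p - yB F o) * (τ r * τ r) := by rw [← key]; simp only [mul_assoc]
      _ = _ := by rw [h3, mul_one]
  · rw [simpleT_of_ne r h2 h1, map_sub, sub_mul, mul_sub, (h r).iotaAt_yB_mul hω h2 h1,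
      (h r).iotaAt_yB_mul hω h2 h1]

theorem yB_sub_mem_interAlg (hω : ∀ w, Red (ω w) w)
    (h : ∀ r, IsTau F ω r (τ r) (ε r)) (p : Fin e) : yB F p - yB F ⟨0, NeZero.pos e⟩ ∈ interAlg τ := by
  by_cases he : e = 2
  · exact yB_sub_mem_interAlg_of_eq_two he hω h p
  · exact crossAlg_le_interAlg hω h e (yB_sub_mem_crossAlg he p)

theorem etaKLR_mem_interAlg (hω : ∀ w, Red (ω w) w) (h : ∀ r, IsTau F ω r (τ r) (ε r)) (x : KLR F e e) :
    etaKLR F e x ∈ interAlg τ := by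
  refine KLR.induction (S := (interAlg τ).comap (etaKLR F e)) (fun i => ?_) (fun p => ?_) (fun a => ?_) x
  · rw [Subalgebra.mem_comap, etaKLR, KLR.lift_idem]
    exact eB_mem_interAlg hω h i
  · rw [Subalgebra.mem_comap, etaKLR, KLR.lift_y, map_sub]
    exact yB_sub_mem_interAlg hω h p
  · rw [Subalgebra.mem_comap, etaKLR, KLR.lift_psi]
    exact pB_mem_interAlg hω h a

end Intertwine

/-! ### The homomorphism from the wreath product -/

section Theta

variable {F : Type*} [Field F] {d e : ℕ} [NeZero e] [Fact (1 < e)]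
  {ω : Equiv.Perm (Fin (d * e)) → List (Fin (d * e - 1))} {τ ε : Fin (d - 1) → TruncR F e d}

theorem KLRcyca.lift_eq_lift_val {n : ℕ} {B : Type*} [Ring B] [Algebra F B] (α lam : ZMod e → ℕ)
    (g : KLR F e n →ₐ[F] B) (hg : ∀ (i : Fin n → ZMod e) (h : 0 < n),
      g (KLR.y F ⟨0, h⟩) ^ lam (i ⟨0, h⟩) * g (KLR.idem F i) = 0)
    (h1 : g (KLR.esum F (Ialpha n α)) = 1) (x : KLRcyca F n α lam) :
    KLRcyca.lift α lam g hg h1 x = KLRcyc.lift F n lam g hg x.1 := rfl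

theorem KLRcyca.lift_proj {n : ℕ} {B : Type*} [Ring B] [Algebra F B] (α lam : ZMod e → ℕ)
    (g : KLR F e n →ₐ[F] B) (hg : ∀ (i : Fin n → ZMod e) (h : 0 < n),
      g (KLR.y F ⟨0, h⟩) ^ lam (i ⟨0, h⟩) * g (KLR.idem F i) = 0)
    (h1 : g (KLR.esum F (Ialpha n α)) = 1) (x : KLR F e n) :
    KLRcyca.lift α lam g hg h1 (KLRcyca.proj F n α lam x) = g x := by
  rw [KLRcyca.lift_eq_lift_val]
  change KLRcyc.lift F n lam g hg (KLRcyc.proj F n lam (KLR.esum F (Ialpha n α)) *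
    KLRcyc.proj F n lam x * KLRcyc.proj F n lam (KLR.esum F (Ialpha n α))) = g x
  rw [← map_mul, ← map_mul, KLRcyc.lift_proj, map_mul, map_mul, h1, one_mul, mul_one]

theorem eta_proj (x : KLR F e e) :
    eta F e (KLRcyca.proj F e (mdelta e 1) (Pi.single (0 : ZMod e) 1) x) = etaKLR F e x :=
  KLRcyca.lift_proj _ _ _ _ _ x

theorem exists_eta_eq (x : Rcyc F e) : ∃ y, eta F e x = etaKLR F e y := by
  obtain ⟨y, hy⟩ := RingQuot.mkAlgHom_surjective F _ x.1
  refine ⟨y, ?_⟩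
  rw [eta, KLRcyca.lift_eq_lift_val, ← hy]
  exact KLRcyc.lift_proj _ _ _ _ _ _

theorem etaAt_mul_tau (hω : ∀ w, Red (ω w) w) (h : ∀ r, IsTau F ω r (τ r) (ε r)) (r : Fin (d - 1))
    (t : Fin d) (x : Rcyc F e) : etaAt F (simpleT r t) x * τ r = τ r * etaAt F t x := by
  obtain ⟨y, hy⟩ := exists_eta_eq x
  change iotaAt F (simpleT r t) (eta F e x) * τ r = τ r * iotaAt F t (eta F e x)
  rw [hy]
  exact etaKLR_mem_interAlg hω h y r t

theorem etaTensor_tprod (a : Fin d → Rcyc F e) : etaTensor F e d (PiTensorProduct.tprod F a) =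
    iota F e d (PiTensorProduct.tprod F fun t => eta F e (a t)) := by
  rw [etaTensor, LinearMap.comp_apply, PiTensorProduct.map_tprod]
  rfl

theorem etaTensor_mulSingle (t : Fin d) (x : Rcyc F e) :
    etaTensor F e d (PiTensorProduct.tprod F (Pi.mulSingle (M := fun _ => Rcyc F e) t x)) = etaAt F t x := by
  rw [etaTensor_tprod]
  refine Eq.trans ?_ (iota_mulSingle t (eta F e x))
  congr 2
  funext s
  by_cases h : s = t
  · subst h; simp
  · rw [Pi.mulSingle_eq_of_ne h, Pi.mulSingle_eq_of_ne h, map_one]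

theorem etaTensor_one : etaTensor F e d 1 = 1 := by
  rw [PiTensorProduct.one_def, etaTensor_tprod, ← iota_one, PiTensorProduct.one_def]
  congr 2
  funext t
  exact map_one _

theorem etaTensor_mul (x y : TPow F (Rcyc F e) d) :
    etaTensor F e d (x * y) = etaTensor F e d x * etaTensor F e d y := by
  induction x using PiTensorProduct.induction_on with
  | smul_tprod r f =>
    induction y using PiTensorProduct.induction_on with
    | smul_tprod s g =>
      rw [smul_mul_assoc, mul_smul_comm, PiTensorProduct.tprod_mul_tprod, map_smul, map_smul, map_smul,
        map_smul, smul_mul_assoc, mul_smul_comm, etaTensor_tprod, etaTensor_tprod, etaTensor_tprod,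
        ← iota_mul, PiTensorProduct.tprod_mul_tprod]
      simp only [Pi.mul_apply, map_mul]
      rfl
    | add a b ha hb => rw [mul_add, map_add, map_add, mul_add, ha, hb]
  | add a b ha hb => rw [add_mul, map_add, map_add, add_mul, ha, hb]

/-- The map `ι ∘ η^{⊗ d}` as a homomorphism of algebras. -/
def etaHom (F : Type*) [Field F] (e d : ℕ) [NeZero e] [Fact (1 < e)] : TPow F (Rcyc F e) d →ₐ[F] TruncR F e d :=
  AlgHom.ofLinearMap (etaTensor F e d) etaTensor_one etaTensor_mul

theorem smul_tprod {A : Type*} [Ring A] [Algebra F A] (u : Equiv.Perm (Fin d)) (a : Fin d → A) :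
    u • (PiTensorProduct.tprod F a : TPow F A d) = PiTensorProduct.tprod F fun t => a (u⁻¹ t) :=
  PiTensorProduct.reindex_tprod _ _

theorem etaHom_simpleT_smul_mul (hω : ∀ w, Red (ω w) w) (h : ∀ r, IsTau F ω r (τ r) (ε r))
    (r : Fin (d - 1)) (x : TPow F (Rcyc F e) d) :
    etaHom F e d (simpleT r • x) * τ r = τ r * etaHom F e d x := by
  induction x using PiTensorProduct.induction_on with
  | smul_tprod c a =>
    rw [permAction_smul_comm, map_smul (etaHom F e d) c, map_smul (etaHom F e d) c, smul_mul_assoc,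
      mul_smul_comm]
    congr 1
    rw [← tprod_eq_list_prod a]
    generalize hl : List.ofFn (fun t => PiTensorProduct.tprod F
      (Pi.mulSingle (M := fun _ => Rcyc F e) t (a t))) = l
    have hmem : ∀ x ∈ l, ∃ t b, x = PiTensorProduct.tprod F (Pi.mulSingle (M := fun _ => Rcyc F e) t b) := by
      intro x hx
      rw [← hl, List.mem_ofFn] at hx
      obtain ⟨t, rfl⟩ := hx
      exact ⟨t, _, rfl⟩
    clear hl
    induction l with
    | nil => rw [List.prod_nil, smul_one, map_one, one_mul, mul_one]
    | cons x l ih =>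
      rw [List.prod_cons, MulSemiringAction.smul_mul, map_mul, map_mul, mul_assoc,
        ih fun y hy => hmem y (List.mem_cons_of_mem _ hy), ← mul_assoc, ← mul_assoc]
      congr 1
      obtain ⟨t, b, rfl⟩ := hmem x List.mem_cons_self
      have h1 : (simpleT r • PiTensorProduct.tprod F (Pi.mulSingle (M := fun _ => Rcyc F e) t b) :
          TPow F (Rcyc F e) d) =
          PiTensorProduct.tprod F (Pi.mulSingle (M := fun _ => Rcyc F e) (simpleT r t) b) := by
        rw [smul_tprod]
        congr 1
        funext s
        rw [simpleT_inv]
        by_cases h : s = simpleT r t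
        · rw [h, simpleT_apply_apply, Pi.mulSingle_eq_same, Pi.mulSingle_eq_same]
        · rw [Pi.mulSingle_eq_of_ne h, Pi.mulSingle_eq_of_ne]
          intro h'
          rw [← h', simpleT_apply_apply] at h
          exact h rfl
      rw [h1]
      refine Eq.trans (congrArg (· * τ r) (etaTensor_mulSingle _ _)) ?_
      refine Eq.trans ?_ (congrArg (τ r * ·) (etaTensor_mulSingle _ _).symm)
      exact etaAt_mul_tau hω h r t b
  | add x y hx hy => rw [smul_add, map_add, map_add, add_mul, mul_add, hx, hy]

theorem etaHom_smul_mul (hω : ∀ w, Red (ω w) w) (h : ∀ r, IsTau F ω r (τ r) (ε r))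
    (u : Equiv.Perm (Fin d)) (x : TPow F (Rcyc F e) d) :
    etaHom F e d (u • x) * tauHom hω h u = tauHom hω h u * etaHom F e d x := by
  obtain ⟨l, hl⟩ := exists_red u
  rw [← hl.wprod_eq]
  clear hl
  induction l generalizing x with
  | nil => rw [wprod_nil, one_smul, map_one, mul_one, one_mul]
  | cons r l ih =>
    rw [wprod_cons, map_mul, mul_smul, ← mul_assoc, tauHom_simpleT, etaHom_simpleT_smul_mul hω h, mul_assoc,
      ih, mul_assoc]

/-- The homomorphism from the wreath product. -/
def thetaHom (hω : ∀ w, Red (ω w) w) (h : ∀ r, IsTau F ω r (τ r) (ε r)) :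
    Wreath F (Rcyc F e) d →ₐ[F] TruncR F e d :=
  AlgHom.ofLinearMap
    { SkewMonoidAlgebra.liftNC ((etaHom F e d : TPow F (Rcyc F e) d →+* TruncR F e d) :
        TPow F (Rcyc F e) d →+ TruncR F e d) (tauHom hω h) with
      map_smul' := fun c x => by
        induction x using SkewMonoidAlgebra.induction_on with
        | zero => simp
        | single σ a => simp [SkewMonoidAlgebra.smul_single]
        | add p q hp hq =>
          simp only [ZeroHom.toFun_eq_coe, AddMonoidHom.toZeroHom_coe, RingHom.id_apply] at hp hq ⊢
          rw [smul_add, map_add, map_add, smul_add, hp, hq] }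
    (SkewMonoidAlgebra.liftNC_one _ _)
    fun x y => SkewMonoidAlgebra.liftNC_mul _ _ x y fun {_ u} _ => etaHom_smul_mul hω h u _

theorem thetaHom_single (hω : ∀ w, Red (ω w) w) (h : ∀ r, IsTau F ω r (τ r) (ε r))
    (u : Equiv.Perm (Fin d)) (x : TPow F (Rcyc F e) d) :
    thetaHom hω h (SkewMonoidAlgebra.single u x) = etaTensor F e d x * tauHom hω h u :=
  SkewMonoidAlgebra.liftNC_single _ _ _ _

end Theta

/-! ### Degrees -/

section Degrees

variable {F : Type*} [Field F] {d e : ℕ} [NeZero e] [Fact (1 < e)]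
  {ω : Equiv.Perm (Fin (d * e)) → List (Fin (d * e - 1))}

theorem KLR.idem_mem_deg {n : ℕ} (i : Fin n → ZMod e) : KLR.idem F i ∈ KLR.deg F 0 :=
  Submodule.subset_span (by simpa using (IsMonomial.one (F := F)).idem_mul i)

theorem KLR.esum_mem_deg {n : ℕ} (S : Set (Fin n → ZMod e)) : KLR.esum F S ∈ KLR.deg F 0 :=
  Submodule.sum_mem _ fun i _ => KLR.idem_mem_deg i

theorem KLR.y_mem_deg {n : ℕ} (p : Fin n) : (KLR.y F p : KLR F e n) ∈ KLR.deg F 2 :=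
  Submodule.subset_span (by simpa using (IsMonomial.one (F := F)).y_mul p)

theorem KLR.psi_mul_idem_mem_deg {n : ℕ} (r : Fin (n - 1)) (i : Fin n → ZMod e) :
    KLR.psi F r * KLR.idem F i ∈ KLR.deg F (-cartan (i (lo r)) (i (hi r))) :=
  Submodule.subset_span (by simpa using (IsMonomial.one (F := F)).psi_mul r i)

theorem DMon.mem_deg {n l : ℕ} {m : ℤ} {x : KLR F e n} (h : DMon l m x) : x ∈ KLR.deg F m := by
  induction h with
  | one => exact Submodule.subset_span IsMonomial.one
  | idem_mul i _ ih => simpa using KLR.deg_mul (KLR.idem_mem_deg i) ih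
  | ydiff_mul p q _ ih =>
    exact KLR.deg_mul (Submodule.sub_mem _ (KLR.y_mem_deg p) (KLR.y_mem_deg q)) ih
  | psi_mul r i _ ih => exact KLR.deg_mul (KLR.psi_mul_idem_mem_deg r i) ih

theorem TruncR.proj_mem_deg {m : ℤ} {x : KLR F e (d * e)} (h : x ∈ KLR.deg F m) :
    TruncR.proj F e d x ∈ TruncR.deg F e d m := by
  have h1 : edd F e d ∈ KLRbar.deg F (mdelta e d) (shuffles e d) 0 := ⟨_, KLR.esum_mem_deg (Idd e d), rfl⟩
  have h2 : Rbar.proj F e d x ∈ KLRbar.deg F (mdelta e d) (shuffles e d) m := ⟨_, h, rfl⟩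
  have h3 := KLRbar.deg_mul (KLRbar.deg_mul h1 h2) h1
  rw [zero_add, add_zero] at h3
  exact h3

theorem TruncR.deg_mul {m m' : ℤ} {x x' : TruncR F e d} (h : x ∈ TruncR.deg F e d m)
    (h' : x' ∈ TruncR.deg F e d m') : x * x' ∈ TruncR.deg F e d (m + m') :=
  KLRbar.deg_mul h h'

theorem TruncR.one_mem_deg : (1 : TruncR F e d) ∈ TruncR.deg F e d 0 :=
  ⟨_, KLR.esum_mem_deg (Idd e d), rfl⟩

theorem TruncR.list_prod_mem_deg {n : ℕ} {x : Fin n → TruncR F e d} {a : Fin n → ℤ}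
    (h : ∀ k, x k ∈ TruncR.deg F e d (a k)) : (List.ofFn x).prod ∈ TruncR.deg F e d (∑ k, a k) := by
  induction n with
  | zero => simpa using TruncR.one_mem_deg
  | succ n ih =>
    rw [List.ofFn_succ, List.prod_cons, Fin.sum_univ_succ]
    exact TruncR.deg_mul (h 0) (ih fun k => h k.succ)

theorem monSpan_le_deg (m : ℤ) : monSpan F d e m ≤ TruncR.deg F e d m := by
  refine Submodule.span_le.2 ?_
  rintro _ ⟨l, x, h, rfl⟩
  exact TruncR.proj_mem_deg h.mem_deg

theorem blockHom_mem_deg (t : Fin d) {m : ℤ} {x : KLR F e e} (h : x ∈ KLR.deg F m) :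
    blockHom F t x ∈ KLR.deg F m := by
  refine (Submodule.span_le.2 ?_ : KLR.deg F m ≤ (KLR.deg F m).comap (blockHom F t).toLinearMap) h
  intro x hx
  clear h
  change blockHom F t x ∈ KLR.deg F m
  induction hx with
  | one => rw [map_one]; exact Submodule.subset_span IsMonomial.one
  | idem_mul i _ ih =>
    have h1 : blockHom F t (KLR.idem F i) ∈ KLR.deg F 0 := by
      rw [blockHom, KLR.lift_idem]
      exact KLR.esum_mem_deg _
    rw [map_mul]
    simpa using KLR.deg_mul h1 ih
  | y_mul r _ ih =>
    rw [map_mul]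
    refine KLR.deg_mul ?_ ih
    rw [blockHom, KLR.lift_y]
    exact KLR.y_mem_deg _
  | psi_mul r i _ ih =>
    rw [map_mul, map_mul]
    refine KLR.deg_mul ?_ ih
    rw [blockHom, KLR.lift_idem, KLR.lift_psi, KLR.esum, Finset.mul_sum]
    refine Submodule.sum_mem _ fun k hk => ?_
    have hk' : k ∈ blockEq t i := by simpa using hk
    rw [← blockEq_lo hk', ← blockEq_hi hk']
    exact KLR.psi_mul_idem_mem_deg _ _

theorem iotaAt_mem_deg (t : Fin d) {m : ℤ} {a : RbarDelta F e} (h : a ∈ RbarDelta.deg F e m) :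
    iotaAt F t a ∈ TruncR.deg F e d m := by
  obtain ⟨x, hx, rfl⟩ := h
  change iotaAt F t (RbarDelta.proj F e x) ∈ _
  rw [iotaAt_proj]
  exact TruncR.proj_mem_deg (blockHom_mem_deg t hx)

theorem etaKLR_mem_deg {m : ℤ} {x : KLR F e e} (h : x ∈ KLR.deg F m) :
    etaKLR F e x ∈ RbarDelta.deg F e m := by
  have hp : ∀ {m : ℤ} {x : KLR F e e}, x ∈ KLR.deg F m → RbarDelta.proj F e x ∈ RbarDelta.deg F e m :=
    fun h => ⟨_, h, rfl⟩
  refine (Submodule.span_le.2 ?_ : KLR.deg F m ≤ (RbarDelta.deg F e m).comap (etaKLR F e).toLinearMap) h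
  intro x hx
  clear h
  change etaKLR F e x ∈ RbarDelta.deg F e m
  induction hx with
  | one => rw [map_one]; exact KLRbar.one_mem_deg _ _
  | idem_mul i _ ih =>
    have h1 : etaKLR F e (KLR.idem F i) ∈ RbarDelta.deg F e 0 := by
      rw [etaKLR, KLR.lift_idem]
      exact hp (KLR.idem_mem_deg i)
    rw [map_mul]
    simpa using KLRbar.deg_mul h1 ih
  | y_mul r _ ih =>
    rw [map_mul]
    refine KLRbar.deg_mul ?_ ih
    rw [etaKLR, KLR.lift_y]
    exact hp (Submodule.sub_mem _ (KLR.y_mem_deg _) (KLR.y_mem_deg _))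
  | psi_mul r i _ ih =>
    rw [map_mul, map_mul]
    refine KLRbar.deg_mul ?_ ih
    rw [etaKLR, KLR.lift_idem, KLR.lift_psi, ← map_mul]
    exact hp (KLR.psi_mul_idem_mem_deg _ _)

theorem etaAt_mem_deg (t : Fin d) {m : ℤ} {x : Rcyc F e} (h : x ∈ Rcyc.deg F e m) :
    etaAt F t x ∈ TruncR.deg F e d m := by
  obtain ⟨y, hy, rfl⟩ := h
  refine iotaAt_mem_deg t ?_
  change eta F e (KLRcyca.proj F e (mdelta e 1) (Pi.single (0 : ZMod e) 1) y) ∈ _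
  rw [eta_proj]
  exact etaKLR_mem_deg hy

theorem thetaHom_mem_deg {τ ε : Fin (d - 1) → TruncR F e d} (hω : ∀ w, Red (ω w) w)
    (h : ∀ r, IsTau F ω r (τ r) (ε r)) {m : ℤ} {x : Wreath F (Rcyc F e) d}
    (hx : x ∈ Wreath.deg F d (Rcyc.deg F e) m) : thetaHom hω h x ∈ TruncR.deg F e d m := by
  refine (Submodule.span_le.2 ?_ : Wreath.deg F d (Rcyc.deg F e) m ≤
    (TruncR.deg F e d m).comap (thetaHom hω h).toLinearMap) hx
  rintro _ ⟨σ, a, ⟨p, hp, rfl⟩, rfl⟩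
  change thetaHom hω h _ ∈ TruncR.deg F e d (∑ k, p k)
  rw [thetaHom_single, etaTensor_tprod, iota_tprod]
  have h1 : tauHom hω h σ ∈ TruncR.deg F e d 0 :=
    monSpan_le_deg 0 (tauW_mem_monSpan (fun r => (h r).mem_monSpan hω) _)
  have h2 := TruncR.deg_mul (TruncR.list_prod_mem_deg fun k => etaAt_mem_deg k (hp k)) h1
  rw [add_zero] at h2
  exact h2

end Degrees

end KLRTheta

end

open KLRTheta

theorem theorem5 {F : Type*} [Field F] (e : ℕ) [NeZero e] (ξ : F)
    (hξ : IsLeast {k : ℕ | 2 ≤ k ∧ ∑ i ∈ Finset.range k, ξ ^ i = 0} e) (d : ℕ)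
    (ω : Equiv.Perm (Fin (d * e)) → List (Fin (d * e - 1))) (hω : ∀ w, IsReducedWord (ω w) w)
    (ν : Equiv.Perm (Fin d) → List (Fin (d - 1))) (hν : ∀ u, IsReducedWord (ν u) u) :
    ∃ τ ε : Fin (d - 1) → TruncR F e d,
      (∀ r, IsTau F ω r (τ r) (ε r)) ∧
      (∀ r τ' ε', IsTau F ω r τ' ε' → τ' = τ r ∧ ε' = ε r) ∧
      (∀ r, τ r * τ r = 1) ∧
      (∀ r s : Fin (d - 1), (s : ℕ) = r + 1 → τ r * τ s * τ r = τ s * τ r * τ s) ∧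
      (∀ r t : Fin (d - 1), (r : ℕ) + 2 ≤ t ∨ (t : ℕ) + 2 ≤ r → τ r * τ t = τ t * τ r) ∧
      (∀ (r : Fin (d - 1)) (x : Rcyc F e),
        etaAt F (lo r) x * τ r = τ r * etaAt F (hi r) x ∧
        etaAt F (hi r) x * τ r = τ r * etaAt F (lo r) x) ∧
      (∀ r : Fin (d - 1), zElt F (hi r) - τ r * zElt F (lo r) * τ r ∈ scrT F ω ν) ∧
      ∃ Θ : Wreath F (Rcyc F e) d →ₐ[F] TruncR F e d,
        (∀ a : TPow F (Rcyc F e) d, Θ (SkewMonoidAlgebra.single 1 a) = etaTensor F e d a) ∧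
        (∀ r, Θ (SkewMonoidAlgebra.single (simpleT r) 1) = τ r) ∧
        ∀ (m : ℤ), ∀ x ∈ Wreath.deg F d (Rcyc.deg F e) m, Θ x ∈ TruncR.deg F e d m := by
  have : Fact (1 < e) := ⟨hξ.1.1⟩
  have hω' : ∀ w, Red (ω w) w := fun w => isReducedWord_iff.1 (hω w)
  have hν' : ∀ u, Red (ν u) u := fun u => isReducedWord_iff.1 (hν u)
  choose τ ε h using fun r => exists_isTau (F := F) hω' r
  refine ⟨τ, ε, h, fun r τ' ε' h' => ⟨(h r).tau_unique hω' h', (h r).eps_unique hω' h'⟩,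
    tau_mul_self hω' h, fun r s => tau_braid hω' h, fun r t hrt => tau_comm hω' h hrt,
    fun r x => ⟨?_, ?_⟩, zElt_sub_mem_scrT hω' hν' h, thetaHom hω' h, fun a => ?_, fun r => ?_,
    fun m x => thetaHom_mem_deg hω' h⟩
  · have := etaAt_mul_tau hω' h r (hi r) x
    rwa [simpleT_hi] at this
  · have := etaAt_mul_tau hω' h r (lo r) x
    rwa [simpleT_lo] at this
  · rw [thetaHom_single, map_one, mul_one]
  · rw [thetaHom_single, etaTensor_one, one_mul, tauHom_simpleT]
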